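/- **Conventions.** Let $G$ be a unital inverse semigroup (e.g. a group), $E\subseteq G$ its commutative subsemigroup of idempotents. A $G$-algebra is a complex algebra $A$ with a unital semigroup homomorphism $\alpha:G\to\mathrm{End}(A)$ such that $\alpha_e(a)b=a\,\alpha_e(b)$ for $e\in E$; morphisms are the equivariant homomorphisms. We work in one of two situations: (alg) algebras, all quadratik (each element is a finite sum of products); (C*) $C^*$-algebras, where all homomorphisms and actions are by $*$-homomorphisms. $M_n$ is the algebra of $n\times n$-matrices with finitely many nonzero entries ($n$ a cardinal), replaced by the compact operators on $\ell^2(n)$ in (C*), with matrix units $e_{ij}$; tensor products are algebraic in (alg) and $C^*$-tensor products in (C*). $(\mathfrak c,\chi)$ is the algebra $\mathbb C[E]$ (in (C*): $C^*(E)$) with $\chi_g(e)=geg^*$; it is unital, and equals $\mathbb C$ if $G$ is a group. A very special corner embedding is an equivariant homomorphism $e:(A,\alpha)\to(M_n\otimes A,\sigma\otimes\alpha)$, $e(a)=e_{00}\otimes a$ ($0\in n$ a fixed index), where $\sigma$ is a $G$-action on $M_n$. Fix a class $R$ of $G$-algebras and a class of permitted sizes $n$ that are sufficiently big: $\mathfrak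 c\in R$, finite sizes and products of permitted sizes are permitted, and $R$ is closed under forming $(M_n\otimes A,\sigma\otimes\alpha)$ for permitted $n$ and under split extensions. Very special $GK^G$ is the category with object class $R$ whose morphisms are the valid strings (written from left to right) in $+,-,\cdot$ and the generators: all equivariant homomorphisms, an $e^{-1}$ for each very special corner embedding $e$ of permitted size, and a $\Delta_s:X\to J$ for each split exact sequence $0\to J\xrightarrow{\iota}X\xrightarrow{f}A\to0$ with equivariant split $s$; modulo the laws of an additive category, $f\cdot g=g\circ f$ for homomorphisms, $e\cdot e^{-1}=\mathrm{id}$, $e^{-1}\cdot e=\mathrm{id}$, $f_0=f_1$ for homotopic homomorphisms (in (alg) by continuous, smooth or polynomial paths, a fixed choice; in (C*) by continuous paths), and $\mathrm{id}_X=\Delta_s\iota+fs$, $\iota\Delta_s=\mathrm{id}_J$. In (C*) this category is very special $KK^G$, and the Kasparov product is understood as its composition, via $KK^G\cong GK^G$. A level-one sequence $s$ from $A$ to $B$ consists of a very special corner embedding $e:B\to J$, a split exact sequence $0\to J\xrightarrow{\iota}X\to A\to0$ with equivariant split $s_-:A\to(X,\gamma_-)$, a homomorphism $s_+:A\to(X,\gamma_+)$,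 equivariant for a second action, with $s_+(a)-s_-(a)\in\iota(J)$, and a very special upper left corner embedding $f_1:(X,\gamma_-)\to(M_2(X),\delta)$ for which the lower right embedding $f_2:(X,\gamma_+)\to(M_2(X),\delta)$ is equivariant and $\delta$ induces an action of the form $\mathrm{id}_{M_2}\otimes\alpha'$ on $M_2(X)/M_2(\iota(J))$. Its morphism is $s_+\nabla_{s_-}:=s_+\cdot f_2\cdot f_1^{-1}\cdot\Delta_{s_-}\cdot e^{-1}\in GK^G(A,B)$, and $L_1GK^G(A,B)$ is the set of all these morphisms. **Statement.** Let $A,B\in R$. Let $t$ be a level-one sequence from $A$ to $\mathfrak c$ with exit corner embedding $\mathfrak c\to K=(M_n\otimes\mathfrak c,\sigma\otimes\chi)$, and let $s$ be a level-one sequence from $\mathfrak c$ to $B$ with algebra $X$, ideal $J$ and exit corner embedding $e_s:B\to J$. Let $\varphi$ be the action of $\mathfrak c$ on $X$ determined by $\varphi(e)=\gamma_{-,e}$ ($e\in E$). Let $M_n\otimes X$ and $M_n\otimes J$ carry $\sigma\otimes\gamma_-$. For $k\in K$, $a\in A$ put $$S_\pm(k)=(\mathrm{id}_{M_n}\otimes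 s_\pm)(k)\oplus k\in (M_n\otimes X)\oplus K,\qquad \vartheta(k)=(\mathrm{id}_{M_n}\otimes\varphi)(k)\oplus k,\qquad T(a)=\lim_F\vartheta\big(t_-(a)\,p_F\big),$$ where $\vartheta(k)$ and $T(a)$ act on $(M_n\otimes X)\oplus K$ by multiplication from both sides (the limit being pointwise; from the right, $v\,T(a)=\lim_F v\,\vartheta(p_F t_-(a))$), and $p_F=\sum_{i\in F}e_{ii}\otimes1$ for finite $F\subseteq n$. Then the product $t_+\nabla_{t_-}\cdot s_+\nabla_{s_-}$ is the level-one element $x_+\nabla_{x_-}$ given by the formula $$x_\pm(a)=\Big(S_\pm\big((t_+-t_-)(a)\big)+T(a)\Big)\oplus a\qquad(a\in A),$$ with ideal $M_n\otimes J$ (embedded as $(M_n\otimes J)\oplus0\oplus 0$) and exit corner embedding $b\mapsto e_{00}\otimes e_s(b)$. Here the algebra of $x$ consists of the elements $(v+T(a))\oplus a$ with $v\in S_-\big((t_+-t_-)(a)\big)+(M_n\otimes J)\oplus 0$, an element being recorded by its coordinates $(v,a)$, with product $(v,a)(w,b)=(vw+v\,T(b)+T(a)\,w,\ ab)$. That is: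 a level-one sequence $x$ given by this formula exists, and for every such $x$ one has $t_+\nabla_{t_-}\cdot s_+\nabla_{s_-}=x_+\nabla_{x_-}$. In particular, the product of very special $GK^G$ (in (C*): of very special $KK^G$) restricts to $$L_1GK^G(A,\mathfrak c)\otimes_{\mathbb Z}L_1GK^G(\mathfrak c,B)\to L_1GK^G(A,B),\qquad z\otimes w\mapsto z\cdot w,$$ meaning that $z\cdot w\in L_1GK^G(A,B)$ for all $z\in L_1GK^G(A,\mathfrak c)$, $w\in L_1GK^G(\mathfrak c,B)$, and that there is a $\mathbb Z$-linear map with this formula between (tensor products of) the subgroups generated by these sets. -/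

import Mathlib

open CategoryTheory Filter Topology
open scoped TensorProduct ContinuousMapZero

universe u

/-! ## Unital inverse semigroups -/

/-- A unital inverse semigroup: a monoid with an involution `star` (written `g ↦ g*`) such that
`(gh)* = h* g*`, `g g* g = g`, and the elements `g g*` commute with each other. A group is a
unital inverse semigroup with `g* = g⁻¹`. -/
class InverseMonoid (G : Type*) extends Monoid G, StarMul G where
  mul_star_mul_self : ∀ g : G, g * star g * g = g
  mul_star_comm : ∀ g h : G, (g * star g) * (h * star h) = (h * star h) * (g * star g)

namespace InverseMonoid

variable {G : Type*} [InverseMonoid G]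

theorem star_eq_of_idem {e : G} (he : e * e = e) : star e = e := by
  have hs : star e * star e = star e := by rw [← star_mul, he]
  have h3 : star e * e * star e = star e := by
    have := mul_star_mul_self (star e)
    rwa [star_star] at this
  have hc := mul_star_comm e (star e)
  rw [star_star] at hc
  have h1 : e * star e * (star e * e) = e := by
    rw [mul_assoc, ← mul_assoc (star e), hs, ← mul_assoc, mul_star_mul_self]
  have h2 : star e * e * (e * star e) = star e := by
    rw [mul_assoc, ← mul_assoc e, he, ← mul_assoc, h3]
  rw [← h2, ← hc, h1]

theorem idem_comm {e f : G} (he : e * e = e) (hf : f * f = f) : e * f = f * e := by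
  have h := mul_star_comm e f
  rwa [star_eq_of_idem he, star_eq_of_idem hf, he, hf] at h

theorem idem_conj (g : G) {e : G} (he : e * e = e) :
    (g * e * star g) * (g * e * star g) = g * e * star g := by
  have hg : (star g * g) * (star g * g) = star g * g := by
    rw [mul_assoc, ← mul_assoc g, mul_star_mul_self]
  calc (g * e * star g) * (g * e * star g)
      = g * (e * (star g * g) * e) * star g := by simp only [mul_assoc]
    _ = g * ((star g * g) * e * e) * star g := by rw [idem_comm he hg]
    _ = g * e * star g := by
      rw [mul_assoc (star g * g), he, ← mul_assoc g, ← mul_assoc g, mul_star_mul_self]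

theorem conj_mul (g : G) {e : G} (f : G) (he : e * e = e) :
    g * (e * f) * star g = (g * e * star g) * (g * f * star g) := by
  have hg : (star g * g) * (star g * g) = star g * g := by
    rw [mul_assoc, ← mul_assoc g, mul_star_mul_self]
  calc g * (e * f) * star g
      = (g * star g * g) * (e * f) * star g := by rw [mul_star_mul_self]
    _ = g * ((star g * g) * e) * f * star g := by simp only [mul_assoc]
    _ = g * (e * (star g * g)) * f * star g := by rw [idem_comm he hg]
    _ = (g * e * star g) * (g * f * star g) := by simp only [mul_assoc]

end InverseMonoid

/-- The semilattice `E` of idempotents of `G`. -/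
def Idem (G : Type*) [InverseMonoid G] : Type _ := {e : G // e * e = e}

namespace Idem

variable {G : Type*} [InverseMonoid G]

instance : CommMonoid (Idem G) where
  mul e f := ⟨e.1 * f.1, by
    rw [mul_assoc, ← mul_assoc f.1, InverseMonoid.idem_comm f.2 e.2, mul_assoc e.1 f.1 f.1, f.2,
      ← mul_assoc, e.2]⟩
  one := ⟨1, one_mul 1⟩
  mul_assoc e f k := Subtype.ext (mul_assoc e.1 f.1 k.1)
  one_mul e := Subtype.ext (one_mul e.1)
  mul_one e := Subtype.ext (mul_one e.1)
  mul_comm e f := Subtype.ext (InverseMonoid.idem_comm e.2 f.2)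

/-- `e ↦ g e g*`. -/
def conj (g : G) : Idem G →ₙ* Idem G where
  toFun e := ⟨g * e.1 * star g, InverseMonoid.idem_conj g e.2⟩
  map_mul' e f := Subtype.ext (InverseMonoid.conj_mul g f.1 e.2)

theorem conj_one (e : Idem G) : conj (1 : G) e = e :=
  Subtype.ext (by change 1 * e.1 * star 1 = e.1; simp)

theorem conj_conj (g h : G) (e : Idem G) : conj g (conj h e) = conj (g * h) e :=
  Subtype.ext (by
    change g * (h * e.1 * star h) * star g = g * h * e.1 * star (g * h)
    simp only [star_mul, mul_assoc])

theorem conj_idem (e f : Idem G) : conj e.1 f = e * f :=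
  Subtype.ext (by
    change e.1 * f.1 * star e.1 = e.1 * f.1
    rw [InverseMonoid.star_eq_of_idem e.2, InverseMonoid.idem_comm e.2 f.2, mul_assoc, e.2])

end Idem

/-! ## `G`-algebras -/

/-- A `G`-algebra: a not necessarily unital complex algebra with a unital semigroup homomorphism
`G → End(A)` such that `α_e(a) b = a α_e(b)` for idempotents `e`. -/
structure GAlg (G : Type u) [InverseMonoid G] where
  carrier : Type u
  [ring : NonUnitalRing carrier]
  [module : Module ℂ carrier]
  [tower : IsScalarTower ℂ carrier carrier]
  [smulComm : SMulCommClass ℂ carrier carrier]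
  act : G → carrier →ₙₐ[ℂ] carrier
  act_one : ∀ a, act 1 a = a
  act_mul : ∀ g h a, act (g * h) a = act g (act h a)
  compat : ∀ e : Idem G, ∀ a b, act e.1 a * b = a * act e.1 b

namespace GAlg

attribute [instance] GAlg.ring GAlg.module GAlg.tower GAlg.smulComm

/-- Equivariant algebra homomorphisms. -/
@[ext] structure Hom {G : Type u} [InverseMonoid G] (A B : GAlg G) where
  toHom : A.carrier →ₙₐ[ℂ] B.carrier
  map_act : ∀ g a, toHom (A.act g a) = B.act g (toHom a)

instance (G : Type u) [InverseMonoid G] : Category.{u} (GAlg G) where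
  Hom := Hom
  id A := ⟨NonUnitalAlgHom.id ℂ A.carrier, fun _ _ => rfl⟩
  comp f k := ⟨k.toHom.comp f.toHom, fun g a => by
    change k.toHom (f.toHom _) = _
    rw [f.map_act, k.map_act]; rfl⟩

end GAlg

/-- A `G`-C*-algebra: a C*-algebra with a unital semigroup homomorphism from `G` to its
`*`-endomorphisms such that `α_e(a) b = a α_e(b)` for idempotents `e`. -/
structure CGAlg (G : Type u) [InverseMonoid G] where
  carrier : Type u
  [cstar : NonUnitalCStarAlgebra carrier]
  act : G → carrier →⋆ₙₐ[ℂ] carrier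
  act_one : ∀ a, act 1 a = a
  act_mul : ∀ g h a, act (g * h) a = act g (act h a)
  compat : ∀ e : Idem G, ∀ a b, act e.1 a * b = a * act e.1 b

namespace CGAlg

attribute [instance] CGAlg.cstar

/-- Equivariant `*`-homomorphisms. -/
@[ext] structure Hom {G : Type u} [InverseMonoid G] (A B : CGAlg G) where
  toHom : A.carrier →⋆ₙₐ[ℂ] B.carrier
  map_act : ∀ g a, toHom (A.act g a) = B.act g (toHom a)

instance (G : Type u) [InverseMonoid G] : Category.{u} (CGAlg G) where
  Hom := Hom
  id A := ⟨NonUnitalStarAlgHom.id ℂ A.carrier, fun _ _ => rfl⟩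
  comp f k := ⟨k.toHom.comp f.toHom, fun g a => by
    change k.toHom (f.toHom _) = _
    rw [f.map_act, k.map_act]; rfl⟩

/-- Forgetting the involution and the norm. -/
def forget (G : Type u) [InverseMonoid G] : CGAlg G ⥤ GAlg G where
  obj A :=
    { carrier := A.carrier
      act := fun g => (A.act g).toNonUnitalAlgHom
      act_one := A.act_one
      act_mul := A.act_mul
      compat := A.compat }
  map f := ⟨f.toHom.toNonUnitalAlgHom, f.map_act⟩

end CGAlg

/-! ## Settings: algebras and C*-algebras

The theory is developed simultaneously for algebras and for C*-algebras. A `Setting` lists the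
ingredients which differ; the only settings used are the ones defined by `setting` below. -/

/-- The ingredients of the theory which differ between algebras and C*-algebras. -/
structure Setting (G : Type u) [InverseMonoid G] where
  /-- the category of all `G`-algebras of the kind considered -/
  C : Type (u + 1)
  [cat : Category.{u} C]
  /-- the underlying `G`-algebra -/
  U : C ⥤ GAlg G
  /-- the topology of the algebras (discrete for algebras, the norm topology for C*-algebras) -/
  top : ∀ A : C, TopologicalSpace (U.obj A).carrier
  /-- `τ` exhibits `D` as the tensor product `M ⊗ A`, disregarding the `G`-actions -/
  IsTensor : ∀ {M A D : C},
    ((U.obj M).carrier →ₗ[ℂ] (U.obj A).carrier →ₗ[ℂ] (U.obj D).carrier) → Prop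
  /-- two homomorphisms are the end points of a homotopy -/
  Homotopic : ∀ {A B : C}, (A ⟶ B) → (A ⟶ B) → Prop
  /-- the matrix algebra `M_ι` (for C*-algebras: the compact operators on `ℓ²(ι)`) with the
  trivial `G`-action -/
  mat : Type u → C
  /-- the matrix units of `M_ι` -/
  unit : ∀ {ι : Type u}, ι → ι → (U.obj (mat ι)).carrier
  /-- the coefficient algebra `𝔠` generated by the idempotents of `G` -/
  coeff : C
  /-- the idempotents of `G` as elements of `𝔠` -/
  idem : Idem G → (U.obj coeff).carrier

attribute [instance] Setting.cat Setting.top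

/-! ### The setting of algebras -/

section Algebraic

/-- The space of finitely supported vectors indexed by `ι`. -/
def FinVec (ι : Type u) : Type u := ι →₀ ℂ

noncomputable instance (ι : Type u) : AddCommGroup (FinVec ι) :=
  inferInstanceAs (AddCommGroup (ι →₀ ℂ))

noncomputable instance (ι : Type u) : Module ℂ (FinVec ι) := inferInstanceAs (Module ℂ (ι →₀ ℂ))

/-- The matrix unit `e_{ij}`, as an operator on finitely supported vectors. -/
noncomputable def finUnit {ι : Type u} (i j : ι) : Module.End ℂ (FinVec ι) :=
  (Finsupp.lsingle i ∘ₗ Finsupp.lapply j : (ι →₀ ℂ) →ₗ[ℂ] (ι →₀ ℂ))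

/-- The algebra `M_ι` of matrices with finitely many nonzero entries: the algebra generated by the
matrix units. -/
noncomputable abbrev FinMat (ι : Type u) : NonUnitalSubalgebra ℂ (Module.End ℂ (FinVec ι)) :=
  NonUnitalAlgebra.adjoin ℂ (Set.range fun p : ι × ι => finUnit p.1 p.2)

/-- The three usual choices of paths. -/
inductive PathKind
  | continuous
  | smooth
  | polynomial

/-- The algebra of continuous, smooth or polynomial functions on `[0,1]`. -/
noncomputable def pathAlgebra : PathKind → Subalgebra ℂ (unitInterval → ℂ)
  | .continuous =>
    { carrier := {f | Continuous f}
      mul_mem' := fun ha hb => Continuous.mul ha hb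
      add_mem' := fun ha hb => Continuous.add ha hb
      algebraMap_mem' := fun _ => continuous_const }
  | .smooth =>
    { carrier := {f | ∃ F : ℝ → ℂ, ContDiff ℝ (⊤ : ℕ∞) F ∧ ∀ t : unitInterval, f t = F t}
      mul_mem' := by
        rintro a b ⟨F, hF, ha⟩ ⟨K, hK, hb⟩
        exact ⟨fun t => F t * K t, hF.mul hK, fun t => by simp [ha, hb]⟩
      add_mem' := by
        rintro a b ⟨F, hF, ha⟩ ⟨K, hK, hb⟩
        exact ⟨fun t => F t + K t, hF.add hK, fun t => by simp [ha, hb]⟩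
      algebraMap_mem' := fun r => ⟨fun _ => r, contDiff_const, fun _ => rfl⟩ }
  | .polynomial => Algebra.adjoin ℂ {fun t : unitInterval => ((t : ℝ) : ℂ)}

/-- Evaluation `B ⊗ P[0,1] → B` at a point of the interval. -/
noncomputable def evalPath (p : PathKind) (B : Type u) [AddCommGroup B] [Module ℂ B]
    (t : unitInterval) : B ⊗[ℂ] pathAlgebra p →ₗ[ℂ] B :=
  (TensorProduct.rid ℂ B).toLinearMap ∘ₗ
    LinearMap.lTensor B (LinearMap.proj t ∘ₗ (pathAlgebra p).val.toLinearMap)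

/-- The algebra `𝔠` of complex linear combinations of idempotents of `G`, with `χ_g(e) = g e g*`.
(If `G` is a group this is `ℂ` with the trivial action.) -/
noncomputable def algCoeff (G : Type u) [InverseMonoid G] : GAlg G where
  carrier := MonoidAlgebra ℂ (Idem G)
  act g := MonoidAlgebra.mapDomainNonUnitalAlgHom ℂ ℂ (Idem.conj g)
  act_one a := by
    induction a using MonoidAlgebra.induction_linear with
    | zero => simp
    | add f k hf hk => rw [map_add, hf, hk]
    | single e r =>
      simp [MonoidAlgebra.mapDomain_single, Idem.conj_one]
  act_mul g h a := by
    induction a using MonoidAlgebra.induction_linear with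
    | zero => simp
    | add f k hf hk => simp only [map_add, hf, hk]
    | single e r =>
      simp [MonoidAlgebra.mapDomain_single, Idem.conj_conj]
  compat e a b := by
    induction a using MonoidAlgebra.induction_linear with
    | zero => simp
    | add f k hf hk => simp only [map_add, add_mul, hf, hk]
    | single e' r =>
      induction b using MonoidAlgebra.induction_linear with
      | zero => simp
      | add f k hf hk => simp only [map_add, mul_add, hf, hk]
      | single e'' r' =>
        simp [MonoidAlgebra.mapDomain_single, MonoidAlgebra.single_mul_single, Idem.conj_idem,
          mul_assoc, mul_left_comm]

/-- The setting of algebras, with one of the three notions of homotopy. -/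
noncomputable def algSetting (G : Type u) [InverseMonoid G] (p : PathKind) : Setting G where
  C := GAlg G
  U := 𝟭 _
  top _ := ⊥
  IsTensor τ :=
    (∀ m m' a a', τ m a * τ m' a' = τ (m * m') (a * a')) ∧
      Function.Bijective (TensorProduct.lift τ)
  Homotopic {A B} f k := ∃ H : A.carrier →ₙₐ[ℂ] B.carrier ⊗[ℂ] pathAlgebra p,
    (∀ g a, H (A.act g a) =
      LinearMap.rTensor (pathAlgebra p) (B.act g : B.carrier →ₗ[ℂ] B.carrier) (H a)) ∧
    ∀ a, evalPath p B.carrier 0 (H a) = f.toHom a ∧ evalPath p B.carrier 1 (H a) = k.toHom a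
  mat ι :=
    { carrier := FinMat ι
      act := fun _ => NonUnitalAlgHom.id ℂ _
      act_one := fun _ => rfl
      act_mul := fun _ _ _ => rfl
      compat := fun _ _ _ => rfl }
  unit i j := (⟨finUnit i j, NonUnitalAlgebra.subset_adjoin ℂ ⟨(i, j), rfl⟩⟩ : FinMat _)
  coeff := algCoeff G
  idem e := (MonoidAlgebra.single e 1 : MonoidAlgebra ℂ (Idem G))

end Algebraic

/-! ### The setting of C*-algebras -/

section CStar

/-- The matrix unit `e_{ij}`, as an operator on `ℓ²(ι)`. -/
noncomputable def l2Unit {ι : Type u} (i j : ι) :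
    lp (fun _ : ι => ℂ) 2 →L[ℂ] lp (fun _ : ι => ℂ) 2 :=
  open Classical in
  (innerSL ℂ (lp.single 2 j (1 : ℂ) : lp (fun _ : ι => ℂ) 2)).smulRight (lp.single 2 i (1 : ℂ))

/-- The C*-algebra of compact operators on `ℓ²(ι)`: the closed `*`-algebra generated by the matrix
units. -/
noncomputable abbrev CptMat (ι : Type u) :
    NonUnitalStarSubalgebra ℂ (lp (fun _ : ι => ℂ) 2 →L[ℂ] lp (fun _ : ι => ℂ) 2) :=
  (NonUnitalStarAlgebra.adjoin ℂ
    (Set.range fun p : ι × ι => l2Unit p.1 p.2)).topologicalClosure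

/-- The semicharacters `E → {0,1}` of the semilattice of idempotents, including the zero one. -/
@[ext] structure SemiChar (G : Type u) [InverseMonoid G] where
  toFun : Idem G → Bool
  map_mul : ∀ e f, toFun (e * f) = (toFun e && toFun f)

namespace SemiChar

variable {G : Type u} [InverseMonoid G]

/-- The topology of pointwise convergence. -/
instance : TopologicalSpace (SemiChar G) := TopologicalSpace.induced toFun inferInstance

theorem continuous_toFun : Continuous (toFun : SemiChar G → Idem G → Bool) :=
  continuous_induced_dom

instance : CompactSpace (SemiChar G) := by
  have hr : Set.range (toFun : SemiChar G → Idem G → Bool) =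
      ⋂ e, ⋂ f, {ξ : Idem G → Bool | ξ (e * f) = (ξ e && ξ f)} := by
    ext ξ
    simp only [Set.mem_range, Set.mem_iInter]
    exact ⟨fun ⟨η, h⟩ e f => h ▸ η.map_mul e f, fun h => ⟨⟨ξ, fun e f => h e f⟩, rfl⟩⟩
  have hc : IsClosed (Set.range (toFun : SemiChar G → Idem G → Bool)) := by
    rw [hr]
    refine isClosed_iInter fun e => isClosed_iInter fun f => ?_
    refine isClosed_eq (continuous_apply _) ?_
    have h2 : Continuous fun ξ : Idem G → Bool => (ξ e, ξ f) :=
      (continuous_apply e).prodMk (continuous_apply f)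
    exact (continuous_of_discreteTopology (f := fun q : Bool × Bool => (q.1 && q.2))).comp h2
  have hi : IsClosedEmbedding (toFun : SemiChar G → Idem G → Bool) :=
    ⟨⟨⟨rfl⟩, fun _ _ h => SemiChar.ext h⟩, hc⟩
  exact hi.compactSpace

instance : Zero (SemiChar G) := ⟨⟨fun _ => false, fun _ _ => rfl⟩⟩

/-- `ξ ↦ ξ(g · g*)`. -/
def shift (g : G) : C(SemiChar G, SemiChar G)₀ where
  toFun ξ := ⟨fun e => ξ.toFun (Idem.conj g e), fun e f => by simp only [_root_.map_mul, ξ.map_mul]⟩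
  continuous_toFun := continuous_induced_rng.mpr
    (continuous_pi fun e => (continuous_apply (Idem.conj g e)).comp continuous_toFun)
  map_zero' := rfl

/-- The function `ξ ↦ ξ(e)`. -/
def eval (e : Idem G) : C(SemiChar G, ℂ)₀ where
  toFun ξ := if ξ.toFun e then 1 else 0
  continuous_toFun :=
    (continuous_of_discreteTopology (f := fun b : Bool => if b then (1 : ℂ) else 0)).comp
      ((continuous_apply e).comp continuous_toFun)
  map_zero' := rfl

end SemiChar

noncomputable instance semiCharCStar (G : Type u) [InverseMonoid G] :
    NonUnitalCStarAlgebra C(SemiChar G, ℂ)₀ where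

/-- The C*-algebra `𝔠 = C*(E)`, realized as the continuous functions on the space of semicharacters
of `E` vanishing at the zero semicharacter, with the idempotent `e` corresponding to the function
`ξ ↦ ξ(e)` and the action `χ_g(e) = g e g*`. (If `G` is a group this is `ℂ`.) -/
noncomputable def cstarCoeff (G : Type u) [InverseMonoid G] : CGAlg G where
  carrier := C(SemiChar G, ℂ)₀
  act g := ContinuousMapZero.nonUnitalStarAlgHom_precomp ℂ (SemiChar.shift g)
  act_one a := by
    ext ξ
    change a (SemiChar.shift 1 ξ) = a ξ
    congr 1
    exact SemiChar.ext (funext fun e => congrArg ξ.toFun (Idem.conj_one e))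
  act_mul g h a := by
    ext ξ
    change a (SemiChar.shift (g * h) ξ) = a (SemiChar.shift h (SemiChar.shift g ξ))
    congr 1
    exact SemiChar.ext (funext fun e => congrArg ξ.toFun (Idem.conj_conj g h e).symm)
  compat e a b := by
    ext ξ
    change a (SemiChar.shift e.1 ξ) * b ξ = a ξ * b (SemiChar.shift e.1 ξ)
    have key : ∀ f, (SemiChar.shift e.1 ξ).toFun f = (ξ.toFun e && ξ.toFun f) := fun f => by
      change ξ.toFun (Idem.conj e.1 f) = _
      rw [Idem.conj_idem, ξ.map_mul]
    cases h : ξ.toFun e with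
    | true =>
      have : SemiChar.shift e.1 ξ = ξ := SemiChar.ext (funext fun f => by rw [key, h]; simp)
      rw [this]
    | false =>
      have : SemiChar.shift e.1 ξ = 0 := SemiChar.ext (funext fun f => by rw [key, h]; rfl)
      rw [this, map_zero, map_zero, zero_mul, mul_zero]

/-- The setting of C*-algebras. Here `D = M ⊗ A` means that `D` is a C*-completion of the algebraic
tensor product of `*`-algebras; it is only used for `M = CptMat ι`, which is nuclear, so that there
is only one such completion. -/
noncomputable def cstarSetting (G : Type u) [InverseMonoid G] : Setting G where
  C := CGAlg G
  U := CGAlg.forget G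
  top A := inferInstanceAs (TopologicalSpace A.carrier)
  IsTensor {M A D} (τ : M.carrier →ₗ[ℂ] A.carrier →ₗ[ℂ] D.carrier) :=
    (∀ m m' a a', τ m a * τ m' a' = τ (m * m') (a * a')) ∧
      (∀ m a, star (τ m a) = τ (star m) (star a)) ∧
      Function.Injective (TensorProduct.lift τ) ∧ DenseRange (TensorProduct.lift τ)
  Homotopic {A B} f k := ∃ F : unitInterval → (A ⟶ B),
    (∀ a : A.carrier, Continuous fun t => ((F t).toHom a : B.carrier)) ∧ F 0 = f ∧ F 1 = k
  mat ι :=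
    letI : NonUnitalCStarAlgebra (CptMat ι) :=
      NonUnitalStarSubalgebra.nonUnitalCStarAlgebra _
        (h_closed := NonUnitalStarSubalgebra.isClosed_topologicalClosure _)
    { carrier := CptMat ι
      act := fun _ => NonUnitalStarAlgHom.id ℂ _
      act_one := fun _ => rfl
      act_mul := fun _ _ _ => rfl
      compat := fun _ _ _ => rfl }
  unit i j := (⟨l2Unit i j, NonUnitalStarSubalgebra.le_topologicalClosure _
    (NonUnitalStarAlgebra.subset_adjoin ℂ _ ⟨(i, j), rfl⟩)⟩ : CptMat _)
  coeff := cstarCoeff G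
  idem e := (SemiChar.eval e : C(SemiChar G, ℂ)₀)

end CStar

/-- The kinds of `GK^G`-theory considered: for algebras (with a choice of paths for homotopies), and
for C*-algebras, where the theory is `KK^G`. -/
inductive Flavor
  | algebras (p : PathKind)
  | cstarAlgebras

/-- The setting of the given kind. -/
noncomputable def setting (G : Type u) [InverseMonoid G] : Flavor → Setting G
  | .algebras p => algSetting G p
  | .cstarAlgebras => cstarSetting G

/-! ## Matrix corner embeddings and split exact sequences -/

namespace Setting

variable {G : Type u} [InverseMonoid G] (S : Setting G)

/-- The elements of an algebra. -/
abbrev El (A : S.C) : Type u := (S.U.obj A).carrier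

variable {S}

/-- A morphism as a map of elements. -/
def ap {A B : S.C} (f : A ⟶ B) : S.El A →ₙₐ[ℂ] S.El B := (S.U.map f).toHom

/-- The action of `G` on elements. -/
def act {A : S.C} (g : G) (a : S.El A) : S.El A := (S.U.obj A).act g a

variable (S)

/-- A `G`-action `σ` on the matrix algebra `M_ι`. -/
structure MatAction (ι : Type u) where
  hom : G → (S.mat ι ⟶ S.mat ι)
  hom_one : hom 1 = 𝟙 _
  hom_mul : ∀ g h, hom (g * h) = hom h ≫ hom g
  compat : ∀ e : Idem G, ∀ a b, ap (hom e.1) a * b = a * ap (hom e.1) b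

/-- `(D, δ) = (M_ι ⊗ A, σ ⊗ α)`: a very special matrix algebra over `(A, α)`. -/
structure MatTensor {ι : Type u} (σ : S.MatAction ι) (A D : S.C) where
  tmul : S.El (S.mat ι) →ₗ[ℂ] S.El A →ₗ[ℂ] S.El D
  isTensor : S.IsTensor tmul
  act_tmul : ∀ g m a, act g (tmul m a) = tmul (ap (σ.hom g) m) (act g a)

/-- A very special canonical matrix corner embedding `e : (A, α) → (M_ι ⊗ A, σ ⊗ α)`,
`e(a) = e_{00} ⊗ a`, where `0` denotes a base point of `ι`. -/
structure Corner (A D : S.C) where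
  index : Type u
  base : index
  σ : S.MatAction index
  tensor : S.MatTensor σ A D
  hom : A ⟶ D
  hom_apply : ∀ a, ap hom a = tensor.tmul (S.unit base base) a

/-- `e` is a very special matrix corner embedding of a permitted size. -/
def IsCorner (P : Type u → Prop) {A D : S.C} (e : A ⟶ D) : Prop :=
  ∃ c : S.Corner A D, P c.index ∧ c.hom = e

/-- `0 → J → X → A → 0` is short exact and split by `s` (all maps equivariant homomorphisms). -/
structure SplitExact {J X A : S.C} (i : J ⟶ X) (f : X ⟶ A) (s : A ⟶ X) : Prop where
  injective : Function.Injective (ap i)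
  exact : ∀ x, ap f x = 0 ↔ ∃ j, ap i j = x
  split : ∀ a, ap f (ap s a) = a

/-- The class `R` of objects and the class `P` of permitted matrix sizes are sufficiently big: all
algebras in `R` are quadratik (every element is a finite sum of products), `𝔠` is in `R`, finite
sizes are permitted, as are products of permitted sizes, and `R` is closed under very special matrix
algebras of permitted size and under split extensions. For instance `R` may consist of all quadratik
algebras, with all sizes permitted. -/
structure SufficientlyBig (R : S.C → Prop) (P : Type u → Prop) : Prop where
  quadratik : ∀ A, R A → ∀ a : S.El A, a ∈ AddSubmonoid.closure {x | ∃ b c : S.El A, x = b * c}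
  coeff_mem : R S.coeff
  finite_mem : ∀ ι : Type u, Finite ι → P ι
  prod_mem : ∀ ι κ : Type u, P ι → P κ → P (ι × κ)
  mat_mem : ∀ (ι : Type u) (σ : S.MatAction ι) (A D : S.C), S.MatTensor σ A D → P ι → R A → R D
  ext_mem : ∀ {J X A : S.C} (i : J ⟶ X) (f : X ⟶ A) (s : A ⟶ X),
    S.SplitExact i f s → R J → R A → R X

end Setting

/-! ## Very special `GK^G`-theory by generators and relations -/

section GKTheory

variable {G : Type u} [InverseMonoid G]

/-- The objects of very special `GK^G`-theory: the algebras in the class `R`. -/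
def GK (S : Setting G) (R : S.C → Prop) (_P : Type u → Prop) : Type (u + 1) := {A : S.C // R A}

variable {S : Setting G} {R : S.C → Prop} {P : Type u → Prop}

/-- The valid strings in the generators and `+`, `-`, `·`: the generators are the homomorphisms, an
inverse for each very special corner embedding, and a synthetic split `Δ_s` for each split exact
sequence. Products are read from left to right. -/
inductive Word : GK S R P → GK S R P → Type (u + 1)
  | hom {A B : GK S R P} (f : A.1 ⟶ B.1) : Word A B
  | inv {A D : GK S R P} (e : A.1 ⟶ D.1) (he : S.IsCorner P e) : Word D A
  | split {J X A : GK S R P} (i : J.1 ⟶ X.1) (f : X.1 ⟶ A.1) (s : A.1 ⟶ X.1)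
      (h : S.SplitExact i f s) : Word X J
  | zero (A B : GK S R P) : Word A B
  | add {A B : GK S R P} (x y : Word A B) : Word A B
  | neg {A B : GK S R P} (x : Word A B) : Word A B
  | comp {A B C : GK S R P} (x : Word A B) (y : Word B C) : Word A C

/-- The equivalence relation generated by the relations of `GK^G`-theory. -/
inductive Word.Rel : ∀ {A B : GK S R P}, Word A B → Word A B → Prop
  | refl {A B : GK S R P} (x : Word A B) : Rel x x
  | symm {A B : GK S R P} {x y : Word A B} : Rel x y → Rel y x
  | trans {A B : GK S R P} {x y z : Word A B} : Rel x y → Rel y z → Rel x z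
  | add_congr {A B : GK S R P} {x x' y y' : Word A B} :
      Rel x x' → Rel y y' → Rel (.add x y) (.add x' y')
  | neg_congr {A B : GK S R P} {x x' : Word A B} : Rel x x' → Rel (.neg x) (.neg x')
  | comp_congr {A B C : GK S R P} {x x' : Word A B} {y y' : Word B C} :
      Rel x x' → Rel y y' → Rel (.comp x y) (.comp x' y')
  | add_assoc {A B : GK S R P} (x y z : Word A B) :
      Rel (.add (.add x y) z) (.add x (.add y z))
  | add_comm {A B : GK S R P} (x y : Word A B) : Rel (.add x y) (.add y x)
  | add_zero {A B : GK S R P} (x : Word A B) : Rel (.add x (.zero A B)) x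
  | add_neg {A B : GK S R P} (x : Word A B) : Rel (.add x (.neg x)) (.zero A B)
  | comp_assoc {A B C D : GK S R P} (x : Word A B) (y : Word B C) (z : Word C D) :
      Rel (.comp (.comp x y) z) (.comp x (.comp y z))
  | comp_add {A B C : GK S R P} (x : Word A B) (y z : Word B C) :
      Rel (.comp x (.add y z)) (.add (.comp x y) (.comp x z))
  | add_comp {A B C : GK S R P} (x y : Word A B) (z : Word B C) :
      Rel (.comp (.add x y) z) (.add (.comp x z) (.comp y z))
  | id_comp {A B : GK S R P} (x : Word A B) : Rel (.comp (.hom (𝟙 A.1)) x) x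
  | comp_id {A B : GK S R P} (x : Word A B) : Rel (.comp x (.hom (𝟙 B.1))) x
  | hom_comp {A B C : GK S R P} (f : A.1 ⟶ B.1) (k : B.1 ⟶ C.1) :
      Rel (.comp (.hom f) (.hom k)) (.hom (f ≫ k) : Word A C)
  | hom_inv {A D : GK S R P} (e : A.1 ⟶ D.1) (he : S.IsCorner P e) :
      Rel (.comp (.hom e) (.inv e he)) (.hom (𝟙 A.1) : Word A A)
  | inv_hom {A D : GK S R P} (e : A.1 ⟶ D.1) (he : S.IsCorner P e) :
      Rel (.comp (.inv e he) (.hom e)) (.hom (𝟙 D.1) : Word D D)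
  | homotopy {A B : GK S R P} (f k : A.1 ⟶ B.1) (h : S.Homotopic f k) :
      Rel (.hom f : Word A B) (.hom k)
  | split_sum {J X A : GK S R P} (i : J.1 ⟶ X.1) (f : X.1 ⟶ A.1) (s : A.1 ⟶ X.1)
      (h : S.SplitExact i f s) :
      Rel (.hom (𝟙 X.1) : Word X X)
        (.add (.comp (.split i f s h) (.hom i)) (.comp (.hom f) (.hom s)))
  | split_incl {J X A : GK S R P} (i : J.1 ⟶ X.1) (f : X.1 ⟶ A.1) (s : A.1 ⟶ X.1)
      (h : S.SplitExact i f s) :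
      Rel (.comp (.hom i) (.split i f s h)) (.hom (𝟙 J.1) : Word J J)

/-- Strings up to equivalence. -/
instance Word.setoid (A B : GK S R P) : Setoid (Word A B) where
  r := Word.Rel
  iseqv := ⟨.refl, .symm, .trans⟩

/-- Very special `GK^G`-theory as a category; `x ≫ y` is the product `x · y`. -/
instance : Category.{u + 1} (GK S R P) where
  Hom A B := Quotient (Word.setoid A B)
  id A := ⟦.hom (𝟙 A.1)⟧
  comp := Quotient.map₂ .comp fun _ _ h _ _ h' => .comp_congr h h'
  id_comp := by rintro A B ⟨x⟩; exact Quotient.sound (.id_comp x)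
  comp_id := by rintro A B ⟨x⟩; exact Quotient.sound (.comp_id x)
  assoc := by rintro A B C D ⟨x⟩ ⟨y⟩ ⟨z⟩; exact Quotient.sound (.comp_assoc x y z)

instance (A B : GK S R P) : Add (A ⟶ B) where
  add := Quotient.map₂ .add fun _ _ h _ _ h' => .add_congr h h'

instance (A B : GK S R P) : Zero (A ⟶ B) where
  zero := ⟦.zero A B⟧

instance (A B : GK S R P) : Neg (A ⟶ B) where
  neg := Quotient.map .neg fun _ _ h => .neg_congr h

instance (A B : GK S R P) : AddCommGroup (A ⟶ B) where
  add_assoc := by rintro ⟨x⟩ ⟨y⟩ ⟨z⟩; exact Quotient.sound (.add_assoc x y z)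
  zero_add := by
    rintro ⟨x⟩; exact Quotient.sound ((Word.Rel.add_comm _ _).trans (.add_zero x))
  add_zero := by rintro ⟨x⟩; exact Quotient.sound (.add_zero x)
  neg_add_cancel := by
    rintro ⟨x⟩; exact Quotient.sound ((Word.Rel.add_comm _ _).trans (.add_neg x))
  add_comm := by rintro ⟨x⟩ ⟨y⟩; exact Quotient.sound (.add_comm x y)
  nsmul := nsmulRec
  zsmul := zsmulRec

/-- The morphism given by a string. -/
def Word.toGK {A B : GK S R P} (x : Word A B) : A ⟶ B := (⟦x⟧ : Quotient (Word.setoid A B))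

instance : Preadditive (GK S R P) where
  add_comp := by rintro A B C ⟨x⟩ ⟨y⟩ ⟨z⟩; exact Quotient.sound (.add_comp x y z)
  comp_add := by rintro A B C ⟨x⟩ ⟨y⟩ ⟨z⟩; exact Quotient.sound (.comp_add x y z)

/-! ## Level-one elements -/

open Setting

/-- An extended double split exact sequence (in very special `GK^G`-theory)
`B ⟶ J ⟶ X ⇄ A` with exit corner embedding `B ⟶ J`, ideal `J`, a split exact sequence
`0 → J → X → A → 0` with equivariant split `s₋ : A → (X, γ₋)`, and a second homomorphism `s₊` from
`A` to `X`, equivariant for a second action `γ₊`, with `s₊(a) - s₋(a) ∈ J`. The two actions are the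
restrictions of an action `δ` on `M₂(X)` to the two diagonal corners:
`(X, γ₋) → (M₂(X), δ) ← (X, γ₊)`. The algebras `(X, γ₋)`, `(X, γ₊)`, `(M₂(X), δ)` are called
`Xm`, `Xp`, `M`. -/
structure LevelOneSeq (A B : GK S R P) where
  J : GK S R P
  Xm : GK S R P
  Xp : GK S R P
  M : GK S R P
  exit : S.Corner B.1 J.1
  exit_mem : P exit.index
  inc : J.1 ⟶ Xm.1
  proj : Xm.1 ⟶ A.1
  sm : A.1 ⟶ Xm.1
  splitExact : S.SplitExact inc proj sm
  sp : A.1 ⟶ Xp.1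
  /-- the upper left corner embedding; as it is inverted, it has to be very special -/
  left : S.Corner Xm.1 M.1
  left_mem : P left.index
  /-- the second index; the first one is `left.base` -/
  other : left.index
  other_ne : other ≠ left.base
  eq_or_eq : ∀ i, i = left.base ∨ i = other
  /-- the lower right corner embedding -/
  right : Xp.1 ⟶ M.1
  right_injective : Function.Injective (ap right)
  right_range : Set.range (ap right) = Set.range (left.tensor.tmul (S.unit other other))
  /-- `s₊(a) - s₋(a) ∈ J`, an identity in the non-equivariant algebra `X` -/
  diff_mem : ∀ a, ∃ j,
    ap right (ap sp a) = left.tensor.tmul (S.unit other other) (ap sm a + ap inc j)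
  /-- the action induced by `δ` on `M₂(X)/M₂(J) = M₂ ⊗ X/J` is the identity on `M₂` tensored with
  an action on `X/J` (which must then be the one induced by `γ₋`) -/
  quotient_act : ∀ g m x,
    act g (left.tensor.tmul m x) - left.tensor.tmul m (act g x) ∈
      Submodule.span ℂ {y | ∃ m' j, y = left.tensor.tmul m' (ap inc j)}

namespace LevelOneSeq

variable {A B : GK S R P}

/-- `j = s₊(a) - s₋(a)`. -/
def IsDiff (t : LevelOneSeq A B) (a : S.El A.1) (j : S.El t.J.1) : Prop :=
  ap t.right (ap t.sp a) =
    t.left.tensor.tmul (S.unit t.other t.other) (ap t.sm a + ap t.inc j)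

/-- The morphism `s₊ ∇_{s₋} = s₊ · f₂ · f₁⁻¹ · Δ_{s₋} · e⁻¹` associated to an extended double split
exact sequence, where `f₁`, `f₂` are the upper left and the lower right corner embedding of `X` and
`e` is the exit corner embedding. -/
def toGK (t : LevelOneSeq A B) : A ⟶ B :=
  (Word.hom t.sp : Word A t.Xp).toGK ≫ (Word.hom t.right : Word t.Xp t.M).toGK ≫
    (Word.inv t.left.hom ⟨t.left, t.left_mem, rfl⟩ : Word t.M t.Xm).toGK ≫
      (Word.split t.inc t.proj t.sm t.splitExact : Word t.Xm t.J).toGK ≫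
        (Word.inv t.exit.hom ⟨t.exit, t.exit_mem, rfl⟩ : Word t.J B).toGK

end LevelOneSeq

/-- The level-one elements of `GK^G(A, B)`. -/
def L1 (A B : GK S R P) : Set (A ⟶ B) := Set.range LevelOneSeq.toGK

/-! ## The explicit product -/

/-- The idempotent `p_F = ∑_{i ∈ F} e_{ii} ⊗ 1` of the ideal `M_n(𝔠)` of a level-one element
`A → 𝔠`; here `1` is the unit of `𝔠`. -/
def LevelOneSeq.approxUnit {h : R S.coeff} {A : GK S R P} (t : LevelOneSeq A ⟨S.coeff, h⟩)
    (F : Finset t.exit.index) : S.El t.J.1 :=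
  ∑ i ∈ F, t.exit.tensor.tmul (S.unit i i) (S.idem 1)

/-- `ProductFormula t s x` says that the extended double split exact sequence `x` from `A` to `B` is
the one computed from `t` (from `A` to `𝔠`) and `s` (from `𝔠` to `B`) by the explicit product
formula. Write `t = (t_±)` with ideal `K = M_n(𝔠)` and `s = (s_±)` with algebra `X` and ideal
`J`. Then

* `u_± := id ⊗ s_± : K = M_n(𝔠) → M_n(X)` and `S_±(k) := u_±(k) ⊕ k ∈ M_n(X) ⊕ K`;
* `φ : 𝔠 → L(X)` is given by `φ(e) x = γ_e(x)` for idempotents `e ∈ G`, and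
  `ϑ(k) := (id ⊗ φ)(k) ⊕ k`, acting by multiplication from both sides on `M_n(X) ⊕ K`;
* `T(a) := lim_F ϑ(t₋(a) p_F)`, acting by multiplication from both sides on `M_n(X) ⊕ K`;
* `x` has the ideal `M_n(J)`, which is embedded as `M_n(J) ⊕ 0` into `M_n(X) ⊕ K`, the exit corner
  embedding `B → J → M_n(J)`, and the two homomorphisms
  `x_±(a) = (S_±((t₊ - t₋)(a)) + T(a)) ⊕ a`.

The algebra of `x` thus consists of the elements `(v + T(a)) ⊕ a` with
`v = S_±((t₊ - t₋)(a)) + (j ⊕ 0)`, `j ∈ M_n(J)`. These elements are recorded by their coordinates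
`(v, a) ∈ (M_n(X) ⊕ K) ⊕ A`, in which the product is
`(v, a)(w, b) = (v w + v T(b) + T(a) w, a b)`. -/
structure ProductFormula {h : R S.coeff} {A B : GK S R P} (t : LevelOneSeq A ⟨S.coeff, h⟩)
    (s : LevelOneSeq ⟨S.coeff, h⟩ B) (x : LevelOneSeq A B) where
  /-- the algebra `M_n(X)` with action `σ ⊗ γ₋` -/
  D : GK S R P
  tensorD : S.MatTensor t.exit.σ s.Xm.1 D.1
  /-- the ideal of `x` is `M_n(J)` with action `σ ⊗ γ₋` -/
  tensorJ : S.MatTensor t.exit.σ s.J.1 x.J.1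
  /-- the exit corner embedding of `x` is `B → J → M_n(J)` -/
  exit_apply : ∀ b, ap x.exit.hom b =
    tensorJ.tmul (S.unit t.exit.base t.exit.base) (ap s.exit.hom b)
  /-- the inclusion `M_n(J) → M_n(X)` -/
  incD : x.J.1 ⟶ D.1
  incD_tmul : ∀ m j, ap incD (tensorJ.tmul m j) = tensorD.tmul m (ap s.inc j)
  /-- `u₋ = id ⊗ s₋` -/
  um : t.J.1 ⟶ D.1
  um_tmul : ∀ m c, ap um (t.exit.tensor.tmul m c) = tensorD.tmul m (ap s.sm c)
  /-- `u₊ = id ⊗ s₊` -/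
  up : t.J.1 ⟶ D.1
  up_tmul : ∀ m c j, s.IsDiff c j →
    ap up (t.exit.tensor.tmul m c) = tensorD.tmul m (ap s.sm c + ap s.inc j)
  /-- `φ` -/
  φ : S.El S.coeff →ₗ[ℂ] S.El s.Xm.1 →ₗ[ℂ] S.El s.Xm.1
  φ_idem : ∀ e y, φ (S.idem e) y = act e.1 y
  φ_continuous : ∀ y, Continuous fun c => φ c y
  /-- left multiplication of `M_n(X)` by `id ⊗ φ` -/
  mulLeft : S.El t.J.1 →ₗ[ℂ] S.El D.1 →ₗ[ℂ] S.El D.1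
  mulLeft_tmul : ∀ m c m' y, mulLeft (t.exit.tensor.tmul m c) (tensorD.tmul m' y) =
    tensorD.tmul (m * m') (φ c y)
  mulLeft_continuous : ∀ y, Continuous fun k => mulLeft k y
  mulLeft_continuous' : ∀ k, Continuous fun y => mulLeft k y
  /-- right multiplication of `M_n(X)` by `id ⊗ φ`; note that `φ` is central -/
  mulRight : S.El t.J.1 →ₗ[ℂ] S.El D.1 →ₗ[ℂ] S.El D.1
  mulRight_tmul : ∀ m c m' y, mulRight (t.exit.tensor.tmul m c) (tensorD.tmul m' y) =
    tensorD.tmul (m' * m) (φ c y)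
  mulRight_continuous : ∀ y, Continuous fun k => mulRight k y
  mulRight_continuous' : ∀ k, Continuous fun y => mulRight k y
  /-- `v ↦ T(a) v` -/
  TL : S.El A.1 → S.El D.1 × S.El t.J.1 → S.El D.1 × S.El t.J.1
  TL_tendsto : ∀ a (k : Finset t.exit.index → S.El t.J.1),
    (∀ F, ap t.inc (k F) = ap t.sm a * ap t.inc (t.approxUnit F)) →
    ∀ v, Tendsto (fun F => (mulLeft (k F) v.1, k F * v.2)) atTop (𝓝 (TL a v))
  /-- `v ↦ v T(a)` -/
  TR : S.El A.1 → S.El D.1 × S.El t.J.1 → S.El D.1 × S.El t.J.1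
  TR_tendsto : ∀ a (k : Finset t.exit.index → S.El t.J.1),
    (∀ F, ap t.inc (k F) = ap t.inc (t.approxUnit F) * ap t.sm a) →
    ∀ v, Tendsto (fun F => (mulRight (k F) v.1, v.2 * k F)) atTop (𝓝 (TR a v))
  /-- the coordinates of the elements of the algebra of `x` -/
  coord : S.El x.Xm.1 →ₗ[ℂ] (S.El D.1 × S.El t.J.1) × S.El A.1
  coord_injective : Function.Injective coord
  coord_mul : ∀ v w, coord (v * w) =
    ((coord v).1 * (coord w).1 + TR (coord w).2 (coord v).1 + TL (coord v).2 (coord w).1,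
      (coord v).2 * (coord w).2)
  coord_inc : ∀ j, coord (ap x.inc j) = ((ap incD j, 0), 0)
  /-- `x₋(a) = (S₋((t₊ - t₋)(a)) + T(a)) ⊕ a` -/
  coord_minus : ∀ a k, t.IsDiff a k → coord (ap x.sm a) = ((ap um k, k), a)
  /-- `x₊(a) = (S₊((t₊ - t₋)(a)) + T(a)) ⊕ a` -/
  coord_plus : ∀ a k j, t.IsDiff a k → x.IsDiff a j →
    coord (ap x.sm a + ap x.inc j) = ((ap up k, k), a)

end GKTheory

/-! The product is computed from the naturality of synthetic splits, once the actions and corner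
embeddings have been straightened out.

In a very special sequence the action `δ` on `M_2 ⊗ X` has the form `σ ⊗ γ_-` with `σ` an action on
`M_2`. The condition on `M_2(X)/M_2(J)` forces `σ_g = id` for every `g` that does not act as zero on
`A`. Therefore `s_+` is equivariant for `γ_-` as well, a rotation homotopy moves it from the lower
to the upper corner, and `s_+ ∇_{s_-} = s_+ · Δ_{s_-} · e⁻¹` (`LevelOneSeq.exists_equivariant`).

Let `Y` be the algebra of `t`, with ideal `K = M_n(𝔠)`, and let `u_± = id ⊗ s_±`. As `𝔠` is unital,
the base projection `e_00` is invariant (`Corner.act_base`), so `y ↦ e_00 ⊗ y` is an equivariant map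
`X → M_n(X)`, and naturality rewrites the morphism of `s` as `e_t · u_+ · Δ_{u_-} · e_x⁻¹`. Then
`e_t⁻¹ · e_t` cancels in the product, leaving `t_+ · Δ_{t_-} · u_+ · Δ_{u_-} · e_x⁻¹`.

To get rid of `Δ_{t_-}`, the maps `u_±` are extended from the ideal `K` to `Y`. Since `K` acts on
`M_n(X)` through `φ` and the `p_F` act as approximate units, `Y` acts by multipliers, `y v = lim (y
p_F) v`. This gives a split extension `Ω = M_n(X) + T(A)` with a projection to `Y` whose kernel is
`M_n(J)`, and with two sections `θ_±` which extend `u_±` and send `t_-(a)` to `T(a)`. Because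
`Δ_{t_-}` followed by the inclusion of `K` is `id` minus the projection through `t_-`, the product
equals `(t_+ - t_-) · θ_+ · Δ_{θ_-} · e_x⁻¹`. The summand `t_- · θ_+ = t_- · θ_-` is killed by
`Δ_{θ_-}`. What remains is `t_+ · θ_+ · Δ_{θ_-} · e_x⁻¹` (`gk_product`). Pulling `Ω → Y` back along
`t_+` yields the sequence `x` with `x_± = θ_± ∘ t_+`; splitting `t_+ = (t_+ - t_-) + t_-` turns this
into the stated formula (`exists_productFormula`). Conversely, the coordinates of any `x` given by
the formula define a map to `Ω` compatible with all these data, so the same computation applies to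
it (`ProductFormula.toGK_comp`).

The argument uses only the properties listed in `Setting.Good`. For algebras these are linear
algebra with discrete topologies. For C*-algebras they rest on comparing norms of matrix systems, on
the GNS construction for the existence of `M_n ⊗ A`, on Gelfand duality for `𝔠`, and on multiplier
algebras for semidirect products. -/

namespace Setting

variable {G : Type u} [InverseMonoid G] {S : Setting G}

/-! ### Elements, actions and split exact sequences -/

theorem ap_comp {A B C : S.C} (f : A ⟶ B) (k : B ⟶ C) (a : S.El A) :
    ap (f ≫ k) a = ap k (ap f a) := by
  unfold ap
  rw [S.U.map_comp]
  rfl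

theorem ap_id {A : S.C} (a : S.El A) : ap (𝟙 A) a = a := by
  unfold ap
  rw [S.U.map_id]
  rfl

theorem ap_act {A B : S.C} (f : A ⟶ B) (g : G) (a : S.El A) :
    ap f (act g a) = act g (ap f a) := (S.U.map f).map_act g a

/-- The action of `g` as an algebra homomorphism. -/
def actHom {A : S.C} (g : G) : S.El A →ₙₐ[ℂ] S.El A := (S.U.obj A).act g

theorem act_one' {A : S.C} (a : S.El A) : act (1 : G) a = a := (S.U.obj A).act_one a

theorem act_mul' {A : S.C} (g h : G) (a : S.El A) : act (g * h) a = act g (act h a) :=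
  (S.U.obj A).act_mul g h a

theorem act_compat {A : S.C} (e : Idem G) (a b : S.El A) : act e.1 a * b = a * act e.1 b :=
  (S.U.obj A).compat e a b

theorem map_act_mul {A : S.C} (g : G) (a b : S.El A) : act g (a * b) = act g a * act g b :=
  map_mul (actHom g) a b

theorem map_act_add {A : S.C} (g : G) (a b : S.El A) : act g (a + b) = act g a + act g b :=
  map_add (actHom g) a b

theorem map_act_zero {A : S.C} (g : G) : act g (0 : S.El A) = 0 := map_zero (actHom g)

theorem act_idem_idem {A : S.C} (e : Idem G) (a : S.El A) : act e.1 (act e.1 a) = act e.1 a := by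
  rw [← act_mul', e.2]

theorem act_idem_mul {A : S.C} (e : Idem G) (a b : S.El A) : act e.1 (a * b) = act e.1 a * b := by
  rw [map_act_mul, ← act_compat, act_idem_idem]

theorem act_idem_mul' {A : S.C} (e : Idem G) (a b : S.El A) : act e.1 (a * b) = a * act e.1 b := by
  rw [act_idem_mul, act_compat]

namespace SplitExact

variable {J X A : S.C} {i : J ⟶ X} {f : X ⟶ A} {s : A ⟶ X}

theorem proj_inc (h : S.SplitExact i f s) (j : S.El J) : ap f (ap i j) = 0 :=
  (h.exact _).mpr ⟨j, rfl⟩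

theorem exists_eq (h : S.SplitExact i f s) (x : S.El X) : ∃ j, x = ap i j + ap s (ap f x) := by
  obtain ⟨j, hj⟩ := (h.exact (x - ap s (ap f x))).mp (by rw [map_sub, h.split, sub_self])
  exact ⟨j, by rw [hj, sub_add_cancel]⟩

theorem exists_inc (h : S.SplitExact i f s) {x : S.El X} (hx : ap f x = 0) : ∃ j, ap i j = x :=
  (h.exact x).mp hx

theorem mul_mem (h : S.SplitExact i f s) (x : S.El X) (j : S.El J) : ∃ k, ap i k = x * ap i j :=
  h.exists_inc (by rw [map_mul, h.proj_inc, mul_zero])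

theorem mul_mem' (h : S.SplitExact i f s) (x : S.El X) (j : S.El J) : ∃ k, ap i k = ap i j * x :=
  h.exists_inc (by rw [map_mul, h.proj_inc, zero_mul])

end SplitExact

end Setting

/-! ### Calculus with corner inverses and synthetic splits -/

section GKLemmas

open Setting

variable {G : Type u} [InverseMonoid G] {S : Setting G} {R : S.C → Prop} {P : Type u → Prop}

/-- The morphism of `GK^G` given by a homomorphism. -/
def gk {A B : GK S R P} (f : A.1 ⟶ B.1) : A ⟶ B := (Word.hom f).toGK

/-- The inverse of a corner embedding in `GK^G`. -/
def gkInv {A D : GK S R P} (e : A.1 ⟶ D.1) (he : S.IsCorner P e) : D ⟶ A := (Word.inv e he).toGK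

/-- The synthetic split in `GK^G`. -/
def gkSplit {J X A : GK S R P} {i : J.1 ⟶ X.1} {f : X.1 ⟶ A.1} {s : A.1 ⟶ X.1}
    (h : S.SplitExact i f s) : X ⟶ J := (Word.split i f s h).toGK

theorem gk_comp {A B C : GK S R P} (f : A.1 ⟶ B.1) (k : B.1 ⟶ C.1) :
    gk f ≫ gk k = (gk (f ≫ k) : A ⟶ C) := Quotient.sound (.hom_comp f k)

theorem gk_id (A : GK S R P) : gk (𝟙 A.1) = 𝟙 A := rfl

theorem gk_gkInv {A D : GK S R P} (e : A.1 ⟶ D.1) (he : S.IsCorner P e) :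
    gk e ≫ gkInv e he = 𝟙 A := Quotient.sound (.hom_inv e he)

theorem gkInv_gk {A D : GK S R P} (e : A.1 ⟶ D.1) (he : S.IsCorner P e) :
    gkInv e he ≫ gk e = 𝟙 D := Quotient.sound (.inv_hom e he)

theorem gk_homotopy {A B : GK S R P} {f k : A.1 ⟶ B.1} (h : S.Homotopic f k) :
    (gk f : A ⟶ B) = gk k := Quotient.sound (.homotopy f k h)

section Split

variable {J X A : GK S R P} {i : J.1 ⟶ X.1} {f : X.1 ⟶ A.1} {s : A.1 ⟶ X.1}

theorem gkSplit_sum (h : S.SplitExact i f s) : 𝟙 X = gkSplit h ≫ gk i + gk f ≫ gk s :=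
  Quotient.sound (.split_sum i f s h)

theorem gk_gkSplit (h : S.SplitExact i f s) : gk i ≫ gkSplit h = 𝟙 J :=
  Quotient.sound (.split_incl i f s h)

theorem gkSplit_gk (h : S.SplitExact i f s) : gkSplit h ≫ gk i = 𝟙 X - gk f ≫ gk s :=
  eq_sub_of_add_eq (gkSplit_sum h).symm

/-- From `ι Δ = id` one gets `Δ = Δ ι Δ`, and `Δ ι = id - f s` is annihilated by `s` from the left.
-/
theorem gk_section_gkSplit (h : S.SplitExact i f s) (hs : s ≫ f = 𝟙 _) :
    gk s ≫ gkSplit h = 0 := by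
  have h1 : gk s ≫ gkSplit h = gk s ≫ (gkSplit h ≫ gk i) ≫ gkSplit h := by
    rw [Category.assoc, gk_gkSplit, Category.comp_id]
  rw [h1, gkSplit_gk, Preadditive.sub_comp, Preadditive.comp_sub, Category.id_comp,
    Category.assoc, ← Category.assoc (gk s) (gk f), gk_comp, hs, gk_id, Category.id_comp, sub_self]

/-- Synthetic splits are natural. -/
theorem gkSplit_naturality {J' X' A' : GK S R P} {i' : J'.1 ⟶ X'.1} {f' : X'.1 ⟶ A'.1}
    {s' : A'.1 ⟶ X'.1} (h : S.SplitExact i f s) (h' : S.SplitExact i' f' s')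
    (hs' : s' ≫ f' = 𝟙 _) (j : J.1 ⟶ J'.1) (ξ : X.1 ⟶ X'.1) (α : A.1 ⟶ A'.1)
    (hi : i ≫ ξ = j ≫ i') (hs : s ≫ ξ = α ≫ s') :
    gk ξ ≫ gkSplit h' = gkSplit h ≫ (gk j : J ⟶ J') := by
  -- Insert `id = Δ ι + f s` in front of `ξ Δ'`: the first summand becomes `Δ j ι' Δ' = Δ j`, the
  -- second ends in `s' Δ' = 0`.
  rw [← Category.id_comp (gk ξ), gkSplit_sum h, Preadditive.add_comp, Preadditive.add_comp,
    Category.assoc _ (gk i), Category.assoc _ (gk s), gk_comp i, gk_comp s, hi, hs, ← gk_comp,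
    ← gk_comp, Category.assoc _ _ (gkSplit h'), Category.assoc _ _ (gkSplit h'),
    Category.assoc _ _ (gkSplit h'), Category.assoc _ _ (gkSplit h'), gk_gkSplit,
    gk_section_gkSplit h' hs', Category.comp_id, Limits.comp_zero, Limits.comp_zero, add_zero]

end Split

/-- The computation in `GK^G` behind the product formula. -/
theorem gk_product {A 𝔠 B K Y X J D J' Ω Z : GK S R P}
    {iK : K.1 ⟶ Y.1} {pY : Y.1 ⟶ A.1} {tm tp : A.1 ⟶ Y.1} (ht : S.SplitExact iK pY tm)
    (htp : tp ≫ pY = 𝟙 _)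
    {et : 𝔠.1 ⟶ K.1} (het : S.IsCorner P et)
    {iJ : J.1 ⟶ X.1} {pX : X.1 ⟶ 𝔠.1} {sm sp : 𝔠.1 ⟶ X.1} (hs : S.SplitExact iJ pX sm)
    {es : B.1 ⟶ J.1} (hes : S.IsCorner P es)
    {iD : J'.1 ⟶ D.1} {pD : D.1 ⟶ K.1} {um up : K.1 ⟶ D.1} (hD : S.SplitExact iD pD um)
    (hum : um ≫ pD = 𝟙 _)
    {EX : X.1 ⟶ D.1} {EJ : J.1 ⟶ J'.1} (hEm : sm ≫ EX = et ≫ um) (hEp : sp ≫ EX = et ≫ up)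
    (hEJ : iJ ≫ EX = EJ ≫ iD)
    {ex : B.1 ⟶ J'.1} (hex : S.IsCorner P ex) (hex' : ex = es ≫ EJ)
    {iΩ : D.1 ⟶ Ω.1} {pΩ : Ω.1 ⟶ Y.1} {θm θp : Y.1 ⟶ Ω.1}
    (hΩ : S.SplitExact (iD ≫ iΩ) pΩ θm) (hθ : θm ≫ pΩ = 𝟙 _)
    (hum' : um ≫ iΩ = iK ≫ θm) (hup' : up ≫ iΩ = iK ≫ θp) (htθ : tm ≫ θp = tm ≫ θm)
    {iZ : J'.1 ⟶ Z.1} {pZ : Z.1 ⟶ A.1} {xm xp : A.1 ⟶ Z.1} (hZ : S.SplitExact iZ pZ xm)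
    (Ψ : Z.1 ⟶ Ω.1) (hΨ : iZ ≫ Ψ = iD ≫ iΩ) (hΨm : xm ≫ Ψ = tp ≫ θm)
    (hΨp : xp ≫ Ψ = tp ≫ θp) :
    (gk tp ≫ gkSplit ht ≫ gkInv et het) ≫ gk sp ≫ gkSplit hs ≫ gkInv es hes =
      (gk xp ≫ gkSplit hZ ≫ gkInv ex hex : A ⟶ B) := by
  -- Only `e_x = e_s E_J` is assumed to be invertible here, so `E_J` is handled by inserting `e_x
  -- e_x⁻¹` after `e_s⁻¹`.
  have h1 : gkInv es hes = gk EJ ≫ gkInv ex hex := by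
    have h := gk_gkInv ex hex
    rw [← Category.comp_id (gkInv es hes), ← h]
    subst hex'
    rw [← gk_comp, Category.assoc, ← Category.assoc (gkInv es hes), gkInv_gk, Category.id_comp]
  have h2 : gkSplit hs ≫ gk EJ = gk EX ≫ gkSplit hD :=
    (gkSplit_naturality hs hD hum EJ EX et hEJ hEm).symm
  -- The morphism of `s` is now expressed by its matrix version, preceded by the exit corner
  -- embedding of `t`.
  have h3 : gk sp ≫ gkSplit hs ≫ gkInv es hes = gk et ≫ gk up ≫ gkSplit hD ≫ gkInv ex hex := by
    rw [h1, ← Category.assoc (gkSplit hs), h2, Category.assoc, ← Category.assoc (gk sp), gk_comp,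
      hEp, ← gk_comp, Category.assoc]
  -- Both this split and the one of `Z` are restrictions of the split of `Ω`, the ideal being the
  -- same in all three extensions.
  have h4 : gkSplit hD = gk iΩ ≫ gkSplit hΩ := by
    have := gkSplit_naturality hD hΩ hθ (𝟙 J'.1) iΩ iK (by rw [Category.id_comp]) hum'
    rw [this, gk_id, Category.comp_id]
  have h5 : gkSplit hZ = gk Ψ ≫ gkSplit hΩ := by
    have : gk Ψ ≫ gkSplit hΩ = gkSplit hZ ≫ gk (𝟙 J'.1) := by
      exact gkSplit_naturality hZ hΩ hθ (𝟙 J'.1) Ψ tp (by rw [Category.id_comp, hΨ]) hΨm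
    rw [this, gk_id, Category.comp_id]
  -- On the range of `t_-` the two sections of `Ω` agree, and a split vanishes on its own section.
  have h6 : gk tm ≫ gk θp ≫ gkSplit hΩ = 0 := by
    rw [← Category.assoc, gk_comp, htθ, ← gk_comp, Category.assoc, gk_section_gkSplit hΩ hθ,
      Limits.comp_zero]
  -- This makes the difference `t_+ - t_-` of the formula appear.
  have h7 : gk tp ≫ gkSplit ht ≫ gk iK = gk tp - gk tm := by
    rw [gkSplit_gk, Preadditive.comp_sub, Category.comp_id, ← Category.assoc, gk_comp, htp, gk_id,
      Category.id_comp]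
  calc (gk tp ≫ gkSplit ht ≫ gkInv et het) ≫ gk sp ≫ gkSplit hs ≫ gkInv es hes
      = gk tp ≫ gkSplit ht ≫ (gkInv et het ≫ gk et) ≫ gk up ≫ gkSplit hD ≫ gkInv ex hex := by
        rw [h3]; simp only [Category.assoc]
    _ = (gk tp ≫ gkSplit ht ≫ gk iK) ≫ gk θp ≫ gkSplit hΩ ≫ gkInv ex hex := by
        rw [gkInv_gk, Category.id_comp, h4, Category.assoc, ← Category.assoc (gk up), gk_comp, hup',
          ← gk_comp]
        simp only [Category.assoc]
    _ = gk tp ≫ gk θp ≫ gkSplit hΩ ≫ gkInv ex hex := by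
        rw [h7, Preadditive.sub_comp]
        have : gk tm ≫ gk θp ≫ gkSplit hΩ ≫ gkInv ex hex = 0 := by
          rw [← Category.assoc (gk θp), ← Category.assoc (gk tm), h6, Limits.zero_comp]
        rw [this, sub_zero]
    _ = gk xp ≫ gkSplit hZ ≫ gkInv ex hex := by
        rw [h5, Category.assoc, ← Category.assoc (gk xp), gk_comp, hΨp, ← gk_comp, Category.assoc]

end GKLemmas

/-! ### Common properties of the two settings -/

/-- A system of maps `a ↦ e_{ij} ⊗ a` from `A` to `D` multiplying like matrix units. -/
structure IsMatrixSystem {ι A D : Type*} [Mul A] [Mul D] [Zero D] (u : ι → ι → A → D) : Prop where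
  mul_same : ∀ i j k a b, u i j a * u j k b = u i k (a * b)
  mul_ne : ∀ i j k l a b, j ≠ k → u i j a * u k l b = 0

/-- A pair of commuting left and right multiplications of `A` on the algebra `D`. -/
structure IsBiaction {A D : Type*} [NonUnitalRing A] [Module ℂ A] [NonUnitalRing D] [Module ℂ D]
    (L R : A →ₗ[ℂ] D →ₗ[ℂ] D) : Prop where
  left_mul : ∀ a b v, L (a * b) v = L a (L b v)
  right_mul : ∀ a b v, R (a * b) v = R b (R a v)
  left_assoc : ∀ a v w, L a (v * w) = L a v * w
  right_assoc : ∀ a v w, R a (v * w) = v * R a w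
  middle : ∀ a v w, R a v * w = v * L a w
  comm : ∀ a b v, L a (R b v) = R b (L a v)

namespace Setting

variable {G : Type u} [InverseMonoid G]

/-- The properties of the settings of algebras and of C*-algebras on which the theory is built. For
algebras `hasStar` is false, and `conj` is irrelevant. -/
class Good (S : Setting G) where
  hasStar : Prop
  conj : ∀ {A : S.C}, S.El A → S.El A
  conj_conj : hasStar → ∀ {A : S.C} (a : S.El A), conj (conj a) = a
  conj_mul : hasStar → ∀ {A : S.C} (a b : S.El A), conj (a * b) = conj b * conj a
  conj_add : hasStar → ∀ {A : S.C} (a b : S.El A), conj (a + b) = conj a + conj b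
  conj_smul : hasStar → ∀ {A : S.C} (c : ℂ) (a : S.El A), conj (c • a) = star c • conj a
  conj_continuous : ∀ {A : S.C}, Continuous (conj : S.El A → S.El A)
  t2 : ∀ A : S.C, T2Space (S.El A)
  continuousAdd : ∀ A : S.C, ContinuousAdd (S.El A)
  continuousMul : ∀ A : S.C, ContinuousMul (S.El A)
  continuousSMul : ∀ A : S.C, ContinuousConstSMul ℂ (S.El A)
  hom_ext : ∀ {A B : S.C} (f k : A ⟶ B), (∀ a, ap f a = ap k a) → f = k
  exists_hom : ∀ {A B : S.C} (F : S.El A →ₙₐ[ℂ] S.El B), (∀ g a, F (act g a) = act g (F a)) →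
    (hasStar → ∀ a, F (conj a) = conj (F a)) → ∃ f : A ⟶ B, ∀ a, ap f a = F a
  ap_conj : hasStar → ∀ {A B : S.C} (f : A ⟶ B) (a : S.El A), ap f (conj a) = conj (ap f a)
  act_conj : hasStar → ∀ {A : S.C} (g : G) (a : S.El A), act g (conj a) = conj (act g a)
  continuous_hom : ∀ {A B : S.C} (F : S.El A →ₙₐ[ℂ] S.El B),
    (hasStar → ∀ a, F (conj a) = conj (F a)) → Continuous F
  isClosedEmbedding : ∀ {A B : S.C} (F : S.El A →ₙₐ[ℂ] S.El B),
    (hasStar → ∀ a, F (conj a) = conj (F a)) → Function.Injective F → IsClosedEmbedding F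
  tensor_mul : ∀ {M A D : S.C} {τ : S.El M →ₗ[ℂ] S.El A →ₗ[ℂ] S.El D}, S.IsTensor τ →
    ∀ m m' a a', τ m a * τ m' a' = τ (m * m') (a * a')
  tensor_conj : hasStar → ∀ {M A D : S.C} {τ : S.El M →ₗ[ℂ] S.El A →ₗ[ℂ] S.El D}, S.IsTensor τ →
    ∀ m a, conj (τ m a) = τ (conj m) (conj a)
  tensor_continuous_left : ∀ {M A D : S.C} {τ : S.El M →ₗ[ℂ] S.El A →ₗ[ℂ] S.El D}, S.IsTensor τ →
    ∀ a, Continuous fun m => τ m a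
  tensor_continuous_right : ∀ {M A D : S.C} {τ : S.El M →ₗ[ℂ] S.El A →ₗ[ℂ] S.El D}, S.IsTensor τ →
    ∀ m, Continuous fun a => τ m a
  tensor_dense : ∀ {M A D : S.C} {τ : S.El M →ₗ[ℂ] S.El A →ₗ[ℂ] S.El D}, S.IsTensor τ →
    Dense (Submodule.span ℂ {y | ∃ m a, τ m a = y} : Set (S.El D))
  tensor_eq_zero : ∀ {M A D : S.C} {τ : S.El M →ₗ[ℂ] S.El A →ₗ[ℂ] S.El D}, S.IsTensor τ →
    ∀ m a, τ m a = 0 → m = 0 ∨ a = 0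
  -- Continuous entry maps take the place of injectivity on the algebraic tensor product and are
  -- easier to transport.
  isTensor_of : ∀ {ι : Type u} {A D : S.C} {τ : S.El (S.mat ι) →ₗ[ℂ] S.El A →ₗ[ℂ] S.El D},
    (∀ m m' a a', τ m a * τ m' a' = τ (m * m') (a * a')) →
    (hasStar → ∀ m a, conj (τ m a) = τ (conj m) (conj a)) →
    Dense (Submodule.span ℂ {y | ∃ m a, τ m a = y} : Set (S.El D)) →
    (∀ i j, ∃ ε : S.El D →ₗ[ℂ] S.El A, Continuous ε ∧ (∀ a, ε (τ (S.unit i j) a) = a) ∧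
      ∀ k l a, (i, j) ≠ (k, l) → ε (τ (S.unit k l) a) = 0) → S.IsTensor τ
  tensor_entry : ∀ {ι : Type u} {A D : S.C} {τ : S.El (S.mat ι) →ₗ[ℂ] S.El A →ₗ[ℂ] S.El D},
    S.IsTensor τ → ∀ i j, ∃ ε : S.El D →ₗ[ℂ] S.El A, Continuous ε ∧
      (∀ a, ε (τ (S.unit i j) a) = a) ∧ ∀ k l a, (i, j) ≠ (k, l) → ε (τ (S.unit k l) a) = 0
  unit_system : ∀ {ι : Type u} (i j k : ι),
    S.unit i j * S.unit j k = (S.unit i k : S.El (S.mat ι))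
  unit_mul_ne : ∀ {ι : Type u} (i j k l : ι), j ≠ k →
    S.unit i j * S.unit k l = (0 : S.El (S.mat ι))
  unit_conj : hasStar → ∀ {ι : Type u} (i j : ι), conj (S.unit i j) = S.unit j i
  unit_ne_zero : ∀ {ι : Type u} (i j : ι), S.unit i j ≠ 0
  unit_coef : ∀ {ι : Type u} (i j : ι) (m : S.El (S.mat ι)),
    ∃ c : ℂ, S.unit i i * m * S.unit j j = c • S.unit i j
  unit_separating : ∀ {ι : Type u} (m : S.El (S.mat ι)),
    (∀ i j, S.unit i i * m * S.unit j j = 0) → m = 0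
  unit_dense : ∀ ι : Type u,
    Dense (Submodule.span ℂ {y : S.El (S.mat ι) | ∃ i j, S.unit i j = y} : Set (S.El (S.mat ι)))
  mat_act : ∀ {ι : Type u} (g : G) (m : S.El (S.mat ι)), act g m = m
  idem_mul : ∀ e f : Idem G, S.idem e * S.idem f = S.idem (e * f)
  idem_conj : hasStar → ∀ e : Idem G, conj (S.idem e) = S.idem e
  idem_act : ∀ (g : G) (e : Idem G), act g (S.idem e) = S.idem (Idem.conj g e)
  idem_ne_zero : ∀ e : Idem G, S.idem e ≠ 0
  idem_dense : Dense (Submodule.span ℂ {y | ∃ e, S.idem e = y} : Set (S.El S.coeff))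
  lift : ∀ {ι : Type u} {A D B : S.C} {τ : S.El (S.mat ι) →ₗ[ℂ] S.El A →ₗ[ℂ] S.El D},
    S.IsTensor τ → ∀ h : ι → ι → S.El A →ₗ[ℂ] S.El B, IsMatrixSystem (fun i j a => h i j a) →
    (hasStar → ∀ i j a, conj (h i j a) = h j i (conj a)) →
    ∃ F : S.El D →ₙₐ[ℂ] S.El B, (hasStar → ∀ a, F (conj a) = conj (F a)) ∧
      ∀ i j a, F (τ (S.unit i j) a) = h i j a
  tensor_injective : ∀ {ι : Type u} {A A' D D' : S.C}
    {τ : S.El (S.mat ι) →ₗ[ℂ] S.El A →ₗ[ℂ] S.El D}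
    {τ' : S.El (S.mat ι) →ₗ[ℂ] S.El A' →ₗ[ℂ] S.El D'}, S.IsTensor τ → S.IsTensor τ' →
    ∀ f : S.El A →ₙₐ[ℂ] S.El A', (hasStar → ∀ a, f (conj a) = conj (f a)) →
    Function.Injective f → ∀ F : S.El D →ₙₐ[ℂ] S.El D',
    (hasStar → ∀ a, F (conj a) = conj (F a)) → (∀ m a, F (τ m a) = τ' m (f a)) →
    Function.Injective F
  lift_mat : ∀ {ι : Type u} {B : S.C} (h : ι → ι → S.El B),
    (∀ i j k, h i j * h j k = h i k) → (∀ i j k l, j ≠ k → h i j * h k l = 0) →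
    (hasStar → ∀ i j, conj (h i j) = h j i) →
    ∃ F : S.El (S.mat ι) →ₙₐ[ℂ] S.El B, (hasStar → ∀ a, F (conj a) = conj (F a)) ∧
      ∀ i j, F (S.unit i j) = h i j
  exists_coeff_action : ∀ X : S.C, ∃ φ : S.El S.coeff →ₗ[ℂ] S.El X →ₗ[ℂ] S.El X,
    (∀ e y, φ (S.idem e) y = act e.1 y) ∧ (∀ y, Continuous fun c => φ c y) ∧
      ∀ c, Continuous fun y => φ c y
  exists_semidirect : ∀ {D A : S.C} (L R : S.El A →ₗ[ℂ] S.El D →ₗ[ℂ] S.El D), IsBiaction L R →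
    (∀ g a v, act g (L a v) = L (act g a) (act g v)) →
    (∀ g a v, act g (R a v) = R (act g a) (act g v)) →
    (∀ (e : Idem G) a v, L (act e.1 a) v = L a (act e.1 v)) →
    (∀ (e : Idem G) a v, R (act e.1 a) v = R a (act e.1 v)) →
    (hasStar → ∀ a v, conj (L a v) = R (conj a) (conj v)) →
    ∃ (Q : S.C) (i : D ⟶ Q) (p : Q ⟶ A) (r : A ⟶ Q), S.SplitExact i p r ∧
      (∀ a v, ap r a * ap i v = ap i (L a v)) ∧ ∀ a v, ap i v * ap r a = ap i (R a v)
  exists_pullback : ∀ {X A B : S.C} (f : X ⟶ B) (k : A ⟶ B),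
    ∃ (Q : S.C) (p : Q ⟶ X) (q : Q ⟶ A), (∀ z, ap f (ap p z) = ap k (ap q z)) ∧
      (∀ z w, ap p z = ap p w → ap q z = ap q w → z = w) ∧
      ∀ x a, ap f x = ap k a → ∃ z, ap p z = x ∧ ap q z = a
  exists_tensor : ∀ {ι : Type u} (σ : S.MatAction ι) (A : S.C),
    ∃ D : S.C, Nonempty (S.MatTensor σ A D)
  -- Equivariance is required only over the range of `f`, since `σ_g` may differ from the identity
  -- when `g` acts there as zero.
  rotation : ∀ {ι : Type u} {σ : S.MatAction ι} {A X M : S.C} (T : S.MatTensor σ X M) (f : A ⟶ X)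
    (i j : ι), i ≠ j →
    (∀ g a p q, act g (T.tmul (S.unit p q) (ap f a)) = T.tmul (S.unit p q) (ap f (act g a))) →
    ∀ F₀ F₁ : A ⟶ M, (∀ a, ap F₀ a = T.tmul (S.unit i i) (ap f a)) →
      (∀ a, ap F₁ a = T.tmul (S.unit j j) (ap f a)) → S.Homotopic F₀ F₁
  -- Boundedness serves one purpose: along a bounded net the vectors with convergent products form a
  -- closed set, so convergence can be tested on a dense subspace.
  bdd : ∀ {A : S.C} {I : Type u}, (I → S.El A) → Prop
  bdd_projection : ∀ {A : S.C} {I : Type u} (p : I → S.El A), (∀ i, p i * p i = p i) →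
    (hasStar → ∀ i, conj (p i) = p i) → bdd p
  bdd_map : ∀ {A B : S.C} {I : Type u} (f : A ⟶ B) (k : I → S.El A), bdd k →
    bdd fun i => ap f (k i)
  bdd_of_map : ∀ {A B : S.C} {I : Type u} (f : A ⟶ B) (k : I → S.El A),
    Function.Injective (ap f) → (bdd fun i => ap f (k i)) → bdd k
  bdd_mul_left : ∀ {A : S.C} {I : Type u} (a : S.El A) (k : I → S.El A), bdd k →
    bdd fun i => a * k i
  bdd_mul_right : ∀ {A : S.C} {I : Type u} (a : S.El A) (k : I → S.El A), bdd k →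
    bdd fun i => k i * a
  isClosed_exists_left : ∀ {A : S.C} {I : Type u} (l : Filter I) [l.NeBot] (k : I → S.El A),
    bdd k → IsClosed {v : S.El A | ∃ c, Tendsto (fun i => k i * v) l (𝓝 c)}
  isClosed_exists_right : ∀ {A : S.C} {I : Type u} (l : Filter I) [l.NeBot] (k : I → S.El A),
    bdd k → IsClosed {v : S.El A | ∃ c, Tendsto (fun i => v * k i) l (𝓝 c)}
  isClosed_eq_left : ∀ {A : S.C} {I : Type u} (l : Filter I) (k : I → S.El A),
    bdd k → IsClosed {v : S.El A | Tendsto (fun i => k i * v) l (𝓝 v)}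
  isClosed_eq_right : ∀ {A : S.C} {I : Type u} (l : Filter I) (k : I → S.El A),
    bdd k → IsClosed {v : S.El A | Tendsto (fun i => v * k i) l (𝓝 v)}

attribute [instance] Good.t2 Good.continuousAdd Good.continuousMul Good.continuousSMul

namespace Good

variable {S : Setting G}

theorem mem_of_dense {A : S.C} {s : Set (S.El A)}
    (hs : Dense (Submodule.span ℂ s : Set (S.El A))) (p : Submodule ℂ (S.El A))
    (hp : IsClosed (p : Set (S.El A))) (h : s ⊆ p) (x : S.El A) : x ∈ p := by
  have h1 : closure (Submodule.span ℂ s : Set (S.El A)) ⊆ p :=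
    closure_minimal (Submodule.span_le.mpr h) hp
  exact h1 (hs x)

variable [S.Good]

/-- A map is compatible with the involutions, if there are any. -/
def IsStarMap {A B : S.C} (F : S.El A → S.El B) : Prop :=
  Good.hasStar S → ∀ a, F (Good.conj a) = Good.conj (F a)

theorem continuous_ap {A B : S.C} (f : A ⟶ B) : Continuous (ap f) :=
  Good.continuous_hom _ fun h a => Good.ap_conj h f a

theorem continuous_act {A : S.C} (g : G) : Continuous (act g : S.El A → S.El A) :=
  Good.continuous_hom (actHom g) fun h a => Good.act_conj h g a

theorem isClosedEmbedding_ap {A B : S.C} (f : A ⟶ B) (hf : Function.Injective (ap f)) :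
    IsClosedEmbedding (ap f) :=
  Good.isClosedEmbedding _ (fun h a => Good.ap_conj h f a) hf

/-- Induction on a dense subspace, in the form of two agreeing continuous linear maps. -/
theorem eq_of_dense {A B : S.C} {s : Set (S.El A)}
    (hs : Dense (Submodule.span ℂ s : Set (S.El A))) {f k : S.El A →ₗ[ℂ] S.El B}
    (hf : Continuous f) (hk : Continuous k) (h : ∀ x ∈ s, f x = k x) (x : S.El A) : f x = k x := by
  have h1 : Set.EqOn f k (Submodule.span ℂ s) := fun y hy => LinearMap.eqOn_span h hy
  exact congrFun (Continuous.ext_on hs hf hk h1) x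

section Tensor

variable {ι : Type u} {A D : S.C} {τ : S.El (S.mat ι) →ₗ[ℂ] S.El A →ₗ[ℂ] S.El D}

/-- Matrix units span a dense subspace of `M_ι` and `τ` is continuous in its first variable, so the
closed span of the `e_{ij} ⊗ a` contains every elementary tensor. -/
theorem unit_tensor_dense (h : S.IsTensor τ) :
    Dense (Submodule.span ℂ {y | ∃ i j a, τ (S.unit i j) a = y} : Set (S.El D)) := by
  have h1 : ∀ m a, τ m a ∈
      (Submodule.span ℂ {y | ∃ i j a, τ (S.unit i j) a = y}).topologicalClosure := by
    intro m a
    refine mem_of_dense (unit_dense ι) (((Submodule.span ℂ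
      {y | ∃ i j a, τ (S.unit i j) a = y}).topologicalClosure).comap (τ.flip a)) ?_ ?_ m
    · exact (Submodule.isClosed_topologicalClosure _).preimage (tensor_continuous_left h a)
    · rintro _ ⟨i, j, rfl⟩
      exact Submodule.le_topologicalClosure _ (Submodule.subset_span ⟨i, j, a, rfl⟩)
  intro x
  have := mem_of_dense (tensor_dense h)
    (Submodule.span ℂ {y | ∃ i j a, τ (S.unit i j) a = y}).topologicalClosure
    (Submodule.isClosed_topologicalClosure _) (by rintro _ ⟨m, a, rfl⟩; exact h1 m a) x
  exact this

theorem tensor_ext (h : S.IsTensor τ) {B : S.C} {f k : S.El D →ₗ[ℂ] S.El B}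
    (hf : Continuous f) (hk : Continuous k)
    (hfk : ∀ i j a, f (τ (S.unit i j) a) = k (τ (S.unit i j) a)) (x : S.El D) : f x = k x :=
  eq_of_dense (unit_tensor_dense h) hf hk (by rintro _ ⟨i, j, a, rfl⟩; exact hfk i j a) x

theorem tensor_unit_injective (h : S.IsTensor τ) (i j : ι) {a b : S.El A}
    (hab : τ (S.unit i j) a = τ (S.unit i j) b) : a = b := by
  have := (tensor_eq_zero h (S.unit i j) (a - b) (by rw [map_sub, hab, sub_self])).resolve_left
    (unit_ne_zero i j)
  exact sub_eq_zero.mp this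

/-- Tensor products of homomorphisms. -/
theorem exists_tensorMap (h : S.IsTensor τ) {A' D' : S.C}
    {τ' : S.El (S.mat ι) →ₗ[ℂ] S.El A' →ₗ[ℂ] S.El D'} (h' : S.IsTensor τ')
    (ψ : S.El (S.mat ι) →ₙₐ[ℂ] S.El (S.mat ι)) (hψ : IsStarMap ψ)
    (f : S.El A →ₙₐ[ℂ] S.El A') (hf : IsStarMap f) :
    ∃ F : S.El D →ₙₐ[ℂ] S.El D', IsStarMap F ∧ ∀ m a, F (τ m a) = τ' (ψ m) (f a) := by
  obtain ⟨F, hF, hF'⟩ := lift h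
    (fun i j => (τ' (ψ (S.unit i j))).comp (f : S.El A →ₗ[ℂ] S.El A'))
    { mul_same := fun i j k a b => by
        change τ' _ (f a) * τ' _ (f b) = τ' _ (f (a * b))
        rw [tensor_mul h', ← map_mul, unit_system, map_mul f]
      mul_ne := fun i j k l a b hjk => by
        change τ' _ (f a) * τ' _ (f b) = 0
        rw [tensor_mul h', ← map_mul, unit_mul_ne _ _ _ _ hjk, map_zero, map_zero,
          LinearMap.zero_apply] }
    (fun hs i j a => by
      change conj (τ' _ (f a)) = τ' _ (f (conj a))
      rw [tensor_conj hs h', hf hs, ← hψ hs, unit_conj hs])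
  refine ⟨F, hF, fun m a => ?_⟩
  -- `F` is prescribed on matrix units only; both sides are continuous and linear in `m`.
  refine eq_of_dense (unit_dense ι) (f := (F : S.El D →ₗ[ℂ] S.El D').comp (τ.flip a))
    (k := (τ'.flip (f a)).comp (ψ : S.El (S.mat ι) →ₗ[ℂ] S.El (S.mat ι))) ?_ ?_ ?_ m
  · exact (continuous_hom F hF).comp (tensor_continuous_left h a)
  · exact (tensor_continuous_left h' (f a)).comp (continuous_hom ψ hψ)
  · rintro _ ⟨i, j, rfl⟩
    exact hF' i j a

/-- Tensor products of the identity of the matrix algebra with equivariant homomorphisms. -/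
theorem exists_tensorMap_hom {σ : S.MatAction ι} {A D A' D' : S.C} (T : S.MatTensor σ A D)
    (T' : S.MatTensor σ A' D') (f : A ⟶ A') :
    ∃ F : D ⟶ D', ∀ m a, ap F (T.tmul m a) = T'.tmul m (ap f a) := by
  obtain ⟨F, hF, hF'⟩ := exists_tensorMap T.isTensor T'.isTensor
    (NonUnitalAlgHom.id ℂ (S.El (S.mat ι))) (fun _ _ => rfl) (ap f) (fun hs a => ap_conj hs f a)
  obtain ⟨k, hk⟩ := exists_hom F (fun g a => by
    refine tensor_ext T.isTensor (f := (F : S.El D →ₗ[ℂ] S.El D').comp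
      (actHom (S := S) (A := D) g : S.El D →ₗ[ℂ] S.El D)) (k := (actHom (S := S) (A := D') g : S.El D' →ₗ[ℂ] S.El D').comp
      (F : S.El D →ₗ[ℂ] S.El D')) ?_ ?_ ?_ a
    · exact (continuous_hom F hF).comp (continuous_act g)
    · exact (continuous_act g).comp (continuous_hom F hF)
    · intro i j a
      change F (act g _) = act g (F _)
      rw [T.act_tmul, hF', hF', T'.act_tmul, ap_act]
      rfl) hF
  exact ⟨k, fun m a => by rw [hk, hF']; rfl⟩

end Tensor

end Good
end Setting

/-! ### Equivariance of `s_+` in very special sequences -/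

section LevelOne

open Setting Good

variable {G : Type u} [InverseMonoid G] {S : Setting G} [S.Good] {R : S.C → Prop}
  {P : Type u → Prop} {A B : GK S R P}

theorem Setting.Good.isStarMap_ap {A B : S.C} (f : A ⟶ B) : IsStarMap (ap f) :=
  fun hs a => ap_conj hs f a

theorem Setting.Good.exists_hom_of_linear {A B : S.C} (F : S.El A →ₗ[ℂ] S.El B)
    (hm : ∀ a b, F (a * b) = F a * F b) (ha : ∀ g a, F (act g a) = act g (F a))
    (hs : IsStarMap F) : ∃ f : A ⟶ B, ∀ a, ap f a = F a :=
  exists_hom ({ F with map_zero' := map_zero F, map_mul' := hm } : S.El A →ₙₐ[ℂ] S.El B) ha hs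

namespace LevelOneSeq

theorem IsDiff.ext {t : LevelOneSeq A B} {a : S.El A.1} {j j' : S.El t.J.1} (h : t.IsDiff a j)
    (h' : t.IsDiff a j') : j = j' :=
  t.splitExact.injective (add_left_cancel
    (tensor_unit_injective t.left.tensor.isTensor _ _ (h.symm.trans h')))

/-- The homomorphism `s₊`, regarded as a homomorphism to the algebra `X`. -/
theorem exists_linear (t : LevelOneSeq A B) : ∃ F : S.El A.1 →ₗ[ℂ] S.El t.Xm.1,
    (∀ a, ap t.right (ap t.sp a) = t.left.tensor.tmul (S.unit t.other t.other) (F a)) ∧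
      ∀ a, ∃ j, t.IsDiff a j ∧ F a = ap t.sm a + ap t.inc j := by
  choose j hj using t.diff_mem
  have inj := fun {x y} => tensor_unit_injective t.left.tensor.isTensor t.other t.other
    (a := x) (b := y)
  -- Linearity is inherited from `s_+` followed by the lower right embedding, because `y ↦ e_{oo} ⊗
  -- y` is injective (`o` denotes the second index).
  exact ⟨{ toFun := fun a => ap t.sm a + ap t.inc (j a)
           map_add' := fun a b => inj (by rw [← hj, map_add, map_add, hj, hj, ← map_add])
           map_smul' := fun c a => inj (by
            rw [← hj, map_smul, map_smul, hj, ← map_smul]; rfl) },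
    hj, fun a => ⟨j a, hj a, rfl⟩⟩

/-- The action on the algebra of `2 × 2`-matrices is trivial on matrix units over the range of
`s₊`. -/
theorem act_tmul_unit (t : LevelOneSeq A B) {F : S.El A.1 →ₗ[ℂ] S.El t.Xm.1}
    (hF : ∀ a, ap t.right (ap t.sp a) = t.left.tensor.tmul (S.unit t.other t.other) (F a))
    (g : G) (a : S.El A.1) :
    act g (F a) = F (act g a) ∧ ∀ m, act g (t.left.tensor.tmul m (F a)) =
      t.left.tensor.tmul m (F (act g a)) := by
  set T := t.left.tensor with hT
  have h1 : T.tmul (ap (t.left.σ.hom g) (S.unit t.other t.other)) (act g (F a)) =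
      T.tmul (S.unit t.other t.other) (F (act g a)) := by
    rw [← T.act_tmul, ← hF, ← hF, ap_act, ap_act]
  -- If `g` moves some `b` to a nonzero element, then `σ_g` is the identity; otherwise `g` acts as
  -- zero on `A`, and it must be shown to kill `F a`.
  by_cases hg : ∃ b : S.El A.1, act g b ≠ 0
  · obtain ⟨b, hb⟩ := hg
    have h2 : ∀ m, ap (t.left.σ.hom g) m = m := by
      intro m
      obtain ⟨DA, ⟨TA⟩⟩ := exists_tensor t.left.σ A.1
      obtain ⟨p, -, hp⟩ := exists_tensorMap T.isTensor TA.isTensor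
        (NonUnitalAlgHom.id ℂ (S.El (S.mat t.left.index))) (fun _ _ => rfl) (ap t.proj)
        (isStarMap_ap t.proj)
      -- Applying `id ⊗ proj` kills `M_2(J)` and leaves `(σ_g(m) - m) ⊗ g b = 0` in `M_2 ⊗ A`.
      have h3 := t.quotient_act g m (ap t.sm b)
      rw [← hT, T.act_tmul] at h3
      have h4 : Submodule.span ℂ {y | ∃ m' j, y = T.tmul m' (ap t.inc j)} ≤
          LinearMap.ker (p : S.El t.M.1 →ₗ[ℂ] S.El DA) := by
        refine Submodule.span_le.mpr ?_
        rintro _ ⟨m', j, rfl⟩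
        change p _ = 0
        rw [hp, t.splitExact.proj_inc, map_zero]
      have h5 : p _ = 0 := h4 h3
      rw [map_sub, hp, hp, ap_act, t.splitExact.split] at h5
      have h6 : TA.tmul (ap (t.left.σ.hom g) m - m) (act g b) = 0 := by
        rw [map_sub, LinearMap.sub_apply]
        exact h5
      exact sub_eq_zero.mp ((tensor_eq_zero TA.isTensor _ _ h6).resolve_right hb)
    rw [h2] at h1
    have h3 := tensor_unit_injective T.isTensor _ _ h1
    exact ⟨h3, fun m => by rw [T.act_tmul, h2, h3]⟩
  · push Not at hg
    -- Here `σ_g(e_{oo}) ⊗ g (F a) = 0`. If the first factor vanishes then so does `σ_g(e_{00})`, as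
    -- `e_{00}` factors through `e_{oo}`; equivariance of the upper corner embedding then gives
    -- `e_{00} ⊗ g (F a) = 0`.
    have h2 : act g (F a) = 0 := by
      rw [hg, map_zero, map_zero] at h1
      rcases tensor_eq_zero T.isTensor _ _ h1 with h3 | h3
      · have h4 : T.tmul (S.unit t.left.base t.left.base) (act g (F a)) = 0 := by
          have h5 : ap (t.left.σ.hom g) (S.unit t.left.base t.left.base) = 0 := by
            rw [← unit_system t.left.base t.other t.left.base,
              ← unit_system t.other t.other t.left.base, map_mul, map_mul, h3, zero_mul, mul_zero]
          rw [← t.left.hom_apply, ap_act, t.left.hom_apply, ← hT, T.act_tmul, h5, map_zero,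
            LinearMap.zero_apply]
        exact (tensor_eq_zero T.isTensor _ _ h4).resolve_left (unit_ne_zero _ _)
      · exact h3
    exact ⟨by rw [h2, hg, map_zero], fun m => by rw [T.act_tmul, h2, hg, map_zero, map_zero,
      map_zero]⟩

/-- In very special `GK^G`-theory, `s₊` is equivariant for the action `γ₋`, and the two corner
embeddings do not matter. -/
theorem exists_equivariant (t : LevelOneSeq A B) : ∃ τ : A.1 ⟶ t.Xm.1,
    (∀ a j, t.IsDiff a j → ap τ a = ap t.sm a + ap t.inc j) ∧
      t.toGK = gk τ ≫ gkSplit t.splitExact ≫ gkInv t.exit.hom ⟨t.exit, t.exit_mem, rfl⟩ := by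
  obtain ⟨F, hF, hF'⟩ := t.exists_linear
  have T := t.left.tensor.isTensor
  obtain ⟨τ, hτ⟩ := exists_hom_of_linear F
    (fun a b => tensor_unit_injective T t.other t.other (by
      rw [← hF, map_mul, map_mul, hF, hF, tensor_mul T, unit_system]))
    (fun g a => (t.act_tmul_unit hF g a).1.symm)
    (fun hs a => tensor_unit_injective T t.other t.other (by
      rw [← hF, ap_conj hs, ap_conj hs, hF, tensor_conj hs T, unit_conj hs]))
  refine ⟨τ, fun a j hj => ?_, ?_⟩
  · obtain ⟨j', h1, h2⟩ := hF' a
    rw [hτ, h2, hj.ext h1]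
  · have h1 : (gk (t.sp ≫ t.right) : A ⟶ t.M) = gk (τ ≫ t.left.hom) := by
      refine (gk_homotopy (rotation t.left.tensor τ t.left.base t.other t.other_ne.symm ?_ _ _
        ?_ ?_)).symm
      · intro g a p q
        rw [hτ, hτ, (t.act_tmul_unit hF g a).2]
      · intro a
        rw [ap_comp, t.left.hom_apply]
      · intro a
        rw [ap_comp, hτ, hF]
    change gk t.sp ≫ gk t.right ≫ gkInv t.left.hom ⟨t.left, t.left_mem, rfl⟩ ≫
      gkSplit t.splitExact ≫ gkInv t.exit.hom ⟨t.exit, t.exit_mem, rfl⟩ = _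
    rw [← Category.assoc (gk t.sp), gk_comp, h1, ← gk_comp, Category.assoc,
      ← Category.assoc (gk t.left.hom), gk_gkInv t.left.hom ⟨t.left, t.left_mem, rfl⟩,
      Category.id_comp]

end LevelOneSeq

end LevelOne

/-! ### Split extensions and their matrix algebras -/

namespace Setting

open Good

variable {G : Type u} [InverseMonoid G] {S : Setting G}

namespace SplitExact

variable {J X A : S.C} {i : J ⟶ X} {f : X ⟶ A} {s : A ⟶ X}

/-- The linear retraction onto the ideal of a split extension. -/
theorem exists_retraction (h : S.SplitExact i f s) : ∃ d : S.El X →ₗ[ℂ] S.El J,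
    (∀ x, x = ap i (d x) + ap s (ap f x)) ∧ ∀ j a, d (ap i j + ap s a) = j := by
  choose d hd using h.exists_eq
  have hd' : ∀ x, ap i (d x) = x - ap s (ap f x) := fun x => eq_sub_of_add_eq (hd x).symm
  refine ⟨{ toFun := d
            map_add' := fun x y => h.injective (by
              rw [hd', map_add, map_add, map_add, hd', hd']; abel)
            map_smul' := fun c x => h.injective (by
              rw [hd', map_smul, map_smul, ← smul_sub, ← hd', ← map_smul]; rfl) }, hd, ?_⟩
  intro j a
  apply h.injective
  change ap i (d _) = _
  rw [hd', map_add, h.proj_inc, h.split, zero_add, add_sub_cancel_right]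

/-- Homomorphisms out of a split extension. -/
theorem exists_desc [S.Good] (h : S.SplitExact i f s) {Z : S.C} (u : J ⟶ Z) (k : A ⟶ Z)
    (hl : ∀ a v w, ap i w = ap s a * ap i v → ap u w = ap k a * ap u v)
    (hr : ∀ a v w, ap i w = ap i v * ap s a → ap u w = ap u v * ap k a) :
    ∃ F : X ⟶ Z, (∀ v, ap F (ap i v) = ap u v) ∧ ∀ a, ap F (ap s a) = ap k a := by
  obtain ⟨d, hd, hd'⟩ := h.exists_retraction
  -- As a vector space `X` is `J ⊕ A`, which determines the map; multiplicativity needs the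
  -- hypotheses just for the two mixed products.
  let F₀ : S.El X →ₗ[ℂ] S.El Z :=
    (ap u : S.El J →ₗ[ℂ] S.El Z).comp d +
      (ap k : S.El A →ₗ[ℂ] S.El Z).comp (ap f : S.El X →ₗ[ℂ] S.El A)
  have key : ∀ j a, F₀ (ap i j + ap s a) = ap u j + ap k a := by
    intro j a
    change ap u (d _) + ap k (ap f _) = _
    rw [hd', map_add, h.proj_inc, h.split, zero_add]
  obtain ⟨F, hF⟩ := exists_hom_of_linear F₀ (fun x y => by
      rw [hd x, hd y]
      generalize d x = v, ap f x = a, d y = w, ap f y = b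
      obtain ⟨v', hv'⟩ := h.mul_mem' (ap s b) v
      obtain ⟨w', hw'⟩ := h.mul_mem (ap s a) w
      have : (ap i v + ap s a) * (ap i w + ap s b) = ap i (v * w + v' + w') + ap s (a * b) := by
        rw [map_add, map_add, map_mul, map_mul, hv', hw', mul_add, add_mul, add_mul]; abel
      rw [this, key, key, key, map_add, map_add, map_mul, map_mul, hr b v v' hv', hl a w w' hw',
        mul_add, add_mul, add_mul]
      abel)
    (fun g x => by
      rw [hd x, map_act_add, ← ap_act, ← ap_act, key, key, map_act_add, ap_act, ap_act])
    (fun hs x => by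
      rw [hd x, conj_add hs, ← ap_conj hs, ← ap_conj hs, key, key, conj_add hs, ap_conj hs,
        ap_conj hs])
  exact ⟨F, fun v => by simpa [hF] using key v 0, fun a => by simpa [hF] using key 0 a⟩

end SplitExact

section Tensor

variable [S.Good]

instance (A : S.C) : IsTopologicalAddGroup (S.El A) where
  toContinuousAdd := continuousAdd A
  continuous_neg := by
    have := (continuousSMul A).continuous_const_smul (-1 : ℂ)
    simpa using this

/-- Very special matrix algebras preserve split exact sequences. -/
theorem SplitExact.tensor {ι : Type u} {σ : S.MatAction ι} {J X A J' X' A' : S.C}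
    {i : J ⟶ X} {f : X ⟶ A} {s : A ⟶ X} (h : S.SplitExact i f s)
    (TJ : S.MatTensor σ J J') (TX : S.MatTensor σ X X') (TA : S.MatTensor σ A A')
    {i' : J' ⟶ X'} {f' : X' ⟶ A'} {s' : A' ⟶ X'}
    (hi : ∀ m a, ap i' (TJ.tmul m a) = TX.tmul m (ap i a))
    (hf : ∀ m a, ap f' (TX.tmul m a) = TA.tmul m (ap f a))
    (hs : ∀ m a, ap s' (TA.tmul m a) = TX.tmul m (ap s a)) : S.SplitExact i' f' s' := by
  have hinj : Function.Injective (ap i') :=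
    tensor_injective TJ.isTensor TX.isTensor (ap i) (isStarMap_ap i) h.injective (ap i')
      (isStarMap_ap i') hi
  have h1 : ∀ a, ap f' (ap s' a) = a := fun a =>
    tensor_ext TA.isTensor (f := (ap f' : S.El X' →ₗ[ℂ] S.El A').comp
      (ap s' : S.El A' →ₗ[ℂ] S.El X')) (k := LinearMap.id)
      ((continuous_ap f').comp (continuous_ap s')) continuous_id (fun p q a => by
        change ap f' (ap s' _) = _
        rw [hs, hf, h.split]; rfl) a
  have h2 : ∀ j, ap f' (ap i' j) = 0 := fun a =>
    tensor_ext TJ.isTensor (f := (ap f' : S.El X' →ₗ[ℂ] S.El A').comp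
      (ap i' : S.El J' →ₗ[ℂ] S.El X')) (k := 0)
      ((continuous_ap f').comp (continuous_ap i')) continuous_const (fun p q a => by
        change ap f' (ap i' _) = _
        rw [hi, hf, h.proj_inc, map_zero]; rfl) a
  -- Exactness in the middle: an injective homomorphism has closed range, so the assertion may be
  -- checked on elementary tensors, where it comes from the original sequence.
  have h3 : ∀ x, x - ap s' (ap f' x) ∈ LinearMap.range (ap i' : S.El J' →ₗ[ℂ] S.El X') := by
    intro x
    refine mem_of_dense (unit_tensor_dense TX.isTensor)
      ((LinearMap.range (ap i' : S.El J' →ₗ[ℂ] S.El X')).comap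
        (LinearMap.id - (ap s' : S.El A' →ₗ[ℂ] S.El X').comp (ap f' : S.El X' →ₗ[ℂ] S.El A')))
      ?_ ?_ x
    · have hr : IsClosed (Set.range (ap i')) := (isClosedEmbedding_ap i' hinj).isClosed_range
      exact hr.preimage (continuous_id.sub ((continuous_ap s').comp (continuous_ap f')))
    · rintro _ ⟨p, q, a, rfl⟩
      obtain ⟨j, hj⟩ := h.exists_eq a
      refine ⟨TJ.tmul (S.unit p q) j, ?_⟩
      change ap i' _ = TX.tmul _ a - ap s' (ap f' _)
      rw [hi, hf, hs, ← map_sub]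
      congr 1
      exact eq_sub_of_add_eq hj.symm
  refine ⟨hinj, fun x => ⟨fun hx => ?_, ?_⟩, h1⟩
  · obtain ⟨j, hj⟩ := h3 x
    rw [hx, map_zero, sub_zero] at hj
    exact ⟨j, hj⟩
  · rintro ⟨j, rfl⟩
    exact h2 j

end Tensor

end Setting

/-! ### The action of the coefficient algebra -/

namespace Setting

open Good

variable {G : Type u} [InverseMonoid G] {S : Setting G} [S.Good]

section Coeff

theorem idem_one_mul (c : S.El S.coeff) : S.idem 1 * c = c :=
  eq_of_dense idem_dense (f := LinearMap.mulLeft ℂ (S.idem 1)) (k := LinearMap.id)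
    (continuous_const.mul continuous_id) continuous_id
    (by rintro _ ⟨e, rfl⟩; change S.idem 1 * S.idem e = S.idem e; rw [idem_mul, one_mul]) c

theorem mul_idem_one (c : S.El S.coeff) : c * S.idem 1 = c :=
  eq_of_dense idem_dense (f := LinearMap.mulRight ℂ (S.idem 1)) (k := LinearMap.id)
    (continuous_id.mul continuous_const) continuous_id
    (by rintro _ ⟨e, rfl⟩; change S.idem e * S.idem 1 = S.idem e; rw [idem_mul, mul_one]) c

theorem act_idem_coeff (e : Idem G) (c : S.El S.coeff) : act e.1 c = S.idem e * c :=
  eq_of_dense idem_dense (f := (actHom (S := S) (A := S.coeff) e.1 : S.El S.coeff →ₗ[ℂ] S.El S.coeff))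
    (k := LinearMap.mulLeft ℂ (S.idem e)) (continuous_act e.1)
    (continuous_const.mul continuous_id)
    (by
      rintro _ ⟨f, rfl⟩
      change act e.1 (S.idem f) = S.idem e * S.idem f
      rw [idem_mul, idem_act, Idem.conj_idem]) c

theorem coeff_mul_comm (c d : S.El S.coeff) : c * d = d * c := by
  refine eq_of_dense idem_dense (f := LinearMap.mulRight ℂ d) (k := LinearMap.mulLeft ℂ d)
    (continuous_id.mul continuous_const) (continuous_const.mul continuous_id) ?_ c
  rintro _ ⟨e, rfl⟩
  refine eq_of_dense idem_dense (f := LinearMap.mulLeft ℂ (S.idem e))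
    (k := LinearMap.mulRight ℂ (S.idem e))
    (continuous_const.mul continuous_id) (continuous_id.mul continuous_const) ?_ d
  rintro _ ⟨f, rfl⟩
  change S.idem e * S.idem f = S.idem f * S.idem e
  rw [idem_mul, idem_mul, mul_comm]

/-- The multiplication of the coefficient algebra on a `G`-algebra. -/
structure IsCoeffAction {X : S.C} (φ : S.El S.coeff →ₗ[ℂ] S.El X →ₗ[ℂ] S.El X) : Prop where
  idem : ∀ e y, φ (S.idem e) y = act e.1 y
  continuous_left : ∀ y, Continuous fun c => φ c y

namespace IsCoeffAction

variable {X : S.C} {φ : S.El S.coeff →ₗ[ℂ] S.El X →ₗ[ℂ] S.El X} (h : IsCoeffAction φ)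

include h

theorem unique {φ' : S.El S.coeff →ₗ[ℂ] S.El X →ₗ[ℂ] S.El X} (h' : IsCoeffAction φ')
    (c : S.El S.coeff) (y : S.El X) : φ c y = φ' c y :=
  eq_of_dense idem_dense (f := φ.flip y) (k := φ'.flip y) (h.continuous_left y)
    (h'.continuous_left y) (by
      rintro _ ⟨e, rfl⟩
      change φ _ y = φ' _ y
      rw [h.idem, h'.idem]) c

omit [S.Good] in
theorem one_apply (y : S.El X) : φ (S.idem 1) y = y := by
  rw [h.idem]; exact act_one' y

theorem assoc_left (c : S.El S.coeff) (y z : S.El X) : φ c (y * z) = φ c y * z :=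
  eq_of_dense idem_dense (f := φ.flip (y * z)) (k := (LinearMap.mulRight ℂ z).comp (φ.flip y))
    (h.continuous_left _) ((h.continuous_left y).mul continuous_const) (by
      rintro _ ⟨e, rfl⟩
      change φ _ (y * z) = φ _ y * z
      rw [h.idem, h.idem, act_idem_mul]) c

theorem assoc_right (c : S.El S.coeff) (y z : S.El X) : φ c (y * z) = y * φ c z :=
  eq_of_dense idem_dense (f := φ.flip (y * z)) (k := (LinearMap.mulLeft ℂ y).comp (φ.flip z))
    (h.continuous_left _) (continuous_const.mul (h.continuous_left z)) (by
      rintro _ ⟨e, rfl⟩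
      change φ _ (y * z) = y * φ _ z
      rw [h.idem, h.idem, act_idem_mul']) c

theorem mul_apply (hc : ∀ c, Continuous fun y => φ c y) (c d : S.El S.coeff) (y : S.El X) :
    φ (c * d) y = φ c (φ d y) := by
  refine eq_of_dense idem_dense (f := (φ.flip y).comp (LinearMap.mulRight ℂ d))
    (k := φ.flip (φ d y)) ((h.continuous_left y).comp (continuous_id.mul continuous_const))
    (h.continuous_left _) ?_ c
  rintro _ ⟨e, rfl⟩
  refine eq_of_dense idem_dense (f := (φ.flip y).comp (LinearMap.mulLeft ℂ (S.idem e)))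
    (k := (φ (S.idem e)).comp (φ.flip y))
    ((h.continuous_left y).comp (continuous_const.mul continuous_id))
    ((hc _).comp (h.continuous_left y)) ?_ d
  rintro _ ⟨f, rfl⟩
  change φ (S.idem e * S.idem f) y = φ (S.idem e) (φ (S.idem f) y)
  rw [idem_mul, h.idem, h.idem, h.idem, ← act_mul']
  rfl

theorem commute (hc : ∀ c, Continuous fun y => φ c y) (c d : S.El S.coeff) (y : S.El X) :
    φ c (φ d y) = φ d (φ c y) := by
  rw [← h.mul_apply hc, ← h.mul_apply hc, coeff_mul_comm]

theorem act_apply (g : G) (c : S.El S.coeff) (y : S.El X) :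
    act g (φ c y) = φ (act g c) (act g y) := by
  refine eq_of_dense idem_dense (f := (actHom (S := S) (A := X) g : S.El X →ₗ[ℂ] S.El X).comp
    (φ.flip y)) (k := (φ.flip (act g y)).comp
      (actHom (S := S) (A := S.coeff) g : S.El S.coeff →ₗ[ℂ] S.El S.coeff))
    ((continuous_act g).comp (h.continuous_left y))
    ((h.continuous_left _).comp (continuous_act g)) ?_ c
  rintro _ ⟨e, rfl⟩
  change act g (φ (S.idem e) y) = φ (act g (S.idem e)) (act g y)
  rw [h.idem, idem_act, h.idem, ← act_mul', ← act_mul']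
  -- `g e = (g e g*) g`, because the idempotents `e` and `g* g` commute and `g g* g = g`.
  change act (g * e.1) y = act (g * e.1 * star g * g) y
  congr 1
  have hg : (star g * g) * (star g * g) = star g * g := by
    rw [mul_assoc, ← mul_assoc g, InverseMonoid.mul_star_mul_self]
  rw [mul_assoc, mul_assoc g, InverseMonoid.idem_comm e.2 hg, ← mul_assoc, ← mul_assoc,
    InverseMonoid.mul_star_mul_self]

theorem conj_apply (hs : hasStar S) (c : S.El S.coeff) (y : S.El X) :
    conj (φ c y) = φ (conj c) (conj y) := by
  -- Both sides are conjugate linear in `c`, so the density argument for two linear maps does not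
  -- apply; the set of equality is still a closed linear subspace.
  let p : Submodule ℂ (S.El S.coeff) :=
    { carrier := {c | conj (φ c y) = φ (conj c) (conj y)}
      add_mem' := fun {a b} ha hb => by
        change conj (φ (a + b) y) = φ (conj (a + b)) (conj y)
        rw [map_add, LinearMap.add_apply, conj_add hs, conj_add hs, map_add, LinearMap.add_apply,
          ← ha.out, ← hb.out]
      zero_mem' := by
        change conj (φ 0 y) = φ (conj 0) (conj y)
        have h0 : ∀ A : S.C, conj (0 : S.El A) = 0 := fun A => by
          simpa using conj_smul hs (0 : ℂ) (0 : S.El A)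
        simp [h0]
      smul_mem' := fun a b hb => by
        change conj (φ (a • b) y) = φ (conj (a • b)) (conj y)
        rw [map_smul, LinearMap.smul_apply, conj_smul hs, conj_smul hs, map_smul,
          LinearMap.smul_apply, ← hb.out] }
  refine mem_of_dense idem_dense p ?_ ?_ c
  · exact isClosed_eq (conj_continuous.comp (h.continuous_left y))
      ((h.continuous_left _).comp conj_continuous)
  · rintro _ ⟨e, rfl⟩
    change conj (φ _ y) = φ _ _
    rw [h.idem, idem_conj hs, h.idem, act_conj hs]

theorem map_hom {Z : S.C} {ψ : S.El S.coeff →ₗ[ℂ] S.El Z →ₗ[ℂ] S.El Z} (h' : IsCoeffAction ψ)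
    (f : X ⟶ Z) (c : S.El S.coeff) (y : S.El X) : ap f (φ c y) = ψ c (ap f y) :=
  eq_of_dense idem_dense (f := (ap f : S.El X →ₗ[ℂ] S.El Z).comp (φ.flip y))
    (k := ψ.flip (ap f y)) ((continuous_ap f).comp (h.continuous_left y)) (h'.continuous_left _)
    (by
      rintro _ ⟨e, rfl⟩
      change ap f (φ _ y) = ψ _ _
      rw [h.idem, h'.idem, ap_act]) c

end IsCoeffAction

theorem isCoeffAction_mul : IsCoeffAction (X := S.coeff) (LinearMap.mul ℂ (S.El S.coeff)) where
  idem e y := (act_idem_coeff e y).symm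
  continuous_left _ := continuous_id.mul continuous_const

end Coeff

end Setting

/-! ### Diagonal approximate units and the ambient algebra -/

namespace Setting

open Good

variable {G : Type u} [InverseMonoid G] {S : Setting G} {ι : Type u} {σ : S.MatAction ι}

/-- The diagonal matrix with entries `e` at the indices in `F`. -/
noncomputable def MatTensor.diag {A D : S.C} (T : S.MatTensor σ A D) (e : S.El A) (F : Finset ι) :
    S.El D := ∑ i ∈ F, T.tmul (S.unit i i) e

variable [S.Good]

namespace MatTensor

variable {A D : S.C} (T : S.MatTensor σ A D) (e : S.El A)

theorem diag_mul_tmul {F : Finset ι} {i : ι} (hi : i ∈ F) (j : ι) (x : S.El A) :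
    T.diag e F * T.tmul (S.unit i j) x = T.tmul (S.unit i j) (e * x) := by
  rw [diag, Finset.sum_mul, Finset.sum_eq_single i]
  · rw [tensor_mul T.isTensor, unit_system]
  · intro k _ hk
    rw [tensor_mul T.isTensor, unit_mul_ne _ _ _ _ hk, map_zero, LinearMap.zero_apply]
  · exact fun h => absurd hi h

theorem tmul_mul_diag {F : Finset ι} {j : ι} (hj : j ∈ F) (i : ι) (x : S.El A) :
    T.tmul (S.unit i j) x * T.diag e F = T.tmul (S.unit i j) (x * e) := by
  rw [diag, Finset.mul_sum, Finset.sum_eq_single j]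
  · rw [tensor_mul T.isTensor, unit_system]
  · intro k _ hk
    rw [tensor_mul T.isTensor, unit_mul_ne _ _ _ _ hk.symm, map_zero, LinearMap.zero_apply]
  · exact fun h => absurd hj h

theorem diag_mul_diag (he : e * e = e) {F F' : Finset ι} (h : F' ⊆ F) :
    T.diag e F * T.diag e F' = T.diag e F' := by
  conv_lhs => rw [diag.eq_def T e F', Finset.mul_sum]
  rw [diag.eq_def T e F']
  exact Finset.sum_congr rfl fun i hi => by rw [diag_mul_tmul _ _ (h hi), he]

theorem diag_mul_diag' (he : e * e = e) {F F' : Finset ι} (h : F' ⊆ F) :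
    T.diag e F' * T.diag e F = T.diag e F' := by
  conv_lhs => rw [diag.eq_def T e F', Finset.sum_mul]
  rw [diag.eq_def T e F']
  exact Finset.sum_congr rfl fun i hi => by rw [tmul_mul_diag _ _ (h hi), he]

theorem conj_sum (hs : hasStar S) {B : S.C} {I : Type*} (F : Finset I) (f : I → S.El B) :
    conj (∑ i ∈ F, f i) = ∑ i ∈ F, conj (f i) := by
  classical
  induction F using Finset.induction_on with
  | empty => simpa using conj_smul hs (0 : ℂ) (0 : S.El B)
  | insert a s ha ih => rw [Finset.sum_insert ha, Finset.sum_insert ha, conj_add hs, ih]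

theorem bdd_diag (he : e * e = e) (he' : hasStar S → conj e = e) : bdd (T.diag e) :=
  bdd_projection _ (fun _ => T.diag_mul_diag e he subset_rfl) fun hs F => by
    rw [diag, conj_sum hs]
    exact Finset.sum_congr rfl fun i _ => by rw [tensor_conj hs T.isTensor, unit_conj hs, he' hs]

/-- On `e_{ij} ⊗ a` the net is constant as soon as `i ∈ F`; boundedness of the diagonal idempotents
extends convergence to the closed span. -/
theorem tendsto_diag_mul (he : e * e = e) (he' : hasStar S → conj e = e) (h : ∀ x, e * x = x)
    (v : S.El D) : Tendsto (fun F => T.diag e F * v) atTop (𝓝 v) := by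
  let p : Submodule ℂ (S.El D) :=
    { carrier := {v | Tendsto (fun F => T.diag e F * v) atTop (𝓝 v)}
      add_mem' := fun {a b} ha hb => by simpa [mul_add] using ha.out.add hb.out
      zero_mem' := by simp
      smul_mem' := fun c x hx => by
        have := (continuousSMul D).continuous_const_smul c |>.tendsto _ |>.comp hx.out
        exact this.congr fun F => (mul_smul_comm _ _ _).symm }
  refine mem_of_dense (unit_tensor_dense T.isTensor) p
    (isClosed_eq_left _ _ (T.bdd_diag e he he')) ?_ v
  rintro _ ⟨i, j, a, rfl⟩
  refine tendsto_const_nhds.congr' ?_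
  filter_upwards [eventually_ge_atTop {i}] with F hF
  rw [T.diag_mul_tmul e (Finset.singleton_subset_iff.mp hF), h]

theorem tendsto_mul_diag (he : e * e = e) (he' : hasStar S → conj e = e) (h : ∀ x, x * e = x)
    (v : S.El D) : Tendsto (fun F => v * T.diag e F) atTop (𝓝 v) := by
  let p : Submodule ℂ (S.El D) :=
    { carrier := {v | Tendsto (fun F => v * T.diag e F) atTop (𝓝 v)}
      add_mem' := fun {a b} ha hb => by simpa [add_mul] using ha.out.add hb.out
      zero_mem' := by simp
      smul_mem' := fun c x hx => by
        have := (continuousSMul D).continuous_const_smul c |>.tendsto _ |>.comp hx.out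
        exact this.congr fun F => (smul_mul_assoc _ _ _).symm }
  refine mem_of_dense (unit_tensor_dense T.isTensor) p
    (isClosed_eq_right _ _ (T.bdd_diag e he he')) ?_ v
  rintro _ ⟨i, j, a, rfl⟩
  refine tendsto_const_nhds.congr' ?_
  filter_upwards [eventually_ge_atTop {j}] with F hF
  rw [T.tmul_mul_diag e (Finset.singleton_subset_iff.mp hF), h]

end MatTensor

variable {K X D : S.C} (TK : S.MatTensor σ S.coeff K) (TD : S.MatTensor σ X D)


/-- An algebra containing both `K = M_n(𝔠)` and, as an ideal, `D = M_n(X)`, where `𝔠` acts on `X`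
by the actions of the idempotents. -/
structure Ambient where
  Q : S.C
  i : D ⟶ Q
  r : K ⟶ Q
  i_injective : Function.Injective (ap i)
  φ : S.El S.coeff →ₗ[ℂ] S.El X →ₗ[ℂ] S.El X
  isCoeffAction : IsCoeffAction φ
  mulLeft : S.El K →ₗ[ℂ] S.El D →ₗ[ℂ] S.El D
  mulRight : S.El K →ₗ[ℂ] S.El D →ₗ[ℂ] S.El D
  r_mul : ∀ k v, ap r k * ap i v = ap i (mulLeft k v)
  mul_r : ∀ k v, ap i v * ap r k = ap i (mulRight k v)
  mulLeft_tmul : ∀ m c m' y, mulLeft (TK.tmul m c) (TD.tmul m' y) = TD.tmul (m * m') (φ c y)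
  mulRight_tmul : ∀ m c m' y, mulRight (TK.tmul m c) (TD.tmul m' y) = TD.tmul (m' * m) (φ c y)
  tendsto_left : ∀ w, Tendsto (fun F => ap r (TK.diag (S.idem 1) F) * w) atTop (𝓝 w)
  tendsto_right : ∀ w, Tendsto (fun F => w * ap r (TK.diag (S.idem 1) F)) atTop (𝓝 w)

/-- Take `Q = M_n(X ⋊ 𝔠)`, where `𝔠` acts on `X` by `φ` from both sides. Since `1 ∈ 𝔠` acts on `X`
as the identity, it is a unit of `X ⋊ 𝔠`, so the `p_F` form an approximate unit of the whole of `Q`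
and not merely of `K`. -/
theorem exists_ambient : Nonempty (Ambient TK TD) := by
  obtain ⟨φ, hφ₁, hφ₂, hc⟩ := exists_coeff_action X
  have hφ : IsCoeffAction φ := ⟨hφ₁, hφ₂⟩
  have hcompat : ∀ (e : Idem G) a v, φ (act e.1 a) v = φ a (act e.1 v) := fun e a v => by
    rw [act_idem_coeff, hφ.mul_apply hc, hφ.commute hc, hφ.idem]
  obtain ⟨Q₀, i₀, p₀, r₀, h₀, hl, hr⟩ := exists_semidirect φ φ
    { left_mul := hφ.mul_apply hc
      right_mul := fun a b v => by rw [hφ.mul_apply hc, hφ.commute hc]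
      left_assoc := hφ.assoc_left
      right_assoc := hφ.assoc_right
      middle := fun a v w => by rw [← hφ.assoc_left, hφ.assoc_right]
      comm := hφ.commute hc } hφ.act_apply hφ.act_apply hcompat hcompat
    (fun hs => hφ.conj_apply hs)
  obtain ⟨Q, ⟨TQ⟩⟩ := exists_tensor σ Q₀
  obtain ⟨i, hi⟩ := exists_tensorMap_hom TD TQ i₀
  obtain ⟨p, hp⟩ := exists_tensorMap_hom TQ TK p₀
  obtain ⟨r, hr'⟩ := exists_tensorMap_hom TK TQ r₀
  have h := h₀.tensor TD TQ TK hi hp hr'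
  -- `M_n(X)` is an ideal of `Q`, and the multiplications by `K` are those of `Q`.
  choose L hL using fun k v => h.mul_mem (ap r k) v
  choose M hM using fun k v => h.mul_mem' (ap r k) v
  have hone : ∀ F, ap r (TK.diag (S.idem 1) F) = TQ.diag (ap r₀ (S.idem 1)) F := fun F => by
    rw [MatTensor.diag, map_sum]
    exact Finset.sum_congr rfl fun j _ => hr' _ _
  have he : ap r₀ (S.idem 1) * ap r₀ (S.idem 1) = ap r₀ (S.idem 1) := by
    rw [← map_mul, idem_one_mul]
  have he' : hasStar S → conj (ap r₀ (S.idem 1)) = ap r₀ (S.idem 1) := fun hs => by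
    rw [← ap_conj hs, idem_conj hs]
  exact ⟨{
    Q := Q
    i := i
    r := r
    i_injective := h.injective
    φ := φ
    isCoeffAction := hφ
    mulLeft := LinearMap.mk₂ ℂ L
      (fun a b v => h.injective (by rw [hL, map_add, map_add, hL, hL, add_mul]))
      (fun c a v => h.injective (by rw [hL, map_smul, map_smul, hL, smul_mul_assoc]))
      (fun a v w => h.injective (by rw [hL, map_add, map_add, hL, hL, mul_add]))
      (fun c a v => h.injective (by rw [hL, map_smul, map_smul, hL, mul_smul_comm]))
    mulRight := LinearMap.mk₂ ℂ M
      (fun a b v => h.injective (by rw [hM, map_add, map_add, hM, hM, mul_add]))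
      (fun c a v => h.injective (by rw [hM, map_smul, map_smul, hM, mul_smul_comm]))
      (fun a v w => h.injective (by rw [hM, map_add, map_add, hM, hM, add_mul]))
      (fun c a v => h.injective (by rw [hM, map_smul, map_smul, hM, smul_mul_assoc]))
    r_mul := fun k v => (hL k v).symm
    mul_r := fun k v => (hM k v).symm
    mulLeft_tmul := fun m c m' y => h.injective (by
      change ap i (L _ _) = _
      rw [hL, hr', hi, hi, tensor_mul TQ.isTensor, hl])
    mulRight_tmul := fun m c m' y => h.injective (by
      change ap i (M _ _) = _
      rw [hM, hr', hi, hi, tensor_mul TQ.isTensor, hr])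
    tendsto_left := fun w => by
      simp only [hone]
      refine TQ.tendsto_diag_mul _ he he' (fun x => ?_) w
      obtain ⟨v, hv⟩ := h₀.exists_eq x
      rw [hv, mul_add, hl, hφ.one_apply, ← map_mul, idem_one_mul]
    tendsto_right := fun w => by
      simp only [hone]
      refine TQ.tendsto_mul_diag _ he he' (fun x => ?_) w
      obtain ⟨v, hv⟩ := h₀.exists_eq x
      rw [hv, add_mul, hr, hφ.one_apply, ← map_mul, mul_idem_one] }⟩

end Setting

/-! ### Multipliers: the action of `Y` on `M_n(X)` -/

namespace Setting

open Good

variable {G : Type u} [InverseMonoid G] {S : Setting G} {ι : Type u} {σ : S.MatAction ι}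
  [S.Good] {K X D : S.C} {TK : S.MatTensor σ S.coeff K} {TD : S.MatTensor σ X D}

namespace Ambient

variable (E : Ambient TK TD)

/-- The elements `p_F` of `K` satisfy `p_F w → w`, so an element of `Q` is determined by its
products with `K`. This replaces limits by algebra in most of the verifications below. -/
theorem eq_of_left {w w' : S.El E.Q} (h : ∀ k, ap E.r k * w = ap E.r k * w') : w = w' :=
  tendsto_nhds_unique ((E.tendsto_left w).congr fun _ => h _) (E.tendsto_left w')

theorem eq_of_right {w w' : S.El E.Q} (h : ∀ k, w * ap E.r k = w' * ap E.r k) : w = w' :=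
  tendsto_nhds_unique ((E.tendsto_right w).congr fun _ => h _) (E.tendsto_right w')

theorem mulLeft_continuous (v : S.El D) : Continuous fun k => E.mulLeft k v := by
  rw [(isClosedEmbedding_ap E.i E.i_injective).isEmbedding.continuous_iff]
  exact ((continuous_ap E.r).mul continuous_const).congr fun k => E.r_mul k v

theorem mulLeft_continuous' (k : S.El K) : Continuous fun v => E.mulLeft k v := by
  rw [(isClosedEmbedding_ap E.i E.i_injective).isEmbedding.continuous_iff]
  exact (continuous_const.mul (continuous_ap E.i)).congr fun v => E.r_mul k v

theorem mulRight_continuous (v : S.El D) : Continuous fun k => E.mulRight k v := by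
  rw [(isClosedEmbedding_ap E.i E.i_injective).isEmbedding.continuous_iff]
  exact (continuous_const.mul (continuous_ap E.r)).congr fun k => E.mul_r k v

theorem mulRight_continuous' (k : S.El K) : Continuous fun v => E.mulRight k v := by
  rw [(isClosedEmbedding_ap E.i E.i_injective).isEmbedding.continuous_iff]
  exact ((continuous_ap E.i).mul continuous_const).congr fun v => E.mul_r k v

variable {Y A : S.C} {inc : K ⟶ Y} {pY : Y ⟶ A} {sm : A ⟶ Y}

/-- The left and right multiplication of `Y` on `D = M_n(X)`, where `Y` contains `K = M_n(𝔠)` as an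
ideal. -/
structure Multiplier (inc : K ⟶ Y) where
  L : S.El Y →ₗ[ℂ] S.El D →ₗ[ℂ] S.El D
  R : S.El Y →ₗ[ℂ] S.El D →ₗ[ℂ] S.El D
  left_spec : ∀ y v k k', ap inc k' = ap inc k * y →
    ap E.r k * ap E.i (L y v) = ap E.r k' * ap E.i v
  right_spec : ∀ y v k k', ap inc k' = y * ap inc k →
    ap E.i (R y v) * ap E.r k = ap E.i v * ap E.r k'
  tendsto_left : ∀ y (k : Finset ι → S.El K),
    (∀ F, ap inc (k F) = y * ap inc (TK.diag (S.idem 1) F)) →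
    ∀ v, Tendsto (fun F => E.mulLeft (k F) v) atTop (𝓝 (L y v))
  tendsto_right : ∀ y (k : Finset ι → S.El K),
    (∀ F, ap inc (k F) = ap inc (TK.diag (S.idem 1) F) * y) →
    ∀ v, Tendsto (fun F => E.mulRight (k F) v) atTop (𝓝 (R y v))

theorem bdd_diag_idem : bdd (TK.diag (S.idem 1)) :=
  TK.bdd_diag _ (idem_one_mul _) fun hs => idem_conj hs 1

/-- For `v` replaced by `p_{F'} v` the net is eventually constant, since `(y p_F) p_{F'} = y p_{F'}`
for `F ⊇ F'`. These vectors approximate `v` and the net `y p_F` is bounded, so the limit exists in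
`Q`; it stays in `M_n(X)`, which is closed. -/
theorem exists_limit_left (hinc : Function.Injective (ap inc)) (y : S.El Y)
    (k : Finset ι → S.El K) (hk : ∀ F, ap inc (k F) = y * ap inc (TK.diag (S.idem 1) F))
    (v : S.El D) : ∃ w, Tendsto (fun F => E.mulLeft (k F) v) atTop (𝓝 w) := by
  -- Boundedness is visible in `Y`, where `k F` is `y p_F`; the injective inclusion of `K` reflects
  -- it and the map to `Q` preserves it.
  have hb : bdd fun F => ap E.r (k F) := bdd_map _ _ (bdd_of_map inc _ hinc (by
    simpa only [hk] using bdd_mul_left y _ (bdd_map inc _ bdd_diag_idem)))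
  have h1 : ∃ c, Tendsto (fun F => ap E.r (k F) * ap E.i v) atTop (𝓝 c) := by
    refine (isClosed_exists_left atTop _ hb).mem_of_tendsto (E.tendsto_left (ap E.i v))
      (Eventually.of_forall fun F' => ⟨ap E.r (k F') * ap E.i v, tendsto_const_nhds.congr' ?_⟩)
    filter_upwards [eventually_ge_atTop F'] with F hF
    rw [← mul_assoc, ← map_mul]
    congr 2
    apply hinc
    rw [map_mul, hk, hk, mul_assoc, ← map_mul, TK.diag_mul_diag _ (idem_one_mul _) hF]
  obtain ⟨c, hc⟩ := h1
  have hE := isClosedEmbedding_ap E.i E.i_injective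
  obtain ⟨w, rfl⟩ := hE.isClosed_range.mem_of_tendsto hc
    (Eventually.of_forall fun F => ⟨_, (E.r_mul _ _).symm⟩)
  exact ⟨w, hE.isEmbedding.tendsto_nhds_iff.mpr (hc.congr fun F => E.r_mul _ _)⟩

theorem exists_limit_right (hinc : Function.Injective (ap inc)) (y : S.El Y)
    (k : Finset ι → S.El K) (hk : ∀ F, ap inc (k F) = ap inc (TK.diag (S.idem 1) F) * y)
    (v : S.El D) : ∃ w, Tendsto (fun F => E.mulRight (k F) v) atTop (𝓝 w) := by
  have hb : bdd fun F => ap E.r (k F) := bdd_map _ _ (bdd_of_map inc _ hinc (by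
    simpa only [hk] using bdd_mul_right y _ (bdd_map inc _ bdd_diag_idem)))
  have h1 : ∃ c, Tendsto (fun F => ap E.i v * ap E.r (k F)) atTop (𝓝 c) := by
    refine (isClosed_exists_right atTop _ hb).mem_of_tendsto (E.tendsto_right (ap E.i v))
      (Eventually.of_forall fun F' => ⟨ap E.i v * ap E.r (k F'), tendsto_const_nhds.congr' ?_⟩)
    filter_upwards [eventually_ge_atTop F'] with F hF
    rw [mul_assoc, ← map_mul]
    congr 2
    apply hinc
    rw [map_mul, hk, hk, ← mul_assoc, ← map_mul, TK.diag_mul_diag' _ (idem_one_mul _) hF]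
  obtain ⟨c, hc⟩ := h1
  have hE := isClosedEmbedding_ap E.i E.i_injective
  obtain ⟨w, rfl⟩ := hE.isClosed_range.mem_of_tendsto hc
    (Eventually.of_forall fun F => ⟨_, (E.mul_r _ _).symm⟩)
  exact ⟨w, hE.isEmbedding.tendsto_nhds_iff.mpr (hc.congr fun F => E.mul_r _ _)⟩

/-- After the limits are known to exist, only the identities `k (y v) = (k y) v` and `(v y) k = v (y
k)` are needed: they characterize the multiplications, so bilinearity follows by multiplying with
`k`. -/
theorem exists_multiplier (h : S.SplitExact inc pY sm) : Nonempty (E.Multiplier inc) := by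
  have hE := isClosedEmbedding_ap E.i E.i_injective
  choose kl hkl using fun (y : S.El Y) (F : Finset ι) => h.mul_mem y (TK.diag (S.idem 1) F)
  choose kr hkr using fun (y : S.El Y) (F : Finset ι) => h.mul_mem' y (TK.diag (S.idem 1) F)
  choose L hL using fun y v => E.exists_limit_left h.injective y (kl y) (hkl y) v
  choose M hM using fun y v => E.exists_limit_right h.injective y (kr y) (hkr y) v
  -- Pass to the limit in `k (y p_F) v = (k y) p_F v`.
  have hL' : ∀ y v k k', ap inc k' = ap inc k * y →
      ap E.r k * ap E.i (L y v) = ap E.r k' * ap E.i v := by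
    intro y v k k' hk
    have h1 : Tendsto (fun F => ap E.r k * ap E.i (E.mulLeft (kl y F) v)) atTop
        (𝓝 (ap E.r k * ap E.i (L y v))) :=
      ((continuous_const.mul (continuous_ap E.i)).tendsto _).comp (hL y v)
    have h2 : Tendsto (fun F => ap E.r k' * (ap E.r (TK.diag (S.idem 1) F) * ap E.i v)) atTop
        (𝓝 (ap E.r k' * ap E.i v)) := (E.tendsto_left (ap E.i v)).const_mul _
    refine tendsto_nhds_unique h1 (h2.congr fun F => ?_)
    rw [← E.r_mul, ← mul_assoc, ← mul_assoc, ← map_mul, ← map_mul]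
    congr 2
    apply h.injective
    rw [map_mul, map_mul, hk, hkl, mul_assoc]
  have hM' : ∀ y v k k', ap inc k' = y * ap inc k →
      ap E.i (M y v) * ap E.r k = ap E.i v * ap E.r k' := by
    intro y v k k' hk
    have h1 : Tendsto (fun F => ap E.i (E.mulRight (kr y F) v) * ap E.r k) atTop
        (𝓝 (ap E.i (M y v) * ap E.r k)) :=
      (((continuous_ap E.i).mul continuous_const).tendsto _).comp (hM y v)
    have h2 : Tendsto (fun F => (ap E.i v * ap E.r (TK.diag (S.idem 1) F)) * ap E.r k') atTop
        (𝓝 (ap E.i v * ap E.r k')) := (E.tendsto_right (ap E.i v)).mul_const _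
    refine tendsto_nhds_unique h1 (h2.congr fun F => ?_)
    rw [← E.mul_r, mul_assoc, mul_assoc, ← map_mul, ← map_mul]
    congr 2
    apply h.injective
    rw [map_mul, map_mul, hk, hkr, mul_assoc]
  choose l hl using fun (y : S.El Y) (k : S.El K) => h.mul_mem' y k
  choose m hm using fun (y : S.El Y) (k : S.El K) => h.mul_mem y k
  have hLl := fun y v k => hL' y v k (l y k) (hl y k)
  have hMm := fun y v k => hM' y v k (m y k) (hm y k)
  have l_add : ∀ y z k, l (y + z) k = l y k + l z k := fun y z k => h.injective (by
    rw [hl, map_add, hl, hl, mul_add])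
  have l_smul : ∀ (c : ℂ) y k, l (c • y) k = c • l y k := fun c y k => h.injective (by
    rw [hl, map_smul, hl, mul_smul_comm])
  have m_add : ∀ y z k, m (y + z) k = m y k + m z k := fun y z k => h.injective (by
    rw [hm, map_add, hm, hm, add_mul])
  have m_smul : ∀ (c : ℂ) y k, m (c • y) k = c • m y k := fun c y k => h.injective (by
    rw [hm, map_smul, hm, smul_mul_assoc])
  refine ⟨{
    L := LinearMap.mk₂ ℂ L
      (fun a b v => E.i_injective (E.eq_of_left fun k => by
        rw [hLl, map_add, mul_add, hLl, hLl, l_add, map_add, add_mul]))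
      (fun c a v => E.i_injective (E.eq_of_left fun k => by
        rw [hLl, map_smul, mul_smul_comm, hLl, l_smul, map_smul, smul_mul_assoc]))
      (fun a v w => E.i_injective (E.eq_of_left fun k => by
        rw [hLl, map_add, map_add, mul_add, mul_add, hLl, hLl]))
      (fun c a v => E.i_injective (E.eq_of_left fun k => by
        rw [hLl, map_smul, map_smul, mul_smul_comm, mul_smul_comm, hLl]))
    R := LinearMap.mk₂ ℂ M
      (fun a b v => E.i_injective (E.eq_of_right fun k => by
        rw [hMm, map_add, add_mul, hMm, hMm, m_add, map_add, mul_add]))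
      (fun c a v => E.i_injective (E.eq_of_right fun k => by
        rw [hMm, map_smul, smul_mul_assoc, hMm, m_smul, map_smul, mul_smul_comm]))
      (fun a v w => E.i_injective (E.eq_of_right fun k => by
        rw [hMm, map_add, map_add, add_mul, add_mul, hMm, hMm]))
      (fun c a v => E.i_injective (E.eq_of_right fun k => by
        rw [hMm, map_smul, map_smul, smul_mul_assoc, smul_mul_assoc, hMm]))
    left_spec := hL'
    right_spec := hM'
    tendsto_left := fun y k hk v => (hL y v).congr fun F => by
      rw [h.injective ((hkl y F).trans (hk F).symm)]
    tendsto_right := fun y k hk v => (hM y v).congr fun F => by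
      rw [h.injective ((hkr y F).trans (hk F).symm)] }⟩

namespace Multiplier

variable {E} (N : E.Multiplier inc) (h : S.SplitExact inc pY sm)

include h

/-- To recognize `y v`, it is enough to know its products with all `k ∈ K`. -/
theorem eq_left {y : S.El Y} {v w : S.El D}
    (hw : ∀ k k', ap inc k' = ap inc k * y → ap E.r k * ap E.i w = ap E.r k' * ap E.i v) :
    w = N.L y v :=
  E.i_injective (E.eq_of_left fun k => by
    obtain ⟨k', hk'⟩ := h.mul_mem' y k
    rw [hw k k' hk', N.left_spec y v k k' hk'])

theorem eq_right {y : S.El Y} {v w : S.El D}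
    (hw : ∀ k k', ap inc k' = y * ap inc k → ap E.i w * ap E.r k = ap E.i v * ap E.r k') :
    w = N.R y v :=
  E.i_injective (E.eq_of_right fun k => by
    obtain ⟨k', hk'⟩ := h.mul_mem y k
    rw [hw k k' hk', N.right_spec y v k k' hk'])

/-- All laws except the middle one are tested against `K` and become associativity in `Y` and `Q`.
-/
theorem isBiaction : IsBiaction N.L N.R where
  left_mul a b v := by
    symm
    refine N.eq_left h fun k k' hk => ?_
    obtain ⟨l, hl⟩ := h.mul_mem' a k
    rw [N.left_spec _ _ k l hl, N.left_spec _ _ l k' (by rw [hk, hl, mul_assoc])]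
  right_mul a b v := by
    symm
    refine N.eq_right h fun k k' hk => ?_
    obtain ⟨l, hl⟩ := h.mul_mem b k
    rw [N.right_spec _ _ k l hl, N.right_spec _ _ l k' (by rw [hk, hl, mul_assoc])]
  left_assoc a v w := by
    symm
    refine N.eq_left h fun k k' hk => ?_
    rw [map_mul, ← mul_assoc, N.left_spec _ _ k k' hk, map_mul, mul_assoc]
  right_assoc a v w := by
    symm
    refine N.eq_right h fun k k' hk => ?_
    rw [map_mul, mul_assoc, N.right_spec _ _ k k' hk, map_mul, mul_assoc]
  middle a v w := by
    apply E.i_injective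
    -- For the middle law an approximate unit is inserted: `(v a) w = lim (v a) p_F w = lim v (a
    -- p_F) w = v (a w)`.
    choose k hk using fun F : Finset ι => h.mul_mem a (TK.diag (S.idem 1) F)
    have h1 := (E.tendsto_left (ap E.i w)).const_mul (ap E.i (N.R a v))
    have h2 := (((continuous_ap E.i).tendsto _).comp (N.tendsto_left a k hk w)).const_mul (ap E.i v)
    rw [map_mul, map_mul]
    refine tendsto_nhds_unique h1 (h2.congr fun F => ?_)
    change _ * ap E.i _ = _
    rw [← E.r_mul, ← mul_assoc, ← mul_assoc, N.right_spec a v _ (k F) (hk F)]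
  comm a b v := by
    symm
    refine N.eq_left h fun k k' hk => ?_
    refine E.eq_of_right fun l => ?_
    obtain ⟨l', hl⟩ := h.mul_mem b l
    rw [mul_assoc, N.right_spec _ _ l l' hl, ← mul_assoc, N.left_spec _ _ k k' hk, mul_assoc,
      mul_assoc, N.right_spec _ _ l l' hl]

/-- As `g` acts by an endomorphism, the test element `k` need not lie in the range of `g`, and
`left_spec` cannot be transported by `g`. The limit formula helps: `k · g(a p_F) = (k · g(a)) ·
g(p_F)`. -/
theorem act_left (g : G) (a : S.El Y) (v : S.El D) :
    act g (N.L a v) = N.L (act g a) (act g v) := by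
  refine N.eq_left h fun k k' hk => ?_
  choose l hl using fun F : Finset ι => h.mul_mem a (TK.diag (S.idem 1) F)
  have h1 : Tendsto (fun F => ap E.r k * act g (ap E.i (E.mulLeft (l F) v))) atTop
      (𝓝 (ap E.r k * act g (ap E.i (N.L a v)))) :=
    ((continuous_const.mul ((continuous_act g).comp (continuous_ap E.i))).tendsto _).comp
      (N.tendsto_left a l hl v)
  have h2 : Tendsto (fun F => ap E.r k' * act g (ap E.r (TK.diag (S.idem 1) F) * ap E.i v)) atTop
      (𝓝 (ap E.r k' * act g (ap E.i v))) :=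
    ((continuous_const.mul (continuous_act g)).tendsto _).comp (E.tendsto_left (ap E.i v))
  rw [ap_act, ap_act]
  refine tendsto_nhds_unique h1 (h2.congr fun F => ?_)
  rw [← E.r_mul, map_act_mul, map_act_mul, ← mul_assoc, ← mul_assoc, ← ap_act, ← ap_act, ← ap_act,
    ← map_mul, ← map_mul]
  congr 2
  apply h.injective
  rw [map_mul, map_mul, hk, ap_act, ap_act, hl, map_act_mul, mul_assoc]

theorem act_right (g : G) (a : S.El Y) (v : S.El D) :
    act g (N.R a v) = N.R (act g a) (act g v) := by
  refine N.eq_right h fun k k' hk => ?_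
  choose l hl using fun F : Finset ι => h.mul_mem' a (TK.diag (S.idem 1) F)
  have h1 : Tendsto (fun F => act g (ap E.i (E.mulRight (l F) v)) * ap E.r k) atTop
      (𝓝 (act g (ap E.i (N.R a v)) * ap E.r k)) :=
    ((((continuous_act g).comp (continuous_ap E.i)).mul continuous_const).tendsto _).comp
      (N.tendsto_right a l hl v)
  have h2 : Tendsto (fun F => act g (ap E.i v * ap E.r (TK.diag (S.idem 1) F)) * ap E.r k') atTop
      (𝓝 (act g (ap E.i v) * ap E.r k')) :=
    (((continuous_act g).mul continuous_const).tendsto _).comp (E.tendsto_right (ap E.i v))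
  rw [ap_act, ap_act]
  refine tendsto_nhds_unique h1 (h2.congr fun F => ?_)
  rw [← E.mul_r, map_act_mul, map_act_mul, mul_assoc, mul_assoc, ← ap_act, ← ap_act, ← ap_act,
    ← map_mul, ← map_mul]
  congr 2
  apply h.injective
  rw [map_mul, map_mul, hk, ap_act, ap_act, hl, map_act_mul, mul_assoc]

/-- For `l = k a` one has `k · e(a) = e(l)`, and in `Q` the idempotent `e` can be moved from one
factor of a product to the other. -/
theorem compat_left (e : Idem G) (a : S.El Y) (v : S.El D) :
    N.L (act e.1 a) v = N.L a (act e.1 v) := by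
  symm
  refine N.eq_left h fun k k' hk => ?_
  obtain ⟨l, hl⟩ := h.mul_mem' a k
  rw [N.left_spec _ _ k l hl, ap_act, ← act_compat, ← ap_act]
  congr 2
  apply h.injective
  rw [hk, ap_act, hl, act_idem_mul']

theorem compat_right (e : Idem G) (a : S.El Y) (v : S.El D) :
    N.R (act e.1 a) v = N.R a (act e.1 v) := by
  symm
  refine N.eq_right h fun k k' hk => ?_
  obtain ⟨l, hl⟩ := h.mul_mem a k
  rw [N.right_spec _ _ k l hl, ap_act, act_compat, ← ap_act]
  congr 2
  apply h.injective
  rw [hk, ap_act, hl, act_idem_mul]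

theorem conj_left (hs : hasStar S) (a : S.El Y) (v : S.El D) :
    conj (N.L a v) = N.R (conj a) (conj v) := by
  refine N.eq_right h fun k k' hk => ?_
  have h1 := congrArg conj (N.left_spec a v (conj k) (conj k') (by
    rw [ap_conj hs, hk, conj_mul hs, conj_conj hs, ap_conj hs]))
  rwa [conj_mul hs, conj_mul hs, ← ap_conj hs, ← ap_conj hs, ← ap_conj hs, ← ap_conj hs,
    conj_conj hs, conj_conj hs] at h1

end Multiplier

end Ambient

end Setting

/-! ### The extension of `M_n(X)` by `A` and its sections over `Y` -/

namespace Setting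

open Good

variable {G : Type u} [InverseMonoid G] {S : Setting G} {ι : Type u} {σ : S.MatAction ι}
  [S.Good] {K X D : S.C} {TK : S.MatTensor σ S.coeff K} {TD : S.MatTensor σ X D}

namespace Ambient

variable (E : Ambient TK TD) {Y A : S.C} {inc : K ⟶ Y} {pY : Y ⟶ A} {sm : A ⟶ Y}

theorem tensor_ext₂ {B : S.C} {f k : S.El K →ₗ[ℂ] S.El D →ₗ[ℂ] S.El B}
    (hf : ∀ v, Continuous fun x => f x v) (hf' : ∀ x, Continuous fun v => f x v)
    (hk : ∀ v, Continuous fun x => k x v) (hk' : ∀ x, Continuous fun v => k x v)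
    (h : ∀ m c m' y, f (TK.tmul m c) (TD.tmul m' y) = k (TK.tmul m c) (TD.tmul m' y))
    (x : S.El K) (v : S.El D) : f x v = k x v :=
  tensor_ext TK.isTensor (f := f.flip v) (k := k.flip v) (hf v) (hk v) (fun _ _ _ =>
    tensor_ext TD.isTensor (hf' _) (hk' _) (fun _ _ _ => h _ _ _ _) v) x

/-- An equivariant map to `𝔠` carries the action `φ` to multiplication in `𝔠`, so `id ⊗ p_X` is
compatible with the multiplications by `K`. -/
theorem map_mulLeft {pX : X ⟶ S.coeff} {q : D ⟶ K}
    (hq : ∀ m x, ap q (TD.tmul m x) = TK.tmul m (ap pX x)) (k : S.El K) (v : S.El D) :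
    ap q (E.mulLeft k v) = k * ap q v := by
  refine tensor_ext₂ (TK := TK) (TD := TD) (f := E.mulLeft.compr₂ (ap q : S.El D →ₗ[ℂ] S.El K))
    (k := (LinearMap.mul ℂ (S.El K)).compl₂ (ap q : S.El D →ₗ[ℂ] S.El K))
    (fun v => (continuous_ap q).comp (E.mulLeft_continuous v))
    (fun x => (continuous_ap q).comp (E.mulLeft_continuous' x))
    (fun v => continuous_id.mul continuous_const)
    (fun x => continuous_const.mul (continuous_ap q)) (fun m c m' y => ?_) k v
  change ap q (E.mulLeft _ _) = TK.tmul m c * ap q _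
  rw [E.mulLeft_tmul, hq, hq, tensor_mul TK.isTensor,
    E.isCoeffAction.map_hom isCoeffAction_mul pX]
  rfl

theorem map_mulRight {pX : X ⟶ S.coeff} {q : D ⟶ K}
    (hq : ∀ m x, ap q (TD.tmul m x) = TK.tmul m (ap pX x)) (k : S.El K) (v : S.El D) :
    ap q (E.mulRight k v) = ap q v * k := by
  refine tensor_ext₂ (TK := TK) (TD := TD) (f := E.mulRight.compr₂ (ap q : S.El D →ₗ[ℂ] S.El K))
    (k := (LinearMap.mul ℂ (S.El K)).flip.compl₂ (ap q : S.El D →ₗ[ℂ] S.El K))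
    (fun v => (continuous_ap q).comp (E.mulRight_continuous v))
    (fun x => (continuous_ap q).comp (E.mulRight_continuous' x))
    (fun v => continuous_const.mul continuous_id)
    (fun x => (continuous_ap q).mul continuous_const) (fun m c m' y => ?_) k v
  change ap q (E.mulRight _ _) = ap q _ * TK.tmul m c
  rw [E.mulRight_tmul, hq, hq, tensor_mul TK.isTensor,
    E.isCoeffAction.map_hom isCoeffAction_mul pX, coeff_mul_comm (ap pX y)]
  rfl

/-- Any equivariant homomorphism `𝔠 → X` intertwines multiplication with `φ`. This is used for `s_-`
and for `s_+`, which is possible because `s_+` is equivariant for `γ_-`. -/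
theorem mulLeft_map {ξ : S.coeff ⟶ X} {w : K ⟶ D}
    (hw : ∀ m c, ap w (TK.tmul m c) = TD.tmul m (ap ξ c)) (k l : S.El K) :
    E.mulLeft k (ap w l) = ap w (k * l) := by
  refine tensor_ext₂ (TK := TK) (TD := TK) (f := E.mulLeft.compl₂ (ap w : S.El K →ₗ[ℂ] S.El D))
    (k := (LinearMap.mul ℂ (S.El K)).compr₂ (ap w : S.El K →ₗ[ℂ] S.El D))
    (fun v => E.mulLeft_continuous _)
    (fun x => (E.mulLeft_continuous' x).comp (continuous_ap w))
    (fun v => (continuous_ap w).comp (continuous_id.mul continuous_const))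
    (fun x => (continuous_ap w).comp (continuous_const.mul continuous_id))
    (fun m c m' y => ?_) k l
  change E.mulLeft _ (ap w _) = ap w (TK.tmul m c * TK.tmul m' y)
  rw [hw, E.mulLeft_tmul, tensor_mul TK.isTensor, hw,
    ← isCoeffAction_mul.map_hom E.isCoeffAction ξ]
  rfl

theorem mulRight_map {ξ : S.coeff ⟶ X} {w : K ⟶ D}
    (hw : ∀ m c, ap w (TK.tmul m c) = TD.tmul m (ap ξ c)) (k l : S.El K) :
    E.mulRight k (ap w l) = ap w (l * k) := by
  refine tensor_ext₂ (TK := TK) (TD := TK) (f := E.mulRight.compl₂ (ap w : S.El K →ₗ[ℂ] S.El D))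
    (k := (LinearMap.mul ℂ (S.El K)).flip.compr₂ (ap w : S.El K →ₗ[ℂ] S.El D))
    (fun v => E.mulRight_continuous _)
    (fun x => (E.mulRight_continuous' x).comp (continuous_ap w))
    (fun v => (continuous_ap w).comp (continuous_const.mul continuous_id))
    (fun x => (continuous_ap w).comp (continuous_id.mul continuous_const))
    (fun m c m' y => ?_) k l
  change E.mulRight _ (ap w _) = ap w (TK.tmul m' y * TK.tmul m c)
  rw [hw, E.mulRight_tmul, tensor_mul TK.isTensor, hw,
    ← isCoeffAction_mul.map_hom E.isCoeffAction ξ, coeff_mul_comm y]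
  rfl

namespace Multiplier

variable {E} (N : E.Multiplier inc) (h : S.SplitExact inc pY sm)

include h

/-- The limit of the corresponding identity for the elements `y p_F` of `K`. -/
theorem map_left {pX : X ⟶ S.coeff} {q : D ⟶ K}
    (hq : ∀ m x, ap q (TD.tmul m x) = TK.tmul m (ap pX x)) (y : S.El Y) (v : S.El D) :
    ap inc (ap q (N.L y v)) = y * ap inc (ap q v) := by
  choose l hl using fun F : Finset ι => h.mul_mem y (TK.diag (S.idem 1) F)
  have h1 : Tendsto (fun F => ap inc (ap q (E.mulLeft (l F) v))) atTop
      (𝓝 (ap inc (ap q (N.L y v)))) :=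
    (((continuous_ap inc).comp (continuous_ap q)).tendsto _).comp (N.tendsto_left y l hl v)
  have h2 : Tendsto (fun F => y * ap inc (TK.diag (S.idem 1) F * ap q v)) atTop
      (𝓝 (y * ap inc (ap q v))) :=
    ((continuous_const.mul (continuous_ap inc)).tendsto _).comp
      (TK.tendsto_diag_mul _ (idem_one_mul _) (fun hs => idem_conj hs 1) idem_one_mul (ap q v))
  refine tendsto_nhds_unique h1 (h2.congr fun F => ?_)
  rw [E.map_mulLeft hq, map_mul, map_mul, hl, mul_assoc]

theorem map_right {pX : X ⟶ S.coeff} {q : D ⟶ K}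
    (hq : ∀ m x, ap q (TD.tmul m x) = TK.tmul m (ap pX x)) (y : S.El Y) (v : S.El D) :
    ap inc (ap q (N.R y v)) = ap inc (ap q v) * y := by
  choose l hl using fun F : Finset ι => h.mul_mem' y (TK.diag (S.idem 1) F)
  have h1 : Tendsto (fun F => ap inc (ap q (E.mulRight (l F) v))) atTop
      (𝓝 (ap inc (ap q (N.R y v)))) :=
    (((continuous_ap inc).comp (continuous_ap q)).tendsto _).comp (N.tendsto_right y l hl v)
  have h2 : Tendsto (fun F => ap inc (ap q v * TK.diag (S.idem 1) F) * y) atTop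
      (𝓝 (ap inc (ap q v) * y)) :=
    (((continuous_ap inc).mul continuous_const).tendsto _).comp
      (TK.tendsto_mul_diag _ (idem_one_mul _) (fun hs => idem_conj hs 1) mul_idem_one (ap q v))
  refine tendsto_nhds_unique h1 (h2.congr fun F => ?_)
  rw [E.map_mulRight hq, map_mul, map_mul, hl, mul_assoc]

/-- Multiplying with `m ∈ K` reduces the identity `y w(k) = w(y k)` to `(m y) k = m (y k)`. -/
theorem left_map {ξ : S.coeff ⟶ X} {w : K ⟶ D}
    (hw : ∀ m c, ap w (TK.tmul m c) = TD.tmul m (ap ξ c)) {y : S.El Y} {k l : S.El K}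
    (hl : ap inc l = y * ap inc k) : N.L y (ap w k) = ap w l := by
  symm
  refine N.eq_left h fun m m' hm => ?_
  rw [E.r_mul, E.r_mul, E.mulLeft_map hw, E.mulLeft_map hw]
  congr 2
  apply h.injective
  rw [map_mul, map_mul, hl, hm, mul_assoc]

theorem right_map {ξ : S.coeff ⟶ X} {w : K ⟶ D}
    (hw : ∀ m c, ap w (TK.tmul m c) = TD.tmul m (ap ξ c)) {y : S.El Y} {k l : S.El K}
    (hl : ap inc l = ap inc k * y) : N.R y (ap w k) = ap w l := by
  symm
  refine N.eq_right h fun m m' hm => ?_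
  rw [E.mul_r, E.mul_r, E.mulRight_map hw, E.mulRight_map hw]
  congr 2
  apply h.injective
  rw [map_mul, map_mul, hl, hm, mul_assoc]

end Multiplier

variable {E} in
/-- The algebra `D + T(A)`, with coordinates in `D × A`. -/
structure Extension (N : E.Multiplier inc) (sm : A ⟶ Y) where
  Ω : S.C
  i : D ⟶ Ω
  p : Ω ⟶ A
  r : A ⟶ Ω
  splitExact : S.SplitExact i p r
  r_mul : ∀ a v, ap r a * ap i v = ap i (N.L (ap sm a) v)
  mul_r : ∀ a v, ap i v * ap r a = ap i (N.R (ap sm a) v)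

variable {E} {N : E.Multiplier inc} (h : S.SplitExact inc pY sm)

include h

/-- The semidirect product for the action of `A` on `M_n(X)` obtained by composing `t_-` with the
multipliers; the section plays the role of `T`. -/
theorem exists_extension : Nonempty (Extension N sm) := by
  have hN := N.isBiaction h
  obtain ⟨Ω, i, p, r, hΩ, hl, hr⟩ := exists_semidirect
    (N.L.comp (ap sm : S.El A →ₗ[ℂ] S.El Y)) (N.R.comp (ap sm : S.El A →ₗ[ℂ] S.El Y))
    { left_mul := fun a b v => by
        change N.L (ap sm (a * b)) v = _
        rw [map_mul, hN.left_mul]; rfl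
      right_mul := fun a b v => by
        change N.R (ap sm (a * b)) v = _
        rw [map_mul, hN.right_mul]; rfl
      left_assoc := fun a => hN.left_assoc _
      right_assoc := fun a => hN.right_assoc _
      middle := fun a => hN.middle _
      comm := fun a b => hN.comm _ _ }
    (fun g a v => by
      change act g (N.L (ap sm a) v) = N.L (ap sm (act g a)) (act g v)
      rw [N.act_left h, ap_act])
    (fun g a v => by
      change act g (N.R (ap sm a) v) = N.R (ap sm (act g a)) (act g v)
      rw [N.act_right h, ap_act])
    (fun e a v => by
      change N.L (ap sm (act e.1 a)) v = N.L (ap sm a) (act e.1 v)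
      rw [ap_act, N.compat_left h])
    (fun e a v => by
      change N.R (ap sm (act e.1 a)) v = N.R (ap sm a) (act e.1 v)
      rw [ap_act, N.compat_right h])
    (fun hs a v => by
      change conj (N.L (ap sm a) v) = N.R (ap sm (conj a)) (conj v)
      rw [N.conj_left h hs, ap_conj hs])
  exact ⟨⟨Ω, i, p, r, hΩ, hl, hr⟩⟩

namespace Extension

variable (W : Extension N sm)

/-- The projection `Ω → Y` is `id ⊗ p_X` on `M_n(X)` and sends `T(a)` to `t_-(a)`; it is
multiplicative because `id ⊗ p_X` is compatible with the multiplications by `Y`. -/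
theorem exists_proj {pX : X ⟶ S.coeff} {q : D ⟶ K}
    (hq : ∀ m x, ap q (TD.tmul m x) = TK.tmul m (ap pX x)) :
    ∃ π : W.Ω ⟶ Y, (∀ v, ap π (ap W.i v) = ap inc (ap q v)) ∧ ∀ a, ap π (ap W.r a) = ap sm a := by
  obtain ⟨π, h1, h2⟩ := W.splitExact.exists_desc (q ≫ inc) sm
    (fun a v w hw => by
      rw [W.r_mul] at hw
      rw [W.splitExact.injective hw, ap_comp, ap_comp, N.map_left h hq])
    (fun a v w hw => by
      rw [W.mul_r] at hw
      rw [W.splitExact.injective hw, ap_comp, ap_comp, N.map_right h hq])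
  exact ⟨π, fun v => by rw [h1, ap_comp], h2⟩

/-- Yields `θ_-` and `θ_+`, by taking `s_-` and `s_+` for `ξ`. Both send `t_-(a)` to `T(a)`. -/
theorem exists_section {ξ : S.coeff ⟶ X} {w : K ⟶ D}
    (hw : ∀ m c, ap w (TK.tmul m c) = TD.tmul m (ap ξ c)) :
    ∃ θ : Y ⟶ W.Ω, (∀ k, ap θ (ap inc k) = ap W.i (ap w k)) ∧ ∀ a, ap θ (ap sm a) = ap W.r a := by
  obtain ⟨θ, h1, h2⟩ := h.exists_desc (w ≫ W.i) W.r
    (fun a v l hl => by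
      rw [ap_comp, ap_comp, W.r_mul, N.left_map h hw hl])
    (fun a v l hl => by
      rw [ap_comp, ap_comp, W.mul_r, N.right_map h hw hl])
  exact ⟨θ, fun v => by rw [h1, ap_comp], h2⟩

-- If `v + T(a)` maps to zero in `Y`, projecting to `A` gives `a = 0`; then `v` lies in the kernel
-- of `M_n(X) → K`, which is the ideal `J` of the given sequence.
omit [S.Good] in
theorem splitExact_comp {J : S.C} {iD : J ⟶ D} {q : D ⟶ K} {w : K ⟶ D} (hD : S.SplitExact iD q w)
    {π : W.Ω ⟶ Y} (hπ : ∀ v, ap π (ap W.i v) = ap inc (ap q v))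
    (hπ' : ∀ a, ap π (ap W.r a) = ap sm a) {θ : Y ⟶ W.Ω}
    (hθ : ∀ k, ap θ (ap inc k) = ap W.i (ap w k)) (hθ' : ∀ a, ap θ (ap sm a) = ap W.r a) :
    S.SplitExact (iD ≫ W.i) π θ where
  injective a b hab := by
    rw [ap_comp, ap_comp] at hab
    exact hD.injective (W.splitExact.injective hab)
  exact x := by
    constructor
    · intro hx
      obtain ⟨v, hv⟩ := W.splitExact.exists_eq x
      rw [hv, map_add, hπ, hπ'] at hx
      have h1 := congrArg (ap pY) hx
      rw [map_add, h.proj_inc, h.split, zero_add, map_zero] at h1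
      rw [h1, map_zero, add_zero] at hx
      obtain ⟨j, rfl⟩ := hD.exists_inc (h.injective (hx.trans (map_zero (ap inc)).symm))
      exact ⟨j, by rw [ap_comp, hv, h1, map_zero, add_zero]⟩
    · rintro ⟨j, rfl⟩
      rw [ap_comp, hπ, hD.proj_inc, map_zero]
  split y := by
    obtain ⟨k, hk⟩ := h.exists_eq y
    rw [hk, map_add, hθ, hθ', map_add, hπ, hπ', hD.split]

end Extension

end Ambient

end Setting

/-! ### Iterated matrix algebras and composed corner embeddings -/

namespace Setting

open Good

variable {G : Type u} [InverseMonoid G] {S : Setting G}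

/-- The trivial action on a matrix algebra. -/
def MatAction.trivial (S : Setting G) (ι : Type u) : S.MatAction ι where
  hom _ := 𝟙 _
  hom_one := rfl
  hom_mul _ _ := (Category.id_comp _).symm
  compat _ _ _ := by rw [ap_id, ap_id]

variable [S.Good]

theorem MatTensor.ext_bilinear {M A D B : S.C} {τ : S.El M →ₗ[ℂ] S.El A →ₗ[ℂ] S.El D}
    (h : S.IsTensor τ) {f k : S.El D →ₗ[ℂ] S.El B} (hf : Continuous f) (hk : Continuous k)
    (hfk : ∀ m a, f (τ m a) = k (τ m a)) (x : S.El D) : f x = k x :=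
  eq_of_dense (tensor_dense h) hf hk (by rintro _ ⟨m, a, rfl⟩; exact hfk m a) x

/-- The isomorphism `M_ι ⊗ M_κ ≅ M_{ι × κ}`. -/
theorem exists_kronecker (S : Setting G) [S.Good] (ι κ : Type u) :
    ∃ τ : S.El (S.mat ι) →ₗ[ℂ] S.El (S.mat κ) →ₗ[ℂ] S.El (S.mat (ι × κ)), S.IsTensor τ ∧
      ∀ i j k l, τ (S.unit i j) (S.unit k l) = S.unit (i, k) (j, l) := by
  obtain ⟨D, ⟨T⟩⟩ := exists_tensor (MatAction.trivial S ι) (S.mat κ)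
  have hT := T.isTensor
  obtain ⟨Ψ, hΨ, hΨu⟩ := lift_mat (ι := ι × κ) (B := D)
    (fun p q => T.tmul (S.unit p.1 q.1) (S.unit p.2 q.2))
    (fun p q r => by rw [tensor_mul hT, unit_system, unit_system])
    (fun p q r s hqr => by
      rw [tensor_mul hT]
      by_cases h1 : q.1 = r.1
      · have h2 : q.2 ≠ r.2 := fun h2 => hqr (Prod.ext h1 h2)
        rw [unit_mul_ne _ _ _ _ h2, map_zero]
      · rw [unit_mul_ne _ _ _ _ h1, map_zero, LinearMap.zero_apply])
    (fun hs p q => by rw [tensor_conj hs hT, unit_conj hs, unit_conj hs])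
  -- Compressing an element of the kernel to one entry gives a multiple of a matrix unit in the
  -- kernel, but matrix units have nonzero images.
  have hinj : Function.Injective Ψ := by
    rw [injective_iff_map_eq_zero]
    intro m hm
    refine unit_separating m fun p q => ?_
    obtain ⟨c, hc⟩ := unit_coef p q m
    have h1 : c • Ψ (S.unit p q) = 0 := by
      rw [← map_smul, ← hc, map_mul, map_mul, hm, mul_zero, zero_mul]
    rw [hΨu, smul_eq_zero] at h1
    rcases h1 with h1 | h1
    · rw [hc, h1, zero_smul]
    · rcases tensor_eq_zero hT _ _ h1 with h | h
      · exact absurd h (unit_ne_zero _ _)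
      · exact absurd h (unit_ne_zero _ _)
  have hemb := isClosedEmbedding Ψ hΨ hinj
  -- The range is closed and contains the elementary tensors of matrix units, which span a dense
  -- subspace.
  have hsurj : Function.Surjective Ψ := by
    let p : Submodule ℂ (S.El D) := LinearMap.range (Ψ : S.El (S.mat (ι × κ)) →ₗ[ℂ] S.El D)
    have hp : IsClosed (p : Set (S.El D)) := by
      have := hemb.isClosed_range
      exact this
    intro x
    refine mem_of_dense (unit_tensor_dense hT) p hp ?_ x
    rintro _ ⟨i, j, m, rfl⟩
    refine mem_of_dense (unit_dense κ) (p.comap (T.tmul (S.unit i j)))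
      (hp.preimage (tensor_continuous_right hT _)) ?_ m
    rintro _ ⟨k, l, rfl⟩
    exact ⟨S.unit (i, k) (j, l), hΨu _ _⟩
  let e : S.El (S.mat (ι × κ)) ≃ₗ[ℂ] S.El D :=
    LinearEquiv.ofBijective (Ψ : S.El (S.mat (ι × κ)) →ₗ[ℂ] S.El D) ⟨hinj, hsurj⟩
  have he : ∀ x, Ψ (e.symm x) = x := fun x => e.apply_symm_apply x
  have hu : ∀ i j k l, e.symm (T.tmul (S.unit i j) (S.unit k l)) = S.unit (i, k) (j, l) :=
    fun i j k l => hinj (by rw [he, hΨu])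
  refine ⟨T.tmul.compr₂ e.symm.toLinearMap, isTensor_of (fun m m' a a' => hinj ?_)
    (fun hs m a => hinj ?_) ?_ (fun i j => ?_), hu⟩
  · change Ψ (e.symm _ * e.symm _) = Ψ (e.symm _)
    rw [map_mul, he, he, he, tensor_mul hT]
  · change Ψ (conj (e.symm _)) = Ψ (e.symm _)
    rw [hΨ hs, he, he, tensor_conj hs hT]
  · refine (unit_dense (ι × κ)).mono (Submodule.span_mono ?_)
    rintro _ ⟨p, q, rfl⟩
    exact ⟨_, _, hu p.1 q.1 p.2 q.2⟩
  · obtain ⟨ε, hε, h1, h2⟩ := tensor_entry hT i j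
    refine ⟨ε.comp (Ψ : S.El (S.mat (ι × κ)) →ₗ[ℂ] S.El D), hε.comp (continuous_hom Ψ hΨ),
      fun a => ?_, fun k l a hkl => ?_⟩
    · change ε (Ψ (e.symm _)) = a
      rw [he, h1]
    · change ε (Ψ (e.symm _)) = 0
      rw [he, h2 k l a hkl]

/-- The tensor product of two actions on matrix algebras. -/
theorem exists_prodAction {ι κ : Type u} (σ : S.MatAction ι) (σ' : S.MatAction κ)
    {τ : S.El (S.mat ι) →ₗ[ℂ] S.El (S.mat κ) →ₗ[ℂ] S.El (S.mat (ι × κ))} (h : S.IsTensor τ) :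
    ∃ σ'' : S.MatAction (ι × κ), ∀ g m m', ap (σ''.hom g) (τ m m') =
      τ (ap (σ.hom g) m) (ap (σ'.hom g) m') := by
  have h1 : ∀ g, ∃ F : S.mat (ι × κ) ⟶ S.mat (ι × κ), ∀ m m', ap F (τ m m') =
      τ (ap (σ.hom g) m) (ap (σ'.hom g) m') := fun g => by
    obtain ⟨F, hF, hF'⟩ := exists_tensorMap h h (ap (σ.hom g)) (isStarMap_ap _)
      (ap (σ'.hom g)) (isStarMap_ap _)
    -- The objects `S.mat` carry the trivial action, so equivariance is no condition.
    obtain ⟨f, hf⟩ := exists_hom F (fun g a => by rw [mat_act, mat_act]) hF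
    exact ⟨f, fun m m' => by rw [hf, hF']⟩
  choose F hF using h1
  have hext : ∀ {f k : S.mat (ι × κ) ⟶ S.mat (ι × κ)},
      (∀ m m', ap f (τ m m') = ap k (τ m m')) → f = k := fun {f k} hfk =>
    hom_ext _ _ fun x => MatTensor.ext_bilinear h
      (f := (ap f : S.El (S.mat (ι × κ)) →ₗ[ℂ] S.El (S.mat (ι × κ))))
      (k := (ap k : S.El (S.mat (ι × κ)) →ₗ[ℂ] S.El (S.mat (ι × κ))))
      (continuous_ap f) (continuous_ap k) hfk x
  refine ⟨⟨F, hext fun m m' => ?_, fun g k => hext fun m m' => ?_, fun e a b => ?_⟩, hF⟩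
  · rw [hF, σ.hom_one, σ'.hom_one, ap_id, ap_id, ap_id]
  · rw [hF, ap_comp, hF, hF, σ.hom_mul, σ'.hom_mul, ap_comp, ap_comp]
  · let M := S.mat (ι × κ)
    let L : S.El M →ₗ[ℂ] S.El M := (ap (F e.1) : S.El M →ₗ[ℂ] S.El M)
    refine MatTensor.ext_bilinear h (f := (LinearMap.mulRight ℂ b).comp L)
      (k := LinearMap.mulRight ℂ (L b)) ((continuous_ap _).mul continuous_const)
      (continuous_id.mul continuous_const) (fun m m' => ?_) a
    refine MatTensor.ext_bilinear h (f := LinearMap.mulLeft ℂ (L (τ m m')))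
      (k := (LinearMap.mulLeft ℂ (τ m m')).comp L) (continuous_const.mul continuous_id)
      (continuous_const.mul (continuous_ap _)) (fun n n' => ?_) b
    change ap (F e.1) _ * τ n n' = τ m m' * ap (F e.1) _
    rw [hF, hF, tensor_mul h, tensor_mul h, σ.compat, σ'.compat]

/-- `M_ι(M_κ(B))` is a very special matrix algebra over `B`. -/
theorem exists_matTensor_prod {ι κ : Type u} {σ : S.MatAction ι} {σ' : S.MatAction κ} {B J J' : S.C}
    (T : S.MatTensor σ' B J) (T' : S.MatTensor σ J J') :
    ∃ (σ'' : S.MatAction (ι × κ)) (T'' : S.MatTensor σ'' B J'), ∀ i j k l b,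
      T''.tmul (S.unit (i, k) (j, l)) b = T'.tmul (S.unit i j) (T.tmul (S.unit k l) b) := by
  have hT := T.isTensor
  have hT' := T'.isTensor
  obtain ⟨τ, hτ, hτu⟩ := exists_kronecker S ι κ
  obtain ⟨σ'', hσ⟩ := exists_prodAction σ σ' hτ
  obtain ⟨D, ⟨TD⟩⟩ := exists_tensor σ'' B
  obtain ⟨F, hF, hFu⟩ := lift TD.isTensor
    (fun p q => (T'.tmul (S.unit p.1 q.1)).comp (T.tmul (S.unit p.2 q.2)))
    { mul_same := fun p q r a b => by
        change T'.tmul _ (T.tmul _ _) * T'.tmul _ (T.tmul _ _) = T'.tmul _ (T.tmul _ _)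
        rw [tensor_mul hT', tensor_mul hT, unit_system, unit_system]
      mul_ne := fun p q r s a b hqr => by
        change T'.tmul _ (T.tmul _ _) * T'.tmul _ (T.tmul _ _) = 0
        rw [tensor_mul hT', tensor_mul hT]
        by_cases h1 : q.1 = r.1
        · have h2 : q.2 ≠ r.2 := fun h2 => hqr (Prod.ext h1 h2)
          rw [unit_mul_ne _ _ _ _ h2, map_zero, LinearMap.zero_apply, map_zero]
        · rw [unit_mul_ne _ _ _ _ h1, map_zero, LinearMap.zero_apply] }
    (fun hs p q a => by
      change conj (T'.tmul _ (T.tmul _ _)) = T'.tmul _ (T.tmul _ _)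
      rw [tensor_conj hs hT', tensor_conj hs hT, unit_conj hs, unit_conj hs])
  have hFc := continuous_hom F hF
  have hFτ : ∀ m m' b, F (TD.tmul (τ m m') b) = T'.tmul m (T.tmul m' b) := by
    intro m m' b
    refine eq_of_dense (unit_dense ι) (f := (F : S.El D →ₗ[ℂ] S.El J').comp
      ((TD.tmul.flip b).comp (τ.flip m'))) (k := T'.tmul.flip (T.tmul m' b))
      (hFc.comp ((tensor_continuous_left TD.isTensor b).comp (tensor_continuous_left hτ m')))
      (tensor_continuous_left hT' _) ?_ m
    rintro _ ⟨i, j, rfl⟩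
    refine eq_of_dense (unit_dense κ) (f := (F : S.El D →ₗ[ℂ] S.El J').comp
      ((TD.tmul.flip b).comp (τ (S.unit i j)))) (k := (T'.tmul (S.unit i j)).comp (T.tmul.flip b))
      (hFc.comp ((tensor_continuous_left TD.isTensor b).comp (tensor_continuous_right hτ _)))
      ((tensor_continuous_right hT' _).comp (tensor_continuous_left hT b)) ?_ m'
    rintro _ ⟨k, l, rfl⟩
    change F (TD.tmul (τ _ _) b) = T'.tmul _ (T.tmul _ b)
    rw [hτu, hFu]
    rfl
  -- `F` need not be shown to be an isomorphism: its composite with the tensor map of `M_{ι × κ} ⊗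
  -- B` satisfies the entry criterion directly, the entries being taken in two stages.
  refine ⟨σ'', ⟨TD.tmul.compr₂ (F : S.El D →ₗ[ℂ] S.El J'), isTensor_of (fun m m' a a' => ?_)
    (fun hs m a => ?_) ?_ (fun p q => ?_), fun g m b => ?_⟩, fun i j k l b => ?_⟩
  · change F _ * F _ = F _
    rw [← map_mul, tensor_mul TD.isTensor]
  · change conj (F _) = F _
    rw [← hF hs, tensor_conj hs TD.isTensor]
  · let p := (Submodule.span ℂ
      {y | ∃ m b, (TD.tmul.compr₂ (F : S.El D →ₗ[ℂ] S.El J')) m b = y}).topologicalClosure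
    have hp : IsClosed (p : Set (S.El J')) := Submodule.isClosed_topologicalClosure _
    intro x
    refine mem_of_dense (unit_tensor_dense hT') p hp ?_ x
    rintro _ ⟨i, j, y, rfl⟩
    refine mem_of_dense (tensor_dense hT) (p.comap (T'.tmul (S.unit i j)))
      (hp.preimage (tensor_continuous_right hT' _)) ?_ y
    rintro _ ⟨m, b, rfl⟩
    exact Submodule.le_topologicalClosure _ (Submodule.subset_span ⟨τ (S.unit i j) m, b, hFτ _ _ _⟩)
  · obtain ⟨ε, hε, h1, h2⟩ := tensor_entry hT p.2 q.2
    obtain ⟨ε', hε', h1', h2'⟩ := tensor_entry hT' p.1 q.1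
    have h3 : ∀ r s b, F (TD.tmul (S.unit r s) b) =
        T'.tmul (S.unit r.1 s.1) (T.tmul (S.unit r.2 s.2) b) := fun r s b => by
      rw [← hFτ, hτu]
    refine ⟨ε.comp ε', hε.comp hε', fun b => ?_, fun r s b hrs => ?_⟩
    · change ε (ε' (F _)) = b
      rw [h3, h1', h1]
    · change ε (ε' (F _)) = 0
      rw [h3]
      by_cases h4 : (p.1, q.1) = (r.1, s.1)
      · rw [Prod.mk.injEq] at h4
        rw [← h4.1, ← h4.2, h1', h2]
        intro h5
        rw [Prod.mk.injEq] at h5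
        exact hrs (by rw [Prod.ext h4.1 h5.1, Prod.ext h4.2 h5.2])
      · rw [h2' _ _ _ h4, map_zero]
  · refine MatTensor.ext_bilinear hτ
      (f := (actHom (S := S) (A := J') g : S.El J' →ₗ[ℂ] S.El J').comp
        ((F : S.El D →ₗ[ℂ] S.El J').comp (TD.tmul.flip b)))
      (k := ((F : S.El D →ₗ[ℂ] S.El J').comp (TD.tmul.flip (act g b))).comp
        (ap (σ''.hom g) : S.El (S.mat (ι × κ)) →ₗ[ℂ] S.El (S.mat (ι × κ))))
      ((continuous_act g).comp (hFc.comp (tensor_continuous_left TD.isTensor b)))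
      ((hFc.comp (tensor_continuous_left TD.isTensor _)).comp (continuous_ap _))
      (fun n n' => ?_) m
    change act g (F (TD.tmul (τ n n') b)) = F (TD.tmul (ap (σ''.hom g) (τ n n')) (act g b))
    rw [hσ, hFτ, hFτ, T'.act_tmul, T.act_tmul]
  · change F _ = _
    rw [← hτu, hFτ]

/-- The base point projection of a very special corner embedding of `𝔠` is invariant. -/
theorem Corner.act_base {K : S.C} (c : S.Corner S.coeff K) (g : G) :
    ap (c.σ.hom g) (S.unit c.base c.base) = S.unit c.base c.base := by
  have h1 := ap_act c.hom g (S.idem 1)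
  -- Equivariance at the unit of `𝔠` gives `(e_{00} - σ_g(e_{00})) ⊗ g 1 g* = 0`, and `g 1 g*` is a
  -- nonzero element of `𝔠`.
  rw [c.hom_apply, c.hom_apply, c.tensor.act_tmul, ← sub_eq_zero, ← LinearMap.sub_apply, ← map_sub,
    idem_act] at h1
  exact (sub_eq_zero.mp ((tensor_eq_zero c.tensor.isTensor _ _ h1).resolve_right
    (idem_ne_zero _))).symm

/-- The corner embedding `X → M_n(X)` at an invariant matrix unit. -/
theorem MatTensor.exists_corner {ι : Type u} {σ : S.MatAction ι} {X D : S.C}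
    (T : S.MatTensor σ X D) (i : ι) (hi : ∀ g, ap (σ.hom g) (S.unit i i) = S.unit i i) :
    ∃ e : X ⟶ D, ∀ x, ap e x = T.tmul (S.unit i i) x :=
  exists_hom_of_linear (T.tmul (S.unit i i))
    (fun a b => by rw [tensor_mul T.isTensor, unit_system])
    (fun g a => by rw [T.act_tmul, hi])
    (fun hs a => by rw [tensor_conj hs T.isTensor, unit_conj hs])

/-- The composition of a very special corner embedding with the corner embedding at an invariant
matrix unit. -/
theorem Corner.exists_comp {ι : Type u} {σ : S.MatAction ι} {B J J' : S.C} (c : S.Corner B J)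
    (T : S.MatTensor σ J J') (i : ι) (hi : ∀ g, ap (σ.hom g) (S.unit i i) = S.unit i i) :
    ∃ c' : S.Corner B J', c'.index = (ι × c.index) ∧
      ∀ b, ap c'.hom b = T.tmul (S.unit i i) (ap c.hom b) := by
  obtain ⟨e, he⟩ := T.exists_corner i hi
  obtain ⟨σ'', T'', h⟩ := exists_matTensor_prod c.tensor T
  refine ⟨⟨ι × c.index, (i, c.base), σ'', T'', c.hom ≫ e, fun b => ?_⟩, rfl, fun b => ?_⟩
  · rw [ap_comp, he, c.hom_apply, h]
  · rw [ap_comp, he]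

end Setting

/-! ### Existence of the product sequence -/

section Product

open Setting Good

variable {G : Type u} [InverseMonoid G] {S : Setting G} {R : S.C → Prop} {P : Type u → Prop}

/-- The maps `id ⊗ s_±`, and the extension of `M_n(X)` by `A` together with its map to the algebra
of `t` and the two sections of this map. -/
structure ProductData [S.Good] {h : R S.coeff} {A B : GK S R P} (t : LevelOneSeq A ⟨S.coeff, h⟩)
    (s : LevelOneSeq ⟨S.coeff, h⟩ B) {D J : S.C} (TD : S.MatTensor t.exit.σ s.Xm.1 D)
    (TJ : S.MatTensor t.exit.σ s.J.1 J) where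
  τt : A.1 ⟶ t.Xm.1
  τt_eq : ∀ a j, t.IsDiff a j → ap τt a = ap t.sm a + ap t.inc j
  t_toGK : t.toGK = gk τt ≫ gkSplit t.splitExact ≫ gkInv t.exit.hom ⟨t.exit, t.exit_mem, rfl⟩
  τs : S.coeff ⟶ s.Xm.1
  τs_eq : ∀ a j, s.IsDiff a j → ap τs a = ap s.sm a + ap s.inc j
  s_toGK : s.toGK = gk (A := ⟨S.coeff, h⟩) τs ≫ gkSplit s.splitExact ≫
    gkInv s.exit.hom ⟨s.exit, s.exit_mem, rfl⟩
  inc : J ⟶ D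
  inc_tmul : ∀ m j, ap inc (TJ.tmul m j) = TD.tmul m (ap s.inc j)
  q : D ⟶ t.J.1
  q_tmul : ∀ m y, ap q (TD.tmul m y) = t.exit.tensor.tmul m (ap s.proj y)
  um : t.J.1 ⟶ D
  um_tmul : ∀ m c, ap um (t.exit.tensor.tmul m c) = TD.tmul m (ap s.sm c)
  up : t.J.1 ⟶ D
  up_tmul : ∀ m c, ap up (t.exit.tensor.tmul m c) = TD.tmul m (ap τs c)
  E : Ambient t.exit.tensor TD
  N : E.Multiplier t.inc
  W : Ambient.Extension N t.sm
  π : W.Ω ⟶ t.Xm.1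
  π_i : ∀ v, ap π (ap W.i v) = ap t.inc (ap q v)
  π_r : ∀ a, ap π (ap W.r a) = ap t.sm a
  θm : t.Xm.1 ⟶ W.Ω
  θm_inc : ∀ k, ap θm (ap t.inc k) = ap W.i (ap um k)
  θm_sm : ∀ a, ap θm (ap t.sm a) = ap W.r a
  θp : t.Xm.1 ⟶ W.Ω
  θp_inc : ∀ k, ap θp (ap t.inc k) = ap W.i (ap up k)
  θp_sm : ∀ a, ap θp (ap t.sm a) = ap W.r a

namespace ProductData

variable [S.Good] {h : R S.coeff} {A B : GK S R P} {t : LevelOneSeq A ⟨S.coeff, h⟩}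
    {s : LevelOneSeq ⟨S.coeff, h⟩ B} {D J : S.C} {TD : S.MatTensor t.exit.σ s.Xm.1 D}
    {TJ : S.MatTensor t.exit.σ s.J.1 J}

theorem nonempty (TD : S.MatTensor t.exit.σ s.Xm.1 D) (TJ : S.MatTensor t.exit.σ s.J.1 J) :
    Nonempty (ProductData t s TD TJ) := by
  obtain ⟨τt, ht, ht'⟩ := t.exists_equivariant
  obtain ⟨τs, hs, hs'⟩ := s.exists_equivariant
  obtain ⟨inc, hinc⟩ := exists_tensorMap_hom TJ TD s.inc
  obtain ⟨q, hq⟩ := exists_tensorMap_hom TD t.exit.tensor s.proj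
  obtain ⟨um, hum⟩ := exists_tensorMap_hom t.exit.tensor TD s.sm
  obtain ⟨up, hup⟩ := exists_tensorMap_hom t.exit.tensor TD τs
  obtain ⟨E⟩ := exists_ambient t.exit.tensor TD
  obtain ⟨N⟩ := E.exists_multiplier t.splitExact
  obtain ⟨W⟩ := Ambient.exists_extension (N := N) t.splitExact
  obtain ⟨π, h1, h2⟩ := Ambient.Extension.exists_proj t.splitExact W hq
  obtain ⟨θm, h3, h4⟩ := Ambient.Extension.exists_section t.splitExact W hum
  obtain ⟨θp, h5, h6⟩ := Ambient.Extension.exists_section t.splitExact W hup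
  exact ⟨⟨τt, ht, ht', τs, hs, hs', inc, hinc, q, hq, um, hum, up, hup, E, N, W, π, h1, h2, θm, h3,
    h4, θp, h5, h6⟩⟩

variable (d : ProductData t s TD TJ)

theorem splitExact_D : S.SplitExact d.inc d.q d.um :=
  s.splitExact.tensor TJ TD t.exit.tensor d.inc_tmul d.q_tmul d.um_tmul

theorem splitExact_Ω : S.SplitExact (d.inc ≫ d.W.i) d.π d.θm :=
  Ambient.Extension.splitExact_comp t.splitExact d.W d.splitExact_D d.π_i d.π_r d.θm_inc d.θm_sm

theorem τt_eq' (a : S.El A.1) : ∃ k, t.IsDiff a k ∧ ap d.τt a = ap t.inc k + ap t.sm a := by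
  obtain ⟨k, hk⟩ := t.diff_mem a
  exact ⟨k, hk, by rw [d.τt_eq a k hk, add_comm]⟩

theorem proj_τt (a : S.El A.1) : ap t.proj (ap d.τt a) = a := by
  obtain ⟨k, -, hk⟩ := d.τt_eq' a
  rw [hk, map_add, t.splitExact.proj_inc, t.splitExact.split, zero_add]

theorem proj_τs (c : S.El S.coeff) : ap s.proj (ap d.τs c) = c := by
  obtain ⟨k, hk⟩ := s.diff_mem c
  rw [d.τs_eq c k hk, map_add, s.splitExact.proj_inc, s.splitExact.split, add_zero]

theorem q_up (k : S.El t.J.1) : ap d.q (ap d.up k) = k :=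
  MatTensor.ext_bilinear t.exit.tensor.isTensor (B := t.J.1)
    (f := (ap d.q : S.El D →ₗ[ℂ] S.El t.J.1).comp (ap d.up : S.El t.J.1 →ₗ[ℂ] S.El D))
    (k := LinearMap.id) ((continuous_ap _).comp (continuous_ap _)) continuous_id (fun m c => by
      change ap d.q (ap d.up _) = _
      rw [d.up_tmul, d.q_tmul, d.proj_τs]
      rfl) k

theorem π_θp (y : S.El t.Xm.1) : ap d.π (ap d.θp y) = y := by
  obtain ⟨k, hk⟩ := t.splitExact.exists_eq y
  rw [hk, map_add, map_add, d.θp_inc, d.θp_sm, d.π_i, d.π_r, d.q_up]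

theorem p_eq (ω : S.El d.W.Ω) : ap d.W.p ω = ap t.proj (ap d.π ω) := by
  obtain ⟨v, hv⟩ := d.W.splitExact.exists_eq ω
  conv_rhs => rw [hv]
  rw [map_add, map_add, d.π_i, d.π_r, t.splitExact.proj_inc, t.splitExact.split, zero_add]

end ProductData

/-- The universal property of a pullback. -/
theorem Setting.Good.exists_pullback_lift [S.Good] {X A B Q Z : S.C} {f : X ⟶ B} {k : A ⟶ B}
    {p : Q ⟶ X} {q : Q ⟶ A} (hinj : ∀ z w, ap p z = ap p w → ap q z = ap q w → z = w)
    (hex : ∀ x a, ap f x = ap k a → ∃ z, ap p z = x ∧ ap q z = a) (u : Z ⟶ X) (v : Z ⟶ A)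
    (huv : ∀ z, ap f (ap u z) = ap k (ap v z)) :
    ∃ w : Z ⟶ Q, (∀ z, ap p (ap w z) = ap u z) ∧ ∀ z, ap q (ap w z) = ap v z := by
  choose w hw hw' using fun z => hex _ _ (huv z)
  let W : S.El Z →ₗ[ℂ] S.El Q :=
    { toFun := w
      map_add' := fun a b => hinj _ _ (by simp only [map_add, hw]) (by simp only [map_add, hw'])
      map_smul' := fun c a => hinj _ _ (by simp only [map_smul, hw, RingHom.id_apply])
        (by simp only [map_smul, hw', RingHom.id_apply]) }
  obtain ⟨F, hF⟩ := exists_hom_of_linear W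
    (fun a b => hinj _ _ (by change ap p (w _) = ap p (w _ * w _); simp only [map_mul, hw])
      (by change ap q (w _) = ap q (w _ * w _); simp only [map_mul, hw']))
    (fun g a => hinj _ _ (by change ap p (w _) = ap p (act g (w _)); simp only [ap_act, hw])
      (by change ap q (w _) = ap q (act g (w _)); simp only [ap_act, hw']))
    (fun hs a => hinj _ _
      (by change ap p (w _) = ap p (conj (w _)); simp only [ap_conj hs, hw])
      (by change ap q (w _) = ap q (conj (w _)); simp only [ap_conj hs, hw']))
  exact ⟨F, fun z => by rw [hF]; exact hw z, fun z => by rw [hF]; exact hw' z⟩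

/-- A level-one sequence with a second homomorphism which is equivariant for the first action. -/
theorem LevelOneSeq.exists_of_hom [S.Good] (hRP : S.SufficientlyBig R P) {A B J X : GK S R P}
    (exit : S.Corner B.1 J.1) (hexit : P exit.index) {inc : J.1 ⟶ X.1} {proj : X.1 ⟶ A.1}
    {sm : A.1 ⟶ X.1} (hs : S.SplitExact inc proj sm) (τ : A.1 ⟶ X.1)
    (hτ : ∀ a, ap proj (ap τ a) = a) :
    ∃ (M : GK S R P) (c : S.Corner X.1 M.1) (hc : P c.index) (o : c.index) (ho : o ≠ c.base)
      (hoo : ∀ i, i = c.base ∨ i = o) (r : X.1 ⟶ M.1)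
      (h1 : Function.Injective (ap r))
      (h2 : Set.range (ap r) = Set.range (c.tensor.tmul (S.unit o o)))
      (h3 : ∀ a, ∃ j, ap r (ap τ a) = c.tensor.tmul (S.unit o o) (ap sm a + ap inc j))
      (h4 : ∀ g m x, act g (c.tensor.tmul m x) - c.tensor.tmul m (act g x) ∈
        Submodule.span ℂ {y | ∃ m' j, y = c.tensor.tmul m' (ap inc j)}),
      ∀ a j, LevelOneSeq.IsDiff (B := B) ⟨J, X, X, M, exit, hexit, inc, proj, sm, hs, τ, c, hc, o, ho,
        hoo, r, h1, h2, h3, h4⟩ a j ↔ ap τ a = ap sm a + ap inc j := by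
  -- With `γ_+ = γ_-` one can take `M_2(X)` with the action `id ⊗ γ_-`, for which the quotient
  -- condition is trivial.
  let ι : Type u := ULift.{u} (Fin 2)
  obtain ⟨M, ⟨T⟩⟩ := exists_tensor (MatAction.trivial S ι) X.1
  have hP : P ι := hRP.finite_mem _ inferInstance
  obtain ⟨e, he⟩ := T.exists_corner ⟨0⟩ (fun g => ap_id _)
  obtain ⟨r, hr⟩ := T.exists_corner ⟨1⟩ (fun g => ap_id _)
  have hinj : Function.Injective (ap r) := fun x y hxy => by
    rw [hr, hr] at hxy
    exact tensor_unit_injective T.isTensor _ _ hxy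
  refine ⟨⟨M, hRP.mat_mem _ _ _ _ T hP X.2⟩, ⟨ι, ⟨0⟩, _, T, e, he⟩, hP, ⟨1⟩, by simp [ι], ?_, r,
    hinj, congrArg Set.range (funext hr), fun a => ?_, fun g m x => ?_, fun a j => ?_⟩
  · rintro ⟨i⟩
    fin_cases i
    · exact Or.inl rfl
    · exact Or.inr rfl
  · obtain ⟨j, hj⟩ := hs.exists_eq (ap τ a)
    exact ⟨j, by rw [hr, hj, hτ, add_comm]⟩
  · have h1 : act g (T.tmul m x) = T.tmul m (act g x) := by
      rw [T.act_tmul]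
      congr 1
      exact congrArg _ (ap_id m)
    change act g (T.tmul m x) - T.tmul m (act g x) ∈ _
    rw [h1, sub_self]
    exact zero_mem _
  · change ap r (ap τ a) = T.tmul (S.unit (⟨1⟩ : ι) ⟨1⟩) (ap sm a + ap inc j) ↔ _
    rw [← hr]
    exact hinj.eq_iff

/-- The algebra of `x` is the pullback of `Ω → Y ← A` along `t_+`, with `x_± = (θ_± t_+, id)`. Its
kernel over `A` is the kernel `M_n(J)` of `Ω → Y`. -/
theorem exists_productFormula [S.Good] (hRP : S.SufficientlyBig R P) {A B : GK S R P}
    {h : R S.coeff} (t : LevelOneSeq A ⟨S.coeff, h⟩) (s : LevelOneSeq ⟨S.coeff, h⟩ B) :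
    ∃ x : LevelOneSeq A B, Nonempty (ProductFormula t s x) := by
  obtain ⟨D, ⟨TD⟩⟩ := exists_tensor t.exit.σ s.Xm.1
  obtain ⟨J, ⟨TJ⟩⟩ := exists_tensor t.exit.σ s.J.1
  obtain ⟨d⟩ := ProductData.nonempty (t := t) (s := s) TD TJ
  obtain ⟨Q, p, qA, hpq, hinj, hex⟩ := exists_pullback d.π d.τt
  obtain ⟨exit, hexit, hexit'⟩ := s.exit.exists_comp TJ t.exit.base t.exit.act_base
  have hJ : R J := hRP.mat_mem _ _ _ _ TJ t.exit_mem s.J.2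
  have hD : R D := hRP.mat_mem _ _ _ _ TD t.exit_mem s.Xm.2
  have hP : P exit.index := hexit ▸ hRP.prod_mem _ _ t.exit_mem s.exit_mem
  have hπi : ∀ j, ap d.π (ap (d.inc ≫ d.W.i) j) = 0 := d.splitExact_Ω.proj_inc
  obtain ⟨z, hz⟩ : ∃ z : J ⟶ A.1, ∀ j, ap z j = 0 := exists_hom_of_linear 0
    (fun _ _ => (mul_zero _).symm) (fun g _ => (map_act_zero g).symm)
    (fun hs _ => by simpa using (conj_smul hs (0 : ℂ) (0 : S.El A.1)).symm)
  obtain ⟨inc, hinc, hinc'⟩ := exists_pullback_lift hinj hex (d.inc ≫ d.W.i) z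
    (fun j => by rw [hπi, hz, map_zero])
  obtain ⟨sm, hsm, hsm'⟩ := exists_pullback_lift hinj hex (d.τt ≫ d.θm) (𝟙 A.1)
    (fun a => by rw [ap_comp, d.splitExact_Ω.split, ap_id])
  obtain ⟨τ, hτ, hτ'⟩ := exists_pullback_lift hinj hex (d.τt ≫ d.θp) (𝟙 A.1)
    (fun a => by rw [ap_comp, d.π_θp, ap_id])
  have hsplit : S.SplitExact inc qA sm :=
    { injective := fun a b hab => d.splitExact_Ω.injective (by rw [← hinc, hab, hinc])
      exact := fun x => by
        constructor
        · intro hx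
          obtain ⟨j, hj⟩ := d.splitExact_Ω.exists_inc (x := ap p x) (by rw [hpq, hx, map_zero])
          exact ⟨j, hinj _ _ (by rw [hinc, hj]) (by rw [hinc', hz, hx])⟩
        · rintro ⟨j, rfl⟩
          rw [hinc', hz]
      split := fun a => by rw [hsm', ap_id] }
  have hQ : R Q := hRP.ext_mem inc qA sm hsplit hJ A.2
  obtain ⟨M, c, hc, o, ho, hoo, r, h1, h2, h3, h4, hdiff⟩ := LevelOneSeq.exists_of_hom hRP
    (J := ⟨J, hJ⟩) (X := ⟨Q, hQ⟩) exit hP hsplit τ (fun a => by rw [hτ', ap_id])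
  obtain ⟨ρ, hρ, hρ'⟩ := d.W.splitExact.exists_retraction
  have hWp : ∀ z, ap d.W.p (ap p z) = ap qA z := fun z => by rw [d.p_eq, hpq, d.proj_τt]
  have hp : ∀ z, ap p z = ap d.W.i (ρ (ap p z)) + ap d.W.r (ap qA z) := fun z => by
    rw [← hWp]; exact hρ _
  choose l hl using fun (a : S.El A.1) (k : S.El t.J.1) => t.splitExact.mul_mem (ap t.sm a) k
  choose m hm using fun (a : S.El A.1) (k : S.El t.J.1) => t.splitExact.mul_mem' (ap t.sm a) k
  have hemb := isClosedEmbedding_ap t.inc t.splitExact.injective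
  -- Over `a`, an element of the pullback has `Ω`-component `v + T(a)`. The condition `q(v) + t_-(a)
  -- = t_+(a)` says that `q(v) = (t_+ - t_-)(a)`, which is the `K`-coordinate of the formula.
  let co : S.El Q →ₗ[ℂ] (S.El D × S.El t.J.1) × S.El A.1 :=
    ((ρ.prod ((ap d.q : S.El D →ₗ[ℂ] S.El t.J.1).comp ρ)).comp
      (ap p : S.El Q →ₗ[ℂ] S.El d.W.Ω)).prod (ap qA : S.El Q →ₗ[ℂ] S.El A.1)
  have hco : ∀ z, co z = ((ρ (ap p z), ap d.q (ρ (ap p z))), ap qA z) := fun z => rfl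
  refine ⟨⟨⟨J, hJ⟩, ⟨Q, hQ⟩, ⟨Q, hQ⟩, M, exit, hP, inc, qA, sm, hsplit, τ, c, hc, o, ho, hoo, r, h1,
    h2, h3, h4⟩, ⟨{
      D := ⟨D, hD⟩
      tensorD := TD
      tensorJ := TJ
      exit_apply := hexit'
      incD := d.inc
      incD_tmul := d.inc_tmul
      um := d.um
      um_tmul := d.um_tmul
      up := d.up
      up_tmul := fun m c j hj => by rw [d.up_tmul, d.τs_eq _ _ hj]
      φ := d.E.φ
      φ_idem := d.E.isCoeffAction.idem
      φ_continuous := d.E.isCoeffAction.continuous_left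
      mulLeft := d.E.mulLeft
      mulLeft_tmul := d.E.mulLeft_tmul
      mulLeft_continuous := d.E.mulLeft_continuous
      mulLeft_continuous' := d.E.mulLeft_continuous'
      mulRight := d.E.mulRight
      mulRight_tmul := d.E.mulRight_tmul
      mulRight_continuous := d.E.mulRight_continuous
      mulRight_continuous' := d.E.mulRight_continuous'
      TL := fun a v => (d.N.L (ap t.sm a) v.1, l a v.2)
      TL_tendsto := fun a k hk v => (d.N.tendsto_left _ k hk v.1).prodMk_nhds ?_
      TR := fun a v => (d.N.R (ap t.sm a) v.1, m a v.2)
      TR_tendsto := fun a k hk v => (d.N.tendsto_right _ k hk v.1).prodMk_nhds ?_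
      coord := co
      coord_injective := fun z w hzw => ?_
      coord_mul := fun z w => ?_
      coord_inc := fun j => ?_
      coord_minus := fun a k hk => ?_
      coord_plus := fun a k j hk hj => ?_ }⟩⟩
  -- The `K`-component of the limit is computed in `Y`: `t_-(a) p_F v → t_-(a) v`.
  · rw [hemb.isEmbedding.tendsto_nhds_iff]
    have := (t.exit.tensor.tendsto_diag_mul _ (idem_one_mul _) (fun hs => idem_conj hs 1)
      idem_one_mul v.2)
    have := (((continuous_const (y := ap t.sm a)).mul (continuous_ap t.inc)).tendsto _).comp this
    rw [hl]
    refine this.congr fun F => ?_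
    change ap t.sm a * ap t.inc (_ * _) = ap t.inc (k F * v.2)
    rw [map_mul, map_mul, hk, mul_assoc]
    rfl
  · rw [hemb.isEmbedding.tendsto_nhds_iff]
    have := (t.exit.tensor.tendsto_mul_diag _ (idem_one_mul _) (fun hs => idem_conj hs 1)
      mul_idem_one v.2)
    have := (((continuous_ap t.inc).mul (continuous_const (y := ap t.sm a))).tendsto _).comp this
    rw [hm]
    refine this.congr fun F => ?_
    change ap t.inc (_ * _) * ap t.sm a = ap t.inc (v.2 * k F)
    rw [map_mul, map_mul, hk, mul_assoc]
    rfl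
  · rw [hco, hco, Prod.mk.injEq, Prod.mk.injEq] at hzw
    exact hinj _ _ (by rw [hp z, hp w, hzw.1.1, hzw.2]) hzw.2
  -- Expand `(v + T(a)) (w + T(b))` in `Ω`; the `K`-coordinate follows by applying `q`, which
  -- respects the multiplications by `Y`.
  · have h5 : ρ (ap p (z * w)) = ρ (ap p z) * ρ (ap p w) +
        d.N.R (ap t.sm (ap qA w)) (ρ (ap p z)) + d.N.L (ap t.sm (ap qA z)) (ρ (ap p w)) := by
      rw [← hρ' (ρ (ap p z) * ρ (ap p w) + d.N.R (ap t.sm (ap qA w)) (ρ (ap p z)) +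
        d.N.L (ap t.sm (ap qA z)) (ρ (ap p w))) (ap qA z * ap qA w)]
      congr 1
      rw [map_mul]
      conv_lhs => rw [hp z, hp w]
      rw [map_add, map_add, ← d.W.r_mul, ← d.W.mul_r, map_mul, map_mul, mul_add, add_mul, add_mul]
      abel
    rw [hco, h5, hco, hco, map_mul]
    refine Prod.ext (Prod.ext rfl ?_) rfl
    change ap d.q (_ + _ + _) = ap d.q _ * ap d.q _ + m _ _ + l _ _
    rw [map_add, map_add, map_mul]
    congr 1
    · congr 1
      exact t.splitExact.injective (by
        rw [d.N.map_right t.splitExact d.q_tmul, hm])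
    · exact t.splitExact.injective (by
        rw [d.N.map_left t.splitExact d.q_tmul, hl])
  · change co (ap inc j) = _
    have h5 := hρ' (ap d.inc j) 0
    rw [map_zero, add_zero] at h5
    rw [hco, hinc, hinc', hz, ap_comp, h5, d.splitExact_D.proj_inc]
  · change co (ap sm a) = _
    obtain ⟨k', hk', h5⟩ := d.τt_eq' a
    obtain rfl := hk.ext hk'
    rw [hco, hsm, hsm', ap_id, ap_comp, h5, map_add, d.θm_inc, d.θm_sm, hρ', d.splitExact_D.split]
  · rw [hdiff] at hj
    change co (ap sm a + ap inc j) = _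
    obtain ⟨k', hk', h5⟩ := d.τt_eq' a
    obtain rfl := hk.ext hk'
    rw [← hj, hco, hτ, hτ', ap_id, ap_comp, h5, map_add, d.θp_inc, d.θp_sm, hρ', d.q_up]

end Product

/-! ### Every sequence given by the formula represents the product -/

section ProductFormula

open Setting Good

variable {G : Type u} [InverseMonoid G] {S : Setting G} [S.Good] {R : S.C → Prop} {P : Type u → Prop}
  {A B : GK S R P} {h : R S.coeff} {t : LevelOneSeq A ⟨S.coeff, h⟩} {s : LevelOneSeq ⟨S.coeff, h⟩ B}

namespace ProductFormula

variable {x : LevelOneSeq A B} (f : ProductFormula t s x) (d : ProductData t s f.tensorD f.tensorJ)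

/-- The data of the formula are prescribed on elementary tensors and continuous, hence coincide with
the constructed ones. This and the next lemmas allow the replacement. -/
theorem incD_eq (j : S.El x.J.1) : ap f.incD j = ap d.inc j :=
  MatTensor.ext_bilinear f.tensorJ.isTensor (f := (ap f.incD : S.El x.J.1 →ₗ[ℂ] S.El f.D.1))
    (k := (ap d.inc : S.El x.J.1 →ₗ[ℂ] S.El f.D.1)) (continuous_ap _) (continuous_ap _)
    (fun m c => (f.incD_tmul m c).trans (d.inc_tmul m c).symm) j

theorem um_eq (k : S.El t.J.1) : ap f.um k = ap d.um k :=
  MatTensor.ext_bilinear t.exit.tensor.isTensor (f := (ap f.um : S.El t.J.1 →ₗ[ℂ] S.El f.D.1))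
    (k := (ap d.um : S.El t.J.1 →ₗ[ℂ] S.El f.D.1)) (continuous_ap _) (continuous_ap _)
    (fun m c => (f.um_tmul m c).trans (d.um_tmul m c).symm) k

theorem up_eq (k : S.El t.J.1) : ap f.up k = ap d.up k :=
  MatTensor.ext_bilinear t.exit.tensor.isTensor (f := (ap f.up : S.El t.J.1 →ₗ[ℂ] S.El f.D.1))
    (k := (ap d.up : S.El t.J.1 →ₗ[ℂ] S.El f.D.1)) (continuous_ap _) (continuous_ap _)
    (fun m c => by
      obtain ⟨j, hj⟩ := s.diff_mem c
      exact (f.up_tmul m c j hj).trans (by rw [← d.τs_eq c j hj]; exact (d.up_tmul m c).symm)) k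

omit [S.Good] in
theorem isCoeffAction : IsCoeffAction f.φ := ⟨f.φ_idem, f.φ_continuous⟩

theorem mulLeft_eq (k : S.El t.J.1) (v : S.El f.D.1) : f.mulLeft k v = d.E.mulLeft k v :=
  Ambient.tensor_ext₂ f.mulLeft_continuous f.mulLeft_continuous' d.E.mulLeft_continuous
    d.E.mulLeft_continuous' (fun m c m' y => by
      rw [f.mulLeft_tmul, f.isCoeffAction.unique d.E.isCoeffAction]
      exact (d.E.mulLeft_tmul m c m' y).symm) k v

theorem mulRight_eq (k : S.El t.J.1) (v : S.El f.D.1) : f.mulRight k v = d.E.mulRight k v :=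
  Ambient.tensor_ext₂ f.mulRight_continuous f.mulRight_continuous' d.E.mulRight_continuous
    d.E.mulRight_continuous' (fun m c m' y => by
      rw [f.mulRight_tmul, f.isCoeffAction.unique d.E.isCoeffAction]
      exact (d.E.mulRight_tmul m c m' y).symm) k v

/-- Both sides are limits of the same net, after the multiplications by `K` have been identified. -/
theorem TL_fst (a : S.El A.1) (v : S.El f.D.1 × S.El t.J.1) :
    (f.TL a v).1 = d.N.L (ap t.sm a) v.1 := by
  choose k hk using fun F => t.splitExact.mul_mem (ap t.sm a) (t.approxUnit F)
  refine tendsto_nhds_unique ((continuous_fst.tendsto _).comp (f.TL_tendsto a k hk v)) ?_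
  exact (d.N.tendsto_left _ k hk v.1).congr fun F => (f.mulLeft_eq d _ _).symm

theorem TR_fst (a : S.El A.1) (v : S.El f.D.1 × S.El t.J.1) :
    (f.TR a v).1 = d.N.R (ap t.sm a) v.1 := by
  choose k hk using fun F => t.splitExact.mul_mem' (ap t.sm a) (t.approxUnit F)
  refine tendsto_nhds_unique ((continuous_fst.tendsto _).comp (f.TR_tendsto a k hk v)) ?_
  exact (d.N.tendsto_right _ k hk v.1).congr fun F => (f.mulRight_eq d _ _).symm

/-- The homomorphism from the algebra of the product to the extension of `M_n(X)` by `A`. -/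
theorem exists_toExtension : ∃ Ψ : x.Xm.1 ⟶ d.W.Ω,
    (∀ j, ap Ψ (ap x.inc j) = ap d.W.i (ap d.inc j)) ∧
      ∀ a, ap Ψ (ap x.sm a) = ap d.θm (ap d.τt a) := by
  -- The element `x_-(a)` has first coordinate `u_-(k)` with `k = (t_+ - t_-)(a)`, so by `coord_mul`
  -- it multiplies `M_n(J)` as `u_-(k) + T(a)`, which is `θ_-(t_+(a))`.
  obtain ⟨Ψ, h1, h2⟩ := x.splitExact.exists_desc (d.inc ≫ d.W.i) (d.τt ≫ d.θm)
    (fun a v w hw => by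
      obtain ⟨k, hk, hk'⟩ := d.τt_eq' a
      have h1 := congrArg (fun z => (f.coord z).1.1) hw
      simp only [f.coord_mul, f.coord_inc, f.coord_minus a k hk, Prod.fst_add, Prod.fst_mul,
        f.TL_fst d, f.TR_fst d, map_zero, LinearMap.zero_apply, add_zero, f.incD_eq d,
        f.um_eq d] at h1
      rw [ap_comp, ap_comp, ap_comp, h1, hk', map_add, map_add, d.θm_inc, d.θm_sm, add_mul,
        d.W.r_mul, map_mul])
    (fun a v w hw => by
      obtain ⟨k, hk, hk'⟩ := d.τt_eq' a
      have h1 := congrArg (fun z => (f.coord z).1.1) hw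
      simp only [f.coord_mul, f.coord_inc, f.coord_minus a k hk, Prod.fst_add, Prod.fst_mul,
        f.TL_fst d, f.TR_fst d, map_zero, LinearMap.zero_apply, add_zero, f.incD_eq d,
        f.um_eq d] at h1
      rw [ap_comp, ap_comp, ap_comp, h1, hk', map_add, map_add, d.θm_inc, d.θm_sm, mul_add,
        d.W.mul_r, map_mul])
  exact ⟨Ψ, fun j => by rw [h1, ap_comp], fun a => by rw [h2, ap_comp]⟩

/-- The summand `T(a)` is common to `x_+(a)` and `x_-(a)`, so their difference is `u_+ - u_-`
evaluated at `(t_+ - t_-)(a)`. -/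
theorem inc_sub {a : S.El A.1} {k : S.El t.J.1} {j : S.El x.J.1} (hk : t.IsDiff a k)
    (hj : x.IsDiff a j) : ap d.inc j = ap d.up k - ap d.um k := by
  have h1 := f.coord_plus a k j hk hj
  rw [map_add, f.coord_minus a k hk, f.coord_inc] at h1
  have h2 := congrArg (fun z => z.1.1) h1
  simp only [Prod.fst_add, f.um_eq d, f.up_eq d, f.incD_eq d] at h2
  rw [← h2, add_sub_cancel_left]

-- Only the map to `Ω` and the values of `x_±` enter `gk_product`, so the argument does not depend
-- on how `x` was obtained.
include f in
theorem toGK_comp (hRP : S.SufficientlyBig R P) : t.toGK ≫ s.toGK = x.toGK := by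
  obtain ⟨d⟩ := ProductData.nonempty (t := t) (s := s) f.tensorD f.tensorJ
  obtain ⟨Ψ, hΨ, hΨ'⟩ := f.exists_toExtension d
  obtain ⟨τx, hx, hx'⟩ := x.exists_equivariant
  obtain ⟨EX, hEX⟩ := f.tensorD.exists_corner t.exit.base t.exit.act_base
  obtain ⟨EJ, hEJ⟩ := f.tensorJ.exists_corner t.exit.base t.exit.act_base
  let Ω : GK S R P := ⟨d.W.Ω, hRP.ext_mem _ _ _ d.W.splitExact f.D.2 A.2⟩
  have hΩ : S.SplitExact (J := x.J.1) (X := Ω.1) (d.inc ≫ d.W.i) d.π d.θm := d.splitExact_Ω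
  rw [d.t_toGK, d.s_toGK, hx']
  refine gk_product (𝔠 := ⟨S.coeff, h⟩) (D := f.D) (Ω := Ω) (iK := t.inc) (tm := t.sm) (EX := EX)
    (EJ := EJ) (iΩ := d.W.i) (up := d.up) (θp := d.θp) t.splitExact ?_ _ s.splitExact _ d.splitExact_D ?_ ?_ ?_
    ?_ _ ?_ hΩ ?_ ?_ ?_ ?_ x.splitExact Ψ ?_ ?_ ?_
  · exact hom_ext _ _ fun a => by rw [ap_comp, ap_id, d.proj_τt]
  · exact hom_ext _ _ fun a => by rw [ap_comp, ap_id, d.splitExact_D.split]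
  · exact hom_ext _ _ fun a => by rw [ap_comp, ap_comp, hEX, t.exit.hom_apply, d.um_tmul]
  · exact hom_ext _ _ fun a => by rw [ap_comp, ap_comp, hEX, t.exit.hom_apply, d.up_tmul]
  · exact hom_ext _ _ fun a => by rw [ap_comp, ap_comp, hEX, hEJ, d.inc_tmul]
  · exact hom_ext _ _ fun a => by rw [ap_comp, hEJ, f.exit_apply]
  · exact hom_ext _ _ fun a => by rw [ap_comp, ap_id]; exact hΩ.split a
  · exact hom_ext _ _ fun a => by rw [ap_comp, ap_comp, d.θm_inc]
  · exact hom_ext _ _ fun a => by rw [ap_comp, ap_comp, d.θp_inc]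
  · exact hom_ext _ _ fun a => by rw [ap_comp, ap_comp, d.θp_sm, d.θm_sm]
  · exact hom_ext _ _ fun a => by rw [ap_comp, ap_comp, hΨ]
  · exact hom_ext _ _ fun a => by rw [ap_comp, ap_comp, hΨ']
  -- The image of `x_+(a)` is `θ_-(t_+(a))` corrected by `u_+(k) - u_-(k)`, where `k = (t_+ -
  -- t_-)(a)`; this is `θ_+(t_+(a))`, since the sections agree on `t_-(a)`.
  · refine hom_ext _ _ fun a => ?_
    obtain ⟨k, hk, hk'⟩ := d.τt_eq' a
    obtain ⟨j, hj⟩ := x.diff_mem a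
    rw [ap_comp, ap_comp, hx a j hj, map_add, hΨ, hΨ', hk', map_add, map_add, d.θm_inc, d.θm_sm,
      d.θp_inc, d.θp_sm, f.inc_sub d hk hj, map_sub]
    abel

end ProductFormula

end ProductFormula

/-! ### Biadditivity and the theorem for good settings -/

/-- The product of two subsets of the groups of morphisms of a preadditive category, on the
subgroups generated by them. -/
theorem Preadditive.exists_closure_comp {C : Type*} [Category C] [Preadditive C] {X Y Z : C}
    {U : Set (X ⟶ Y)} {V : Set (Y ⟶ Z)} {W : Set (X ⟶ Z)}
    (h : ∀ z ∈ U, ∀ w ∈ V, z ≫ w ∈ W) :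
    ∃ μ : AddSubgroup.closure U ⊗[ℤ] AddSubgroup.closure V →ₗ[ℤ] AddSubgroup.closure W,
      ∀ z w, (μ (z ⊗ₜ[ℤ] w) : X ⟶ Z) = (z : X ⟶ Y) ≫ (w : Y ⟶ Z) := by
  have h1 : ∀ z ∈ AddSubgroup.closure U, ∀ w ∈ AddSubgroup.closure V,
      z ≫ w ∈ AddSubgroup.closure W := by
    intro z hz w hw
    induction hz using AddSubgroup.closure_induction with
    | mem z hz =>
      induction hw using AddSubgroup.closure_induction with
      | mem w hw => exact AddSubgroup.subset_closure (h z hz w hw)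
      | zero => rw [Limits.comp_zero]; exact zero_mem _
      | add w w' _ _ hw hw' => rw [Preadditive.comp_add]; exact add_mem hw hw'
      | neg w _ hw => rw [Preadditive.comp_neg]; exact neg_mem hw
    | zero => rw [Limits.zero_comp]; exact zero_mem _
    | add z z' _ _ hz hz' => rw [Preadditive.add_comp]; exact add_mem hz hz'
    | neg z _ hz => rw [Preadditive.neg_comp]; exact neg_mem hz
  let m : AddSubgroup.closure U →+ AddSubgroup.closure V →+ AddSubgroup.closure W :=
    AddMonoidHom.mk' (fun z => AddMonoidHom.mk' (fun w => ⟨z.1 ≫ w.1, h1 _ z.2 _ w.2⟩)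
      fun w w' => Subtype.ext (Preadditive.comp_add _ _ _ _ _ _))
      fun z z' => by ext w; exact Preadditive.add_comp _ _ _ _ _ _
  let l := TensorProduct.liftAddHom (R := ℤ) m fun r z w => by
    rw [map_zsmul, AddMonoidHom.zsmul_apply, map_zsmul]
  exact ⟨l.toIntLinearMap, fun z w => rfl⟩

section ProductTheorem

open Setting

variable {G : Type u} [InverseMonoid G] {S : Setting G} [S.Good] {R : S.C → Prop} {P : Type u → Prop}

/-- The product formula, for the settings with the properties collected in `Setting.Good`. -/
theorem Setting.Good.product (hRP : S.SufficientlyBig R P) (A B : GK S R P) :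
    let 𝔠 : GK S R P := ⟨S.coeff, hRP.coeff_mem⟩
    (∀ (t : LevelOneSeq A 𝔠) (s : LevelOneSeq 𝔠 B),
      (∃ x : LevelOneSeq A B, Nonempty (ProductFormula t s x)) ∧
      ∀ x : LevelOneSeq A B, Nonempty (ProductFormula t s x) → t.toGK ≫ s.toGK = x.toGK) ∧
    (∀ z ∈ L1 A 𝔠, ∀ w ∈ L1 𝔠 B, z ≫ w ∈ L1 A B) ∧
    ∃ μ : AddSubgroup.closure (L1 A 𝔠) ⊗[ℤ] AddSubgroup.closure (L1 𝔠 B) →ₗ[ℤ]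
        AddSubgroup.closure (L1 A B),
      ∀ z w, (μ (z ⊗ₜ[ℤ] w) : A ⟶ B) = (z : A ⟶ 𝔠) ≫ (w : 𝔠 ⟶ B) := by
  intro 𝔠
  have h1 : ∀ z ∈ L1 A 𝔠, ∀ w ∈ L1 𝔠 B, z ≫ w ∈ L1 A B := by
    rintro _ ⟨t, rfl⟩ _ ⟨s, rfl⟩
    obtain ⟨x, ⟨f⟩⟩ := exists_productFormula hRP t s
    exact ⟨x, (f.toGK_comp hRP).symm⟩
  exact ⟨fun t s => ⟨exists_productFormula hRP t s, fun x ⟨f⟩ => f.toGK_comp hRP⟩, h1,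
    Preadditive.exists_closure_comp h1⟩

end ProductTheorem

/-! ### Finite matrices and algebraic tensor products -/

section FinMat

variable {ι : Type u}

theorem finUnit_apply (i j : ι) (v : ι →₀ ℂ) :
    (finUnit i j : Module.End ℂ (FinVec ι)) v = (Finsupp.single i (v j) : ι →₀ ℂ) := rfl

theorem finUnit_mul_same (i j k : ι) : finUnit i j * finUnit j k = finUnit i k := by
  refine LinearMap.ext fun (v : ι →₀ ℂ) => ?_
  change finUnit i j (Finsupp.single j (v k) : ι →₀ ℂ) = _
  rw [finUnit_apply, Finsupp.single_eq_same]
  rfl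

theorem finUnit_mul_ne {j k : ι} (h : j ≠ k) (i l : ι) : finUnit i j * finUnit k l = 0 := by
  refine LinearMap.ext fun (v : ι →₀ ℂ) => ?_
  change finUnit i j (Finsupp.single k (v l) : ι →₀ ℂ) = _
  rw [finUnit_apply, Finsupp.single_eq_of_ne h, Finsupp.single_zero]
  rfl

/-- The matrix units as elements of `FinMat`. -/
noncomputable def FinMat.unit (p : ι × ι) : FinMat ι :=
  ⟨finUnit p.1 p.2, NonUnitalAlgebra.subset_adjoin ℂ ⟨p, rfl⟩⟩

/-- The entries of a matrix. -/
noncomputable def FinMat.entry (p : ι × ι) : FinMat ι →ₗ[ℂ] ℂ where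
  toFun m := (show ι →₀ ℂ from m.1 (Finsupp.single p.2 1 : ι →₀ ℂ)) p.1
  map_add' _ _ := rfl
  map_smul' _ _ := rfl

theorem FinMat.entry_unit (p q : ι × ι) : FinMat.entry p (FinMat.unit q) =
    (Finsupp.single q.1 ((Finsupp.single p.2 (1 : ℂ) : ι →₀ ℂ) q.2) : ι →₀ ℂ) p.1 := rfl

theorem FinMat.entry_unit_same (p : ι × ι) : FinMat.entry p (FinMat.unit p) = 1 := by
  rw [FinMat.entry_unit, Finsupp.single_eq_same, Finsupp.single_eq_same]

theorem FinMat.entry_unit_ne {p q : ι × ι} (h : p ≠ q) : FinMat.entry p (FinMat.unit q) = 0 := by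
  rw [FinMat.entry_unit]
  by_cases h1 : p.1 = q.1
  · have h2 : q.2 ≠ p.2 := fun h2 => h (Prod.ext h1 h2.symm)
    rw [Finsupp.single_eq_of_ne h2, Finsupp.single_zero]
    rfl
  · rw [Finsupp.single_eq_of_ne h1]

/-- Products of matrix units are matrix units or zero, so their span is already closed under
multiplication. -/
theorem FinMat.mem_span {x : Module.End ℂ (FinVec ι)} (hx : x ∈ FinMat ι) :
    x ∈ Submodule.span ℂ (Set.range fun p : ι × ι => finUnit p.1 p.2) := by
  induction hx using NonUnitalAlgebra.adjoin_induction with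
  | mem x hx => exact Submodule.subset_span hx
  | add x y hx hy h h' => exact add_mem h h'
  | zero => exact zero_mem _
  | smul r x hx h => exact Submodule.smul_mem _ r h
  | mul x y hx hy h h' =>
    have h1 := Submodule.mul_mem_mul h h'
    rw [Submodule.span_mul_span] at h1
    refine (Submodule.span_le (p := Submodule.span ℂ
      (Set.range fun p : ι × ι => finUnit p.1 p.2))).mpr ?_ h1
    rintro _ ⟨_, ⟨p, rfl⟩, _, ⟨q, rfl⟩, rfl⟩
    change finUnit p.1 p.2 * finUnit q.1 q.2 ∈ _
    by_cases hpq : p.2 = q.1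
    · rw [hpq, finUnit_mul_same]
      exact Submodule.subset_span ⟨(p.1, q.2), rfl⟩
    · rw [finUnit_mul_ne hpq]
      exact zero_mem _

theorem FinMat.span_unit : (⊤ : Submodule ℂ (FinMat ι)) ≤
    Submodule.span ℂ (Set.range FinMat.unit) := by
  rintro ⟨x, hx⟩ -
  have h1 := FinMat.mem_span hx
  have h2 : (Set.range fun p : ι × ι => finUnit p.1 p.2) =
      (FinMat ι).toSubmodule.subtype '' Set.range FinMat.unit := by
    rw [← Set.range_comp]
    rfl
  rw [h2, Submodule.span_image] at h1
  obtain ⟨y, hy, rfl⟩ := h1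
  exact hy

theorem FinMat.linearIndependent_unit : LinearIndependent ℂ (FinMat.unit (ι := ι)) := by
  rw [linearIndependent_iff]
  intro l hl
  ext p
  have h := congrArg (FinMat.entry p) hl
  rw [map_zero, Finsupp.linearCombination_apply, Finsupp.sum, map_sum] at h
  by_cases hp : p ∈ l.support
  · rw [Finset.sum_eq_single p] at h
    · rwa [map_smul, FinMat.entry_unit_same, smul_eq_mul, mul_one] at h
    · intro q _ hq
      rw [map_smul, FinMat.entry_unit_ne hq.symm, smul_zero]
    · exact fun h' => absurd hp h'
  · exact Finsupp.notMem_support_iff.mp hp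

/-- The basis of matrix units. -/
noncomputable def FinMat.basis (ι : Type u) : Module.Basis (ι × ι) ℂ (FinMat ι) :=
  Module.Basis.mk FinMat.linearIndependent_unit FinMat.span_unit

theorem FinMat.basis_apply (p : ι × ι) : FinMat.basis ι p = FinMat.unit p :=
  Module.Basis.mk_apply _ _ p

variable {A D B : Type*} [AddCommGroup A] [Module ℂ A] [AddCommGroup D] [Module ℂ D]
  [AddCommGroup B] [Module ℂ B] {τ : FinMat ι →ₗ[ℂ] A →ₗ[ℂ] D}

theorem FinMat.tensor_ext (h : Function.Surjective (TensorProduct.lift τ)) {f k : D →ₗ[ℂ] B}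
    (hfk : ∀ p a, f (τ (FinMat.unit p) a) = k (τ (FinMat.unit p) a)) : f = k := by
  have h1 : f.comp (TensorProduct.lift τ) = k.comp (TensorProduct.lift τ) := by
    refine TensorProduct.ext ((FinMat.basis ι).ext fun p => LinearMap.ext fun a => ?_)
    rw [FinMat.basis_apply]
    change f (TensorProduct.lift τ (_ ⊗ₜ a)) = k (TensorProduct.lift τ (_ ⊗ₜ a))
    rw [TensorProduct.lift.tmul, hfk]
  exact LinearMap.ext fun x => by
    obtain ⟨y, rfl⟩ := h x
    exact LinearMap.congr_fun h1 y

theorem FinMat.exists_linear (h : Function.Bijective (TensorProduct.lift τ))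
    (k : ι × ι → A →ₗ[ℂ] B) : ∃ F : D →ₗ[ℂ] B, ∀ p a, F (τ (FinMat.unit p) a) = k p a := by
  let e := LinearEquiv.ofBijective _ h
  refine ⟨(TensorProduct.lift ((FinMat.basis ι).constr ℂ k)).comp e.symm.toLinearMap,
    fun p a => ?_⟩
  have h1 : e.symm (τ (FinMat.unit p) a) = FinMat.unit p ⊗ₜ a := by
    rw [LinearEquiv.symm_apply_eq]
    exact (TensorProduct.lift.tmul _ _).symm
  change TensorProduct.lift _ (e.symm _) = _
  rw [h1, TensorProduct.lift.tmul, ← FinMat.basis_apply, Module.Basis.constr_basis]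

theorem FinMat.exists_entry (h : Function.Bijective (TensorProduct.lift τ)) (p : ι × ι) :
    ∃ ε : D →ₗ[ℂ] A, (∀ a, ε (τ (FinMat.unit p) a) = a) ∧
      ∀ q a, p ≠ q → ε (τ (FinMat.unit q) a) = 0 := by
  classical
  obtain ⟨F, hF⟩ := FinMat.exists_linear h fun q => if p = q then (LinearMap.id : A →ₗ[ℂ] A) else 0
  exact ⟨F, fun a => by rw [hF, if_pos rfl]; rfl, fun q a hq => by rw [hF, if_neg hq]; rfl⟩

/-- In the coordinates `M_ι ⊗ A ≅ (ι × ι →₀ A)` the maps `ε` read off every coefficient from the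
image. -/
theorem FinMat.injective_of_entry {ε : ι × ι → D →ₗ[ℂ] A} (h1 : ∀ p a, ε p (τ (FinMat.unit p) a) = a)
    (h2 : ∀ p q a, p ≠ q → ε p (τ (FinMat.unit q) a) = 0) :
    Function.Injective (TensorProduct.lift τ) := by
  classical
  let e := TensorProduct.equivFinsuppOfBasisLeft (N := A) (FinMat.basis ι)
  have h3 : ∀ p x, e x p = ε p (TensorProduct.lift τ x) := by
    intro p x
    have : (Finsupp.lapply p).comp e.toLinearMap = (ε p).comp (TensorProduct.lift τ) := by
      refine TensorProduct.ext ((FinMat.basis ι).ext fun q => LinearMap.ext fun a => ?_)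
      change e (FinMat.basis ι q ⊗ₜ a) p = ε p (TensorProduct.lift τ (FinMat.basis ι q ⊗ₜ a))
      rw [TensorProduct.equivFinsuppOfBasisLeft_apply_tmul_apply, TensorProduct.lift.tmul,
        Module.Basis.repr_self, FinMat.basis_apply]
      by_cases hpq : p = q
      · rw [hpq, h1, Finsupp.single_eq_same, one_smul]
      · rw [h2 _ _ _ hpq, Finsupp.single_eq_of_ne hpq, zero_smul]
    exact LinearMap.congr_fun this x
  rw [injective_iff_map_eq_zero]
  intro x hx
  refine (LinearEquiv.map_eq_zero_iff e).mp (Finsupp.ext fun p => ?_)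
  rw [h3, hx, map_zero]
  rfl

theorem tmul_eq_zero_or {M A : Type*} [AddCommGroup M] [Module ℂ M] [AddCommGroup A] [Module ℂ A]
    {m : M} {a : A} (h : m ⊗ₜ[ℂ] a = 0) : m = 0 ∨ a = 0 := by
  classical
  let b := Module.Basis.ofVectorSpace ℂ M
  by_cases ha : a = 0
  · exact Or.inr ha
  · refine Or.inl (b.ext_elem fun i => ?_)
    have h1 := congrArg (fun z => TensorProduct.equivFinsuppOfBasisLeft b z i) h
    simp only [TensorProduct.equivFinsuppOfBasisLeft_apply_tmul_apply, map_zero,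
      Finsupp.coe_zero, Pi.zero_apply, smul_eq_zero] at h1
    rw [h1.resolve_right ha, map_zero]
    rfl

end FinMat

/-! ### Semidirect products of algebras -/

section Semidirect

/-- The underlying space of the semidirect product of two algebras with respect to a biaction. -/
structure Semidirect {A D : Type*} [NonUnitalRing A] [Module ℂ A] [NonUnitalRing D] [Module ℂ D]
    (L R : A →ₗ[ℂ] D →ₗ[ℂ] D) where
  fst : D
  snd : A

namespace Semidirect

variable {A D : Type*} [NonUnitalRing A] [Module ℂ A] [NonUnitalRing D] [Module ℂ D]
    {L R : A →ₗ[ℂ] D →ₗ[ℂ] D}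

theorem ext' {x y : Semidirect L R} (h1 : x.fst = y.fst) (h2 : x.snd = y.snd) : x = y := by
  cases x; cases y; cases h1; cases h2; rfl

def equiv (L R : A →ₗ[ℂ] D →ₗ[ℂ] D) : Semidirect L R ≃ D × A where
  toFun x := (x.fst, x.snd)
  invFun x := ⟨x.1, x.2⟩
  left_inv _ := rfl
  right_inv _ := rfl

instance : AddCommGroup (Semidirect L R) := (equiv L R).addCommGroup

instance : Module ℂ (Semidirect L R) := (equiv L R).module ℂ

/-- A separate type is needed because `D × A` already carries the componentwise product. -/
instance : Mul (Semidirect L R) :=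
  ⟨fun x y => ⟨x.fst * y.fst + L x.snd y.fst + R y.snd x.fst, x.snd * y.snd⟩⟩

theorem fst_add (x y : Semidirect L R) : (x + y).fst = x.fst + y.fst := rfl
theorem snd_add (x y : Semidirect L R) : (x + y).snd = x.snd + y.snd := rfl
theorem fst_zero : (0 : Semidirect L R).fst = 0 := rfl
theorem snd_zero : (0 : Semidirect L R).snd = 0 := rfl
theorem fst_smul (c : ℂ) (x : Semidirect L R) : (c • x).fst = c • x.fst := rfl
theorem snd_smul (c : ℂ) (x : Semidirect L R) : (c • x).snd = c • x.snd := rfl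
theorem fst_mul (x y : Semidirect L R) :
    (x * y).fst = x.fst * y.fst + L x.snd y.fst + R y.snd x.fst := rfl
theorem snd_mul (x y : Semidirect L R) : (x * y).snd = x.snd * y.snd := rfl

/-- The semidirect product as a ring. -/
@[reducible]
def ring (h : IsBiaction L R) : NonUnitalRing (Semidirect L R) where
  __ := (inferInstance : AddCommGroup (Semidirect L R))
  __ := (inferInstance : Mul (Semidirect L R))
  left_distrib x y z := ext' (by
    simp only [fst_mul, fst_add, snd_add, mul_add, map_add, LinearMap.add_apply]; abel)
    (mul_add _ _ _)
  right_distrib x y z := ext' (by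
    simp only [fst_mul, fst_add, snd_add, add_mul, map_add, LinearMap.add_apply]; abel)
    (add_mul _ _ _)
  zero_mul x := ext' (by
    simp only [fst_mul, fst_zero, snd_zero, zero_mul, map_zero, LinearMap.zero_apply, add_zero])
    (zero_mul _)
  mul_zero x := ext' (by
    simp only [fst_mul, fst_zero, snd_zero, mul_zero, map_zero, LinearMap.zero_apply, add_zero])
    (mul_zero _)
  mul_assoc x y z := ext' (by
    simp only [fst_mul, snd_mul, add_mul, mul_add, map_add, h.left_mul, h.right_mul, h.left_assoc,
      h.right_assoc, h.middle, h.comm, mul_assoc]; abel) (mul_assoc _ _ _)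

end Semidirect

end Semidirect

/-! ### Constructions with `G`-algebras -/

section AlgebraicSetting

open Setting

variable {G : Type u} [InverseMonoid G]

theorem GAlg.exists_semidirect {D A : GAlg G} (L R : A.carrier →ₗ[ℂ] D.carrier →ₗ[ℂ] D.carrier)
    (h : IsBiaction L R) (hL : ∀ g a v, D.act g (L a v) = L (A.act g a) (D.act g v))
    (hR : ∀ g a v, D.act g (R a v) = R (A.act g a) (D.act g v))
    (hL' : ∀ (e : Idem G) a v, L (A.act e.1 a) v = L a (D.act e.1 v))
    (hR' : ∀ (e : Idem G) a v, R (A.act e.1 a) v = R a (D.act e.1 v)) :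
    ∃ (Q : GAlg G) (i : GAlg.Hom D Q) (p : GAlg.Hom Q A) (r : GAlg.Hom A Q),
      (Function.Injective i.toHom ∧ (∀ x, p.toHom x = 0 ↔ ∃ j, i.toHom j = x) ∧
        ∀ a, p.toHom (r.toHom a) = a) ∧
      (∀ a v, r.toHom a * i.toHom v = i.toHom (L a v)) ∧
        ∀ a v, i.toHom v * r.toHom a = i.toHom (R a v) := by
  let _ : NonUnitalRing (Semidirect L R) := Semidirect.ring h
  let Q : GAlg G :=
    { carrier := Semidirect L R
      ring := Semidirect.ring h
      tower := ⟨fun c x y => Semidirect.ext' (by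
        simp only [smul_eq_mul, Semidirect.fst_mul, Semidirect.fst_smul, Semidirect.snd_smul,
          map_smul, LinearMap.smul_apply, smul_add, smul_mul_assoc]) (smul_mul_assoc _ _ _)⟩
      smulComm := ⟨fun c x y => Semidirect.ext' (by
        simp only [smul_eq_mul, Semidirect.fst_mul, Semidirect.fst_smul, Semidirect.snd_smul,
          map_smul, LinearMap.smul_apply, smul_add, mul_smul_comm]) (mul_smul_comm _ _ _).symm⟩
      act := fun g =>
        { toFun := fun x => ⟨D.act g x.fst, A.act g x.snd⟩
          map_smul' := fun c x => Semidirect.ext' (map_smul _ _ _) (map_smul _ _ _)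
          map_zero' := Semidirect.ext' (map_zero _) (map_zero _)
          map_add' := fun x y => Semidirect.ext' (map_add _ _ _) (map_add _ _ _)
          map_mul' := fun x y => Semidirect.ext' (by
            simp only [Semidirect.fst_mul, map_add, map_mul, hL, hR]) (map_mul _ _ _) }
      act_one := fun x => Semidirect.ext' (D.act_one _) (A.act_one _)
      act_mul := fun g k x => Semidirect.ext' (D.act_mul _ _ _) (A.act_mul _ _ _)
      compat := fun e x y => Semidirect.ext' (by
        change D.act e.1 x.fst * y.fst + L (A.act e.1 x.snd) y.fst + R y.snd (D.act e.1 x.fst) =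
          x.fst * D.act e.1 y.fst + L x.snd (D.act e.1 y.fst) + R (A.act e.1 y.snd) x.fst
        rw [D.compat, hL', hR']) (A.compat _ _ _) }
  refine ⟨Q, ⟨{
      toFun := fun v => (⟨v, 0⟩ : Semidirect L R)
      map_smul' := fun c x => Semidirect.ext' rfl (smul_zero _).symm
      map_zero' := rfl
      map_add' := fun x y => Semidirect.ext' rfl (add_zero _).symm
      map_mul' := fun x y => Semidirect.ext' (by
        change x * y = x * y + L 0 y + R 0 x
        simp only [map_zero, LinearMap.zero_apply, add_zero]) (mul_zero _).symm }, fun g v => Semidirect.ext' rfl (map_zero _).symm⟩, ⟨{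
      toFun := fun x : Semidirect L R => x.snd
      map_smul' := fun c x => rfl
      map_zero' := rfl
      map_add' := fun x y => rfl
      map_mul' := fun x y => rfl }, fun g v => rfl⟩, ⟨{
      toFun := fun a => (⟨0, a⟩ : Semidirect L R)
      map_smul' := fun c x => Semidirect.ext' (smul_zero _).symm rfl
      map_zero' := rfl
      map_add' := fun x y => Semidirect.ext' (add_zero _).symm rfl
      map_mul' := fun x y => Semidirect.ext' (by
        change 0 = 0 * 0 + L x 0 + R y 0
        simp only [map_zero, mul_zero, add_zero]) rfl }, fun g v => Semidirect.ext' (map_zero _).symm rfl⟩, ⟨?_, ?_, fun a => rfl⟩, ?_, ?_⟩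
  · intro x y hxy
    exact congrArg Semidirect.fst hxy
  · intro x
    constructor
    · intro hx
      exact ⟨Semidirect.fst x, Semidirect.ext' rfl hx.symm⟩
    · rintro ⟨j, rfl⟩
      rfl
  · intro a v
    refine Semidirect.ext' ?_ (mul_zero _)
    change 0 * v + L a v + R 0 0 = L a v
    rw [zero_mul, zero_add, map_zero, add_zero]
  · intro a v
    refine Semidirect.ext' ?_ (zero_mul _)
    change v * 0 + L 0 0 + R a v = R a v
    rw [mul_zero, zero_add, map_zero, zero_add]

theorem GAlg.exists_pullback {X A B : GAlg G} (f : GAlg.Hom X B) (k : GAlg.Hom A B) :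
    ∃ (Q : GAlg G) (p : GAlg.Hom Q X) (q : GAlg.Hom Q A),
      (∀ z, f.toHom (p.toHom z) = k.toHom (q.toHom z)) ∧
      (∀ z w, p.toHom z = p.toHom w → q.toHom z = q.toHom w → z = w) ∧
      ∀ x a, f.toHom x = k.toHom a → ∃ z, p.toHom z = x ∧ q.toHom z = a := by
  let C : NonUnitalSubalgebra ℂ (X.carrier × A.carrier) :=
    { carrier := {z | f.toHom z.1 = k.toHom z.2}
      add_mem' := fun {a b} ha hb => by
        change f.toHom (a.1 + b.1) = k.toHom (a.2 + b.2)
        rw [map_add, map_add, ha.out, hb.out]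
      zero_mem' := by
        change f.toHom 0 = k.toHom 0
        rw [map_zero, map_zero]
      smul_mem' := fun c a ha => by
        change f.toHom (c • a.1) = k.toHom (c • a.2)
        rw [map_smul, map_smul, ha.out]
      mul_mem' := fun {a b} ha hb => by
        change f.toHom (a.1 * b.1) = k.toHom (a.2 * b.2)
        rw [map_mul, map_mul, ha.out, hb.out] }
  let Q : GAlg G :=
    { carrier := C
      act := fun g =>
        { toFun := fun z => ⟨(X.act g z.1.1, A.act g z.1.2), by
            change f.toHom (X.act g z.1.1) = k.toHom (A.act g z.1.2)
            rw [f.map_act, k.map_act, z.2.out]⟩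
          map_smul' := fun c x => Subtype.ext (Prod.ext (map_smul _ _ _) (map_smul _ _ _))
          map_zero' := Subtype.ext (Prod.ext (map_zero _) (map_zero _))
          map_add' := fun x y => Subtype.ext (Prod.ext (map_add _ _ _) (map_add _ _ _))
          map_mul' := fun x y => Subtype.ext (Prod.ext (map_mul _ _ _) (map_mul _ _ _)) }
      act_one := fun x => Subtype.ext (Prod.ext (X.act_one _) (A.act_one _))
      act_mul := fun g k x => Subtype.ext (Prod.ext (X.act_mul _ _ _) (A.act_mul _ _ _))
      compat := fun e x y => Subtype.ext (Prod.ext (X.compat _ _ _) (A.compat _ _ _)) }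
  exact ⟨Q, ⟨(NonUnitalAlgHom.fst ℂ _ _).comp (NonUnitalSubalgebraClass.subtype C), fun _ _ => rfl⟩,
    ⟨(NonUnitalAlgHom.snd ℂ _ _).comp (NonUnitalSubalgebraClass.subtype C), fun _ _ => rfl⟩,
    fun z => z.2, fun z w h1 h2 => Subtype.ext (Prod.ext h1 h2), fun x a h => ⟨⟨(x, a), h⟩, rfl, rfl⟩⟩

theorem GAlg.exists_coeff_action (X : GAlg G) :
    ∃ φ : (algCoeff G).carrier →ₗ[ℂ] X.carrier →ₗ[ℂ] X.carrier,
      ∀ (e : Idem G) y, φ (MonoidAlgebra.single e 1 : MonoidAlgebra ℂ (Idem G)) y = X.act e.1 y :=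
  ⟨((Finsupp.lsum ℂ fun e : Idem G => (LinearMap.toSpanSingleton ℂ (X.carrier →ₗ[ℂ] X.carrier)
      (X.act e.1 : X.carrier →ₗ[ℂ] X.carrier))) : (Idem G →₀ ℂ) →ₗ[ℂ] X.carrier →ₗ[ℂ] X.carrier) ∘ₗ
      (MonoidAlgebra.coeffLinearEquiv ℂ).toLinearMap,
    fun e y => by
      change (Finsupp.lsum ℂ fun e : Idem G => (LinearMap.toSpanSingleton ℂ
        (X.carrier →ₗ[ℂ] X.carrier) (X.act e.1 : X.carrier →ₗ[ℂ] X.carrier)))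
          (Finsupp.single e 1) y = _
      rw [Finsupp.lsum_single, LinearMap.toSpanSingleton_apply, one_smul]
      rfl⟩

/-- The tensor product of a matrix algebra with an algebra. -/
noncomputable def GAlg.tensor {ι : Type u} (s : G → FinMat ι →ₙₐ[ℂ] FinMat ι)
    (s_one : ∀ m, s 1 m = m) (s_mul : ∀ g h m, s (g * h) m = s g (s h m))
    (compat : ∀ (e : Idem G) m n, s e.1 m * n = m * s e.1 n) (A : GAlg G) : GAlg G where
  carrier := FinMat ι ⊗[ℂ] A.carrier
  act g :=
    { TensorProduct.map (s g : FinMat ι →ₗ[ℂ] FinMat ι) (A.act g : A.carrier →ₗ[ℂ] A.carrier) with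
      map_zero' := map_zero _
      map_mul' := fun x y => by
        change TensorProduct.map (s g : FinMat ι →ₗ[ℂ] FinMat ι)
          (A.act g : A.carrier →ₗ[ℂ] A.carrier) _ = TensorProduct.map _ _ _ * TensorProduct.map _ _ _
        induction x with
        | zero => rw [zero_mul, map_zero, zero_mul]
        | add x x' hx hx' => rw [add_mul, map_add, hx, hx', map_add, add_mul]
        | tmul m a =>
          induction y with
          | zero => rw [mul_zero, map_zero, mul_zero]
          | add x x' hx hx' => rw [mul_add, map_add, hx, hx', map_add, mul_add]
          | tmul n b =>
            rw [Algebra.TensorProduct.tmul_mul_tmul, TensorProduct.map_tmul, TensorProduct.map_tmul,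
              TensorProduct.map_tmul, Algebra.TensorProduct.tmul_mul_tmul]
            exact congrArg₂ _ (map_mul (s g) m n) (map_mul (A.act g) a b) }
  act_one x := by
    change TensorProduct.map (s 1 : FinMat ι →ₗ[ℂ] FinMat ι)
      (A.act 1 : A.carrier →ₗ[ℂ] A.carrier) x = x
    induction x with
    | zero => rw [map_zero]
    | add x x' hx hx' => rw [map_add, hx, hx']
    | tmul m a =>
      rw [TensorProduct.map_tmul]
      exact congrArg₂ (· ⊗ₜ ·) (s_one m) (A.act_one a)
  act_mul g h x := by
    change TensorProduct.map (s (g * h) : FinMat ι →ₗ[ℂ] FinMat ι)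
      (A.act (g * h) : A.carrier →ₗ[ℂ] A.carrier) x = TensorProduct.map _ _ (TensorProduct.map _ _ x)
    induction x with
    | zero => rw [map_zero, map_zero, map_zero]
    | add x x' hx hx' => rw [map_add, hx, hx', map_add, map_add]
    | tmul m a =>
      rw [TensorProduct.map_tmul, TensorProduct.map_tmul, TensorProduct.map_tmul]
      exact congrArg₂ (· ⊗ₜ ·) (s_mul g h m) (A.act_mul g h a)
  compat e x y := by
    change TensorProduct.map (s e.1 : FinMat ι →ₗ[ℂ] FinMat ι)
      (A.act e.1 : A.carrier →ₗ[ℂ] A.carrier) x * y = x * TensorProduct.map _ _ y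
    induction x with
    | zero => rw [zero_mul, map_zero, zero_mul]
    | add x x' hx hx' => rw [add_mul, map_add, add_mul, hx, hx']
    | tmul m a =>
      induction y with
      | zero => rw [mul_zero, map_zero, mul_zero]
      | add x x' hx hx' => rw [mul_add, map_add, hx, hx', mul_add]
      | tmul n b =>
        rw [TensorProduct.map_tmul, TensorProduct.map_tmul, Algebra.TensorProduct.tmul_mul_tmul,
          Algebra.TensorProduct.tmul_mul_tmul]
        exact congrArg₂ _ (compat e m n) (A.compat e a b)

end AlgebraicSetting

/-! ### Rotation homotopies and lifting for algebras -/

section AlgebraicGood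

open Setting

variable {G : Type u} [InverseMonoid G]

/-- The coordinate function of the interval. -/
noncomputable def pathAlgebra.coord (p : PathKind) : pathAlgebra p :=
  ⟨fun t => ((t : ℝ) : ℂ), by
    cases p with
    | continuous =>
      change Continuous fun t : unitInterval => ((t : ℝ) : ℂ)
      fun_prop
    | smooth => exact ⟨fun t => (t : ℂ), Complex.ofRealCLM.contDiff, fun _ => rfl⟩
    | polynomial => exact Algebra.subset_adjoin rfl⟩

theorem evalPath_tmul (p : PathKind) {B : Type u} [AddCommGroup B] [Module ℂ B] (t : unitInterval)
    (b : B) (f : pathAlgebra p) : evalPath p B t (b ⊗ₜ f) = f.1 t • b := by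
  change TensorProduct.rid ℂ B (b ⊗ₜ (f.1 t)) = _
  rw [TensorProduct.rid_tmul]

/-- The rotation homotopy, along a path of rank one idempotents `v wᵀ`. -/
theorem GAlg.exists_rotation (p : PathKind) {A M : GAlg G}
    {u : Bool → Bool → A.carrier →ₗ[ℂ] M.carrier}
    (hu : ∀ i j k a b, u i j a * u j k b = u i k (a * b))
    (hu' : ∀ i j k l a b, j ≠ k → u i j a * u k l b = 0)
    (ha : ∀ i j g a, M.act g (u i j a) = u i j (A.act g a)) :
    ∃ H : A.carrier →ₙₐ[ℂ] M.carrier ⊗[ℂ] pathAlgebra p,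
    (∀ g a, H (A.act g a) =
      LinearMap.rTensor (pathAlgebra p) (M.act g : M.carrier →ₗ[ℂ] M.carrier) (H a)) ∧
    ∀ a, evalPath p M.carrier 0 (H a) = u false false a ∧
      evalPath p M.carrier 1 (H a) = u true true a := by
  let c := pathAlgebra.coord p
  -- Trigonometric functions are not polynomial; instead the rank one idempotent `v wᵀ` is built
  -- from `(1-c)²(1+2c) + c²(3-2c) = 1`, which serves all three kinds of paths. It is `e_{00}` at `c
  -- = 0` and `e_{11}` at `c = 1`.
  let v : Bool → pathAlgebra p := fun b => cond b c (1 - c)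
  let w : Bool → pathAlgebra p := fun b => cond b (c * (3 - 2 * c)) ((1 - c) * (1 + 2 * c))
  have hvw : ∑ i, w i * v i = 1 := by
    rw [Fintype.sum_bool]
    change c * (3 - 2 * c) * c + (1 - c) * (1 + 2 * c) * (1 - c) = 1
    ring
  let H₀ : A.carrier →ₗ[ℂ] M.carrier ⊗[ℂ] pathAlgebra p :=
    ∑ i, ∑ j, ((TensorProduct.mk ℂ M.carrier (pathAlgebra p)).flip (v i * w j)).comp (u i j)
  have hH : ∀ a, H₀ a = ∑ i, ∑ j, u i j a ⊗ₜ (v i * w j) := fun a => by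
    simp only [H₀, LinearMap.sum_apply]
    rfl
  refine ⟨{ H₀ with
    map_zero' := map_zero H₀
    map_mul' := fun a b => ?_ }, fun g a => ?_, fun a => ?_⟩
  · change H₀ (a * b) = H₀ a * H₀ b
    have h1 : ∀ i j k l, (u i j a ⊗ₜ[ℂ] (v i * w j)) * (u k l b ⊗ₜ[ℂ] (v k * w l)) =
        if j = k then u i l (a * b) ⊗ₜ[ℂ] (w j * v j * (v i * w l)) else 0 := by
      intro i j k l
      rw [Algebra.TensorProduct.tmul_mul_tmul]
      split_ifs with hjk
      · rw [← hjk, hu]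
        congr 1
        ring
      · rw [hu' _ _ _ _ _ _ hjk, TensorProduct.zero_tmul]
    rw [hH, hH, hH, Finset.sum_mul_sum]
    simp only [Finset.sum_mul_sum, h1]
    refine Finset.sum_congr rfl fun i _ => ?_
    rw [Finset.sum_comm]
    have h2 : ∀ j, ∑ k, ∑ l, (if j = k then u i l (a * b) ⊗ₜ[ℂ] (w j * v j * (v i * w l)) else 0) =
        ∑ l, u i l (a * b) ⊗ₜ[ℂ] (w j * v j * (v i * w l)) := by
      intro j
      rw [Finset.sum_eq_single j]
      · simp only [if_true]
      · intro k _ hk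
        simp only [if_neg hk.symm, Finset.sum_const_zero]
      · exact fun h => absurd (Finset.mem_univ _) h
    simp only [h2]
    rw [Finset.sum_comm]
    refine Finset.sum_congr rfl fun l _ => ?_
    -- The sum over the middle index is the scalar product of `w` and `v`, which is `1`.
    rw [← TensorProduct.tmul_sum, ← Finset.sum_mul, hvw, one_mul]
  · change H₀ _ = LinearMap.rTensor _ _ (H₀ a)
    rw [hH, hH, map_sum]
    refine Finset.sum_congr rfl fun i _ => ?_
    rw [map_sum]
    refine Finset.sum_congr rfl fun j _ => ?_
    rw [← ha]
    rfl
  · change evalPath p M.carrier 0 (H₀ a) = _ ∧ evalPath p M.carrier 1 (H₀ a) = _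
    have he : ∀ t, evalPath p M.carrier t (H₀ a) =
        ∑ i, ∑ j, ((v i).1 t * (w j).1 t) • u i j a := fun t => by
      rw [hH, map_sum]
      refine Finset.sum_congr rfl fun i _ => ?_
      rw [map_sum]
      exact Finset.sum_congr rfl fun j _ => evalPath_tmul p t _ _
    have hv : ∀ t, (v true).1 t = ((t : ℝ) : ℂ) ∧ (v false).1 t = 1 - ((t : ℝ) : ℂ) :=
      fun t => ⟨rfl, rfl⟩
    have hw : ∀ t, (w true).1 t = ((t : ℝ) : ℂ) * (3 - 2 * ((t : ℝ) : ℂ)) ∧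
        (w false).1 t = (1 - ((t : ℝ) : ℂ)) * (1 + 2 * ((t : ℝ) : ℂ)) := fun t => ⟨rfl, rfl⟩
    constructor
    · rw [he, Fintype.sum_bool, Fintype.sum_bool, Fintype.sum_bool, (hv 0).1, (hv 0).2, (hw 0).1,
        (hw 0).2]
      simp
    · rw [he, Fintype.sum_bool, Fintype.sum_bool, Fintype.sum_bool, (hv 1).1, (hv 1).2, (hw 1).1,
        (hw 1).2]
      norm_num

instance algSetting.discreteTopology (p : PathKind) (A : (algSetting G p).C) :
    DiscreteTopology ((algSetting G p).El A) := ⟨rfl⟩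

theorem algSetting.span_eq_top (p : PathKind) {A : (algSetting G p).C}
    {s : Set ((algSetting G p).El A)}
    (h : Dense (Submodule.span ℂ s : Set ((algSetting G p).El A))) : Submodule.span ℂ s = ⊤ := by
  rw [dense_discrete] at h
  exact SetLike.coe_injective h

theorem algSetting.exists_lift {ι : Type u} {A D B : GAlg G}
    {τ : FinMat ι →ₗ[ℂ] A.carrier →ₗ[ℂ] D.carrier}
    (hτ : ∀ m m' a a', τ m a * τ m' a' = τ (m * m') (a * a'))
    (hτ' : Function.Bijective (TensorProduct.lift τ)) (h : ι × ι → A.carrier →ₗ[ℂ] B.carrier)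
    (h1 : ∀ i j k a b, h (i, j) a * h (j, k) b = h (i, k) (a * b))
    (h2 : ∀ i j k l a b, j ≠ k → h (i, j) a * h (k, l) b = 0) :
    ∃ F : D.carrier →ₙₐ[ℂ] B.carrier, ∀ p a, F (τ (FinMat.unit p) a) = h p a := by
  obtain ⟨F, hF⟩ := FinMat.exists_linear hτ' h
  have hm : (LinearMap.mul ℂ D.carrier).compr₂ F = (LinearMap.mul ℂ B.carrier).compl₁₂ F F := by
    refine FinMat.tensor_ext hτ'.2 fun p a => FinMat.tensor_ext hτ'.2 fun q b => ?_
    change F (τ _ a * τ _ b) = F (τ _ a) * F (τ _ b)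
    rw [hF, hF, hτ]
    by_cases hpq : p.2 = q.1
    · have e : FinMat.unit p * FinMat.unit q = FinMat.unit (p.1, q.2) := Subtype.ext (by
        change finUnit _ _ * finUnit _ _ = finUnit _ _
        rw [hpq, finUnit_mul_same])
      obtain ⟨i, j⟩ := p
      obtain ⟨j', k⟩ := q
      obtain rfl : j = j' := hpq
      rw [e, hF, h1]
    · have e : FinMat.unit p * FinMat.unit q = 0 := Subtype.ext (finUnit_mul_ne hpq _ _)
      rw [e, map_zero, LinearMap.zero_apply, map_zero]
      exact (h2 p.1 p.2 q.1 q.2 a b hpq).symm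
  exact ⟨{ F with
    map_zero' := map_zero F
    map_mul' := fun x y => LinearMap.congr_fun₂ hm x y }, hF⟩

end AlgebraicGood

/-! ### Algebras form a good setting -/

section AlgebraicInstance

open Setting

theorem FinMat.unit_mul_same {ι : Type u} (i j k : ι) :
    FinMat.unit (i, j) * FinMat.unit (j, k) = FinMat.unit (i, k) :=
  Subtype.ext (finUnit_mul_same i j k)

theorem FinMat.unit_mul_ne {ι : Type u} {j k : ι} (h : j ≠ k) (i l : ι) :
    FinMat.unit (i, j) * FinMat.unit (k, l) = 0 := Subtype.ext (finUnit_mul_ne h i l)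

theorem FinMat.unit_ne_zero {ι : Type u} (p : ι × ι) : FinMat.unit p ≠ 0 := fun h =>
  one_ne_zero (α := ℂ) (by rw [← FinMat.entry_unit_same p, h, map_zero])

theorem FinMat.unit_mul_mul_unit {ι : Type u} (i j : ι) (m : FinMat ι) :
    FinMat.unit (i, i) * m * FinMat.unit (j, j) = FinMat.entry (i, j) m • FinMat.unit (i, j) := by
  refine Subtype.ext (LinearMap.ext fun (v : ι →₀ ℂ) => ?_)
  have h1 : (Finsupp.single j (v j) : ι →₀ ℂ) = v j • (Finsupp.single j 1 : ι →₀ ℂ) := by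
    rw [Finsupp.smul_single, smul_eq_mul, mul_one]
  have h2 : m.1 (Finsupp.single j (v j) : ι →₀ ℂ) = v j • m.1 (Finsupp.single j 1 : ι →₀ ℂ) := by
    rw [h1]
    exact map_smul m.1 (v j) (Finsupp.single j 1 : ι →₀ ℂ)
  change finUnit i i (m.1 (Finsupp.single j (v j) : ι →₀ ℂ)) = FinMat.entry (i, j) m • finUnit i j v
  rw [h2, map_smul]
  change v j • (Finsupp.single i (FinMat.entry (i, j) m) : ι →₀ ℂ) =
    FinMat.entry (i, j) m • (Finsupp.single i (v j) : ι →₀ ℂ)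
  rw [Finsupp.smul_single, Finsupp.smul_single, smul_eq_mul, smul_eq_mul, mul_comm]

theorem FinMat.eq_zero_of_forall {ι : Type u} {m : FinMat ι}
    (h : ∀ i j, FinMat.unit (i, i) * m * FinMat.unit (j, j) = 0) : m = 0 := by
  have h1 : ∀ i j, FinMat.entry (i, j) m = 0 := fun i j => by
    have := h i j
    rw [FinMat.unit_mul_mul_unit, smul_eq_zero] at this
    exact this.resolve_right (FinMat.unit_ne_zero _)
  refine Subtype.ext (Finsupp.lhom_ext' (M := ℂ) (R := ℂ) fun j =>
    LinearMap.ext_ring (Finsupp.ext fun i => h1 i j))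

theorem FinMat.span_eq_top {ι : Type u} :
    Submodule.span ℂ {y : FinMat ι | ∃ i j, FinMat.unit (i, j) = y} = ⊤ := by
  have h1 : {y : FinMat ι | ∃ i j, FinMat.unit (i, j) = y} = Set.range FinMat.unit :=
    Set.ext fun y => ⟨fun ⟨i, j, h⟩ => ⟨(i, j), h⟩, fun ⟨q, h⟩ => ⟨q.1, q.2, h⟩⟩
  rw [h1]
  exact top_le_iff.mp FinMat.span_unit

theorem FinMat.exists_lift {ι : Type u} {B : Type*} [NonUnitalRing B] [Module ℂ B]
    [IsScalarTower ℂ B B] [SMulCommClass ℂ B B] (h : ι → ι → B)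
    (h1 : ∀ i j k, h i j * h j k = h i k) (h2 : ∀ i j k l, j ≠ k → h i j * h k l = 0) :
    ∃ F : FinMat ι →ₙₐ[ℂ] B, ∀ i j, F (FinMat.unit (i, j)) = h i j := by
  let F := (FinMat.basis ι).constr ℂ fun p => h p.1 p.2
  have hF : ∀ p, F (FinMat.unit p) = h p.1 p.2 := fun p => by
    rw [← FinMat.basis_apply, Module.Basis.constr_basis]
  have hm : (LinearMap.mul ℂ (FinMat ι)).compr₂ F = (LinearMap.mul ℂ B).compl₁₂ F F := by
    refine (FinMat.basis ι).ext fun p => (FinMat.basis ι).ext fun q => ?_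
    rw [FinMat.basis_apply, FinMat.basis_apply]
    change F (_ * _) = F _ * F _
    obtain ⟨i, j⟩ := p
    obtain ⟨k, l⟩ := q
    rw [hF, hF]
    by_cases hjk : j = k
    · rw [hjk, FinMat.unit_mul_same, hF]
      exact (h1 _ _ _).symm
    · rw [FinMat.unit_mul_ne hjk, map_zero]
      exact (h2 _ _ _ _ hjk).symm
  exact ⟨{ F with
    map_zero' := map_zero F
    map_mul' := fun x y => LinearMap.congr_fun₂ hm x y }, fun i j => hF (i, j)⟩

section Tensor

variable {M A D : Type*} [AddCommGroup M] [Module ℂ M] [AddCommGroup A] [Module ℂ A]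
  [AddCommGroup D] [Module ℂ D] {τ : M →ₗ[ℂ] A →ₗ[ℂ] D}

theorem surjective_lift_iff : Function.Surjective (TensorProduct.lift τ) ↔
    Submodule.span ℂ {y | ∃ m a, τ m a = y} = ⊤ := by
  constructor
  · intro h
    rw [eq_top_iff]
    intro x _
    obtain ⟨y, rfl⟩ := h x
    induction y with
    | zero => rw [map_zero]; exact zero_mem _
    | add y y' hy hy' => rw [map_add]; exact add_mem (hy trivial) (hy' trivial)
    | tmul m a => exact Submodule.subset_span ⟨m, a, rfl⟩
  · intro h x
    have hx : x ∈ Submodule.span ℂ {y | ∃ m a, τ m a = y} := by rw [h]; trivial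
    exact (Submodule.span_le (p := LinearMap.range (TensorProduct.lift τ))).mpr
      (by rintro _ ⟨m, a, rfl⟩; exact ⟨m ⊗ₜ a, TensorProduct.lift.tmul _ _⟩) hx

theorem eq_zero_of_injective_lift (h : Function.Injective (TensorProduct.lift τ)) {m : M} {a : A}
    (hma : τ m a = 0) : m = 0 ∨ a = 0 :=
  tmul_eq_zero_or (h (by rw [map_zero, TensorProduct.lift.tmul, hma]))

/-- `F` corresponds to `id ⊗ f`, which is injective because `M` is flat over the field `ℂ`. -/
theorem injective_of_bijective_lift {A' D' : Type*} [AddCommGroup A'] [Module ℂ A']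
    [AddCommGroup D'] [Module ℂ D'] {τ' : M →ₗ[ℂ] A' →ₗ[ℂ] D'}
    (h : Function.Bijective (TensorProduct.lift τ)) (h' : Function.Bijective (TensorProduct.lift τ'))
    (f : A →ₗ[ℂ] A') (hf : Function.Injective f) (F : D →ₗ[ℂ] D')
    (hF : ∀ m a, F (τ m a) = τ' m (f a)) : Function.Injective F := by
  have h1 : F.comp (TensorProduct.lift τ) = (TensorProduct.lift τ').comp (LinearMap.lTensor M f) := by
    refine TensorProduct.ext' fun m a => ?_
    rw [LinearMap.comp_apply, LinearMap.comp_apply, LinearMap.lTensor_tmul, TensorProduct.lift.tmul,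
      TensorProduct.lift.tmul, hF]
  rw [injective_iff_map_eq_zero]
  intro x hx
  obtain ⟨y, rfl⟩ := h.2 x
  have h2 : TensorProduct.lift τ' (LinearMap.lTensor M f y) = 0 :=
    (LinearMap.congr_fun h1 y).symm.trans hx
  have h3 := h'.1 (h2.trans (map_zero _).symm)
  have h4 := Module.Flat.lTensor_preserves_injective_linearMap (M := M) f hf
    (h3.trans (map_zero _).symm)
  rw [h4, map_zero]

end Tensor

variable {G : Type u} [InverseMonoid G]

theorem algCoeff.span_eq_top : Submodule.span ℂ
    {y | ∃ e : Idem G, (MonoidAlgebra.single e 1 : MonoidAlgebra ℂ (Idem G)) = y} = ⊤ := by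
  rw [eq_top_iff]
  intro x _
  induction x using MonoidAlgebra.induction_linear with
  | zero => exact zero_mem _
  | add f k hf hk => exact add_mem (hf trivial) (hk trivial)
  | single e r =>
    have : (MonoidAlgebra.single e r : MonoidAlgebra ℂ (Idem G)) =
        r • MonoidAlgebra.single e 1 := by rw [MonoidAlgebra.smul_single, smul_eq_mul, mul_one]
    rw [this]
    exact Submodule.smul_mem _ _ (Submodule.subset_span ⟨e, rfl⟩)

/-- The distinct indices `i`, `j` cut out a system of `2 × 2` matrix units, on which the rotation
lives. -/
theorem GAlg.exists_rotation_tensor (p : PathKind) {ι : Type u} {A X M : GAlg G}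
    {τ : FinMat ι →ₗ[ℂ] X.carrier →ₗ[ℂ] M.carrier}
    (hτ : ∀ m m' a a', τ m a * τ m' a' = τ (m * m') (a * a')) (f : GAlg.Hom A X) {i j : ι}
    (hij : i ≠ j)
    (ha : ∀ g a p q, M.act g (τ (FinMat.unit (p, q)) (f.toHom a)) =
      τ (FinMat.unit (p, q)) (f.toHom (A.act g a))) :
    ∃ H : A.carrier →ₙₐ[ℂ] M.carrier ⊗[ℂ] pathAlgebra p,
    (∀ g a, H (A.act g a) =
      LinearMap.rTensor (pathAlgebra p) (M.act g : M.carrier →ₗ[ℂ] M.carrier) (H a)) ∧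
    ∀ a, evalPath p M.carrier 0 (H a) = τ (FinMat.unit (i, i)) (f.toHom a) ∧
      evalPath p M.carrier 1 (H a) = τ (FinMat.unit (j, j)) (f.toHom a) := by
  refine GAlg.exists_rotation p
    (u := fun b c => (τ (FinMat.unit (cond b j i, cond c j i))).comp
      (f.toHom : A.carrier →ₗ[ℂ] X.carrier)) (fun b c d x y => ?_) (fun b c d e x y hcd => ?_)
    (fun b c g a => ha g a _ _)
  · change τ _ (f.toHom x) * τ _ (f.toHom y) = τ _ (f.toHom (x * y))
    rw [hτ, map_mul f.toHom, FinMat.unit_mul_same]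
  · change τ _ (f.toHom x) * τ _ (f.toHom y) = 0
    rw [hτ, FinMat.unit_mul_ne, map_zero, LinearMap.zero_apply]
    cases c <;> cases d <;> simp_all [hij.symm]

theorem GAlg.hom_ext {A B : GAlg G} {f k : A ⟶ B} (h : ∀ a, f.toHom a = k.toHom a) : f = k :=
  GAlg.Hom.ext (NonUnitalAlgHom.ext h)

theorem GAlg.injective_of_bijective_lift {ι : Type u} {A D A' D' : GAlg G}
    {τ : FinMat ι →ₗ[ℂ] A.carrier →ₗ[ℂ] D.carrier}
    {τ' : FinMat ι →ₗ[ℂ] A'.carrier →ₗ[ℂ] D'.carrier}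
    (h : Function.Bijective (TensorProduct.lift τ)) (h' : Function.Bijective (TensorProduct.lift τ'))
    (f : A.carrier →ₙₐ[ℂ] A'.carrier) (hf : Function.Injective f) (F : D.carrier →ₙₐ[ℂ] D'.carrier)
    (hF : ∀ m a, F (τ m a) = τ' m (f a)) : Function.Injective F :=
  _root_.injective_of_bijective_lift h h' (f : A.carrier →ₗ[ℂ] A'.carrier) hf
    (F : D.carrier →ₗ[ℂ] D'.carrier) hF

theorem GAlg.exists_tensor {ι : Type u} (s : G → FinMat ι →ₙₐ[ℂ] FinMat ι)
    (s_one : ∀ m, s 1 m = m) (s_mul : ∀ g h m, s (g * h) m = s g (s h m))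
    (compat : ∀ (e : Idem G) m n, s e.1 m * n = m * s e.1 n) (A : GAlg G) :
    ∃ (D : GAlg G) (τ : FinMat ι →ₗ[ℂ] A.carrier →ₗ[ℂ] D.carrier),
      (∀ m m' a a', τ m a * τ m' a' = τ (m * m') (a * a')) ∧
      Function.Bijective (TensorProduct.lift τ) ∧ ∀ g m a, D.act g (τ m a) = τ (s g m) (A.act g a) :=
  ⟨GAlg.tensor s s_one s_mul compat A, TensorProduct.mk ℂ (FinMat ι) A.carrier,
    fun _ _ _ _ => Algebra.TensorProduct.tmul_mul_tmul _ _ _ _,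
    (by
      rw [TensorProduct.lift_mk]; exact Function.bijective_id :
        Function.Bijective (TensorProduct.lift (TensorProduct.mk ℂ (FinMat ι) A.carrier))),
    fun _ _ _ => TensorProduct.map_tmul _ _ _ _⟩

theorem algSetting.dense_of_span (p : PathKind) {A : (algSetting G p).C}
    {s : Set ((algSetting G p).El A)} (h : Submodule.span ℂ s = ⊤) :
    Dense (Submodule.span ℂ s : Set ((algSetting G p).El A)) := by
  rw [h]
  exact dense_univ

/-- The algebras form a good setting. -/
@[reducible]
noncomputable def algSetting.good (p : PathKind) : (algSetting G p).Good where
  hasStar := False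
  conj a := a
  conj_conj h := h.elim
  conj_mul h := h.elim
  conj_add h := h.elim
  conj_smul h := h.elim
  conj_continuous := continuous_id
  t2 _ := inferInstance
  continuousAdd _ := ⟨continuous_of_discreteTopology⟩
  continuousMul _ := ⟨continuous_of_discreteTopology⟩
  continuousSMul _ := ⟨fun _ => continuous_of_discreteTopology⟩
  hom_ext _ _ := GAlg.hom_ext
  exists_hom F hF _ := ⟨⟨F, hF⟩, fun _ => rfl⟩
  ap_conj h := h.elim
  act_conj h := h.elim
  continuous_hom _ _ := continuous_of_discreteTopology
  isClosedEmbedding F _ h := .of_continuous_injective_isClosedMap continuous_of_discreteTopology h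
    fun _ _ => isClosed_discrete _
  tensor_mul h := And.left h
  tensor_conj h := h.elim
  tensor_continuous_left _ _ := continuous_of_discreteTopology
  tensor_continuous_right _ _ := continuous_of_discreteTopology
  tensor_dense h := algSetting.dense_of_span p (surjective_lift_iff.mp (And.right h).2)
  tensor_eq_zero h _ _ := eq_zero_of_injective_lift (And.right h).1
  isTensor_of {ι A D τ} hm _ hd he := by
    choose ε hε using he
    exact ⟨hm, FinMat.injective_of_entry (ε := fun p => ε p.1 p.2) (fun p => (hε p.1 p.2).2.1)
      (fun p q a hpq => (hε p.1 p.2).2.2 q.1 q.2 a hpq),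
      surjective_lift_iff.mpr (algSetting.span_eq_top p hd)⟩
  tensor_entry {ι A D τ} h i j := by
    obtain ⟨ε, h1, h2⟩ := FinMat.exists_entry (And.right h) (i, j)
    exact ⟨ε, continuous_of_discreteTopology, h1, fun k l => h2 (k, l)⟩
  unit_system := FinMat.unit_mul_same
  unit_mul_ne i j k l h := FinMat.unit_mul_ne h i l
  unit_conj h := h.elim
  unit_ne_zero i j := FinMat.unit_ne_zero (i, j)
  unit_coef i j m := ⟨_, FinMat.unit_mul_mul_unit i j m⟩
  unit_separating _ hm := FinMat.eq_zero_of_forall hm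
  unit_dense ι := algSetting.dense_of_span p FinMat.span_eq_top
  mat_act _ _ := rfl
  idem_mul e f := (MonoidAlgebra.single_mul_single ..).trans (by rw [one_mul]; rfl)
  idem_conj h := h.elim
  idem_act g e := MonoidAlgebra.mapDomain_single ..
  idem_ne_zero e := MonoidAlgebra.single_ne_zero.mpr one_ne_zero
  idem_dense := algSetting.dense_of_span p algCoeff.span_eq_top
  lift {ι A D B τ} h k hk _ := by
    obtain ⟨F, hF⟩ := algSetting.exists_lift (B := B) (And.left h) (And.right h) (fun q => k q.1 q.2)
      (fun i j l => hk.mul_same i j l) (fun i j l m => hk.mul_ne i j l m)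
    exact ⟨F, fun h => h.elim, fun i j => hF (i, j)⟩
  tensor_injective h h' f _ hf F _ hF :=
    GAlg.injective_of_bijective_lift (And.right h) (And.right h') f hf F hF
  lift_mat k h1 h2 _ := by
    obtain ⟨F, hF⟩ := FinMat.exists_lift k h1 h2
    exact ⟨F, fun h => h.elim, hF⟩
  exists_coeff_action X := by
    obtain ⟨φ, hφ⟩ := GAlg.exists_coeff_action X
    exact ⟨φ, hφ, fun _ => continuous_of_discreteTopology, fun _ => continuous_of_discreteTopology⟩
  exists_semidirect {D A} L R h h1 h2 h3 h4 _ := by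
    obtain ⟨Q, i, q, r, ⟨h5, h6, h7⟩, h8, h9⟩ := GAlg.exists_semidirect L R h h1 h2 h3 h4
    exact ⟨Q, i, q, r, ⟨h5, h6, h7⟩, h8, h9⟩
  exists_pullback f k := GAlg.exists_pullback f k
  exists_tensor σ A := by
    obtain ⟨D, τ, h1, h2, h3⟩ := GAlg.exists_tensor (fun g => ap (σ.hom g))
      (fun m => by rw [σ.hom_one]; rfl) (fun g h m => by rw [σ.hom_mul]; rfl) σ.compat A
    exact ⟨D, ⟨⟨τ, ⟨h1, h2⟩, h3⟩⟩⟩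
  rotation T f i j hij ha F₀ F₁ h0 h1 := by
    obtain ⟨H, hH, hH'⟩ := GAlg.exists_rotation_tensor p (And.left T.isTensor) f hij ha
    exact ⟨H, hH, fun a => ⟨(hH' a).1.trans (h0 a).symm, (hH' a).2.trans (h1 a).symm⟩⟩
  -- In the discrete topology every set is closed, so no boundedness is needed.
  bdd _ := True
  bdd_projection _ _ _ := trivial
  bdd_map _ _ _ := trivial
  bdd_of_map _ _ _ _ := trivial
  bdd_mul_left _ _ _ := trivial
  bdd_mul_right _ _ _ := trivial
  isClosed_exists_left _ _ _ _ := isClosed_discrete _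
  isClosed_exists_right _ _ _ _ := isClosed_discrete _
  isClosed_eq_left _ _ _ := isClosed_discrete _
  isClosed_eq_right _ _ _ := isClosed_discrete _

end AlgebraicInstance


theorem NonUnitalStarAlgHom.continuous {A B : Type*} [NonUnitalCStarAlgebra A]
    [NonUnitalCStarAlgebra B] (F : A →⋆ₙₐ[ℂ] B) : Continuous F :=
  AddMonoidHomClass.continuous_of_bound F 1 fun a => by
    rw [one_mul]; exact NonUnitalStarAlgHom.norm_apply_le F a

/-! ### Matrix systems in C*-algebras -/

section StarMatrixSystem

variable {ι A D B : Type*} [NonUnitalCStarAlgebra A] [NonUnitalCStarAlgebra D]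
  [NonUnitalCStarAlgebra B]

/-- A matrix system which is compatible with the involutions. -/
structure IsStarMatrixSystem (u : ι → ι → A →ₗ[ℂ] D) : Prop
    extends IsMatrixSystem (fun i j a => u i j a) where
  star_apply : ∀ i j a, star (u i j a) = u j i (star a)

/-- The sum of `e_{ij} ⊗ a_{ij}` for a matrix `a` with finitely many nonzero entries. -/
noncomputable def matSum (u : ι → ι → A →ₗ[ℂ] D) : (ι × ι →₀ A) →ₗ[ℂ] D :=
  Finsupp.lsum ℂ fun p => u p.1 p.2

@[simp]
theorem matSum_single (u : ι → ι → A →ₗ[ℂ] D) (p : ι × ι) (a : A) :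
    matSum u (Finsupp.single p a) = u p.1 p.2 a := by
  simp [matSum]

theorem matSum_eq_sum (u : ι → ι → A →ₗ[ℂ] D) {s : Finset ι} {x : ι × ι →₀ A}
    (hx : x.support ⊆ s ×ˢ s) : matSum u x = ∑ i : s, ∑ j : s, u i j (x (i, j)) := by
  rw [matSum, Finsupp.lsum_apply, Finsupp.sum_of_support_subset x hx _ (fun _ _ => map_zero _),
    Finset.sum_product, ← Finset.sum_coe_sort]
  exact Finset.sum_congr rfl fun i _ => (Finset.sum_coe_sort s fun j => u i j (x (i, j))).symm

theorem exists_support_subset (x : ι × ι →₀ A) : ∃ s : Finset ι, x.support ⊆ s ×ˢ s := by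
  classical
  exact ⟨x.support.image Prod.fst ∪ x.support.image Prod.snd, fun p hp => by
    simp only [Finset.mem_product, Finset.mem_union, Finset.mem_image]
    exact ⟨.inl ⟨p, hp, rfl⟩, .inr ⟨p, hp, rfl⟩⟩⟩

namespace IsStarMatrixSystem

variable {u : ι → ι → A →ₗ[ℂ] D} {v : ι → ι → A →ₗ[ℂ] B}

/-- The homomorphism on matrices over a finite set of indices. -/
noncomputable def matrixHom (h : IsStarMatrixSystem u) (s : Finset ι) [PartialOrder A]
    [StarOrderedRing A] : CStarMatrix s s A →⋆ₙₐ[ℂ] D where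
  toFun m := ∑ i : s, ∑ j : s, u i j (m i j)
  map_smul' c m := by simp [Finset.smul_sum]
  map_zero' := by simp
  map_add' m n := by simp [Finset.sum_add_distrib]
  map_star' m := by
    simp only [star_sum, h.star_apply]
    rw [Finset.sum_comm]
    rfl
  map_mul' m n := by
    calc ∑ i : s, ∑ j : s, u i j ((m * n) i j)
        = ∑ i : s, ∑ l : s, ∑ k : s, u i k (m i k) * u k l (n k l) := by
          simp only [CStarMatrix.mul_apply, map_sum]
          exact Finset.sum_congr rfl fun i _ => Finset.sum_congr rfl fun l _ =>
            Finset.sum_congr rfl fun k _ => (h.mul_same _ _ _ _ _).symm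
      _ = ∑ i : s, ∑ j : s, ∑ k : s, ∑ l : s, u i j (m i j) * u k l (n k l) := by
          refine Finset.sum_congr rfl fun i _ => ?_
          rw [Finset.sum_comm]
          refine Finset.sum_congr rfl fun j _ => ?_
          refine Eq.symm (Finset.sum_eq_single (f := fun k : s => ∑ l : s,
            u i j (m i j) * u k l (n k l)) j (fun k _ hk => ?_)
            fun h => absurd (Finset.mem_univ _) h)
          exact Finset.sum_eq_zero fun l _ =>
            h.mul_ne _ _ _ _ _ _ fun h' => hk (Subtype.ext h').symm
      _ = (∑ i : s, ∑ j : s, u i j (m i j)) * ∑ k : s, ∑ l : s, u k l (n k l) := by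
          rw [Finset.sum_mul]
          refine Finset.sum_congr rfl fun i _ => ?_
          rw [Finset.sum_mul]
          refine Finset.sum_congr rfl fun j _ => ?_
          rw [Finset.mul_sum]
          exact Finset.sum_congr rfl fun k _ => (Finset.mul_sum _ _ _).symm

theorem mul_sum_mul (h : IsStarMatrixSystem u) {s : Finset ι} (x : s → s → A) (k l : s) (b c : A) :
    u k k b * (∑ i : s, ∑ j : s, u i j (x i j)) * u l l c = u k l (b * x k l * c) := by
  classical
  rw [Finset.mul_sum, Finset.sum_mul, Finset.sum_eq_single k, Finset.mul_sum, Finset.sum_mul,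
    Finset.sum_eq_single l, h.mul_same, h.mul_same]
  · intro j _ hj
    rw [h.mul_same]
    exact h.mul_ne _ _ _ _ _ _ fun h' => hj (Subtype.ext h')
  · exact fun h => absurd (Finset.mem_univ _) h
  · intro i _ hi
    rw [Finset.mul_sum, Finset.sum_mul]
    refine Finset.sum_eq_zero fun j _ => ?_
    rw [h.mul_ne _ _ _ _ _ _ fun h' => hi (Subtype.ext h').symm, zero_mul]
  · exact fun h => absurd (Finset.mem_univ _) h

theorem eq_zero_of_mul_mul {a : A} (h : ∀ b c, b * a * c = 0) : a = 0 := by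
  have h1 : star a * a = 0 := by
    -- This choice turns the hypothesis into `z z* = 0` for `z = a* a`.
    have := h (star a) (star (star a * a))
    exact (CStarRing.mul_star_self_eq_zero_iff _).mp this
  exact (CStarRing.star_mul_self_eq_zero_iff _).mp h1

theorem matrixHom_injective (h : IsStarMatrixSystem u) (h0 : ∀ i j a, u i j a = 0 → a = 0)
    (s : Finset ι) [PartialOrder A] [StarOrderedRing A] : Function.Injective (h.matrixHom s) := by
  rw [injective_iff_map_eq_zero]
  intro m hm
  refine CStarMatrix.ext fun k l => eq_zero_of_mul_mul fun b c => h0 k l _ ?_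
  have h1 := h.mul_sum_mul (fun i j => m i j) k l b c
  rw [← h1]
  change u k k b * h.matrixHom s m * u l l c = 0
  rw [hm, mul_zero, zero_mul]

/-- Matrix systems in a C*-algebra are norm decreasing images of injective matrix systems. -/
theorem norm_matSum_le (hu : IsStarMatrixSystem u) (h0 : ∀ i j a, u i j a = 0 → a = 0)
    (hv : IsStarMatrixSystem v) (x : ι × ι →₀ A) : ‖matSum v x‖ ≤ ‖matSum u x‖ := by
  -- The order enters through the C*-norm of `M_s(A)`. From this C*-algebra the homomorphism of `u`
  -- is injective, hence isometric, while the homomorphism of `v` is contractive.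
  let _ : PartialOrder A := CStarAlgebra.spectralOrder A
  have _ : StarOrderedRing A := CStarAlgebra.spectralOrderedRing A
  obtain ⟨s, hs⟩ := exists_support_subset x
  let m : CStarMatrix s s A := CStarMatrix.ofMatrix fun i j => x (i, j)
  have h1 : matSum u x = hu.matrixHom s m := matSum_eq_sum u hs
  have h2 : matSum v x = hv.matrixHom s m := matSum_eq_sum v hs
  rw [h1, h2, NonUnitalStarAlgHom.norm_map _ (hu.matrixHom_injective h0 s)]
  exact NonUnitalStarAlgHom.norm_apply_le _ _

theorem norm_entry_le (hu : IsStarMatrixSystem u) (h0 : ∀ i j a, u i j a = 0 → a = 0)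
    (x : ι × ι →₀ A) (p : ι × ι) : ‖x p‖ ≤ ‖matSum u x‖ := by
  let _ : PartialOrder A := CStarAlgebra.spectralOrder A
  have _ : StarOrderedRing A := CStarAlgebra.spectralOrderedRing A
  obtain ⟨s, hs⟩ := exists_support_subset x
  let m : CStarMatrix s s A := CStarMatrix.ofMatrix fun i j => x (i, j)
  have h1 : matSum u x = hu.matrixHom s m := matSum_eq_sum u hs
  by_cases hp : p ∈ s ×ˢ s
  · rw [h1, NonUnitalStarAlgHom.norm_map _ (hu.matrixHom_injective h0 s)]
    obtain ⟨h2, h3⟩ := Finset.mem_product.mp hp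
    exact CStarMatrix.norm_entry_le_norm (M := m) (i := ⟨p.1, h2⟩) (j := ⟨p.2, h3⟩)
  · rw [Finsupp.notMem_support_iff.mp fun h => hp (hs h), norm_zero]
    exact norm_nonneg _

/-- Taking entries is contractive for the norm of the matrix system and extends to the closure. -/
theorem exists_entry (hu : IsStarMatrixSystem u) (h0 : ∀ i j a, u i j a = 0 → a = 0)
    (hd : DenseRange (matSum u)) (p : ι × ι) :
    ∃ ε : D →L[ℂ] A, ∀ x, ε (matSum u x) = x p :=
  ⟨(Finsupp.lapply p).extendOfNorm (matSum u), fun x =>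
    LinearMap.extendOfNorm_eq hd ⟨1, fun x => by
      rw [one_mul]; exact hu.norm_entry_le h0 x p⟩ x⟩

/-- The universal property of the C*-algebra generated by an injective matrix system. -/
theorem exists_lift (hu : IsStarMatrixSystem u) (h0 : ∀ i j a, u i j a = 0 → a = 0)
    (hd : DenseRange (matSum u)) (hv : IsStarMatrixSystem v) :
    ∃ F : D →⋆ₙₐ[ℂ] B, ∀ x, F (matSum u x) = matSum v x := by
  let F := (matSum v).extendOfNorm (matSum u)
  have hF : ∀ x, F (matSum u x) = matSum v x := LinearMap.extendOfNorm_eq hd ⟨1, fun x => by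
    rw [one_mul]; exact hu.norm_matSum_le h0 hv x⟩
  have hF' : ∀ i j a, F (u i j a) = v i j a := fun i j a => by
    have := hF (Finsupp.single (i, j) a)
    rwa [matSum_single, matSum_single] at this
  have hc : Continuous F := F.continuous
  have hm : ∀ x y, F (x * y) = F x * F y := by
    refine hd.induction_on₂ (isClosed_eq (by fun_prop) (by fun_prop)) fun x y => ?_
    induction x using Finsupp.induction_linear with
    | zero => simp
    | add x x' hx hx' => rw [map_add, add_mul, map_add, hx, hx', map_add, add_mul]
    | single p a =>
      induction y using Finsupp.induction_linear with
      | zero => simp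
      | add y y' hy hy' => rw [map_add, mul_add, map_add, hy, hy', map_add, mul_add]
      | single q b =>
        obtain ⟨i, j⟩ := p
        obtain ⟨k, l⟩ := q
        simp only [matSum_single, hF']
        by_cases hjk : j = k
        · subst hjk
          rw [hu.mul_same, hv.mul_same, hF']
        · rw [hu.mul_ne _ _ _ _ _ _ hjk, hv.mul_ne _ _ _ _ _ _ hjk, map_zero]
  have hs : ∀ x, F (star x) = star (F x) := by
    refine fun x => hd.induction_on x (isClosed_eq (by fun_prop) (by fun_prop)) fun x => ?_
    induction x using Finsupp.induction_linear with
    | zero => simp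
    | add x x' hx hx' => rw [map_add, star_add, map_add, hx, hx', map_add, star_add]
    | single p a => rw [matSum_single, hu.star_apply, hF', hF', hv.star_apply]
  exact ⟨{ toFun := F, map_smul' := map_smul F, map_zero' := map_zero F, map_add' := map_add F,
           map_mul' := hm, map_star' := hs }, hF⟩

theorem norm_eq_of_matSum (hu : IsStarMatrixSystem u) (h0 : ∀ i j a, u i j a = 0 → a = 0)
    (hd : DenseRange (matSum u)) (hv : IsStarMatrixSystem v) (h0' : ∀ i j a, v i j a = 0 → a = 0)
    {F : D →⋆ₙₐ[ℂ] B} (hF : ∀ x, F (matSum u x) = matSum v x) (y : D) : ‖F y‖ = ‖y‖ := by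
  have hc : Continuous F := NonUnitalStarAlgHom.continuous F
  refine hd.induction_on y (isClosed_eq (by fun_prop) (by fun_prop)) fun x => ?_
  rw [hF]
  exact le_antisymm (hu.norm_matSum_le h0 hv x) (hv.norm_matSum_le h0' hu x)

end IsStarMatrixSystem

end StarMatrixSystem


theorem mem_span_of_mem_starAdjoin {R : Type*} [NonUnitalCStarAlgebra R] {s : Set R}
    (hm : ∀ x ∈ s, ∀ y ∈ s, x * y ∈ Submodule.span ℂ s)
    (hs : ∀ x ∈ s, star x ∈ Submodule.span ℂ s) {x : R}
    (hx : x ∈ NonUnitalStarAlgebra.adjoin ℂ s) : x ∈ Submodule.span ℂ s := by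
  induction hx using NonUnitalStarAlgebra.adjoin_induction with
  | mem x hx => exact Submodule.subset_span hx
  | add x y _ _ hx hy => exact add_mem hx hy
  | zero => exact zero_mem _
  | smul r x _ hx => exact Submodule.smul_mem _ r hx
  | star x h hx =>
    clear h
    induction hx using Submodule.span_induction with
    | mem x hx => exact hs x hx
    | zero => rw [star_zero]; exact zero_mem _
    | add x y _ _ hx hy => rw [star_add]; exact add_mem hx hy
    | smul r x _ hx => rw [star_smul]; exact Submodule.smul_mem _ _ hx
  | mul x y h h' hx hy =>
    clear h h'
    induction hx using Submodule.span_induction with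
    | zero => rw [zero_mul]; exact zero_mem _
    | add x x' _ _ hx hx' => rw [add_mul]; exact add_mem hx hx'
    | smul r x _ hx => rw [smul_mul_assoc]; exact Submodule.smul_mem _ _ hx
    | mem x hx =>
      induction hy using Submodule.span_induction with
      | zero => rw [mul_zero]; exact zero_mem _
      | add y y' _ _ hy hy' => rw [mul_add]; exact add_mem hy hy'
      | smul r y _ hy => rw [mul_smul_comm]; exact Submodule.smul_mem _ _ hy
      | mem y hy => exact hm x hx y hy

/-! ### Compact operators and their matrix units -/

section CptMat

variable {ι : Type u}

/-- The C*-algebra of compact operators on `ℓ²(ι)`. -/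
def Cpt (ι : Type u) : Type u := CptMat ι

noncomputable instance Cpt.nonUnitalCStarAlgebra (ι : Type u) : NonUnitalCStarAlgebra (Cpt ι) :=
  NonUnitalStarSubalgebra.nonUnitalCStarAlgebra (CptMat ι)
    (h_closed := NonUnitalStarSubalgebra.isClosed_topologicalClosure _)

open Classical in
theorem l2Unit_apply (i j : ι) (v : lp (fun _ : ι => ℂ) 2) :
    l2Unit i j v = v j • lp.single 2 i (1 : ℂ) := by
  rw [l2Unit, ContinuousLinearMap.smulRight_apply, innerSL_apply_apply, lp.inner_single_left]
  simp

theorem l2Unit_mul_same (i j k : ι) : l2Unit i j * l2Unit j k = l2Unit i k := by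
  classical
  ext1 v
  rw [mul_apply_eq_comp, l2Unit_apply j k, map_smul, l2Unit_apply, l2Unit_apply,
    lp.single_apply_self, one_smul]

theorem l2Unit_mul_ne {j k : ι} (h : j ≠ k) (i l : ι) : l2Unit i j * l2Unit k l = 0 := by
  classical
  ext1 v
  rw [mul_apply_eq_comp, l2Unit_apply k l, map_smul, l2Unit_apply,
    lp.single_apply_ne _ _ _ h, zero_smul, smul_zero]
  rfl

theorem star_l2Unit (i j : ι) : star (l2Unit i j) = l2Unit j i := by
  classical
  rw [ContinuousLinearMap.star_eq_adjoint]
  refine ((ContinuousLinearMap.eq_adjoint_iff _ _).mpr fun x y => ?_).symm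
  rw [l2Unit_apply, l2Unit_apply, inner_smul_left, inner_smul_right, lp.inner_single_left,
    lp.inner_single_right]
  simp [mul_comm]

theorem l2Unit_mul_mul (i j : ι) (m : lp (fun _ : ι => ℂ) 2 →L[ℂ] lp (fun _ : ι => ℂ) 2) :
    ∃ c : ℂ, l2Unit i i * m * l2Unit j j = c • l2Unit i j := by
  classical
  refine ⟨m (lp.single 2 j 1) i, ?_⟩
  ext1 v
  simp only [mul_apply_eq_comp, l2Unit_apply, map_smul, smul_apply, smul_smul]
  rw [mul_comm]

theorem eq_zero_of_l2Unit_mul_mul {m : lp (fun _ : ι => ℂ) 2 →L[ℂ] lp (fun _ : ι => ℂ) 2}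
    (h : ∀ i j, l2Unit i i * m * l2Unit j j = 0) : m = 0 := by
  classical
  refine lp.ext_continuousLinearMap (𝕜 := ℂ) ENNReal.ofNat_ne_top fun j => ?_
  ext1
  change m (lp.single 2 j 1) = 0
  refine lp.ext (funext fun i => ?_)
  have h1 := congrArg (fun f : lp (fun _ : ι => ℂ) 2 →L[ℂ] lp (fun _ : ι => ℂ) 2 =>
    f (lp.single 2 j 1) i) (h i j)
  simp only [mul_apply_eq_comp, l2Unit_apply, lp.single_apply_self, one_smul,
    lp.coeFn_smul, Pi.smul_apply, smul_eq_mul, mul_one] at h1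
  exact h1

/-- The underlying operator. -/
def Cpt.val (m : Cpt ι) : lp (fun _ : ι => ℂ) 2 →L[ℂ] lp (fun _ : ι => ℂ) 2 := Subtype.val m

theorem Cpt.ext {m n : Cpt ι} (h : m.val = n.val) : m = n := Subtype.ext h

/-- The matrix unit `e_{ij}`. -/
noncomputable def Cpt.unit (i j : ι) : Cpt ι :=
  ⟨l2Unit i j, NonUnitalStarSubalgebra.le_topologicalClosure _
    (NonUnitalStarAlgebra.subset_adjoin ℂ _ ⟨(i, j), rfl⟩)⟩

namespace Cpt

theorem unit_mul_same (i j k : ι) : unit i j * unit j k = unit i k :=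
  Cpt.ext (l2Unit_mul_same i j k)

theorem unit_mul_ne (i j k l : ι) (h : j ≠ k) : unit i j * unit k l = 0 :=
  Cpt.ext (l2Unit_mul_ne h i l)

theorem star_unit (i j : ι) : star (unit i j) = unit j i :=
  Cpt.ext (star_l2Unit i j)

theorem unit_ne_zero (i j : ι) : unit i j ≠ 0 := fun h => by
  classical
  have h1 := congrArg (fun f : Cpt ι => (f.val (lp.single 2 j 1) : lp (fun _ : ι => ℂ) 2) i) h
  change (l2Unit i j (lp.single 2 j 1) : lp (fun _ : ι => ℂ) 2) i = 0 at h1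
  rw [l2Unit_apply, lp.single_apply_self, one_smul, lp.single_apply_self] at h1
  exact one_ne_zero h1

theorem unit_mul_mul_unit (i j : ι) (m : Cpt ι) :
    ∃ c : ℂ, unit i i * m * unit j j = c • unit i j := by
  obtain ⟨c, hc⟩ := l2Unit_mul_mul i j m.val
  exact ⟨c, Cpt.ext hc⟩

theorem eq_zero_of_forall {m : Cpt ι} (h : ∀ i j, unit i i * m * unit j j = 0) : m = 0 :=
  Cpt.ext (eq_zero_of_l2Unit_mul_mul fun i j => congrArg Cpt.val (h i j))

theorem mem_span_of_mem_adjoin {x : lp (fun _ : ι => ℂ) 2 →L[ℂ] lp (fun _ : ι => ℂ) 2}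
    (hx : x ∈ NonUnitalStarAlgebra.adjoin ℂ (Set.range fun p : ι × ι => l2Unit p.1 p.2)) :
    x ∈ Submodule.span ℂ (Set.range fun p : ι × ι => l2Unit p.1 p.2) := by
  refine mem_span_of_mem_starAdjoin ?_ ?_ hx
  · rintro _ ⟨⟨i, j⟩, rfl⟩ _ ⟨⟨k, l⟩, rfl⟩
    by_cases h : j = k
    · subst h
      exact Submodule.subset_span ⟨(i, l), (l2Unit_mul_same i j l).symm⟩
    · simp only [l2Unit_mul_ne h]
      exact zero_mem _
  · rintro _ ⟨p, rfl⟩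
    exact Submodule.subset_span ⟨(p.2, p.1), (star_l2Unit p.1 p.2).symm⟩

theorem dense_span_unit :
    Dense (Submodule.span ℂ {y : Cpt ι | ∃ i j, unit i j = y} : Set (Cpt ι)) := by
  have h1 : ∀ x, x ∈ Submodule.span ℂ (Set.range fun p : ι × ι => l2Unit p.1 p.2) →
      ∃ y ∈ Submodule.span ℂ {y : Cpt ι | ∃ i j, unit i j = y}, y.val = x := by
    intro x hx
    induction hx using Submodule.span_induction with
    | mem x hx =>
      obtain ⟨p, rfl⟩ := hx
      exact ⟨unit p.1 p.2, Submodule.subset_span ⟨_, _, rfl⟩, rfl⟩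
    | zero => exact ⟨0, zero_mem _, rfl⟩
    | add x y _ _ hx hy =>
      obtain ⟨x', hx', rfl⟩ := hx
      obtain ⟨y', hy', rfl⟩ := hy
      exact ⟨x' + y', add_mem hx' hy', rfl⟩
    | smul r x _ hx =>
      obtain ⟨x', hx', rfl⟩ := hx
      exact ⟨r • x', Submodule.smul_mem _ r hx', rfl⟩
  intro x
  rw [Metric.mem_closure_iff]
  intro ε hε
  obtain ⟨y, hy, hxy⟩ := Metric.mem_closure_iff.mp x.2 ε hε
  obtain ⟨y', hy', rfl⟩ := h1 y (mem_span_of_mem_adjoin hy)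
  exact ⟨y', hy', hxy⟩

end Cpt

end CptMat

theorem denseRange_matSum {ι A D : Type*} [NonUnitalCStarAlgebra A] [NonUnitalCStarAlgebra D]
    {u : ι → ι → A →ₗ[ℂ] D}
    (h : Dense (Submodule.span ℂ {y | ∃ i j a, u i j a = y} : Set D)) : DenseRange (matSum u) := by
  refine h.mono ?_
  have : Submodule.span ℂ {y | ∃ i j a, u i j a = y} ≤ LinearMap.range (matSum u) :=
    Submodule.span_le.mpr (by
      rintro _ ⟨i, j, a, rfl⟩
      exact ⟨Finsupp.single (i, j) a, matSum_single u (i, j) a⟩)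
  exact this

/-! ### C*-completions of tensor products -/

section StarTensor

variable {M A D : Type*} [NonUnitalCStarAlgebra M] [NonUnitalCStarAlgebra A]
  [NonUnitalCStarAlgebra D]

/-- `D` is a C*-completion of `M ⊗ A`. -/
structure IsStarTensor (τ : M →ₗ[ℂ] A →ₗ[ℂ] D) : Prop where
  mul : ∀ m m' a a', τ m a * τ m' a' = τ (m * m') (a * a')
  star_apply : ∀ m a, star (τ m a) = τ (star m) (star a)
  injective : Function.Injective (TensorProduct.lift τ)
  dense : DenseRange (TensorProduct.lift τ)

theorem dense_span_of_denseRange_lift {τ : M →ₗ[ℂ] A →ₗ[ℂ] D}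
    (h : DenseRange (TensorProduct.lift τ)) :
    Dense (Submodule.span ℂ {y | ∃ m a, τ m a = y} : Set D) := by
  refine h.mono ?_
  rintro _ ⟨x, rfl⟩
  induction x with
  | zero => rw [map_zero]; exact zero_mem _
  | add y y' hy hy' => rw [map_add]; exact add_mem hy hy'
  | tmul m a => exact Submodule.subset_span ⟨m, a, rfl⟩

theorem denseRange_lift_of_dense_span {τ : M →ₗ[ℂ] A →ₗ[ℂ] D}
    (h : Dense (Submodule.span ℂ {y | ∃ m a, τ m a = y} : Set D)) :
    DenseRange (TensorProduct.lift τ) := by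
  refine h.mono ?_
  have : Submodule.span ℂ {y | ∃ m a, τ m a = y} ≤ LinearMap.range (TensorProduct.lift τ) :=
    Submodule.span_le.mpr (by rintro _ ⟨m, a, rfl⟩; exact ⟨m ⊗ₜ a, TensorProduct.lift.tmul _ _⟩)
  exact this

/-- No bound on `τ` is assumed: `A` is spanned by the elements `b* b`, and `m ↦ τ(m, b* b)` is
positive because `τ(n* n, b* b) = τ(n, b)* τ(n, b)`. Positive maps between C*-algebras are bounded.
-/
theorem continuous_of_mul_of_star {τ : M →ₗ[ℂ] A →ₗ[ℂ] D}
    (hm : ∀ m m' a a', τ m a * τ m' a' = τ (m * m') (a * a'))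
    (hs : ∀ m a, star (τ m a) = τ (star m) (star a)) (a : A) : Continuous fun m => τ m a := by
  let _ : PartialOrder A := CStarAlgebra.spectralOrder A
  have _ : StarOrderedRing A := CStarAlgebra.spectralOrderedRing A
  let _ : PartialOrder M := CStarAlgebra.spectralOrder M
  have _ : StarOrderedRing M := CStarAlgebra.spectralOrderedRing M
  let _ : PartialOrder D := CStarAlgebra.spectralOrder D
  have _ : StarOrderedRing D := CStarAlgebra.spectralOrderedRing D
  have h1 : a ∈ Submodule.span ℂ {a : A | 0 ≤ a} := by rw [CStarAlgebra.span_nonneg]; trivial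
  induction h1 using Submodule.span_induction with
  | zero => simp only [map_zero]; exact continuous_const
  | add a b _ _ ha hb => simp only [map_add]; exact ha.add hb
  | smul r a _ ha => simp only [map_smul]; exact ha.const_smul r
  | mem a ha =>
    replace ha : 0 ≤ a := ha
    obtain ⟨b, rfl⟩ := CStarAlgebra.nonneg_iff_eq_star_mul_self.mp ha
    let f : M →ₚ[ℂ] D := PositiveLinearMap.mk₀ (τ.flip (star b * b)) fun m hm' => by
      obtain ⟨n, rfl⟩ := CStarAlgebra.nonneg_iff_eq_star_mul_self.mp hm'
      change 0 ≤ τ (star n * n) (star b * b)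
      rw [← hm, ← hs]
      exact star_mul_self_nonneg _
    obtain ⟨C, hC⟩ := PositiveLinearMap.exists_norm_apply_le f
    exact AddMonoidHomClass.continuous_of_bound f.toLinearMap C hC

theorem IsStarTensor.continuous_left {τ : M →ₗ[ℂ] A →ₗ[ℂ] D} (h : IsStarTensor τ) (a : A) :
    Continuous fun m => τ m a :=
  continuous_of_mul_of_star h.mul h.star_apply a

theorem IsStarTensor.continuous_right {τ : M →ₗ[ℂ] A →ₗ[ℂ] D} (h : IsStarTensor τ) (m : M) :
    Continuous fun a => τ m a :=
  continuous_of_mul_of_star (τ := τ.flip) (fun _ _ _ _ => h.mul _ _ _ _)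
    (fun _ _ => h.star_apply _ _) m

end StarTensor


/-! ### Tensor products with compact operators -/

section CptTensor

variable {ι : Type u}

theorem LinearMap.eq_of_dense_span {E F : Type*} [AddCommGroup E] [Module ℂ E] [TopologicalSpace E]
    [AddCommGroup F] [Module ℂ F] [TopologicalSpace F] [T2Space F] {s : Set E}
    (hs : Dense (Submodule.span ℂ s : Set E)) {f k : E →ₗ[ℂ] F} (hf : Continuous f)
    (hk : Continuous k) (h : ∀ x ∈ s, f x = k x) (x : E) : f x = k x := by
  have h1 : Set.EqOn f k (Submodule.span ℂ s) := fun y hy => LinearMap.eqOn_span h hy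
  exact congrFun (Continuous.ext_on hs hf hk h1) x

namespace Cpt

theorem linear_ext {F : Type*} [AddCommGroup F] [Module ℂ F] [TopologicalSpace F] [T2Space F]
    {f k : Cpt ι →ₗ[ℂ] F} (hf : Continuous f) (hk : Continuous k)
    (h : ∀ i j, f (unit i j) = k (unit i j)) (m : Cpt ι) : f m = k m :=
  LinearMap.eq_of_dense_span dense_span_unit hf hk (by rintro _ ⟨i, j, rfl⟩; exact h i j) m

/-- The matrix system `c ↦ c • h_{ij}`. -/
noncomputable def scalarSystem {B : Type*} [NonUnitalCStarAlgebra B] (h : ι → ι → B) (i j : ι) :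
    ℂ →ₗ[ℂ] B :=
  (LinearMap.lsmul ℂ B).flip (h i j)

theorem scalarSystem_apply {B : Type*} [NonUnitalCStarAlgebra B] (h : ι → ι → B) (i j : ι) (c : ℂ) :
    scalarSystem h i j c = c • h i j := rfl

theorem isStarMatrixSystem_scalarSystem {B : Type*} [NonUnitalCStarAlgebra B] {h : ι → ι → B}
    (h1 : ∀ i j k, h i j * h j k = h i k) (h2 : ∀ i j k l, j ≠ k → h i j * h k l = 0)
    (h3 : ∀ i j, star (h i j) = h j i) : IsStarMatrixSystem (scalarSystem h) where
  mul_same i j k a b := by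
    simp only [scalarSystem_apply]
    rw [smul_mul_smul_comm, h1]
  mul_ne i j k l a b hjk := by
    simp only [scalarSystem_apply]
    rw [smul_mul_smul_comm, h2 _ _ _ _ hjk, smul_zero]
  star_apply i j a := by rw [scalarSystem_apply, star_smul, h3, scalarSystem_apply]

theorem isStarMatrixSystem_unit : IsStarMatrixSystem (scalarSystem (unit (ι := ι))) :=
  isStarMatrixSystem_scalarSystem unit_mul_same unit_mul_ne star_unit

theorem eq_zero_of_scalarSystem_unit (i j : ι) (c : ℂ) (h : scalarSystem unit i j c = 0) : c = 0 :=
  (smul_eq_zero.mp h).resolve_right (unit_ne_zero i j)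

theorem denseRange_unit : DenseRange (matSum (scalarSystem (unit (ι := ι)))) := by
  refine denseRange_matSum (dense_span_unit.mono (Submodule.span_mono ?_))
  rintro _ ⟨i, j, rfl⟩
  exact ⟨i, j, 1, one_smul ℂ (unit i j)⟩

/-- The entry functionals of the matrix system with coefficients `ℂ`; the compression formula holds
on matrix units and extends by density. -/
theorem exists_entry : ∃ c : ι → ι → Cpt ι →L[ℂ] ℂ, (∀ i j, c i j (unit i j) = 1) ∧
    (∀ i j k l, (i, j) ≠ (k, l) → c i j (unit k l) = 0) ∧
    ∀ i j m, unit i i * m * unit j j = c i j m • unit i j := by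
  choose c hc using fun p : ι × ι => isStarMatrixSystem_unit.exists_entry
    eq_zero_of_scalarSystem_unit denseRange_unit p
  have hs : ∀ k l : ι, matSum (scalarSystem unit) (Finsupp.single (k, l) (1 : ℂ)) = unit k l :=
    fun k l => by rw [matSum_single, scalarSystem_apply, one_smul]
  have h1 : ∀ i j, c (i, j) (unit i j) = 1 := fun i j => by
    rw [← hs, hc, Finsupp.single_eq_same]
  have h2 : ∀ i j k l, (i, j) ≠ (k, l) → c (i, j) (unit k l) = 0 := fun i j k l h => by
    rw [← hs, hc, Finsupp.single_eq_of_ne h]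
  refine ⟨fun i j => c (i, j), h1, h2, fun i j m => ?_⟩
  refine linear_ext (f := (LinearMap.mulRight ℂ (unit j j)).comp (LinearMap.mulLeft ℂ (unit i i)))
    (k := ((LinearMap.lsmul ℂ (Cpt ι)).flip (unit i j)).comp (c (i, j)).toLinearMap) ?_ ?_ ?_ m
  · exact (continuous_const.mul continuous_id).mul continuous_const
  · exact (c (i, j)).continuous.smul continuous_const
  · intro k l
    change unit i i * unit k l * unit j j = c (i, j) (unit k l) • unit i j
    by_cases hik : i = k
    · subst hik
      rw [unit_mul_same]
      by_cases hjl : l = j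
      · subst hjl
        rw [unit_mul_same, h1, one_smul]
      · rw [unit_mul_ne _ _ _ _ hjl, h2 _ _ _ _ (by simp [Ne.symm hjl]), zero_smul]
    · rw [unit_mul_ne _ _ _ _ hik, zero_mul, h2 _ _ _ _ (by simp [hik]), zero_smul]

theorem exists_lift {B : Type*} [NonUnitalCStarAlgebra B] (h : ι → ι → B)
    (h1 : ∀ i j k, h i j * h j k = h i k) (h2 : ∀ i j k l, j ≠ k → h i j * h k l = 0)
    (h3 : ∀ i j, star (h i j) = h j i) :
    ∃ F : Cpt ι →⋆ₙₐ[ℂ] B, ∀ i j, F (unit i j) = h i j := by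
  obtain ⟨F, hF⟩ := isStarMatrixSystem_unit.exists_lift eq_zero_of_scalarSystem_unit
    denseRange_unit (isStarMatrixSystem_scalarSystem h1 h2 h3)
  refine ⟨F, fun i j => ?_⟩
  have := hF (Finsupp.single (i, j) 1)
  rwa [matSum_single, matSum_single, scalarSystem_apply, scalarSystem_apply, one_smul,
    one_smul] at this

end Cpt

section Entry

variable {A D : Type*} [NonUnitalCStarAlgebra A] [NonUnitalCStarAlgebra D]
  {τ : Cpt ι →ₗ[ℂ] A →ₗ[ℂ] D}

/-- Only injectivity is at stake. Write `x = ∑ m_k ⊗ b_k` with `b_k` from a linear basis of `A`. If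
the image of `x` vanishes, its entry at `(i, j)` is `∑ c_{ij}(m_k) b_k = 0`, so all entries of all
`m_k` are zero. -/
theorem isStarTensor_of_entry (hm : ∀ m m' a a', τ m a * τ m' a' = τ (m * m') (a * a'))
    (hs : ∀ m a, star (τ m a) = τ (star m) (star a))
    (hd : Dense (Submodule.span ℂ {y | ∃ m a, τ m a = y} : Set D))
    (he : ∀ i j, ∃ ε : D →ₗ[ℂ] A, Continuous ε ∧ (∀ a, ε (τ (Cpt.unit i j) a) = a) ∧
      ∀ k l a, (i, j) ≠ (k, l) → ε (τ (Cpt.unit k l) a) = 0) : IsStarTensor τ := by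
  refine ⟨hm, hs, ?_, denseRange_lift_of_dense_span hd⟩
  choose ε hε h1 h2 using he
  classical
  obtain ⟨c, hc1, hc2, hc⟩ := Cpt.exists_entry (ι := ι)
  have key : ∀ i j m a, ε i j (τ m a) = c i j m • a := fun i j m a => by
    refine Cpt.linear_ext (f := (ε i j).comp (τ.flip a))
      (k := ((LinearMap.lsmul ℂ A).flip a).comp (c i j).toLinearMap) ?_ ?_ ?_ m
    · exact (hε i j).comp (continuous_of_mul_of_star hm hs a)
    · exact (c i j).continuous.smul continuous_const
    · intro k l
      change ε i j (τ (Cpt.unit k l) a) = c i j (Cpt.unit k l) • a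
      by_cases h : (i, j) = (k, l)
      · obtain ⟨rfl, rfl⟩ := Prod.mk.inj h
        rw [h1, hc1, one_smul]
      · rw [h2 _ _ _ _ _ h, hc2 _ _ _ _ h, zero_smul]
  rw [injective_iff_map_eq_zero]
  intro x hx
  let b := Module.Basis.ofVectorSpace ℂ A
  let y := TensorProduct.equivFinsuppOfBasisRight (M := Cpt ι) b x
  have hxy : x = y.sum fun k m => m ⊗ₜ b k := by
    rw [← TensorProduct.equivFinsuppOfBasisRight_symm_apply, LinearEquiv.symm_apply_apply]
  suffices hy : ∀ k, y k = 0 by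
    rw [hxy, show y = 0 from Finsupp.ext hy, Finsupp.sum_zero_index]
  intro k
  refine Cpt.eq_zero_of_forall fun i j => ?_
  have h3 : ε i j (TensorProduct.lift τ x) = y.sum fun k m => c i j m • b k := by
    rw [hxy, map_finsuppSum, map_finsuppSum]
    exact Finsupp.sum_congr fun k _ => by rw [TensorProduct.lift.tmul, key]
  rw [hx, map_zero] at h3
  have h4 := linearIndependent_iff'.mp b.linearIndependent y.support (fun k => c i j (y k)) h3.symm
  rw [hc]
  by_cases hk : k ∈ y.support
  · rw [h4 k hk, zero_smul]
  · rw [Finsupp.notMem_support_iff.mp hk, map_zero, zero_smul]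

namespace IsStarTensor

variable (h : IsStarTensor τ)
include h

theorem isStarMatrixSystem : IsStarMatrixSystem fun i j => τ (Cpt.unit i j) where
  mul_same i j k a b := by simp only [h.mul, Cpt.unit_mul_same]
  mul_ne i j k l a b hjk := by
    simp only [h.mul, Cpt.unit_mul_ne _ _ _ _ hjk, map_zero, LinearMap.zero_apply]
  star_apply i j a := by rw [h.star_apply, Cpt.star_unit]

theorem eq_zero_of_unit (i j : ι) (a : A) (ha : τ (Cpt.unit i j) a = 0) : a = 0 :=
  (eq_zero_of_injective_lift h.injective ha).resolve_left (Cpt.unit_ne_zero i j)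

theorem denseRange_matSum : DenseRange (matSum fun i j => τ (Cpt.unit i j)) := by
  refine _root_.denseRange_matSum fun x => ?_
  have h1 : ∀ m a, τ m a ∈
      (Submodule.span ℂ {y | ∃ i j a, τ (Cpt.unit i j) a = y}).topologicalClosure := by
    intro m a
    have h2 : closure (Submodule.span ℂ {y : Cpt ι | ∃ i j, Cpt.unit i j = y} : Set (Cpt ι)) ⊆
        ((Submodule.span ℂ {y | ∃ i j a, τ (Cpt.unit i j) a = y}).topologicalClosure.comap
          (τ.flip a) : Submodule ℂ (Cpt ι)) := by
      refine closure_minimal (Submodule.span_le.mpr ?_)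
        ((Submodule.isClosed_topologicalClosure _).preimage (h.continuous_left a))
      rintro _ ⟨i, j, rfl⟩
      exact Submodule.le_topologicalClosure _ (Submodule.subset_span ⟨i, j, a, rfl⟩)
    exact h2 (Cpt.dense_span_unit m)
  have h3 : closure (Submodule.span ℂ {y | ∃ m a, τ m a = y} : Set D) ⊆
      (Submodule.span ℂ {y | ∃ i j a, τ (Cpt.unit i j) a = y}).topologicalClosure :=
    closure_minimal (Submodule.span_le.mpr (by rintro _ ⟨m, a, rfl⟩; exact h1 m a))
      (Submodule.isClosed_topologicalClosure _)
  exact h3 (dense_span_of_denseRange_lift h.dense x)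

theorem exists_entry (i j : ι) : ∃ ε : D →ₗ[ℂ] A, Continuous ε ∧
    (∀ a, ε (τ (Cpt.unit i j) a) = a) ∧
      ∀ k l a, (i, j) ≠ (k, l) → ε (τ (Cpt.unit k l) a) = 0 := by
  obtain ⟨ε, hε⟩ := h.isStarMatrixSystem.exists_entry h.eq_zero_of_unit h.denseRange_matSum (i, j)
  have hs : ∀ k l a, matSum (fun i j => τ (Cpt.unit i j)) (Finsupp.single (k, l) a) =
      τ (Cpt.unit k l) a := fun k l a => matSum_single _ _ _
  refine ⟨ε.toLinearMap, ε.continuous, fun a => ?_, fun k l a hkl => ?_⟩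
  · change ε _ = _
    rw [← hs, hε, Finsupp.single_eq_same]
  · change ε _ = _
    rw [← hs, hε, Finsupp.single_eq_of_ne hkl]

theorem exists_lift {B : Type*} [NonUnitalCStarAlgebra B] {v : ι → ι → A →ₗ[ℂ] B}
    (hv : IsStarMatrixSystem v) :
    ∃ F : D →⋆ₙₐ[ℂ] B, ∀ i j a, F (τ (Cpt.unit i j) a) = v i j a := by
  obtain ⟨F, hF⟩ := h.isStarMatrixSystem.exists_lift h.eq_zero_of_unit h.denseRange_matSum hv
  refine ⟨F, fun i j a => ?_⟩
  have := hF (Finsupp.single (i, j) a)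
  rwa [matSum_single, matSum_single] at this

/-- The system `e_{ij} ⊗ f(a)` is again injective, and two injective systems over `A` give the same
norms; hence `F` is isometric on a dense subspace and thus everywhere. -/
theorem injective_of_map {A' D' : Type*} [NonUnitalCStarAlgebra A'] [NonUnitalCStarAlgebra D']
    {τ' : Cpt ι →ₗ[ℂ] A' →ₗ[ℂ] D'} (h' : IsStarTensor τ') (f : A →⋆ₙₐ[ℂ] A')
    (hf : Function.Injective f) (F : D →⋆ₙₐ[ℂ] D') (hF : ∀ m a, F (τ m a) = τ' m (f a)) :
    Function.Injective F := by
  let v : ι → ι → A →ₗ[ℂ] D' := fun i j => (τ' (Cpt.unit i j)).comp (f : A →ₗ[ℂ] A')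
  have hv' : ∀ i j a, v i j a = τ' (Cpt.unit i j) (f a) := fun _ _ _ => rfl
  have hv : IsStarMatrixSystem v :=
    { mul_same := fun i j k a b => by
        simp only [hv', map_mul]
        exact h'.isStarMatrixSystem.mul_same i j k _ _
      mul_ne := fun i j k l a b hjk => h'.isStarMatrixSystem.mul_ne i j k l _ _ hjk
      star_apply := fun i j a => by
        rw [hv', hv', map_star]
        exact h'.isStarMatrixSystem.star_apply i j _ }
  have hFv : ∀ x, F (matSum (fun i j => τ (Cpt.unit i j)) x) = matSum v x := fun x => by
    induction x using Finsupp.induction_linear with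
    | zero => simp
    | add x y hx hy => rw [map_add, map_add, hx, hy, map_add]
    | single p a => rw [matSum_single, matSum_single, hF, hv']
  have hn := h.isStarMatrixSystem.norm_eq_of_matSum h.eq_zero_of_unit h.denseRange_matSum hv
    (fun i j a ha => (map_eq_zero_iff f hf).mp (h'.eq_zero_of_unit i j _ ha)) hFv
  rw [injective_iff_map_eq_zero]
  intro y hy
  rw [← norm_eq_zero, ← hn, hy, norm_zero]

end IsStarTensor

end Entry

end CptTensor


/-! ### The C*-algebra `C*(E)` and its actions -/

section CoeffCStar

open scoped MultiplierAlgebra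

variable {G : Type u} [InverseMonoid G]

theorem commute_of_forall_mul_comm {R : Type*} [CStarAlgebra R] {s : Set R}
    (h1 : ∀ a ∈ s, ∀ b ∈ s, a * b = b * a) (h2 : ∀ a ∈ s, star a = a)
    (x y : (StarAlgebra.adjoin ℂ s).topologicalClosure) : x * y = y * x := by
  have hc : ∀ x y : StarAlgebra.adjoin ℂ s, x * y = y * x :=
    (StarAlgebra.isMulCommutative_adjoin ℂ h1 fun a ha b hb => by
      rw [h2 b hb, h1 a ha b hb]).is_comm.comm
  exact (StarSubalgebra.commSemiringTopologicalClosure _ hc).mul_comm x y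

namespace SemiChar

theorem eval_mul (e f : Idem G) : eval e * eval f = eval (e * f) := by
  ext ξ
  change (if ξ.toFun e then (1 : ℂ) else 0) * (if ξ.toFun f then 1 else 0) =
    if ξ.toFun (e * f) then 1 else 0
  rw [ξ.map_mul]
  cases ξ.toFun e <;> cases ξ.toFun f <;> simp

theorem star_eval (e : Idem G) : star (eval e) = eval e := by
  ext ξ
  change star (if ξ.toFun e then (1 : ℂ) else 0) = if ξ.toFun e then 1 else 0
  split <;> simp

theorem eval_ne_zero (e : Idem G) : eval e ≠ 0 := fun h => by
  have h1 : (if (⟨fun _ => true, fun _ _ => rfl⟩ : SemiChar G).toFun e then (1 : ℂ) else 0) = 0 :=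
    DFunLike.congr_fun h ⟨fun _ => true, fun _ _ => rfl⟩
  exact one_ne_zero h1

/-- The norm of a linear combination of commuting projections is dominated by the values of the
coefficients on semicharacters. -/
theorem norm_sum_le {R : Type*} [CStarAlgebra R] {p : Idem G → R}
    (hp : ∀ e f, p e * p f = p (e * f)) (hs : ∀ e, star (p e) = p e) (c : Idem G →₀ ℂ) :
    ‖c.sum fun e r => r • p e‖ ≤ ‖c.sum fun e r => r • (eval e : C(SemiChar G, ℂ)₀)‖ := by
  -- The projections generate a commutative unital C*-algebra, whose norm is the supremum over its
  -- characters.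
  let T := (StarAlgebra.adjoin ℂ (Set.range p)).topologicalClosure
  have hT : IsClosed (T : Set R) := StarSubalgebra.isClosed_topologicalClosure _
  let _ : CStarAlgebra T := StarSubalgebra.cstarAlgebra T
  let _ : CommCStarAlgebra T :=
    { mul_comm := commute_of_forall_mul_comm
        (by rintro _ ⟨e, rfl⟩ _ ⟨f, rfl⟩; rw [hp, hp, mul_comm])
        (by rintro _ ⟨e, rfl⟩; exact hs e) }
  let q : Idem G → T := fun e => ⟨p e, StarSubalgebra.le_topologicalClosure _
    (StarAlgebra.subset_adjoin ℂ _ ⟨e, rfl⟩)⟩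
  have hq : ∀ e f, q e * q f = q (e * f) := fun e f => Subtype.ext (hp e f)
  let a : T := c.sum fun e r => r • q e
  have ha : (a : R) = c.sum fun e r => r • p e := map_finsuppSum T.subtype _ _
  rw [← ha]
  change ‖a‖ ≤ _
  rw [← (gelfandTransform_isometry T).norm_map_of_map_zero (map_zero _) a,
    ContinuousMap.norm_le _ (norm_nonneg _)]
  intro χ
  have h1 : ∀ e, χ (q e) = 0 ∨ χ (q e) = 1 := fun e => by
    have h2 : χ (q e) * χ (q e) = χ (q e) := by
      rw [← _root_.map_mul, hq, show e * e = e from Subtype.ext e.2]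
    rcases eq_or_ne (χ (q e)) 0 with h | h
    · exact .inl h
    · exact .inr (mul_left_cancel₀ h (by rw [h2, mul_one]))
  -- A character takes the values `0` and `1` on projections and so restricts to a semicharacter,
  -- possibly the zero one, where both sums vanish.
  let ξ : SemiChar G := ⟨fun e => decide (χ (q e) = 1), fun e f => by
    rw [← hq, _root_.map_mul]
    rcases h1 e with h | h <;> rcases h1 f with h' | h' <;> simp [h, h']⟩
  have hξ : ∀ e, eval e ξ = χ (q e) := fun e => by
    change (if decide (χ (q e) = 1) then (1 : ℂ) else 0) = χ (q e)
    rcases h1 e with h | h <;> simp [h]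
  have h2 : (c.sum fun e r => r • (eval e : C(SemiChar G, ℂ)₀)) ξ = χ a := by
    let ev : C(SemiChar G, ℂ)₀ →ₗ[ℂ] ℂ :=
      { toFun := fun f => f ξ, map_add' := fun _ _ => rfl, map_smul' := fun _ _ => rfl }
    change ev _ = _
    rw [map_finsuppSum, map_finsuppSum]
    refine Finsupp.sum_congr fun e _ => ?_
    rw [map_smul, map_smul]
    exact congrArg _ (hξ e)
  change ‖χ a‖ ≤ _
  rw [← h2]
  exact ContinuousMap.norm_coe_le_norm ((c.sum fun e r => r • (eval e : C(SemiChar G, ℂ)₀) :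
    C(SemiChar G, ℂ)₀) : C(SemiChar G, ℂ)) ξ

/-- Evaluations separate semicharacters, so by Stone-Weierstrass constants together with the algebra
of evaluations are dense. An approximation `c + k` of `f` has small `c`, since `f` and `k` vanish at
the zero semicharacter; so `c` can be dropped. -/
theorem dense_span_eval : Dense (Submodule.span ℂ
    {y : C(SemiChar G, ℂ)₀ | ∃ e : Idem G, eval e = y} : Set C(SemiChar G, ℂ)₀) := by
  let s : Set C(SemiChar G, ℂ)₀ := {y | ∃ e : Idem G, eval e = y}
  let T := StarAlgebra.adjoin ℂ ((fun f : C(SemiChar G, ℂ)₀ => (f : C(SemiChar G, ℂ))) '' s)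
  have hT : ∀ x ∈ T, ∃ (c : ℂ) (f : C(SemiChar G, ℂ)₀), f ∈ NonUnitalStarAlgebra.adjoin ℂ s ∧
      x = algebraMap ℂ _ c + (f : C(SemiChar G, ℂ)) := by
    intro x hx
    induction hx using StarAlgebra.adjoin_induction with
    | mem x hx =>
      obtain ⟨f, hf, rfl⟩ := hx
      exact ⟨0, f, NonUnitalStarAlgebra.subset_adjoin ℂ _ hf, by rw [map_zero, zero_add]⟩
    | algebraMap c => exact ⟨c, 0, zero_mem _, (add_zero _).symm⟩
    | add x y _ _ hx hy =>
      obtain ⟨c, f, hf, rfl⟩ := hx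
      obtain ⟨d, k, hk, rfl⟩ := hy
      refine ⟨c + d, f + k, add_mem hf hk, ?_⟩
      ext ξ
      change c + f ξ + (d + k ξ) = (c + d) + (f ξ + k ξ)
      ring
    | mul x y _ _ hx hy =>
      obtain ⟨c, f, hf, rfl⟩ := hx
      obtain ⟨d, k, hk, rfl⟩ := hy
      refine ⟨c * d, c • k + d • f + f * k, add_mem (add_mem (SMulMemClass.smul_mem c hk)
        (SMulMemClass.smul_mem d hf)) (mul_mem hf hk), ?_⟩
      ext ξ
      change (c + f ξ) * (d + k ξ) = c * d + (c * k ξ + d * f ξ + f ξ * k ξ)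
      ring
    | star x _ hx =>
      obtain ⟨c, f, hf, rfl⟩ := hx
      refine ⟨star c, star f, star_mem hf, ?_⟩
      ext ξ
      exact star_add c (f ξ)
  have hsep : T.SeparatesPoints := by
    intro ξ η h
    obtain ⟨e, he⟩ : ∃ e, ξ.toFun e ≠ η.toFun e := by
      by_contra h'
      push Not at h'
      exact h (SemiChar.ext (funext h'))
    refine ⟨_, ⟨(eval e : C(SemiChar G, ℂ)), StarAlgebra.subset_adjoin ℂ _
      ⟨eval e, ⟨e, rfl⟩, rfl⟩, rfl⟩, ?_⟩
    change (if ξ.toFun e then (1 : ℂ) else 0) ≠ if η.toFun e then 1 else 0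
    cases h1 : ξ.toFun e <;> cases h2 : η.toFun e <;> simp_all
  have htop := ContinuousMap.starSubalgebra_topologicalClosure_eq_top_of_separatesPoints T hsep
  intro f
  rw [Metric.mem_closure_iff]
  intro ε hε
  have hf : (f : C(SemiChar G, ℂ)) ∈ T.topologicalClosure := by rw [htop]; trivial
  obtain ⟨x, hx, hfx⟩ := Metric.mem_closure_iff.mp hf (ε / 2) (half_pos hε)
  obtain ⟨c, k, hk, rfl⟩ := hT x hx
  refine ⟨k, mem_span_of_mem_starAdjoin ?_ ?_ hk, ?_⟩
  · rintro _ ⟨e, rfl⟩ _ ⟨e', rfl⟩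
    exact Submodule.subset_span ⟨e * e', (eval_mul e e').symm⟩
  · rintro _ ⟨e, rfl⟩
    exact Submodule.subset_span ⟨e, (star_eval e).symm⟩
  · have h0 : ∀ ξ, ‖f ξ - (c + k ξ)‖ ≤
        dist (f : C(SemiChar G, ℂ)) (algebraMap ℂ _ c + (k : C(SemiChar G, ℂ))) := fun ξ => by
      rw [dist_eq_norm]
      exact ContinuousMap.norm_coe_le_norm
        ((f : C(SemiChar G, ℂ)) - (algebraMap ℂ _ c + (k : C(SemiChar G, ℂ)))) ξ
    have h1 : ‖c‖ < ε / 2 := by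
      have := h0 0
      rw [map_zero, map_zero, add_zero, zero_sub, norm_neg] at this
      exact this.trans_lt hfx
    have h2 : ‖f - k‖ ≤ dist (f : C(SemiChar G, ℂ))
        (algebraMap ℂ _ c + (k : C(SemiChar G, ℂ))) + ‖c‖ := by
      rw [ContinuousMapZero.norm_def, ContinuousMap.norm_le _ (by positivity)]
      intro ξ
      calc ‖f ξ - k ξ‖ = ‖(f ξ - (c + k ξ)) + c‖ := by congr 1; ring
        _ ≤ _ := (norm_add_le _ _).trans (by gcongr; exact h0 ξ)
    rw [dist_eq_norm]
    linarith

end SemiChar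

/-- The action of `C*(E)` on a C*-algebra with an action of the idempotents. -/
theorem exists_coeff_action {X : Type*} [NonUnitalCStarAlgebra X] (γ : Idem G → X →⋆ₙₐ[ℂ] X)
    (h1 : ∀ e f x, γ (e * f) x = γ e (γ f x)) (h2 : ∀ e x y, γ e x * y = x * γ e y) :
    ∃ φ : C(SemiChar G, ℂ)₀ →L[ℂ] X →L[ℂ] X, ∀ e y, φ (SemiChar.eval e) y = γ e y := by
  let L : Idem G → X →L[ℂ] X := fun e =>
    { toFun := γ e, map_add' := map_add _, map_smul' := map_smul _,
      cont := NonUnitalStarAlgHom.continuous _ }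
  -- By the compatibility condition each idempotent acts as a central multiplier, and these
  -- multipliers are commuting projections.
  let p : Idem G → 𝓜(ℂ, X) := fun e => ⟨(L e, L e), h2 e⟩
  have hp : ∀ e f, p e * p f = p (e * f) := fun e f => by
    refine DoubleCentralizer.ext ℂ X _ _ (Prod.ext ?_ ?_)
    · ext x
      exact (h1 e f x).symm
    · ext x
      change γ f (γ e x) = γ (e * f) x
      rw [mul_comm, h1]
  have hs : ∀ e, star (p e) = p e := fun e => by
    refine DoubleCentralizer.ext ℂ X _ _ (Prod.ext ?_ ?_)
    · ext x
      change star (γ e (star x)) = γ e x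
      rw [map_star, star_star]
    · ext x
      change star (γ e (star x)) = γ e x
      rw [map_star, star_star]
  let E : (Idem G →₀ ℂ) →ₗ[ℂ] C(SemiChar G, ℂ)₀ :=
    Finsupp.lsum ℂ fun e => (LinearMap.lsmul ℂ C(SemiChar G, ℂ)₀).flip (SemiChar.eval e)
  let f : (Idem G →₀ ℂ) →ₗ[ℂ] X →L[ℂ] X :=
    Finsupp.lsum ℂ fun e => (LinearMap.lsmul ℂ (X →L[ℂ] X)).flip (L e)
  have hE : DenseRange E := by
    refine SemiChar.dense_span_eval.mono ?_
    have : Submodule.span ℂ {y : C(SemiChar G, ℂ)₀ | ∃ e : Idem G, SemiChar.eval e = y} ≤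
        LinearMap.range E := Submodule.span_le.mpr (by
      rintro _ ⟨e, rfl⟩
      exact ⟨Finsupp.single e 1, by simp [E]⟩)
    exact this
  -- With this bound the action extends from linear combinations of idempotents to `C*(E)`.
  have hn : ∀ c, ‖f c‖ ≤ 1 * ‖E c‖ := fun c => by
    have h3 := SemiChar.norm_sum_le hp hs c
    have h4 : f c = (c.sum fun e r => r • p e).fst := by
      let F : 𝓜(ℂ, X) →ₗ[ℂ] X →L[ℂ] X :=
        { toFun := fun m => m.fst, map_add' := fun _ _ => rfl, map_smul' := fun _ _ => rfl }
      change f c = F _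
      rw [map_finsuppSum]
      rfl
    rw [h4, DoubleCentralizer.norm_fst, one_mul]
    exact h3
  refine ⟨f.extendOfNorm E, fun e y => ?_⟩
  have h5 := LinearMap.extendOfNorm_eq hE ⟨1, hn⟩ (Finsupp.single e 1)
  have h6 : E (Finsupp.single e 1) = SemiChar.eval e := by simp [E]
  have h7 : f (Finsupp.single e 1) = L e := by simp [f]
  rw [h6, h7] at h5
  rw [h5]
  rfl

end CoeffCStar


/-! ### Semidirect products and pullbacks of C*-algebras -/

section CStarSemidirect

open scoped MultiplierAlgebra

/-- Closed graph theorem: if `w_n → x` and `f(w_n) → y`, then `v y = k(v) x = v f(x)` for all `v`,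
and left multiplications separate the points of a C*-algebra. -/
theorem LinearMap.continuous_of_mul_eq {D : Type*} [NonUnitalCStarAlgebra D] {f k : D →ₗ[ℂ] D}
    (h : ∀ v w, v * f w = k v * w) : Continuous f := by
  refine LinearMap.continuous_of_seq_closed_graph _ fun w x y hw hy => ?_
  have h1 : ∀ v, v * y = v * f x := fun v => by
    have h2 : Tendsto (fun n => v * f (w n)) atTop (𝓝 (v * y)) := tendsto_const_nhds.mul hy
    have h3 : Tendsto (fun n => k v * w n) atTop (𝓝 (k v * x)) := tendsto_const_nhds.mul hw
    simp only [h] at h2 ⊢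
    exact tendsto_nhds_unique h2 h3
  have h2 := h1 (star (y - f x))
  rw [← sub_eq_zero, ← mul_sub, CStarRing.star_mul_self_eq_zero_iff] at h2
  exact sub_eq_zero.mp h2

variable {D A : Type u} [NonUnitalCStarAlgebra D] [NonUnitalCStarAlgebra A]
  {L R : A →ₗ[ℂ] D →ₗ[ℂ] D}

namespace IsBiaction

theorem continuous_left (h : IsBiaction L R) (a : A) : Continuous (L a) :=
  LinearMap.continuous_of_mul_eq fun v w => (h.middle a v w).symm

theorem continuous_right (h : IsBiaction L R) (hs : ∀ a v, star (L a v) = R (star a) (star v))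
    (a : A) : Continuous (R a) := by
  have h1 : ∀ v, R a v = star (L (star a) (star v)) := fun v => by rw [hs, star_star, star_star]
  simp only [show ⇑(R a) = fun v => star (L (star a) (star v)) from funext h1]
  exact continuous_star.comp ((h.continuous_left (star a)).comp continuous_star)

/-- The homomorphism to the multiplier algebra given by a biaction. -/
noncomputable def toMultiplier (h : IsBiaction L R)
    (hs : ∀ a v, star (L a v) = R (star a) (star v)) : A →⋆ₙₐ[ℂ] 𝓜(ℂ, D) where
  toFun a := ⟨(⟨L a, h.continuous_left a⟩, ⟨R a, h.continuous_right hs a⟩), h.middle a⟩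
  map_smul' c a := DoubleCentralizer.ext ℂ D _ _ (Prod.ext
    (ContinuousLinearMap.ext fun v => LinearMap.congr_fun (map_smul L c a) v)
    (ContinuousLinearMap.ext fun v => LinearMap.congr_fun (map_smul R c a) v))
  map_zero' := DoubleCentralizer.ext ℂ D _ _ (Prod.ext
    (ContinuousLinearMap.ext fun v => LinearMap.congr_fun (map_zero L) v)
    (ContinuousLinearMap.ext fun v => LinearMap.congr_fun (map_zero R) v))
  map_add' a b := DoubleCentralizer.ext ℂ D _ _ (Prod.ext
    (ContinuousLinearMap.ext fun v => LinearMap.congr_fun (map_add L a b) v)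
    (ContinuousLinearMap.ext fun v => LinearMap.congr_fun (map_add R a b) v))
  map_mul' a b := DoubleCentralizer.ext ℂ D _ _ (Prod.ext
    (ContinuousLinearMap.ext fun v => h.left_mul a b v)
    (ContinuousLinearMap.ext fun v => h.right_mul a b v))
  map_star' a := DoubleCentralizer.ext ℂ D _ _ (Prod.ext
    (ContinuousLinearMap.ext fun v => by
      change L (star a) v = star (R a (star v))
      have := hs (star a) v
      rw [star_star] at this
      rw [← this, star_star])
    (ContinuousLinearMap.ext fun v => by
      change R (star a) v = star (L a (star v))
      rw [hs, star_star]))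

theorem toMultiplier_mul_coe (h : IsBiaction L R)
    (hs : ∀ a v, star (L a v) = R (star a) (star v)) (a : A) (v : D) :
    h.toMultiplier hs a * DoubleCentralizer.coeHom (𝕜 := ℂ) v = DoubleCentralizer.coeHom (L a v) :=
  DoubleCentralizer.ext ℂ D _ _ (Prod.ext
    (ContinuousLinearMap.ext fun w => h.left_assoc a v w)
    (ContinuousLinearMap.ext fun w => h.middle a w v))

theorem coe_mul_toMultiplier (h : IsBiaction L R)
    (hs : ∀ a v, star (L a v) = R (star a) (star v)) (a : A) (v : D) :
    DoubleCentralizer.coeHom (𝕜 := ℂ) v * h.toMultiplier hs a = DoubleCentralizer.coeHom (R a v) :=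
  DoubleCentralizer.ext ℂ D _ _ (Prod.ext
    (ContinuousLinearMap.ext fun w => (h.middle a v w).symm)
    (ContinuousLinearMap.ext fun w => h.right_assoc a w v))

theorem coeHom_injective : Function.Injective (DoubleCentralizer.coeHom (𝕜 := ℂ) (A := D)) := by
  rw [injective_iff_map_eq_zero]
  intro v hv
  have h1 : v * star v = 0 := congrArg (fun m : 𝓜(ℂ, D) => m.fst (star v)) hv
  exact (CStarRing.mul_star_self_eq_zero_iff v).mp h1

/-- The C*-algebra structure on `D ⊕ A` given by a biaction of `A` on `D`. -/
theorem exists_cstarAlgebra (h : IsBiaction L R)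
    (hs : ∀ a v, star (L a v) = R (star a) (star v)) :
    ∃ (Q : Type u) (_ : NonUnitalCStarAlgebra Q) (E : D × A ≃ Q),
      (∀ z w, E z + E w = E (z + w)) ∧ (∀ (c : ℂ) z, c • E z = E (c • z)) ∧
      (∀ z w, E z * E w = E (z.1 * w.1 + L z.2 w.1 + R w.2 z.1, z.2 * w.2)) ∧
      ∀ z, star (E z) = E (star z) := by
  -- `D ⊕ A` is realized in `𝓜(D) × A` by `(v, a) ↦ (v + θ(a), a)`, from which it takes its norm.
  let θ := h.toMultiplier hs
  let κ : D →⋆ₙₐ[ℂ] 𝓜(ℂ, D) := DoubleCentralizer.coeHom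
  have hm : ∀ z w : D × A, (κ z.1 + θ z.2) * (κ w.1 + θ w.2) =
      κ (z.1 * w.1 + L z.2 w.1 + R w.2 z.1) + θ (z.2 * w.2) := fun z w => by
    rw [add_mul, mul_add, mul_add, h.toMultiplier_mul_coe hs, h.coe_mul_toMultiplier hs,
      map_add κ, map_add κ, map_mul κ, map_mul θ]
    abel
  let S : NonUnitalStarSubalgebra ℂ (𝓜(ℂ, D) × A) :=
    { carrier := {z | ∃ v, κ v = z.1 - θ z.2}
      add_mem' := by
        rintro z w ⟨v, hv⟩ ⟨v', hv'⟩
        exact ⟨v + v', by rw [map_add, hv, hv', Prod.fst_add, Prod.snd_add, map_add]; abel⟩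
      zero_mem' := ⟨0, by simp⟩
      smul_mem' := by
        rintro c z ⟨v, hv⟩
        exact ⟨c • v, by rw [map_smul, hv, Prod.smul_fst, Prod.smul_snd, map_smul, smul_sub]⟩
      mul_mem' := by
        rintro z w ⟨v, hv⟩ ⟨v', hv'⟩
        refine ⟨v * v' + L z.2 v' + R w.2 v, ?_⟩
        have := hm (v, z.2) (v', w.2)
        simp only [hv, hv', sub_add_cancel] at this
        rw [Prod.fst_mul, Prod.snd_mul, this, add_sub_cancel_right]
      star_mem' := by
        rintro z ⟨v, hv⟩
        exact ⟨star v, by rw [map_star, hv, Prod.fst_star, Prod.snd_star, map_star, star_sub]⟩ }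
  -- `D` is closed in its multiplier algebra, being embedded isometrically, and `(m, a) ↦ m - θ(a)`
  -- is continuous.
  have hcl : IsClosed (S : Set (𝓜(ℂ, D) × A)) := by
    have h1 : IsClosed (Set.range κ) :=
      (NonUnitalStarAlgHom.isometry κ coeHom_injective).isClosedEmbedding.isClosed_range
    exact h1.preimage (continuous_fst.sub
      ((NonUnitalStarAlgHom.continuous θ).comp continuous_snd))
  let E : D × A → S := fun z => ⟨(κ z.1 + θ z.2, z.2), z.1, by simp⟩
  have hE : Function.Bijective E := by
    constructor
    · intro z w hzw
      have h1 : κ z.1 + θ z.2 = κ w.1 + θ w.2 := congrArg (fun x : S => x.1.1) hzw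
      have h2 : z.2 = w.2 := congrArg (fun x : S => x.1.2) hzw
      rw [h2] at h1
      exact Prod.ext (coeHom_injective (add_right_cancel h1)) h2
    · rintro ⟨z, v, hv⟩
      exact ⟨(v, z.2), Subtype.ext (Prod.ext (by
        change κ v + θ z.2 = z.1
        rw [hv, sub_add_cancel]) rfl)⟩
  refine ⟨S, NonUnitalStarSubalgebra.nonUnitalCStarAlgebra S, Equiv.ofBijective E hE,
    fun z w => Subtype.ext (Prod.ext ?_ rfl), fun c z => Subtype.ext (Prod.ext ?_ rfl),
    fun z w => Subtype.ext (Prod.ext (hm z w) rfl), fun z => Subtype.ext (Prod.ext ?_ rfl)⟩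
  · change κ z.1 + θ z.2 + (κ w.1 + θ w.2) = κ (z.1 + w.1) + θ (z.2 + w.2)
    rw [map_add, map_add]
    abel
  · change c • (κ z.1 + θ z.2) = κ (c • z.1) + θ (c • z.2)
    rw [map_smul, map_smul, smul_add]
  · change star (κ z.1 + θ z.2) = κ (star z.1) + θ (star z.2)
    rw [map_star, map_star, star_add]

end IsBiaction

variable {G : Type u} [InverseMonoid G]

/-- The C*-structure comes from `exists_cstarAlgebra`; everything else is transported along the
bijection with `D × A`. -/
theorem CGAlg.exists_semidirect {D A : CGAlg G} (L R : A.carrier →ₗ[ℂ] D.carrier →ₗ[ℂ] D.carrier)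
    (h : IsBiaction L R) (hL : ∀ g a v, D.act g (L a v) = L (A.act g a) (D.act g v))
    (hR : ∀ g a v, D.act g (R a v) = R (A.act g a) (D.act g v))
    (hL' : ∀ (e : Idem G) a v, L (A.act e.1 a) v = L a (D.act e.1 v))
    (hR' : ∀ (e : Idem G) a v, R (A.act e.1 a) v = R a (D.act e.1 v))
    (hs : ∀ a v, star (L a v) = R (star a) (star v)) :
    ∃ (Q : CGAlg G) (i : CGAlg.Hom D Q) (p : CGAlg.Hom Q A) (r : CGAlg.Hom A Q),
      (Function.Injective i.toHom ∧ (∀ x, p.toHom x = 0 ↔ ∃ j, i.toHom j = x) ∧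
        ∀ a, p.toHom (r.toHom a) = a) ∧
      (∀ a v, r.toHom a * i.toHom v = i.toHom (L a v)) ∧
        ∀ a v, i.toHom v * r.toHom a = i.toHom (R a v) := by
  obtain ⟨Q₀, _, E, hadd, hsmul, hmul, hstar⟩ := h.exists_cstarAlgebra hs
  have hzero : E 0 = 0 := by
    have := hsmul 0 0
    rw [zero_smul, zero_smul] at this
    exact this.symm
  have hstar' : ∀ v a, star (E (v, a)) = E (star v, star a) := fun v a => hstar (v, a)
  have hadd' : ∀ v a w b, E (v, a) + E (w, b) = E (v + w, a + b) := fun v a w b => hadd _ _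
  have hsmul' : ∀ (c : ℂ) v a, c • E (v, a) = E (c • v, c • a) := fun c v a => hsmul _ _
  have hmul' : ∀ v a w b, E (v, a) * E (w, b) = E (v * w + L a w + R b v, a * b) :=
    fun v a w b => hmul _ _
  have hE : ∀ x, ∃ v a, E (v, a) = x := fun x => ⟨(E.symm x).1, (E.symm x).2, E.apply_symm_apply x⟩
  have hfst : ∀ v a, (E.symm (E (v, a))).1 = v := fun v a => by rw [E.symm_apply_apply]
  have hsnd : ∀ v a, (E.symm (E (v, a))).2 = a := fun v a => by rw [E.symm_apply_apply]
  let α : G → Q₀ →⋆ₙₐ[ℂ] Q₀ := fun g =>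
    { toFun := fun x => E (D.act g (E.symm x).1, A.act g (E.symm x).2)
      map_smul' := fun c x => by
        obtain ⟨v, a, rfl⟩ := hE x
        change E _ = c • E _
        simp only [hsmul', hfst, hsnd, map_smul]
      map_zero' := by
        rw [← hzero, E.symm_apply_apply]
        simp only [Prod.fst_zero, Prod.snd_zero, map_zero]
        rfl
      map_add' := fun x y => by
        obtain ⟨v, a, rfl⟩ := hE x
        obtain ⟨w, b, rfl⟩ := hE y
        simp only [hadd', hfst, hsnd, map_add]
      map_mul' := fun x y => by
        obtain ⟨v, a, rfl⟩ := hE x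
        obtain ⟨w, b, rfl⟩ := hE y
        simp only [hmul', hfst, hsnd, map_add, map_mul, hL, hR]
      map_star' := fun x => by
        obtain ⟨v, a, rfl⟩ := hE x
        simp only [hstar', hfst, hsnd, map_star] }
  have hα : ∀ g v a, α g (E (v, a)) = E (D.act g v, A.act g a) := fun g v a => by
    change E _ = _
    rw [hfst, hsnd]
  let Q : CGAlg G :=
    { carrier := Q₀
      act := α
      act_one := fun x => by
        obtain ⟨v, a, rfl⟩ := hE x
        rw [hα, D.act_one, A.act_one]
      act_mul := fun g k x => by
        obtain ⟨v, a, rfl⟩ := hE x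
        rw [hα, hα, hα, D.act_mul, A.act_mul]
      compat := fun e x y => by
        obtain ⟨v, a, rfl⟩ := hE x
        obtain ⟨w, b, rfl⟩ := hE y
        rw [hα, hα, hmul', hmul', D.compat, A.compat, hL', hR'] }
  refine ⟨Q, ⟨{
      toFun := fun v => E (v, 0)
      map_smul' := fun c x => by
        change E _ = c • E _
        rw [hsmul', smul_zero]
      map_zero' := hzero
      map_add' := fun x y => by rw [hadd', add_zero]
      map_mul' := fun x y => by
        rw [hmul', map_zero, map_zero, LinearMap.zero_apply, LinearMap.zero_apply, add_zero,
          add_zero, mul_zero]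
      map_star' := fun x => by rw [hstar', star_zero] }, fun g v => ?_⟩, ⟨{
      toFun := fun x => (E.symm x).2
      map_smul' := fun c x => by
        obtain ⟨v, a, rfl⟩ := hE x
        change (E.symm (c • E _)).2 = c • (E.symm (E _)).2
        rw [hsmul', hsnd, hsnd]
      map_zero' := by
        change (E.symm 0).2 = 0
        rw [← hzero, E.symm_apply_apply]
        rfl
      map_add' := fun x y => by
        obtain ⟨v, a, rfl⟩ := hE x
        obtain ⟨w, b, rfl⟩ := hE y
        change (E.symm (E _ + E _)).2 = _
        rw [hadd', hsnd, hsnd, hsnd]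
      map_mul' := fun x y => by
        obtain ⟨v, a, rfl⟩ := hE x
        obtain ⟨w, b, rfl⟩ := hE y
        change (E.symm (E _ * E _)).2 = _
        rw [hmul', hsnd, hsnd, hsnd]
      map_star' := fun x => by
        obtain ⟨v, a, rfl⟩ := hE x
        change (E.symm (star (E _))).2 = _
        rw [hstar', hsnd, hsnd] }, fun g x => ?_⟩, ⟨{
      toFun := fun a => E (0, a)
      map_smul' := fun c x => by
        change E _ = c • E _
        rw [hsmul', smul_zero]
      map_zero' := hzero
      map_add' := fun x y => by rw [hadd', add_zero]
      map_mul' := fun x y => by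
        rw [hmul', map_zero, map_zero, add_zero, add_zero, mul_zero]
      map_star' := fun x => by rw [hstar', star_zero] }, fun g v => ?_⟩, ⟨?_, ?_, fun a => hsnd _ _⟩,
      ?_, ?_⟩
  · change E _ = α g (E _)
    rw [hα, map_zero]
  · obtain ⟨v, a, rfl⟩ := hE x
    change (E.symm (α g (E _))).2 = A.act g (E.symm (E _)).2
    rw [hα, hsnd, hsnd]
  · change E _ = α g (E _)
    rw [hα, map_zero]
  · intro x y hxy
    have h1 : E (x, 0) = E (y, 0) := hxy
    exact congrArg Prod.fst (E.injective h1)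
  · intro x
    constructor
    · intro hx
      obtain ⟨v, a, rfl⟩ := hE x
      have h1 : a = 0 := by rw [← hsnd v a]; exact hx
      exact ⟨v, by rw [h1]; rfl⟩
    · rintro ⟨j, rfl⟩
      exact hsnd _ _
  · intro a v
    change E (0, a) * E (v, 0) = E (L a v, 0)
    rw [hmul', map_zero, zero_mul, zero_add, add_zero, mul_zero]
  · intro a v
    change E (v, 0) * E (0, a) = E (R a v, 0)
    rw [hmul', map_zero, mul_zero, zero_add, zero_add, zero_mul]

theorem CGAlg.exists_pullback {X A B : CGAlg G} (f : CGAlg.Hom X B) (k : CGAlg.Hom A B) :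
    ∃ (Q : CGAlg G) (p : CGAlg.Hom Q X) (q : CGAlg.Hom Q A),
      (∀ z, f.toHom (p.toHom z) = k.toHom (q.toHom z)) ∧
      (∀ z w, p.toHom z = p.toHom w → q.toHom z = q.toHom w → z = w) ∧
      ∀ x a, f.toHom x = k.toHom a → ∃ z, p.toHom z = x ∧ q.toHom z = a := by
  let C : NonUnitalStarSubalgebra ℂ (X.carrier × A.carrier) :=
    { carrier := {z | f.toHom z.1 = k.toHom z.2}
      add_mem' := fun {a b} ha hb => by
        change f.toHom (a.1 + b.1) = k.toHom (a.2 + b.2)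
        rw [map_add, map_add, ha.out, hb.out]
      zero_mem' := by
        change f.toHom 0 = k.toHom 0
        rw [map_zero, map_zero]
      smul_mem' := fun c a ha => by
        change f.toHom (c • a.1) = k.toHom (c • a.2)
        rw [map_smul, map_smul, ha.out]
      mul_mem' := fun {a b} ha hb => by
        change f.toHom (a.1 * b.1) = k.toHom (a.2 * b.2)
        rw [map_mul, map_mul, ha.out, hb.out]
      star_mem' := fun {a} ha => by
        change f.toHom (star a.1) = k.toHom (star a.2)
        rw [map_star, map_star, ha.out] }
  have hC : IsClosed (C : Set (X.carrier × A.carrier)) :=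
    isClosed_eq ((NonUnitalStarAlgHom.continuous f.toHom).comp continuous_fst)
      ((NonUnitalStarAlgHom.continuous k.toHom).comp continuous_snd)
  let _ : NonUnitalCStarAlgebra C := NonUnitalStarSubalgebra.nonUnitalCStarAlgebra C
  let Q : CGAlg G :=
    { carrier := C
      act := fun g =>
        { toFun := fun z => ⟨(X.act g z.1.1, A.act g z.1.2), by
            change f.toHom (X.act g z.1.1) = k.toHom (A.act g z.1.2)
            rw [f.map_act, k.map_act, z.2.out]⟩
          map_smul' := fun c x => Subtype.ext (Prod.ext (map_smul _ _ _) (map_smul _ _ _))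
          map_zero' := Subtype.ext (Prod.ext (map_zero _) (map_zero _))
          map_add' := fun x y => Subtype.ext (Prod.ext (map_add _ _ _) (map_add _ _ _))
          map_mul' := fun x y => Subtype.ext (Prod.ext (map_mul _ _ _) (map_mul _ _ _))
          map_star' := fun x => Subtype.ext (Prod.ext (map_star _ _) (map_star _ _)) }
      act_one := fun x => Subtype.ext (Prod.ext (X.act_one _) (A.act_one _))
      act_mul := fun g k x => Subtype.ext (Prod.ext (X.act_mul _ _ _) (A.act_mul _ _ _))
      compat := fun e x y => Subtype.ext (Prod.ext (X.compat _ _ _) (A.compat _ _ _)) }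
  exact ⟨Q,
    ⟨{ toFun := fun z => z.1.1, map_smul' := fun _ _ => rfl, map_zero' := rfl,
       map_add' := fun _ _ => rfl, map_mul' := fun _ _ => rfl, map_star' := fun _ => rfl },
      fun _ _ => rfl⟩,
    ⟨{ toFun := fun z => z.1.2, map_smul' := fun _ _ => rfl, map_zero' := rfl,
       map_add' := fun _ _ => rfl, map_mul' := fun _ _ => rfl, map_star' := fun _ => rfl },
      fun _ _ => rfl⟩,
    fun z => z.2, fun z w h1 h2 => Subtype.ext (Prod.ext h1 h2),
    fun x a h => ⟨⟨(x, a), h⟩, rfl, rfl⟩⟩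

end CStarSemidirect


/-! ### Faithful matrix systems from GNS representations -/

section FaithfulSystem

open scoped ComplexOrder ENNReal

/-- Hahn-Banach separates `-x` from the closed convex cone of positive elements. The separating
functional is nonnegative on the cone and positive at `x`; it remains to make it complex linear. -/
theorem exists_positive_functional {A : Type*} [NonUnitalCStarAlgebra A] [PartialOrder A]
    [StarOrderedRing A] {x : A} (hx : 0 ≤ x) (h0 : x ≠ 0) : ∃ f : A →ₚ[ℂ] ℂ, f x ≠ 0 := by
  have h1 : -x ∉ {y : A | 0 ≤ y} := fun h => h0 (le_antisymm (neg_nonneg.mp h) hx)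
  have hconv : Convex ℝ {y : A | 0 ≤ y} := fun y hy z hz a b ha hb _ =>
    add_nonneg (smul_nonneg ha hy) (smul_nonneg hb hz)
  obtain ⟨f, u, hu, hf⟩ := geometric_hahn_banach_point_closed hconv
    CStarAlgebra.isClosed_nonneg h1
  have hu0 : u < 0 := by
    have := hf 0 (le_refl (0 : A))
    rwa [map_zero] at this
  have hfx : 0 < f x := by
    rw [map_neg] at hu
    linarith
  have hpos : ∀ y : A, 0 ≤ y → 0 ≤ f y := fun y hy => by
    by_contra h
    push Not at h
    -- Were `f y` negative, this positive multiple of `y` would have value exactly `u`, against the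
    -- strict separation.
    have h2 := hf ((u / f y) • y) (smul_nonneg (div_nonneg_of_nonpos hu0.le h.le) hy)
    rw [map_smul, smul_eq_mul, div_mul_cancel₀ _ h.ne] at h2
    exact lt_irrefl _ h2
  -- Symmetrizing makes the complexification real on selfadjoint elements, with value `2 f(y)`
  -- there.
  let k : Module.Dual ℝ A :=
    { toFun := fun a => f (a + star a)
      map_add' := fun a b => by rw [star_add, ← map_add]; congr 1; abel
      map_smul' := fun c a => by
        rw [star_smul, star_trivial, ← smul_add, map_smul, RingHom.id_apply] }
  have hk : ∀ y : A, IsSelfAdjoint y → k.extendRCLike (𝕜 := ℂ) y = ((f y + f y : ℝ) : ℂ) := by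
    intro y hy
    have h2 : k y = f y + f y := by
      change f (y + star y) = _
      rw [hy.star_eq, map_add]
    have h3 : k (Complex.I • y) = 0 := by
      change f (Complex.I • y + star (Complex.I • y)) = 0
      rw [star_smul, hy.star_eq, Complex.star_def, Complex.conj_I, neg_smul, add_neg_cancel,
        map_zero]
    rw [Module.Dual.extendRCLike_apply]
    change ((k y : ℝ) : ℂ) - Complex.I * ((k (Complex.I • y) : ℝ) : ℂ) = _
    rw [h2, h3, Complex.ofReal_zero, mul_zero, sub_zero]
  refine ⟨PositiveLinearMap.mk₀ (k.extendRCLike (𝕜 := ℂ)) fun y hy => ?_, ?_⟩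
  · rw [hk y (IsSelfAdjoint.of_nonneg hy)]
    exact Complex.zero_le_real.mpr (add_nonneg (hpos y hy) (hpos y hy))
  · change k.extendRCLike (𝕜 := ℂ) x ≠ 0
    rw [hk x (IsSelfAdjoint.of_nonneg hx)]
    exact Complex.ofReal_ne_zero.mpr (add_pos hfx hfx).ne'

/-- Without a unit there is no obvious cyclic vector, so `a` is applied to the vector of `a*`: the
squared norm of the result is `f((a a*)* (a a*))`, and some positive `f` is nonzero there unless `a
a* = 0`. -/
theorem eq_zero_of_gns {A : Type*} [NonUnitalCStarAlgebra A] [PartialOrder A]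
    [StarOrderedRing A] {a : A} (h : ∀ f : A →ₚ[ℂ] ℂ, f.gnsNonUnitalStarAlgHom a = 0) : a = 0 := by
  refine (CStarRing.mul_star_self_eq_zero_iff a).mp ?_
  set b := star a
  by_contra hab
  have h1 : star (a * b) * (a * b) ≠ 0 := fun h => hab ((CStarRing.star_mul_self_eq_zero_iff _).mp h)
  obtain ⟨f, hf⟩ := exists_positive_functional (star_mul_self_nonneg (a * b)) h1
  refine hf ?_
  have h2 : f.gnsNonUnitalStarAlgHom a (f.toPreGNS b) = 0 := by rw [h f]; rfl
  rw [f.gnsNonUnitalStarAlgHom_apply_coe] at h2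
  have h3 := f.preGNS_norm_sq (f.leftMulMapPreGNS a (f.toPreGNS b))
  rw [← UniformSpace.Completion.norm_coe, h2, norm_zero] at h3
  have h4 : f.ofPreGNS (f.leftMulMapPreGNS a (f.toPreGNS b)) = a * b := rfl
  rw [h4] at h3
  rw [← h3]
  norm_num

section Operators

variable {ι : Type*} {H : Type*} [NormedAddCommGroup H] [InnerProductSpace ℂ H] [CompleteSpace H]

open Classical in
/-- The operator `e_{ij} ⊗ T` on `ℓ²(ι, H)`. -/
noncomputable def opUnit (i j : ι) :
    (H →L[ℂ] H) →ₗ[ℂ] lp (fun _ : ι => H) 2 →L[ℂ] lp (fun _ : ι => H) 2 where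
  toFun T := (lp.singleContinuousLinearMap ℂ (fun _ : ι => H) 2 i).comp
    (T.comp (lp.evalCLM ℂ (fun _ : ι => H) 2 j))
  map_add' S T := by
    ext1 v
    exact lp.single_add 2 i _ _
  map_smul' c T := by
    ext1 v
    exact lp.single_smul 2 i _ _

open Classical in
omit [CompleteSpace H] in
theorem opUnit_apply (i j : ι) (T : H →L[ℂ] H) (v : lp (fun _ : ι => H) 2) :
    opUnit i j T v = lp.single 2 i (T (v j)) := rfl

theorem isStarMatrixSystem_opUnit : IsStarMatrixSystem (opUnit (ι := ι) (H := H)) where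
  mul_same i j k S T := by
    classical
    ext1 v
    rw [mul_apply_eq_comp, opUnit_apply, opUnit_apply, opUnit_apply, lp.single_apply_self]
    rfl
  mul_ne i j k l S T hjk := by
    classical
    ext1 v
    rw [mul_apply_eq_comp, opUnit_apply, opUnit_apply, lp.single_apply_ne _ _ _ hjk, map_zero,
      lp.single_zero]
    rfl
  star_apply i j T := by
    classical
    rw [ContinuousLinearMap.star_eq_adjoint, ContinuousLinearMap.star_eq_adjoint]
    refine ((ContinuousLinearMap.eq_adjoint_iff _ _).mpr fun x y => ?_).symm
    rw [opUnit_apply, opUnit_apply, lp.inner_single_left, lp.inner_single_right,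
      ContinuousLinearMap.adjoint_inner_left]

omit [CompleteSpace H] in
theorem norm_opUnit_le (i j : ι) (T : H →L[ℂ] H) : ‖opUnit i j T‖ ≤ ‖T‖ := by
  classical
  refine ContinuousLinearMap.opNorm_le_bound _ (norm_nonneg _) fun v => ?_
  rw [opUnit_apply, lp.norm_single (by norm_num)]
  exact (T.le_opNorm _).trans (by gcongr; exact lp.norm_apply_le_norm (by norm_num) v j)

omit [CompleteSpace H] in
theorem eq_zero_of_opUnit (i j : ι) (T : H →L[ℂ] H) (h : opUnit i j T = 0) : T = 0 := by
  classical
  ext x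
  have h1 := congrArg (fun f : lp (fun _ : ι => H) 2 →L[ℂ] lp (fun _ : ι => H) 2 =>
    f (lp.single 2 j x) i) h
  change opUnit i j T (lp.single 2 j x) i = 0 at h1
  rwa [opUnit_apply, lp.single_apply_self, lp.single_apply_self] at h1

end Operators

/-- A matrix system which is a module over a system of matrix units. -/
structure IsUnitalSystem {ι A B : Type*} [NonUnitalCStarAlgebra A] [NonUnitalCStarAlgebra B]
    (u : ι → ι → A →ₗ[ℂ] B) (h : ι → ι → B) : Prop extends IsStarMatrixSystem u where
  unit_mul_same : ∀ i j k, h i j * h j k = h i k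
  unit_mul_ne : ∀ i j k l, j ≠ k → h i j * h k l = 0
  star_unit : ∀ i j, star (h i j) = h j i
  unit_mul_apply : ∀ i j k a, h i j * u j k a = u i k a
  unit_mul_apply_ne : ∀ i j k l a, j ≠ k → h i j * u k l a = 0

theorem isUnitalSystem_opUnit {ι A H : Type*} [NonUnitalCStarAlgebra A] [NormedAddCommGroup H]
    [InnerProductSpace ℂ H] [CompleteSpace H] (π : A →⋆ₙₐ[ℂ] (H →L[ℂ] H)) :
    IsUnitalSystem (B := lp (fun _ : ι => H) 2 →L[ℂ] lp (fun _ : ι => H) 2)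
      (fun i j : ι => (opUnit i j).comp (π : A →ₗ[ℂ] (H →L[ℂ] H)))
      fun i j => opUnit i j (1 : H →L[ℂ] H) where
  mul_same i j k a b := by
    change opUnit i j (π a) * opUnit j k (π b) = opUnit i k (π (a * b))
    rw [map_mul]
    exact isStarMatrixSystem_opUnit.mul_same _ _ _ _ _
  mul_ne i j k l a b hjk := isStarMatrixSystem_opUnit.mul_ne _ _ _ _ _ _ hjk
  star_apply i j a := by
    change star (opUnit i j (π a)) = opUnit j i (π (star a))
    rw [map_star]
    exact isStarMatrixSystem_opUnit.star_apply _ _ _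
  unit_mul_same i j k := (isStarMatrixSystem_opUnit.mul_same _ _ _ _ _).trans (by rw [mul_one])
  unit_mul_ne i j k l hjk := isStarMatrixSystem_opUnit.mul_ne _ _ _ _ _ _ hjk
  star_unit i j := ((isStarMatrixSystem_opUnit (ι := ι) (H := H)).star_apply i j 1).trans (by rw [star_one])
  unit_mul_apply i j k a :=
    (isStarMatrixSystem_opUnit.mul_same _ _ _ _ _).trans (by rw [one_mul]; rfl)
  unit_mul_apply_ne i j k l a hjk := isStarMatrixSystem_opUnit.mul_ne _ _ _ _ _ _ hjk

/-- The product of a bounded family of matrix systems. -/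
theorem exists_prod_system {ι A Φ : Type u} [NonUnitalCStarAlgebra A] {W : Φ → Type u}
    [∀ f, NonUnitalCStarAlgebra (W f)] {u : ∀ f, ι → ι → A →ₗ[ℂ] W f} {h : ∀ f, ι → ι → W f}
    (hu : ∀ f, IsUnitalSystem (u f) (h f)) (hun : ∀ f i j a, ‖u f i j a‖ ≤ ‖a‖)
    (hhn : ∀ f i j, ‖h f i j‖ ≤ 1) (h0 : ∀ i j a, (∀ f, u f i j a = 0) → a = 0) :
    ∃ (B : Type u) (_ : NonUnitalCStarAlgebra B) (v : ι → ι → A →ₗ[ℂ] B) (k : ι → ι → B),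
      IsUnitalSystem v k ∧ ∀ i j a, v i j a = 0 → a = 0 := by
  let v : ι → ι → A →ₗ[ℂ] lp W ∞ := fun i j =>
    { toFun := fun a => ⟨fun f => u f i j a, memℓp_infty ⟨‖a‖, by
          rintro _ ⟨f, rfl⟩
          exact hun f i j a⟩⟩
      map_add' := fun a b => Subtype.ext (funext fun f => map_add (u f i j) a b)
      map_smul' := fun c a => Subtype.ext (funext fun f => map_smul (u f i j) c a) }
  let k : ι → ι → lp W ∞ := fun i j => ⟨fun f => h f i j, memℓp_infty ⟨1, by
      rintro _ ⟨f, rfl⟩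
      exact hhn f i j⟩⟩
  exact ⟨lp W ∞, inferInstance, v, k,
    { mul_same := fun i j k a b => Subtype.ext (funext fun f => (hu f).mul_same _ _ _ _ _)
      mul_ne := fun i j k l a b hjk =>
        Subtype.ext (funext fun f => (hu f).mul_ne _ _ _ _ _ _ hjk)
      star_apply := fun i j a => Subtype.ext (funext fun f => (hu f).star_apply _ _ _)
      unit_mul_same := fun i j k => Subtype.ext (funext fun f => (hu f).unit_mul_same _ _ _)
      unit_mul_ne := fun i j k l hjk =>
        Subtype.ext (funext fun f => (hu f).unit_mul_ne _ _ _ _ hjk)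
      star_unit := fun i j => Subtype.ext (funext fun f => (hu f).star_unit _ _)
      unit_mul_apply := fun i j k a =>
        Subtype.ext (funext fun f => (hu f).unit_mul_apply _ _ _ _)
      unit_mul_apply_ne := fun i j k l a hjk =>
        Subtype.ext (funext fun f => (hu f).unit_mul_apply_ne _ _ _ _ _ hjk) },
    fun i j a ha => h0 i j a fun f => congrFun (congrArg Subtype.val ha) f⟩

/-- Every C*-algebra has a faithful matrix system. -/
theorem exists_faithful_system (ι A : Type u) [NonUnitalCStarAlgebra A] :
    ∃ (B : Type u) (_ : NonUnitalCStarAlgebra B) (v : ι → ι → A →ₗ[ℂ] B) (k : ι → ι → B),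
      IsUnitalSystem v k ∧ ∀ i j a, v i j a = 0 → a = 0 := by
  let _ : PartialOrder A := CStarAlgebra.spectralOrder A
  have _ : StarOrderedRing A := CStarAlgebra.spectralOrderedRing A
  -- One factor `B(ℓ²(ι, H_f))` for each positive functional `f`; together these GNS representations
  -- are faithful.
  exact exists_prod_system (Φ := A →ₚ[ℂ] ℂ)
    (fun f => isUnitalSystem_opUnit (ι := ι) f.gnsNonUnitalStarAlgHom)
    (fun f i j a => (norm_opUnit_le _ _ _).trans (NonUnitalStarAlgHom.norm_apply_le f.gnsNonUnitalStarAlgHom a))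
    (fun f i j => (norm_opUnit_le _ _ _).trans ContinuousLinearMap.norm_id_le)
    fun i j a ha => eq_zero_of_gns fun f => eq_zero_of_opUnit i j _ (ha f)

end FaithfulSystem


/-! ### Existence of `M_n ⊗ A` for C*-algebras -/

section ExistsTensor

namespace IsUnitalSystem

variable {ι A B : Type*} [NonUnitalCStarAlgebra A] [NonUnitalCStarAlgebra B]
  {v : ι → ι → A →ₗ[ℂ] B} {k : ι → ι → B}

/-- The homomorphism `a ↦ ∑_{i ∈ s} e_{ii} ⊗ a`. -/
noncomputable def diagonal (h : IsUnitalSystem v k) (s : Finset ι) : A →⋆ₙₐ[ℂ] B where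
  toFun a := ∑ i ∈ s, v i i a
  map_smul' c a := by simp [Finset.smul_sum]
  map_zero' := by simp
  map_add' a b := by simp [Finset.sum_add_distrib]
  map_star' a := by simp [star_sum, h.star_apply]
  map_mul' a b := by
    rw [Finset.sum_mul]
    refine Finset.sum_congr rfl fun i hi => ?_
    rw [Finset.mul_sum, Finset.sum_eq_single i]
    · exact (h.mul_same i i i a b).symm
    · exact fun j _ hj => h.mul_ne _ _ _ _ _ _ hj.symm
    · exact fun h => absurd hi h

/-- The sum factors as `(∑ c_{ij} e_{ij}) · (∑_{i ∈ s} e_{ii} ⊗ a)`, and the second factor is the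
image of `a` under a homomorphism. -/
theorem norm_sum_le (h : IsUnitalSystem v k) (c : ι × ι →₀ ℂ) (a : A) :
    ‖c.sum fun p r => r • v p.1 p.2 a‖ ≤ ‖matSum (Cpt.scalarSystem k) c‖ * ‖a‖ := by
  obtain ⟨s, hs⟩ := exists_support_subset c
  have h1 : (c.sum fun p r => r • v p.1 p.2 a) =
      matSum (Cpt.scalarSystem k) c * h.diagonal s a := by
    rw [matSum, Finsupp.lsum_apply, Finsupp.sum, Finsupp.sum, Finset.sum_mul]
    refine Finset.sum_congr rfl fun p hp => ?_
    change _ = (c p • k p.1 p.2) * ∑ i ∈ s, v i i a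
    rw [smul_mul_assoc, Finset.mul_sum, Finset.sum_eq_single p.2, h.unit_mul_apply]
    · exact fun j _ hj => h.unit_mul_apply_ne _ _ _ _ _ hj.symm
    · exact fun h => absurd (Finset.mem_product.mp (hs hp)).2 h
  rw [h1]
  exact (norm_mul_le _ _).trans
    (mul_le_mul_of_nonneg_left (NonUnitalStarAlgHom.norm_apply_le _ _) (norm_nonneg _))

end IsUnitalSystem

/-- `D` is the closed algebra generated by a faithful system. The unital system is needed just for
the cross norm estimate, where its matrix units are compared with those of the compact operators. -/
theorem exists_dense_system (ι A : Type u) [NonUnitalCStarAlgebra A] :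
    ∃ (D : Type u) (_ : NonUnitalCStarAlgebra D) (w : ι → ι → A →ₗ[ℂ] D),
      IsStarMatrixSystem w ∧ (∀ i j a, w i j a = 0 → a = 0) ∧ DenseRange (matSum w) ∧
      ∀ (c : ι × ι →₀ ℂ) a, ‖c.sum fun p r => r • w p.1 p.2 a‖ ≤
        ‖matSum (Cpt.scalarSystem (Cpt.unit (ι := ι))) c‖ * ‖a‖ := by
  obtain ⟨B, _, v, k, h, h0⟩ := exists_faithful_system ι A
  let s : Set B := {y | ∃ i j a, v i j a = y}
  let D := (NonUnitalStarAlgebra.adjoin ℂ s).topologicalClosure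
  let _ : NonUnitalCStarAlgebra D := NonUnitalStarSubalgebra.nonUnitalCStarAlgebra D
    (h_closed := NonUnitalStarSubalgebra.isClosed_topologicalClosure _)
  let w : ι → ι → A →ₗ[ℂ] D := fun i j =>
    { toFun := fun a => ⟨v i j a, NonUnitalStarSubalgebra.le_topologicalClosure _
        (NonUnitalStarAlgebra.subset_adjoin ℂ _ ⟨i, j, a, rfl⟩)⟩
      map_add' := fun a b => Subtype.ext (map_add (v i j) a b)
      map_smul' := fun c a => Subtype.ext (map_smul (v i j) c a) }
  have hw : IsStarMatrixSystem w :=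
    { mul_same := fun i j k a b => Subtype.ext (h.mul_same i j k a b)
      mul_ne := fun i j k l a b hjk => Subtype.ext (h.mul_ne i j k l a b hjk)
      star_apply := fun i j a => Subtype.ext (h.star_apply i j a) }
  refine ⟨D, inferInstance, w, hw, fun i j a ha => h0 i j a (congrArg Subtype.val ha),
    fun x => ?_, fun c a => ?_⟩
  · have h1 : ∀ y ∈ Submodule.span ℂ s, ∃ z, (matSum w z : B) = y := fun y hy => by
      induction hy using Submodule.span_induction with
      | mem y hy =>
        obtain ⟨i, j, a, rfl⟩ := hy
        exact ⟨Finsupp.single (i, j) a, congrArg Subtype.val (matSum_single w (i, j) a)⟩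
      | zero => exact ⟨0, congrArg Subtype.val (map_zero (matSum w))⟩
      | add y y' _ _ hy hy' =>
        obtain ⟨z, rfl⟩ := hy
        obtain ⟨z', rfl⟩ := hy'
        exact ⟨z + z', congrArg Subtype.val (map_add (matSum w) z z')⟩
      | smul r y _ hy =>
        obtain ⟨z, rfl⟩ := hy
        exact ⟨r • z, congrArg Subtype.val (map_smul (matSum w) r z)⟩
    rw [Metric.mem_closure_iff]
    intro ε hε
    obtain ⟨y, hy, hxy⟩ := Metric.mem_closure_iff.mp x.2 ε hε
    obtain ⟨z, rfl⟩ := h1 y (mem_span_of_mem_starAdjoin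
      (by
        rintro _ ⟨i, j, a, rfl⟩ _ ⟨k, l, b, rfl⟩
        by_cases hjk : j = k
        · subst hjk
          exact Submodule.subset_span ⟨i, l, a * b, (h.mul_same i j l a b).symm⟩
        · have : v i j a * v k l b = 0 := h.mul_ne i j k l a b hjk
          rw [this]
          exact zero_mem _)
      (by
        rintro _ ⟨i, j, a, rfl⟩
        exact Submodule.subset_span ⟨j, i, star a, (h.star_apply i j a).symm⟩) hy)
    exact ⟨_, ⟨z, rfl⟩, hxy⟩
  · have h1 : ((c.sum fun p r => r • w p.1 p.2 a : D) : B) = c.sum fun p r => r • v p.1 p.2 a :=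
      map_finsuppSum (NonUnitalStarSubalgebraClass.subtype D) c _
    calc ‖c.sum fun p r => r • w p.1 p.2 a‖ = ‖c.sum fun p r => r • v p.1 p.2 a‖ := by
          rw [← h1]; rfl
      _ ≤ ‖matSum (Cpt.scalarSystem k) c‖ * ‖a‖ := h.norm_sum_le c a
      _ ≤ _ := mul_le_mul_of_nonneg_right (Cpt.isStarMatrixSystem_unit.norm_matSum_le
          Cpt.eq_zero_of_scalarSystem_unit (Cpt.isStarMatrixSystem_scalarSystem h.unit_mul_same
            h.unit_mul_ne h.star_unit) c) (norm_nonneg a)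

/-- The tensor product of a C*-algebra with the compact operators exists. -/
theorem exists_isStarTensor (ι A : Type u) [NonUnitalCStarAlgebra A] :
    ∃ (D : Type u) (_ : NonUnitalCStarAlgebra D) (τ : Cpt ι →ₗ[ℂ] A →ₗ[ℂ] D),
      IsStarTensor τ := by
  obtain ⟨D, _, w, hw, h0, hd, hn⟩ := exists_dense_system ι A
  have hsum : ∀ (p : ι × ι) (r : ℂ) (a : A),
      (Finsupp.single p r).sum (fun p r => r • w p.1 p.2 a) = r • w p.1 p.2 a :=
    fun p r a => Finsupp.sum_single_index (zero_smul ℂ _)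
  -- The bilinear map is extended from matrix units to compact operators with values in bounded
  -- operators `A → D`; the estimate for `w` is exactly the bound required.
  let W : ι × ι → A →L[ℂ] D := fun p =>
    (w p.1 p.2).mkContinuous ‖matSum (Cpt.scalarSystem Cpt.unit) (Finsupp.single p (1 : ℂ))‖
      fun a => by
        have := hn (Finsupp.single p 1) a
        rwa [hsum, one_smul] at this
  let Φ : (ι × ι →₀ ℂ) →ₗ[ℂ] A →L[ℂ] D :=
    Finsupp.lsum ℂ fun p => LinearMap.toSpanSingleton ℂ (A →L[ℂ] D) (W p)
  have hΦ : ∀ c a, Φ c a = c.sum fun p r => r • w p.1 p.2 a := fun c a => by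
    induction c using Finsupp.induction_linear with
    | zero => rw [map_zero, Finsupp.sum_zero_index]; rfl
    | add c c' hc hc' =>
      rw [map_add, Finsupp.sum_add_index' (fun p => zero_smul ℂ (w p.1 p.2 a))
        fun p r r' => add_smul r r' (w p.1 p.2 a), ← hc, ← hc']
      rfl
    | single p r =>
      rw [hsum]
      simp only [Φ, Finsupp.lsum_single]
      rfl
  let T : Cpt ι →L[ℂ] A →L[ℂ] D := Φ.extendOfNorm (matSum (Cpt.scalarSystem Cpt.unit))
  have hT : ∀ c, T (matSum (Cpt.scalarSystem Cpt.unit) c) = Φ c :=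
    LinearMap.extendOfNorm_eq Cpt.denseRange_unit ⟨1, fun c => by
      rw [one_mul]
      refine ContinuousLinearMap.opNorm_le_bound _ (norm_nonneg _) fun a => ?_
      rw [hΦ]
      exact hn c a⟩
  have hTw : ∀ i j a, T (Cpt.unit i j) a = w i j a := fun i j a => by
    have h1 := hT (Finsupp.single (i, j) 1)
    rw [matSum_single, Cpt.scalarSystem_apply, one_smul] at h1
    rw [h1, hΦ, hsum, one_smul]
  have hTc : ∀ a, Continuous fun m => T m a := fun a => by fun_prop
  let τ : Cpt ι →ₗ[ℂ] A →ₗ[ℂ] D := (ContinuousLinearMap.coeLM ℂ).comp T.toLinearMap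
  have hτw : ∀ i j a, τ (Cpt.unit i j) a = w i j a := hTw
  have hτc : ∀ a, Continuous (τ.flip a) := hTc
  refine ⟨D, inferInstance, τ, isStarTensor_of_entry (fun m m' a a' => ?_) (fun m a => ?_) ?_
    fun i j => ?_⟩
  · refine Cpt.linear_ext (f := (LinearMap.mulRight ℂ (τ m' a')).comp (τ.flip a))
      (k := (τ.flip (a * a')).comp (LinearMap.mulRight ℂ m')) ((hτc a).mul continuous_const)
      ((hτc _).comp (continuous_id.mul continuous_const)) (fun i j => ?_) m
    refine Cpt.linear_ext (f := (LinearMap.mulLeft ℂ (τ (Cpt.unit i j) a)).comp (τ.flip a'))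
      (k := (τ.flip (a * a')).comp (LinearMap.mulLeft ℂ (Cpt.unit i j)))
      (continuous_const.mul (hτc _))
      ((hτc _).comp (continuous_const.mul continuous_id)) (fun k l => ?_) m'
    change τ (Cpt.unit i j) a * τ (Cpt.unit k l) a' = τ (Cpt.unit i j * Cpt.unit k l) (a * a')
    rw [hτw, hτw]
    by_cases hjk : j = k
    · subst hjk
      rw [Cpt.unit_mul_same, hτw]
      exact hw.mul_same i j l a a'
    · rw [Cpt.unit_mul_ne _ _ _ _ hjk, map_zero]
      exact hw.mul_ne i j k l a a' hjk
  -- Conjugating `τ` by the involutions gives a map linear in `m`, so that it can be compared with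
  -- `τ` on matrix units.
  · have h1 := Cpt.linear_ext (f := τ.flip a)
      (k :=
        { toFun := fun m => star (τ (star m) (star a))
          map_add' := fun m n => by rw [star_add, map_add, LinearMap.add_apply, star_add]
          map_smul' := fun c m => by
            rw [star_smul, map_smul, LinearMap.smul_apply, star_smul, star_star,
              RingHom.id_apply] })
      (hτc a) ((hτc _).comp continuous_star).star (fun i j => by
        change τ (Cpt.unit i j) a = star (τ (star (Cpt.unit i j)) (star a))
        rw [Cpt.star_unit, hτw, hτw, hw.star_apply, star_star]) m
    change τ m a = star (τ (star m) (star a)) at h1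
    rw [h1, star_star]
  · refine hd.mono ?_
    rintro _ ⟨x, rfl⟩
    induction x using Finsupp.induction_linear with
    | zero => rw [map_zero]; exact zero_mem _
    | add x y hx hy => rw [map_add]; exact add_mem hx hy
    | single p a =>
      rw [matSum_single]
      exact Submodule.subset_span ⟨Cpt.unit p.1 p.2, a, hτw _ _ _⟩
  · obtain ⟨ε, hε⟩ := hw.exists_entry h0 hd (i, j)
    have h1 : ∀ k l a, ε (w k l a) = Finsupp.single (k, l) a (i, j) := fun k l a => by
      rw [← hε, matSum_single]
    refine ⟨ε.toLinearMap, ε.continuous, fun a => ?_, fun k l a hkl => ?_⟩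
    · rw [hτw]
      exact (h1 i j a).trans Finsupp.single_eq_same
    · rw [hτw]
      exact (h1 k l a).trans (Finsupp.single_eq_of_ne hkl)

namespace IsStarTensor

variable {ι : Type u} {A B D : Type*} [NonUnitalCStarAlgebra A] [NonUnitalCStarAlgebra D]
  [NonUnitalCStarAlgebra B] {τ : Cpt ι →ₗ[ℂ] A →ₗ[ℂ] D}

theorem linear_ext (h : IsStarTensor τ) {F : Type*} [AddCommGroup F] [Module ℂ F]
    [TopologicalSpace F] [T2Space F] {f k : D →ₗ[ℂ] F} (hf : Continuous f) (hk : Continuous k)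
    (hfk : ∀ m a, f (τ m a) = k (τ m a)) (x : D) : f x = k x :=
  LinearMap.eq_of_dense_span (dense_span_of_denseRange_lift h.dense) hf hk
    (by rintro _ ⟨m, a, rfl⟩; exact hfk m a) x

theorem exists_map (h : IsStarTensor τ) {τ' : Cpt ι →ₗ[ℂ] B →ₗ[ℂ] D} (h' : IsStarTensor τ')
    (s : Cpt ι →⋆ₙₐ[ℂ] Cpt ι) (f : A →⋆ₙₐ[ℂ] B) :
    ∃ F : D →⋆ₙₐ[ℂ] D, ∀ m a, F (τ m a) = τ' (s m) (f a) := by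
  obtain ⟨F, hF⟩ := h.exists_lift
    (v := fun i j => (τ' (s (Cpt.unit i j))).comp (f : A →ₗ[ℂ] B))
    { mul_same := fun i j k a b => by
        change τ' _ (f a) * τ' _ (f b) = τ' _ (f (a * b))
        rw [h'.mul, ← map_mul, Cpt.unit_mul_same, map_mul f]
      mul_ne := fun i j k l a b hjk => by
        change τ' _ (f a) * τ' _ (f b) = 0
        rw [h'.mul, ← map_mul, Cpt.unit_mul_ne _ _ _ _ hjk, map_zero, map_zero,
          LinearMap.zero_apply]
      star_apply := fun i j a => by
        change star (τ' _ (f a)) = τ' _ (f (star a))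
        rw [h'.star_apply, ← map_star, Cpt.star_unit, map_star f] }
  refine ⟨F, fun m a => ?_⟩
  exact Cpt.linear_ext (f := (F : D →ₗ[ℂ] D).comp (τ.flip a))
    (k := (τ'.flip (f a)).comp (s : Cpt ι →ₗ[ℂ] Cpt ι))
    ((NonUnitalStarAlgHom.continuous F).comp (h.continuous_left a))
    ((h'.continuous_left (f a)).comp (NonUnitalStarAlgHom.continuous s))
    (fun i j => hF i j a) m

end IsStarTensor

variable {G : Type u} [InverseMonoid G]

theorem CGAlg.exists_tensor {ι : Type u} (s : G → Cpt ι →⋆ₙₐ[ℂ] Cpt ι)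
    (s_one : ∀ m, s 1 m = m) (s_mul : ∀ g h m, s (g * h) m = s g (s h m))
    (compat : ∀ (e : Idem G) m n, s e.1 m * n = m * s e.1 n) (A : CGAlg G) :
    ∃ (D : CGAlg G) (τ : Cpt ι →ₗ[ℂ] A.carrier →ₗ[ℂ] D.carrier),
      IsStarTensor τ ∧ ∀ g m a, D.act g (τ m a) = τ (s g m) (A.act g a) := by
  obtain ⟨D, _, τ, h⟩ := exists_isStarTensor ι A.carrier
  choose F hF using fun g => h.exists_map h (s g) (A.act g)
  have hc : ∀ g, Continuous (F g) := fun g => NonUnitalStarAlgHom.continuous (F g)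
  refine ⟨{ carrier := D, act := F, act_one := fun x => ?_, act_mul := fun g k x => ?_,
            compat := fun e x y => ?_ }, τ, h, hF⟩
  · exact h.linear_ext (f := (F 1 : D →ₗ[ℂ] D)) (k := LinearMap.id) (hc 1) continuous_id
      (fun m a => (hF 1 m a).trans (by rw [s_one, A.act_one]; rfl)) x
  · refine h.linear_ext (f := (F (g * k) : D →ₗ[ℂ] D))
      (k := (F g : D →ₗ[ℂ] D).comp (F k : D →ₗ[ℂ] D)) (hc _) ((hc g).comp (hc k))
      (fun m a => ?_) x
    change F (g * k) (τ m a) = F g (F k (τ m a))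
    rw [hF, hF, hF, s_mul, A.act_mul]
  · refine h.linear_ext (f := (LinearMap.mulRight ℂ y).comp (F e.1 : D →ₗ[ℂ] D))
      (k := LinearMap.mulRight ℂ (F e.1 y)) ((hc _).mul continuous_const)
      (continuous_id.mul continuous_const) (fun m a => ?_) x
    refine h.linear_ext (f := LinearMap.mulLeft ℂ (F e.1 (τ m a)))
      (k := (LinearMap.mulLeft ℂ (τ m a)).comp (F e.1 : D →ₗ[ℂ] D))
      (continuous_const.mul continuous_id) (continuous_const.mul (hc _)) (fun n b => ?_) y
    change F e.1 (τ m a) * τ n b = τ m a * F e.1 (τ n b)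
    rw [hF, hF, h.mul, h.mul, compat, A.compat]

end ExistsTensor


/-! ### Bounded nets and convergence on closed subspaces -/

section BoundedFamilies

/-- At a limit point `x`, all `F i x` are uniformly close to the values at a nearby `y` whose net
converges, so the net at `x` is Cauchy. -/
theorem Equicontinuous.isClosed_setOf_exists_tendsto {X E I : Type*} [PseudoMetricSpace X]
    [MetricSpace E] [CompleteSpace E] {l : Filter I} [l.NeBot] {F : I → X → E}
    (hF : Equicontinuous F) : IsClosed {x | ∃ c, Tendsto (fun i => F i x) l (𝓝 c)} := by
  refine isClosed_of_closure_subset fun x hx => cauchy_map_iff_exists_tendsto.mp ?_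
  refine Metric.cauchy_iff.mpr ⟨inferInstance, fun ε hε => ?_⟩
  obtain ⟨δ, hδ, h⟩ := Metric.equicontinuousAt_iff.mp (hF x) (ε / 4) (by positivity)
  obtain ⟨y, ⟨c, hc⟩, hxy⟩ := Metric.mem_closure_iff.mp hx δ hδ
  have h1 : {i | dist (F i y) c < ε / 4} ∈ l := hc (Metric.ball_mem_nhds c (by positivity))
  refine ⟨_, image_mem_map h1, ?_⟩
  have h2 : ∀ i, dist (F i y) c < ε / 4 → dist (F i x) c < ε / 2 := fun i hi =>
    lt_of_le_of_lt (dist_triangle _ (F i y) _) (by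
      have := h y (by rwa [dist_comm]) i
      linarith)
  rintro _ ⟨i, hi, rfl⟩ _ ⟨j, hj, rfl⟩
  have h3 := h2 i hi
  have h4 := h2 j hj
  have h5 := dist_triangle_right (F i x) (F j x) c
  linarith

variable {A : Type*} [NonUnitalCStarAlgebra A] {I : Type*}

/-- Bounded families. -/
def IsBddFamily (p : I → A) : Prop := ∃ C, ∀ i, ‖p i‖ ≤ C

/-- The C*-identity gives `‖p‖ = ‖p* p‖ = ‖p‖²`, so `‖p‖ ≤ 1`. -/
theorem isBddFamily_projection (p : I → A) (h : ∀ i, p i * p i = p i) (hs : ∀ i, star (p i) = p i) :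
    IsBddFamily p := by
  refine ⟨1, fun i => ?_⟩
  have h1 := CStarRing.norm_star_mul_self (x := p i)
  rw [hs, h] at h1
  nlinarith [norm_nonneg (p i)]

theorem IsBddFamily.map {B : Type*} [NonUnitalCStarAlgebra B] {p : I → A} (h : IsBddFamily p)
    (f : A →⋆ₙₐ[ℂ] B) : IsBddFamily fun i => f (p i) :=
  h.imp fun _ h i => (NonUnitalStarAlgHom.norm_apply_le f (p i)).trans (h i)

theorem IsBddFamily.of_map {B : Type*} [NonUnitalCStarAlgebra B] {p : I → A} {f : A →⋆ₙₐ[ℂ] B}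
    (h : IsBddFamily fun i => f (p i)) (hf : Function.Injective f) : IsBddFamily p :=
  h.imp fun _ h i => (NonUnitalStarAlgHom.norm_map f hf (p i)).symm.trans_le (h i)

theorem IsBddFamily.mul_left {p : I → A} (h : IsBddFamily p) (a : A) :
    IsBddFamily fun i => a * p i := by
  obtain ⟨C, hC⟩ := h
  exact ⟨‖a‖ * C, fun i => (norm_mul_le _ _).trans
    (mul_le_mul_of_nonneg_left (hC i) (norm_nonneg a))⟩

theorem IsBddFamily.mul_right {p : I → A} (h : IsBddFamily p) (a : A) :
    IsBddFamily fun i => p i * a := by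
  obtain ⟨C, hC⟩ := h
  exact ⟨C * ‖a‖, fun i => (norm_mul_le _ _).trans
    (mul_le_mul_of_nonneg_right (hC i) (norm_nonneg a))⟩

theorem IsBddFamily.equicontinuous_left {p : I → A} (h : IsBddFamily p) :
    Equicontinuous fun i v => p i * v := by
  obtain ⟨C, hC⟩ := h
  refine Metric.equicontinuous_of_continuity_modulus (fun t => C * t)
    (by simpa using (continuous_const_mul C).tendsto 0) _ fun v w i => ?_
  rw [dist_eq_norm, dist_eq_norm, ← mul_sub]
  exact (norm_mul_le _ _).trans (mul_le_mul_of_nonneg_right (hC i) (norm_nonneg _))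

theorem IsBddFamily.equicontinuous_right {p : I → A} (h : IsBddFamily p) :
    Equicontinuous fun i v => v * p i := by
  obtain ⟨C, hC⟩ := h
  refine Metric.equicontinuous_of_continuity_modulus (fun t => t * C)
    (by simpa using (continuous_mul_const C).tendsto 0) _ fun v w i => ?_
  rw [dist_eq_norm, dist_eq_norm, ← sub_mul]
  exact (norm_mul_le _ _).trans (mul_le_mul_of_nonneg_left (hC i) (norm_nonneg _))

end BoundedFamilies

/-! ### Rotation homotopies for C*-algebras -/

section Rotation

variable {ι : Type u}

namespace Cpt

/-- For `i ≠ j` the path consists of the projections onto the lines spanned by `cos · δ_i + sin ·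
δ_j`, written as `p p*` with the partial isometry `p = cos · e_{ii} + sin · e_{ji}`. -/
theorem exists_projection_path (i j : ι) : ∃ e : unitInterval → Cpt ι, Continuous e ∧
    (∀ t, e t * e t = e t) ∧ (∀ t, star (e t) = e t) ∧ e 0 = unit i i ∧ e 1 = unit j j := by
  by_cases hij : i = j
  · subst hij
    exact ⟨fun _ => unit i i, continuous_const, fun _ => unit_mul_same _ _ _,
      fun _ => star_unit _ _, rfl, rfl⟩
  let c : unitInterval → ℂ := fun t => (Real.cos (Real.pi / 2 * t) : ℝ)
  let s : unitInterval → ℂ := fun t => (Real.sin (Real.pi / 2 * t) : ℝ)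
  have hc : Continuous c := by fun_prop
  have hs : Continuous s := by fun_prop
  have hcs : ∀ t, c t * c t + s t * s t = 1 := fun t => by
    have := Real.cos_sq_add_sin_sq (Real.pi / 2 * t)
    rw [sq, sq] at this
    simp only [c, s]
    exact_mod_cast this
  let p : unitInterval → Cpt ι := fun t => c t • unit i i + s t • unit j i
  have hp : ∀ t, star (p t) = c t • unit i i + s t • unit i j := fun t => by
    simp only [p, c, s, star_add, star_smul, star_unit, Complex.star_def, Complex.conj_ofReal]
  have hpp : ∀ t, star (p t) * p t = unit i i := fun t => by
    rw [hp, add_mul, mul_add, mul_add]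
    simp only [smul_mul_smul_comm, unit_mul_same, unit_mul_ne _ _ _ _ hij,
      unit_mul_ne _ _ _ _ (Ne.symm hij), smul_zero, add_zero, zero_add]
    rw [← add_smul, hcs, one_smul]
  have hpi : ∀ t, p t * unit i i = p t := fun t => by
    simp only [p, add_mul, smul_mul_assoc, unit_mul_same]
  have hpc : Continuous p := (hc.smul continuous_const).add (hs.smul continuous_const)
  refine ⟨fun t => p t * star (p t), hpc.mul hpc.star, fun t => ?_, fun t => ?_, ?_, ?_⟩
  · change p t * star (p t) * (p t * star (p t)) = p t * star (p t)
    rw [mul_assoc, ← mul_assoc (star (p t)), hpp, ← mul_assoc, hpi]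
  · change star (p t * star (p t)) = p t * star (p t)
    rw [star_mul, star_star]
  · have h0 : p 0 = unit i i := by simp [p, c, s]
    change p 0 * star (p 0) = unit i i
    rw [h0, star_unit, unit_mul_same]
  · have h1 : p 1 = unit j i := by simp [p, c, s]
    change p 1 * star (p 1) = unit j j
    rw [h1, star_unit, unit_mul_same]

end Cpt

variable {G : Type u} [InverseMonoid G]

/-- The homotopy is `a ↦ e(t) ⊗ f(a)` along a path of projections. Its equivariance holds for matrix
units by assumption and for `e(t)` by density. -/
theorem CGAlg.exists_rotation {A X M : CGAlg G} {τ : Cpt ι →ₗ[ℂ] X.carrier →ₗ[ℂ] M.carrier}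
    (h : IsStarTensor τ) (f : CGAlg.Hom A X) (i j : ι)
    (ha : ∀ g a p q, M.act g (τ (Cpt.unit p q) (f.toHom a)) =
      τ (Cpt.unit p q) (f.toHom (A.act g a))) :
    ∃ F : unitInterval → CGAlg.Hom A M, (∀ a, Continuous fun t => (F t).toHom a) ∧
      ∀ a, (F 0).toHom a = τ (Cpt.unit i i) (f.toHom a) ∧
        (F 1).toHom a = τ (Cpt.unit j j) (f.toHom a) := by
  obtain ⟨e, hec, he, hes, he0, he1⟩ := Cpt.exists_projection_path i j
  have hact : ∀ g a m, M.act g (τ m (f.toHom a)) = τ m (f.toHom (A.act g a)) := fun g a m =>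
    Cpt.linear_ext (f := (M.act g : M.carrier →ₗ[ℂ] M.carrier).comp (τ.flip (f.toHom a)))
      (k := τ.flip (f.toHom (A.act g a)))
      ((NonUnitalStarAlgHom.continuous (M.act g)).comp (h.continuous_left _))
      (h.continuous_left _) (fun p q => ha g a p q) m
  refine ⟨fun t => ⟨
    { toFun := fun a => τ (e t) (f.toHom a)
      map_smul' := fun c a => by simp
      map_zero' := by simp
      map_add' := fun a b => by simp
      map_mul' := fun a b => by rw [h.mul, he, map_mul]
      map_star' := fun a => by rw [h.star_apply, hes, map_star] }, fun g a => (hact g a _).symm⟩,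
    fun a => (h.continuous_left _).comp hec, fun a => ⟨?_, ?_⟩⟩
  · change τ (e 0) (f.toHom a) = _
    rw [he0]
  · change τ (e 1) (f.toHom a) = _
    rw [he1]

end Rotation

/-! ### C*-algebras form a good setting -/

section CStarInstance

open Setting

theorem NonUnitalStarAlgHom.isClosedEmbedding {A B : Type*} [NonUnitalCStarAlgebra A]
    [NonUnitalCStarAlgebra B] (F : A →⋆ₙₐ[ℂ] B) (hF : Function.Injective F) : IsClosedEmbedding F :=
  (AddMonoidHomClass.isometry_of_norm F (NonUnitalStarAlgHom.norm_map F hF)).isClosedEmbedding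

/-- An algebra homomorphism compatible with the involutions. -/
def NonUnitalAlgHom.toStar {A B : Type*} [NonUnitalCStarAlgebra A] [NonUnitalCStarAlgebra B]
    (F : A →ₙₐ[ℂ] B) (hF : ∀ a, F (star a) = star (F a)) : A →⋆ₙₐ[ℂ] B :=
  { F with map_star' := hF }

variable {G : Type u} [InverseMonoid G]

theorem CGAlg.hom_ext {A B : CGAlg G} {f k : A ⟶ B} (h : ∀ a, f.toHom a = k.toHom a) : f = k :=
  CGAlg.Hom.ext (NonUnitalStarAlgHom.ext h)

theorem cstarSetting.isStarTensor {ι : Type u} {A D : CGAlg G}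
    {τ : Cpt ι →ₗ[ℂ] A.carrier →ₗ[ℂ] D.carrier}
    (h : (cstarSetting G).IsTensor (M := (cstarSetting G).mat ι) (A := A) (D := D) τ) :
    IsStarTensor τ := ⟨And.left h, (And.right h).1, (And.right h).2.1, (And.right h).2.2⟩

/-- An object of the setting of C*-algebras as a `G`-C*-algebra. -/
def CGAlg.of (A : (cstarSetting G).C) : CGAlg G := A

theorem CGAlg.Hom.apply_star {A B : CGAlg G} (f : CGAlg.Hom A B) (a : A.carrier) :
    f.toHom (star a) = star (f.toHom a) := map_star f.toHom a

theorem CGAlg.act_star (A : CGAlg G) (g : G) (a : A.carrier) :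
    A.act g (star a) = star (A.act g a) := map_star (A.act g) a

theorem CGAlg.exists_coeff_action (X : CGAlg G) :
    ∃ φ : C(SemiChar G, ℂ)₀ →ₗ[ℂ] X.carrier →ₗ[ℂ] X.carrier,
      (∀ e y, φ (SemiChar.eval e) y = X.act e.1 y) ∧ (∀ y, Continuous fun c => φ c y) ∧
        ∀ c, Continuous fun y => φ c y := by
  obtain ⟨φ, hφ⟩ := _root_.exists_coeff_action (fun e : Idem G => X.act e.1)
    (fun e f => X.act_mul e.1 f.1) X.compat
  exact ⟨(ContinuousLinearMap.coeLM ℂ).comp φ.toLinearMap, hφ,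
    fun y => (ContinuousLinearMap.apply ℂ X.carrier y).continuous.comp φ.continuous,
    fun c => (φ c).continuous⟩

/-- The C*-algebras form a good setting. -/
@[reducible]
noncomputable def cstarSetting.good : (cstarSetting G).Good where
  hasStar := True
  conj {A} a := (star (a : (CGAlg.of A).carrier) : (CGAlg.of A).carrier)
  conj_conj _ A a := star_star (R := (CGAlg.of A).carrier) a
  conj_mul _ A a b := star_mul (R := (CGAlg.of A).carrier) a b
  conj_add _ A a b := star_add (R := (CGAlg.of A).carrier) a b
  conj_smul _ A c a := star_smul (A := (CGAlg.of A).carrier) c a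
  conj_continuous {A} := continuous_star (R := (CGAlg.of A).carrier)
  t2 A := inferInstanceAs (T2Space (CGAlg.of A).carrier)
  continuousAdd A := inferInstanceAs (ContinuousAdd (CGAlg.of A).carrier)
  continuousMul A := inferInstanceAs (ContinuousMul (CGAlg.of A).carrier)
  continuousSMul A := inferInstanceAs (ContinuousConstSMul ℂ (CGAlg.of A).carrier)
  hom_ext _ _ := CGAlg.hom_ext
  exists_hom {A B} F hF hs :=
    ⟨⟨NonUnitalAlgHom.toStar (A := (CGAlg.of A).carrier) (B := (CGAlg.of B).carrier) F (hs trivial), hF⟩,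
      fun _ => rfl⟩
  ap_conj _ A B f a := CGAlg.Hom.apply_star f a
  act_conj _ A g a := CGAlg.act_star A g a
  continuous_hom {A B} F hs := NonUnitalStarAlgHom.continuous
    (NonUnitalAlgHom.toStar (A := (CGAlg.of A).carrier) (B := (CGAlg.of B).carrier) F (hs trivial))
  isClosedEmbedding {A B} F hs h := NonUnitalStarAlgHom.isClosedEmbedding
    (NonUnitalAlgHom.toStar (A := (CGAlg.of A).carrier) (B := (CGAlg.of B).carrier) F (hs trivial)) h
  tensor_mul h := And.left h
  tensor_conj _ _ _ _ _ h := (And.right h).1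
  tensor_continuous_left {M A D τ} h a := continuous_of_mul_of_star (M := (CGAlg.of M).carrier)
    (A := (CGAlg.of A).carrier) (D := (CGAlg.of D).carrier) (And.left h) (And.right h).1 a
  tensor_continuous_right {M A D τ} h m := IsStarTensor.continuous_right (M := (CGAlg.of M).carrier)
    (A := (CGAlg.of A).carrier) (D := (CGAlg.of D).carrier) (τ := τ)
    ⟨And.left h, (And.right h).1, (And.right h).2.1, (And.right h).2.2⟩ m
  tensor_dense {M A D τ} h := dense_span_of_denseRange_lift (M := (CGAlg.of M).carrier)
    (A := (CGAlg.of A).carrier) (D := (CGAlg.of D).carrier) (τ := τ) (And.right h).2.2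
  tensor_eq_zero {M A D τ} h _ _ := eq_zero_of_injective_lift (M := (CGAlg.of M).carrier)
    (A := (CGAlg.of A).carrier) (D := (CGAlg.of D).carrier) (τ := τ) (And.right h).2.1
  isTensor_of {ι A D τ} hm hs hd he :=
    have h := isStarTensor_of_entry (A := (CGAlg.of A).carrier) (D := (CGAlg.of D).carrier) (τ := τ)
      hm (hs trivial) hd he
    ⟨h.mul, h.star_apply, h.injective, h.dense⟩
  tensor_entry {ι A D τ} h i j := (cstarSetting.isStarTensor (A := CGAlg.of A) (D := CGAlg.of D) h).exists_entry i j
  unit_system := Cpt.unit_mul_same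
  unit_mul_ne := Cpt.unit_mul_ne
  unit_conj _ _ := Cpt.star_unit
  unit_ne_zero := Cpt.unit_ne_zero
  unit_coef := Cpt.unit_mul_mul_unit
  unit_separating _ hm := Cpt.eq_zero_of_forall hm
  unit_dense _ := Cpt.dense_span_unit
  mat_act _ _ := rfl
  idem_mul := SemiChar.eval_mul
  idem_conj _ := SemiChar.star_eval
  -- Precomposing `ξ ↦ ξ(e)` with the shift by `g` gives `ξ ↦ ξ(g e g*)`.
  idem_act _ _ := rfl
  idem_ne_zero := SemiChar.eval_ne_zero
  idem_dense := SemiChar.dense_span_eval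
  lift {ι A D B τ} h k hk hs := by
    obtain ⟨F, hF⟩ := (cstarSetting.isStarTensor (A := CGAlg.of A) (D := CGAlg.of D) h).exists_lift
      (B := (CGAlg.of B).carrier) (v := k) ⟨⟨hk.mul_same, hk.mul_ne⟩, hs trivial⟩
    exact ⟨F.toNonUnitalAlgHom, fun _ => map_star F, hF⟩
  tensor_injective {ι A A' D D' τ τ'} h h' f hs hf F hFs hF :=
    (cstarSetting.isStarTensor (A := CGAlg.of A) (D := CGAlg.of D) h).injective_of_map
      (cstarSetting.isStarTensor (A := CGAlg.of A') (D := CGAlg.of D') h')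
      (NonUnitalAlgHom.toStar (A := (CGAlg.of A).carrier) (B := (CGAlg.of A').carrier) f (hs trivial)) hf
      (NonUnitalAlgHom.toStar (A := (CGAlg.of D).carrier) (B := (CGAlg.of D').carrier) F (hFs trivial)) hF
  lift_mat {ι B} k h1 h2 h3 := by
    obtain ⟨F, hF⟩ := Cpt.exists_lift (ι := ι) (B := (CGAlg.of B).carrier) k h1 h2 (h3 trivial)
    exact ⟨F.toNonUnitalAlgHom, fun _ => map_star F, hF⟩
  exists_coeff_action X := CGAlg.exists_coeff_action X
  exists_semidirect {D A} L R h h1 h2 h3 h4 hs := by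
    obtain ⟨Q, i, q, r, ⟨h5, h6, h7⟩, h8, h9⟩ :=
      CGAlg.exists_semidirect (D := D) (A := A) L R h h1 h2 h3 h4 (hs trivial)
    exact ⟨Q, i, q, r, ⟨h5, h6, h7⟩, h8, h9⟩
  exists_pullback f k := CGAlg.exists_pullback f k
  exists_tensor {ι} σ A :=
    have ⟨D, τ, h, h'⟩ := CGAlg.exists_tensor (ι := ι) (fun g => CGAlg.Hom.toHom (σ.hom g))
      (fun m => by rw [σ.hom_one]; rfl) (fun g h m => by rw [σ.hom_mul]; rfl) σ.compat
      (CGAlg.of A)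
    ⟨D, ⟨⟨τ, ⟨h.mul, h.star_apply, h.injective, h.dense⟩, h'⟩⟩⟩
  rotation {ι σ A X M} T f i j _ ha F₀ F₁ h0 h1 := by
    obtain ⟨F, hF, hF'⟩ := CGAlg.exists_rotation
      (cstarSetting.isStarTensor (A := CGAlg.of X) (D := CGAlg.of M) T.isTensor) f i j ha
    exact ⟨F, hF, CGAlg.hom_ext fun a => (hF' a).1.trans (h0 a).symm,
      CGAlg.hom_ext fun a => (hF' a).2.trans (h1 a).symm⟩
  bdd {A I} p := IsBddFamily (A := (CGAlg.of A).carrier) p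
  bdd_projection {A I} p h hs := isBddFamily_projection (A := (CGAlg.of A).carrier) p h (hs trivial)
  bdd_map {A B I} f k h := IsBddFamily.map (A := (CGAlg.of A).carrier) (B := (CGAlg.of B).carrier) h
    (CGAlg.Hom.toHom f)
  bdd_of_map {A B I} f k hf h := IsBddFamily.of_map (A := (CGAlg.of A).carrier)
    (B := (CGAlg.of B).carrier) (f := CGAlg.Hom.toHom f) h hf
  bdd_mul_left {A I} a k h := IsBddFamily.mul_left (A := (CGAlg.of A).carrier) h a
  bdd_mul_right {A I} a k h := IsBddFamily.mul_right (A := (CGAlg.of A).carrier) h a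
  isClosed_exists_left {A I} l _ k h :=
    (IsBddFamily.equicontinuous_left (A := (CGAlg.of A).carrier) h).isClosed_setOf_exists_tendsto
  isClosed_exists_right {A I} l _ k h :=
    (IsBddFamily.equicontinuous_right (A := (CGAlg.of A).carrier) h).isClosed_setOf_exists_tendsto
  isClosed_eq_left {A I} l k h :=
    (IsBddFamily.equicontinuous_left (A := (CGAlg.of A).carrier) h).isClosed_setOfPred_tendsto
      continuous_id
  isClosed_eq_right {A I} l k h :=
    (IsBddFamily.equicontinuous_right (A := (CGAlg.of A).carrier) h).isClosed_setOfPred_tendsto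
      continuous_id

end CStarInstance

/-! ### The theorem for both settings -/

/-- Both settings are good. -/
theorem Setting.good_setting {G : Type u} [InverseMonoid G] (fl : Flavor) :
    Nonempty (setting G fl).Good := by
  cases fl with
  | algebras p => exact ⟨algSetting.good p⟩
  | cstarAlgebras => exact ⟨cstarSetting.good⟩

/-- Here `x ≫ y` is the product `x · y` of very special `GK^G`-theory (for algebras) respectively of
very special `KK^G`-theory (for C*-algebras). -/
theorem corollary4p2 {G : Type u} [InverseMonoid G] (fl : Flavor)
    (R : (setting G fl).C → Prop) (P : Type u → Prop)
    (hRP : (setting G fl).SufficientlyBig R P) (A B : GK (setting G fl) R P) :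
    let 𝔠 : GK (setting G fl) R P := ⟨(setting G fl).coeff, hRP.coeff_mem⟩
    -- the product of level-one elements is the level-one element computed by the formula
    (∀ (t : LevelOneSeq A 𝔠) (s : LevelOneSeq 𝔠 B),
      (∃ x : LevelOneSeq A B, Nonempty (ProductFormula t s x)) ∧
      ∀ x : LevelOneSeq A B, Nonempty (ProductFormula t s x) → t.toGK ≫ s.toGK = x.toGK) ∧
    -- so the product maps level-one elements to level-one elements
    (∀ z ∈ L1 A 𝔠, ∀ w ∈ L1 𝔠 B, z ≫ w ∈ L1 A B) ∧
    -- and is biadditive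
    ∃ μ : AddSubgroup.closure (L1 A 𝔠) ⊗[ℤ] AddSubgroup.closure (L1 𝔠 B) →ₗ[ℤ]
        AddSubgroup.closure (L1 A B),
      ∀ z w, (μ (z ⊗ₜ[ℤ] w) : A ⟶ B) = (z : A ⟶ 𝔠) ≫ (w : 𝔠 ⟶ B) := by
  obtain ⟨_⟩ := Setting.good_setting (G := G) fl
  exact Setting.Good.product hRP A B
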